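/- **Notation.** Let $p,q\in\mathbb C$ with $0<|p|,|q|<1$. Put $(z;q)_\infty=\prod_{j\ge0}(1-zq^j)$, $(z;p,q)_\infty=\prod_{j,k\ge0}(1-zp^jq^k)$, $\theta(z;p)=(z;p)_\infty(pz^{-1};p)_\infty$, $\Gamma(z;p,q)=\dfrac{(pqz^{-1};p,q)_\infty}{(z;p,q)_\infty}$ and $\kappa=\dfrac{(p;p)_\infty(q;q)_\infty}{4\pi i}$. For base $q$ and nome $p$ put $\theta(t)_n=\prod_{j=0}^{n-1}\theta(tq^j;p)$. A product over several arguments is abbreviated as $\theta(t_1,\dots,t_r)_n=\prod_i\theta(t_i)_n$, $\Gamma(t_1,\dots,t_r;p,q)=\prod_i\Gamma(t_i;p,q)$, $\Gamma(tx^{\pm1};p,q)=\Gamma(tx;p,q)\Gamma(tx^{-1};p,q)$. Let $${}_{12}V_{11}(t_0;t_1,\dots,t_7;q,p)=\sum_{j\ge0}\frac{\theta(t_0q^{2j};p)}{\theta(t_0;p)}\prod_{i=0}^{7}\frac{\theta(t_i)_j}{\theta(qt_0t_i^{-1})_j}\,q^j ,$$ used only when it terminates. Let $S=\{1,2,3,6,8\}$,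 let $\varepsilon_j\in\mathbb C\setminus\{0\}$ $(j\in S)$ be parameters and let $A=\varepsilon_1\varepsilon_2\varepsilon_3\varepsilon_6\varepsilon_8$. For $n,l\in\mathbb Z_{\ge0}$ define $\varepsilon_4,\varepsilon_5,\varepsilon_7$ by $\varepsilon_4\varepsilon_8=p^{l+1}q^{n+1}$, $\varepsilon_7=\varepsilon_8/q$ and $\prod_{j=1}^8\varepsilon_j=p^2q^2$. Under this choice put $$R_n(x;q,p)={}_{12}V_{11}\Big(\tfrac{\varepsilon_6}{\varepsilon_8};\tfrac{q}{\varepsilon_1\varepsilon_8},\tfrac{q}{\varepsilon_2\varepsilon_8},\tfrac{q}{\varepsilon_3\varepsilon_8},\tfrac{qp}{\varepsilon_4\varepsilon_8},\tfrac{qp}{\varepsilon_5\varepsilon_8},\varepsilon_6x,\tfrac{\varepsilon_6}{x};q,p\Big),$$ $$T_n(x;q,p)={}_{12}V_{11}\Big(\tfrac{A\varepsilon_6}{q};\tfrac{A}{\varepsilon_1},\tfrac{A}{\varepsilon_2},\tfrac{A}{\varepsilon_3},\varepsilon_6x,\tfrac{\varepsilon_6}{x},\tfrac{qp}{\varepsilon_4\varepsilon_8},\tfrac{qp}{\varepsilon_5\varepsilon_8};q,p\Big).$$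 The functions $R_l(x;p,q)$ and $T_l(x;p,q)$ are obtained by interchanging $(p,l)$ with $(q,n)$ throughout; this keeps $\varepsilon_4$ and replaces $\varepsilon_7$ by $\varepsilon_8/p$, with $\varepsilon_5$ again determined by $\prod_{j=1}^8\varepsilon_j=p^2q^2$. Put $$R_{nl}(x)=R_n(x;q,p)R_l(x;p,q),\qquad T_{nl}(x)=T_n(x;q,p)T_l(x;p,q).$$ **Theorem (two-index biorthogonality).** Let $n,l,m,k\in\mathbb Z_{\ge0}$. Assume that the parameters are generic in the sense that the $x$-independent factors in the denominators of the terminating series $R_m(x;q,p)$, $R_k(x;p,q)$, $T_n(x;q,p)$, $T_l(x;p,q)$ and the denominators of $h_n(q,p)$, $h_l(p,q)$ below do not vanish. Let $C_{mn,kl}$ be a closed piecewise $C^1$ contour in $\mathbb C\setminus\{0\}$ separating the points $$\varepsilon_jp^aq^b\ (j=1,2,3,6),\qquad \varepsilon_8p^{a-k}q^{b-m},\qquad p^{a+1-l}q^{b+1-n}/A,\qquad a,b\in\mathbb Z_{\ge0},$$ from their reciprocals; that is, it passes through none of these points or their reciprocals, has winding number $1$ about $0$ and about each of these points, and winding number $0$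 about each of their reciprocals. Then the integrand below is integrable along $C_{mn,kl}$ and $$\kappa\int_{C_{mn,kl}}T_{nl}(x)R_{mk}(x)\,\frac{\prod_{j\in S}\Gamma(\varepsilon_jx^{\pm1};p,q)}{\Gamma(x^{\pm2},Ax^{\pm1};p,q)}\,\frac{dx}{x}=h_{nl}\,\delta_{mn}\,\delta_{kl},$$ where $$h_{nl}=\frac{\prod_{j<k;\,j,k\in S}\Gamma(\varepsilon_j\varepsilon_k;p,q)}{\prod_{j\in S}\Gamma(A\varepsilon_j^{-1};p,q)}\;h_n(q,p)\,h_l(p,q),$$ $$h_n(q,p)=\frac{\theta\big(\tfrac{A}{q\varepsilon_8};p\big)\,\theta\big(q,\tfrac{q\varepsilon_6}{\varepsilon_8},\varepsilon_1\varepsilon_2,\varepsilon_1\varepsilon_3,\varepsilon_2\varepsilon_3,A\varepsilon_6\big)_n\,q^{-n}}{\theta\big(\tfrac{Aq^{2n}}{q\varepsilon_8};p\big)\,\theta\big(\tfrac1{\varepsilon_6\varepsilon_8},\varepsilon_1\varepsilon_6,\varepsilon_2\varepsilon_6,\varepsilon_3\varepsilon_6,\tfrac{A}{q\varepsilon_6},\tfrac{A}{q\varepsilon_8}\big)_n}.$$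 -/

import Mathlib

noncomputable section

namespace EllBiorth

open Complex

/-- `(z; q)_∞ = ∏_{j ≥ 0} (1 - z q^j)`. -/
def qPoch (z q : ℂ) : ℂ := ∏' j : ℕ, (1 - z * q ^ j)

/-- `(z; p, q)_∞ = ∏_{j, k ≥ 0} (1 - z p^j q^k)`. -/
def pqPoch (z p q : ℂ) : ℂ := ∏' jk : ℕ × ℕ, (1 - z * p ^ jk.1 * q ^ jk.2)

/-- The modified theta function `θ(z; p) = (z; p)_∞ (p z⁻¹; p)_∞`. -/
def theta (z p : ℂ) : ℂ := qPoch z p * qPoch (p * z⁻¹) p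

/-- The elliptic gamma function `Γ(z; p, q) = (p q z⁻¹; p, q)_∞ / (z; p, q)_∞`. -/
def ellGamma (z p q : ℂ) : ℂ := pqPoch (p * q * z⁻¹) p q / pqPoch z p q

/-- `Γ(t x^{±1}; p, q) = Γ(t x; p, q) Γ(t x⁻¹; p, q)`. -/
def ellGammaPM (t x p q : ℂ) : ℂ := ellGamma (t * x) p q * ellGamma (t * x⁻¹) p q

/-- The elliptic Pochhammer symbol `θ(t)_n = ∏_{j < n} θ(t q^j; p)` with base `q` and nome `p`. -/
def ellPoch (t : ℂ) (n : ℕ) (q p : ℂ) : ℂ := ∏ j ∈ Finset.range n, theta (t * q ^ j) p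

/-- `θ(t_1, …, t_k)_n = θ(t_1)_n ⋯ θ(t_k)_n`. -/
def ellPochs (ts : List ℂ) (n : ℕ) (q p : ℂ) : ℂ := (ts.map fun t => ellPoch t n q p).prod

/-- The very-well-poised series `_{r+5}V_{r+4}(t₀; t_1, …, t_r; q, p)` with argument `y = 1`.
The factor of index `0` is `θ(t₀)_n / θ(q t₀ / t₀)_n = θ(t₀)_n / θ(q)_n`. The series is only used
when it terminates, so that the sum has finite support. -/
def ellV {r : ℕ} (t₀ : ℂ) (t : Fin r → ℂ) (q p : ℂ) : ℂ :=
  ∑' n : ℕ, theta (t₀ * q ^ (2 * n)) p / theta t₀ p *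
    (ellPoch t₀ n q p / ellPoch q n q p) *
    (∏ i : Fin r, ellPoch (t i) n q p / ellPoch (q * t₀ / t i) n q p) * q ^ n

/-- `κ = (p; p)_∞ (q; q)_∞ / (4 π i)`. -/
def kappa (p q : ℂ) : ℂ := qPoch p p * qPoch q q / (4 * Real.pi * I)

/-- The free parameters `ε_j`, `j ∈ S = {1, 2, 3, 6, 8}`. -/
structure Params where
  ε₁ : ℂ
  ε₂ : ℂ
  ε₃ : ℂ
  ε₆ : ℂ
  ε₈ : ℂ

namespace Params

/-- The parameters `ε_j`, `j ∈ S`, as a family, in increasing order of `j`. -/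
def val (e : Params) : Fin 5 → ℂ := ![e.ε₁, e.ε₂, e.ε₃, e.ε₆, e.ε₈]

/-- `A = ε₁ ε₂ ε₃ ε₆ ε₈`. -/
def A (e : Params) : ℂ := e.ε₁ * e.ε₂ * e.ε₃ * e.ε₆ * e.ε₈

/-- `ε₄`, fixed by the termination condition `ε₄ ε₈ = q^{n+1} p^{l+1}`. -/
def ε₄ (e : Params) (q p : ℂ) (n l : ℕ) : ℂ := q ^ (n + 1) * p ^ (l + 1) / e.ε₈

/-- `ε₇ = ε₈ / q`. -/
def ε₇ (e : Params) (q : ℂ) : ℂ := e.ε₈ / q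

/-- `ε₅`, fixed by the balancing condition `ε₁ ε₂ ⋯ ε₈ = p² q²`. -/
def ε₅ (e : Params) (q p : ℂ) (n l : ℕ) : ℂ :=
  p ^ 2 * q ^ 2 / (e.ε₁ * e.ε₂ * e.ε₃ * e.ε₄ q p n l * e.ε₆ * e.ε₇ q * e.ε₈)

end Params

/-- `R_n(x; q, p)` (base `q`, nome `p`) under the termination condition
`ε₄ ε₈ = q^{n+1} p^{l+1}`. -/
def R (e : Params) (q p : ℂ) (n l : ℕ) (x : ℂ) : ℂ :=
  ellV (e.ε₆ / e.ε₈)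
    ![q / (e.ε₁ * e.ε₈), q / (e.ε₂ * e.ε₈), q / (e.ε₃ * e.ε₈),
      q * p / (e.ε₄ q p n l * e.ε₈), q * p / (e.ε₅ q p n l * e.ε₈),
      e.ε₆ * x, e.ε₆ / x] q p

/-- `T_n(x; q, p)` (base `q`, nome `p`) under the termination condition
`ε₄ ε₈ = q^{n+1} p^{l+1}`. -/
def T (e : Params) (q p : ℂ) (n l : ℕ) (x : ℂ) : ℂ :=
  ellV (e.A * e.ε₆ / q)
    ![e.A / e.ε₁, e.A / e.ε₂, e.A / e.ε₃, e.ε₆ * x, e.ε₆ / x,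
      q * p / (e.ε₄ q p n l * e.ε₈), q * p / (e.ε₅ q p n l * e.ε₈)] q p

/-- `R_{mk}(x) = R_m(x; q, p) R_k(x; p, q)`, both series terminating because of
`ε₄ ε₈ = p^{k+1} q^{m+1}`. -/
def R₂ (e : Params) (p q : ℂ) (m k : ℕ) (x : ℂ) : ℂ := R e q p m k x * R e p q k m x

/-- `T_{nl}(x) = T_n(x; q, p) T_l(x; p, q)`, both series terminating because of
`ε₄ ε₈ = p^{l+1} q^{n+1}`. -/
def T₂ (e : Params) (p q : ℂ) (n l : ℕ) (x : ℂ) : ℂ := T e q p n l x * T e p q l n x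

/-- The weight `∏_{j ∈ S} Γ(ε_j x^{±1}; p, q) / Γ(x^{±2}, A x^{±1}; p, q)`. -/
def weight (e : Params) (p q x : ℂ) : ℂ :=
  (∏ j, ellGammaPM (e.val j) x p q) / (ellGammaPM 1 (x ^ 2) p q * ellGammaPM e.A x p q)

/-- The numerator of `h_n(q, p)`. -/
def hNum (e : Params) (q p : ℂ) (n : ℕ) : ℂ :=
  theta (e.A / (q * e.ε₈)) p *
    ellPochs [q, q * e.ε₆ / e.ε₈, e.ε₁ * e.ε₂, e.ε₁ * e.ε₃, e.ε₂ * e.ε₃, e.A * e.ε₆] n q p *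
    (q ^ n)⁻¹

/-- The denominator of `h_n(q, p)`. -/
def hDen (e : Params) (q p : ℂ) (n : ℕ) : ℂ :=
  theta (e.A * q ^ (2 * n) / (q * e.ε₈)) p *
    ellPochs [1 / (e.ε₆ * e.ε₈), e.ε₁ * e.ε₆, e.ε₂ * e.ε₆, e.ε₃ * e.ε₆,
      e.A / (q * e.ε₆), e.A / (q * e.ε₈)] n q p

/-- `h_n(q, p)`. -/
def hOne (e : Params) (q p : ℂ) (n : ℕ) : ℂ := hNum e q p n / hDen e q p n

/-- The normalization constant `h_{nl}`. -/
def h (e : Params) (p q : ℂ) (n l : ℕ) : ℂ :=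
  (∏ j, ∏ k ∈ Finset.Ioi j, ellGamma (e.val j * e.val k) p q) /
    (∏ j, ellGamma (e.A / e.val j) p q) * hOne e q p n * hOne e p q l

/-- The denominators of the terminating series `R_n(x; q, p)` that do not depend on `x` are
nonzero: with `t₀ = ε₆ / ε₈`, these are `θ(t₀; p)`, `θ(q)_n` and `θ(q t₀ / t_i)_n` for the
parameters `t_i = q / ε_j ε₈` (`j = 1, 2, 3`) and `t_i = q p / ε_j ε₈` (`j = 4, 5`). -/
def RRegular (e : Params) (q p : ℂ) (n l : ℕ) : Prop :=
  theta (e.ε₆ / e.ε₈) p ≠ 0 ∧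
    ellPochs [q, e.ε₁ * e.ε₆, e.ε₂ * e.ε₆, e.ε₃ * e.ε₆,
      e.ε₄ q p n l * e.ε₆ / p, e.ε₅ q p n l * e.ε₆ / p] n q p ≠ 0

/-- The denominators of the terminating series `T_n(x; q, p)` that do not depend on `x` are
nonzero: with `t₀ = A ε₆ / q`, these are `θ(t₀; p)`, `θ(q)_n` and `θ(q t₀ / t_i)_n` for the
parameters `t_i = A / ε_j` (`j = 1, 2, 3`) and `t_i = q p / ε_j ε₈` (`j = 4, 5`). -/
def TRegular (e : Params) (q p : ℂ) (n l : ℕ) : Prop :=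
  theta (e.A * e.ε₆ / q) p ≠ 0 ∧
    ellPochs [q, e.ε₁ * e.ε₆, e.ε₂ * e.ε₆, e.ε₃ * e.ε₆,
      e.A * e.ε₆ * e.ε₄ q p n l * e.ε₈ / (q * p),
      e.A * e.ε₆ * e.ε₅ q p n l * e.ε₈ / (q * p)] n q p ≠ 0

/-- A closed piecewise `C¹` curve, parametrized by `[0, 1]`: it is `C¹`, up to the end points, on
every compact interval whose interior contains no point of some finite set. -/
structure IsContour (γ : ℝ → ℂ) : Prop where
  continuousOn : ContinuousOn γ (Set.Icc 0 1)
  closed : γ 0 = γ 1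
  piecewise : ∃ P : Finset ℝ, ∀ a b : ℝ, 0 ≤ a → a < b → b ≤ 1 →
    Disjoint (Set.Ioo a b) (P : Set ℝ) → ContDiffOn ℝ 1 γ (Set.Icc a b)

/-- The pulled back integrand of `∫_γ f(x) dx`. -/
def pullback (f : ℂ → ℂ) (γ : ℝ → ℂ) (t : ℝ) : ℂ := f (γ t) * deriv γ t

/-- `∫_γ f(x) dx`. -/
def contourIntegral (f : ℂ → ℂ) (γ : ℝ → ℂ) : ℂ := ∫ t in (0 : ℝ)..1, pullback f γ t

/-- The winding number of `γ` about `w`. -/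
def windingNumber (γ : ℝ → ℂ) (w : ℂ) : ℂ :=
  (2 * Real.pi * I)⁻¹ * contourIntegral (fun z => (z - w)⁻¹) γ

/-- `γ` is a contour in `ℂ \ {0}` which separates the points of `P` (which accumulate at most
at `0`) from their reciprocals, encircling the former and `0` once in the positive direction. -/
structure Separates (γ : ℝ → ℂ) (P : Set ℂ) : Prop where
  isContour : IsContour γ
  ne_zero : ∀ t ∈ Set.Icc (0 : ℝ) 1, γ t ≠ 0
  winding_zero : windingNumber γ 0 = 1
  notMem : ∀ w ∈ P, w ∉ γ '' Set.Icc 0 1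
  winding : ∀ w ∈ P, windingNumber γ w = 1
  inv_notMem : ∀ w ∈ P, w⁻¹ ∉ γ '' Set.Icc 0 1
  inv_winding : ∀ w ∈ P, windingNumber γ w⁻¹ = 0

/-- The points `ε_j p^a q^b` (`j = 1, 2, 3, 6`), `ε₈ p^{a-k} q^{b-m}` and
`p^{a+1-l} q^{b+1-n} / A`, where `a, b ≥ 0`. -/
def innerPoints (e : Params) (p q : ℂ) (n l m k : ℕ) : Set ℂ :=
  {x | ∃ a b : ℕ,
    x = e.ε₁ * p ^ a * q ^ b ∨ x = e.ε₂ * p ^ a * q ^ b ∨ x = e.ε₃ * p ^ a * q ^ b ∨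
    x = e.ε₆ * p ^ a * q ^ b ∨
    x = e.ε₈ * p ^ ((a : ℤ) - k) * q ^ ((b : ℤ) - m) ∨
    x = p ^ ((a : ℤ) + 1 - l) * q ^ ((b : ℤ) + 1 - n) / e.A}

end EllBiorth

end

/-!
Write `t = q / A`, so that `ε₁ ε₂ ε₃ ε₆ ε₈ t = q`. By `weight_eq_betaKernel` the weight is the kernel
`betaKernel` of the elliptic beta integral with the parameters `ε₁, ε₂, ε₃, ε₆, ε₈, p t`, whose
product is `p q`, and the prefactor of `h` is the value `betaProd` of that integral
(`h_eq_betaProd`). `T_eq_bioRat` and `R_eq_bioRat` express `T_n` and `R_n` by one and the same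
function `bioRat`, with the parameters `ε₈` and `t` interchanged. So everything happens for six
parameters `a, b, c, d, s, p t` with `a b c d s t = q`.

*The elliptic beta integral.* Over the unit circle, with all parameters in the unit disc, a
six-parameter theta identity (`theta_six_identity`) writes a combination of two kernels with shifted
parameters as a difference of one function under `x ↦ x / q`. This gives `betaCircle_shift`: the
quotient of the integral and `betaProd` is unchanged when one parameter is multiplied and another one
divided by `q`. The quotient is analytic on an annulus in that direction and invariant under
a contraction, hence constant (`betaRatio_move`). Its value is found by letting two poles on either
side pinch the circle (`tendsto_circleAverage_pinch`, `betaCircle_eq`). Analytic continuation along a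
curve of parameters extends the evaluation to every cycle which separates the poles
(`betaIntegral_eq`); cycles rather than single curves are used, because for generic parameters a
separating cycle is simply a small circle about `0` together with small circles about the finitely
many points left outside (`exists_cycleSeparates`).

*One index.* The denominators of `bioRat` are absorbed into the kernel, as shifts of `s` and `p t` by
powers of `q`. Expanding what multiplies a numerator `bioNum` in theta monomials
`θ(a x^{±1})_i θ(b x^{±1})_k`, which are again shifts of parameters of the kernel, and evaluating
each beta integral leaves a terminating very-well-poised sum. Its weights are those of Lagrange
interpolation for even theta functions (`vwpWeight_mul_prod`). Hence it vanishes when the summand is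
an even theta function of low degree, which is the orthogonality `betaFun_bioNum_mul_eq_zero`, and
has a closed form with one more factor in the denominator (`sum_vwpWeight_div`), which is the norm
(`betaFun_bioNum_mul_ellPochPM`, `bioNorm_identity`). Together with the symmetry between `s` and `p t`
this gives `betaFun_bioRat_mul_bioRat_eq`.

*Two indices.* The product of the two numerators with base `p` and nome `q` is expanded in theta
monomials in `a` and `b`, and each monomial is absorbed into the kernel as a shift of `a` and `b` by
powers of `p`. The functions with base `q` and nome `p` are elliptic in the parameters, so that these
shifts do not change them (`bioRat_zpow_mul`). The one-index theorem therefore applies to every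
monomial with the same norm, and applies once more, with `p` and `q` interchanged, to their sum
(`betaFun_bioRat_mul_bioRat_two`).

These arguments need parameters off all resonances `p^ℤ q^ℤ`. The remaining regular parameters follow
by continuity along a curve on which all but countably many points are generic
(`betaFun_bioRat_mul_bioRat_two_of_regular`). The integrand is identified with a holomorphic
function times a kernel only off a countable set of points `x`; this suffices for the integral, since the
contour meets a countable set with nonzero speed only at a null set of times (`pullback_ae_eq`).
-/

noncomputable section

namespace EllBiorth

open Complex Filter Topology MeasureTheory

/-! ### Infinite products, theta functions and the elliptic gamma function -/

section Products

variable {ι : Type*} {a : ι → ℂ}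

theorem multipliable_one_sub_mul (ha : Summable fun i => ‖a i‖) (z : ℂ) :
    Multipliable fun i => 1 - z * a i := by
  have := multipliable_one_add_of_summable (f := fun i => -(z * a i))
    (by simpa using ha.mul_left ‖z‖)
  simpa [sub_eq_add_neg] using this

theorem differentiable_tprod_one_sub_mul (ha : Summable fun i => ‖a i‖) :
    Differentiable ℂ fun z : ℂ => ∏' i, (1 - z * a i) := by
  intro z
  have h := Summable.hasProdLocallyUniformlyOn_one_add (R := ℂ) (f := fun i (x : ℂ) => -(x * a i))
    (K := Metric.ball 0 (‖z‖ + 1)) (u := fun i => (‖z‖ + 1) * ‖a i‖) Metric.isOpen_ball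
    (ha.mul_left _) (Eventually.of_forall fun i x hx => by
      simp only [norm_neg, norm_mul]
      gcongr
      simpa using (mem_ball_zero_iff.1 hx).le) (fun i => by fun_prop)
  have h2 : DifferentiableOn ℂ (fun z : ℂ => ∏' i, (1 + -(z * a i))) (Metric.ball 0 (‖z‖ + 1)) :=
    h.differentiableOn (Eventually.of_forall fun _ => by
      simpa [Finset.prod_fn] using DifferentiableOn.finsetProd (fun _ _ ↦ by fun_prop))
      Metric.isOpen_ball
  have h3 := h2.differentiableAt (Metric.isOpen_ball.mem_nhds (by simp : z ∈ Metric.ball 0 (‖z‖ + 1)))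
  simpa [sub_eq_add_neg] using h3

theorem tprod_one_sub_mul_eq_zero_iff (ha : Summable fun i => ‖a i‖) (z : ℂ) :
    ∏' i, (1 - z * a i) = 0 ↔ ∃ i, z * a i = 1 := by
  constructor
  · intro h
    by_contra! hne
    refine tprod_one_add_ne_zero_of_summable (f := fun i => -(z * a i)) (fun i => ?_)
      (by simpa using ha.mul_left ‖z‖) (by simpa [sub_eq_add_neg] using h)
    rw [← sub_eq_add_neg]
    exact sub_ne_zero.2 (hne i).symm
  · rintro ⟨i, hi⟩
    exact tprod_of_exists_eq_zero ⟨i, by simp [hi]⟩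

end Products

/-- Two nomes `p, q` in the punctured open unit disc. -/
structure Nomes (p q : ℂ) : Prop where
  p_ne : p ≠ 0
  p_lt : ‖p‖ < 1
  q_ne : q ≠ 0
  q_lt : ‖q‖ < 1

theorem Nomes.symm {p q : ℂ} (H : Nomes p q) : Nomes q p := ⟨H.q_ne, H.q_lt, H.p_ne, H.p_lt⟩

variable {p q z : ℂ}

theorem summable_norm_pow (hq : ‖q‖ < 1) : Summable fun j : ℕ => ‖q ^ j‖ := by
  simpa using summable_geometric_of_lt_one (norm_nonneg q) hq

theorem Nomes.summable (H : Nomes p q) : Summable fun jk : ℕ × ℕ => ‖p ^ jk.1 * q ^ jk.2‖ := by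
  simpa using (summable_norm_pow H.p_lt).mul_of_nonneg (summable_norm_pow H.q_lt)
    (fun _ => norm_nonneg _) (fun _ => norm_nonneg _)

theorem differentiable_qPoch (hq : ‖q‖ < 1) : Differentiable ℂ fun z => qPoch z q :=
  differentiable_tprod_one_sub_mul (summable_norm_pow hq)

theorem qPoch_eq_zero_iff (hq : ‖q‖ < 1) : qPoch z q = 0 ↔ ∃ j : ℕ, z * q ^ j = 1 :=
  tprod_one_sub_mul_eq_zero_iff (summable_norm_pow hq) z

theorem qPoch_eq_mul (hq : ‖q‖ < 1) (z : ℂ) : qPoch z q = (1 - z) * qPoch (z * q) q := by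
  unfold qPoch
  rw [tprod_eq_zero_mul' (f := fun j : ℕ => 1 - z * q ^ j)]
  · simp [pow_succ, mul_assoc, mul_comm q]
  · simpa [pow_succ, mul_assoc, mul_comm q] using
      multipliable_one_sub_mul (summable_norm_pow hq) (z * q)

theorem pqPoch_def' (z p q : ℂ) :
    pqPoch z p q = ∏' jk : ℕ × ℕ, (1 - z * (p ^ jk.1 * q ^ jk.2)) := by
  simp [pqPoch, mul_assoc]

theorem Nomes.differentiable_pqPoch (H : Nomes p q) : Differentiable ℂ fun z => pqPoch z p q := by
  simp_rw [pqPoch_def']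
  exact differentiable_tprod_one_sub_mul H.summable

theorem Nomes.pqPoch_eq_zero_iff (H : Nomes p q) :
    pqPoch z p q = 0 ↔ ∃ a b : ℕ, z * p ^ a * q ^ b = 1 := by
  rw [pqPoch_def', tprod_one_sub_mul_eq_zero_iff H.summable]
  simp [mul_assoc]

theorem pqPoch_comm (z p q : ℂ) : pqPoch z p q = pqPoch z q p := by
  rw [pqPoch_def', pqPoch_def', ← (Equiv.prodComm ℕ ℕ).tprod_eq]
  simp [mul_comm]

theorem Nomes.pqPoch_eq_mul (H : Nomes p q) (z : ℂ) :
    pqPoch z p q = qPoch z p * pqPoch (z * q) p q := by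
  have hm (w : ℂ) := multipliable_one_sub_mul H.summable w
  have hm1 (w : ℂ) (j : ℕ) : Multipliable fun k : ℕ => 1 - w * (p ^ j * q ^ k) := by
    simpa [mul_assoc] using multipliable_one_sub_mul (summable_norm_pow H.q_lt) (w * p ^ j)
  have key (w : ℂ) : pqPoch w p q = ∏' j : ℕ, qPoch (w * p ^ j) q := by
    rw [pqPoch_def', (hm w).tprod_prod' (hm1 w)]
    simp [qPoch, mul_assoc]
  have hm2 (w : ℂ) : Multipliable fun j : ℕ => qPoch (w * p ^ j) q := by
    have := ((hm w).hasProd.prod_fiberwise fun j => (hm1 w j).hasProd).multipliable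
    simpa [qPoch, mul_assoc] using this
  rw [key, key, qPoch, ← Multipliable.tprod_mul
    (multipliable_one_sub_mul (summable_norm_pow H.p_lt) z) (hm2 _)]
  refine tprod_congr fun j => ?_
  rw [qPoch_eq_mul H.q_lt, mul_right_comm]

theorem Nomes.pqPoch_eq_mul' (H : Nomes p q) (z : ℂ) :
    pqPoch z p q = qPoch z q * pqPoch (z * p) p q := by
  rw [pqPoch_comm, H.symm.pqPoch_eq_mul, pqPoch_comm]

theorem differentiableAt_theta (hp : ‖p‖ < 1) (hz : z ≠ 0) :
    DifferentiableAt ℂ (fun z => theta z p) z := by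
  unfold theta
  exact (differentiable_qPoch hp z).mul ((differentiable_qPoch hp _).comp z
    ((differentiableAt_const p).mul (differentiableAt_id.inv hz)))

theorem theta_one (hp : ‖p‖ < 1) : theta 1 p = 0 := by
  rw [theta, (qPoch_eq_zero_iff hp).2 ⟨0, by simp⟩, zero_mul]

theorem theta_p_div (p z : ℂ) (hp : p ≠ 0) : theta (p / z) p = theta z p := by
  unfold theta
  rw [mul_comm]
  congr 2
  · field_simp

theorem theta_inv (hp : ‖p‖ < 1) (hz : z ≠ 0) : theta z⁻¹ p = -z⁻¹ * theta z p := by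
  unfold theta
  rw [qPoch_eq_mul hp z⁻¹, qPoch_eq_mul hp z, inv_inv, mul_comm p z, mul_comm p z⁻¹]
  field_simp
  ring

theorem theta_mul_p (hp0 : p ≠ 0) (hp : ‖p‖ < 1) (hz : z ≠ 0) :
    theta (p * z) p = -z⁻¹ * theta z p := by
  rw [← theta_inv hp hz, ← theta_p_div p z⁻¹ hp0, div_inv_eq_mul]

theorem theta_eq_zero_iff (hp0 : p ≠ 0) (hp : ‖p‖ < 1) (hz : z ≠ 0) :
    theta z p = 0 ↔ ∃ k : ℤ, z = p ^ k := by
  unfold theta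
  rw [mul_eq_zero, qPoch_eq_zero_iff hp, qPoch_eq_zero_iff hp]
  constructor
  · rintro (⟨j, hj⟩ | ⟨j, hj⟩)
    · exact ⟨-j, by rw [zpow_neg, zpow_natCast]; exact eq_inv_of_mul_eq_one_left hj⟩
    · refine ⟨j + 1, ?_⟩
      rw [zpow_add₀ hp0, zpow_natCast, zpow_one]
      field_simp at hj
      rw [← hj]; ring
  · rintro ⟨k, rfl⟩
    obtain ⟨n, rfl | rfl⟩ := k.eq_nat_or_neg
    · cases n with
      | zero => left; exact ⟨0, by simp⟩
      | succ n => right; refine ⟨n, ?_⟩; rw [zpow_natCast]; field_simp; ring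
    · left; exact ⟨n, by rw [zpow_neg, zpow_natCast]; field_simp⟩

theorem theta_zpow (hp0 : p ≠ 0) (hp : ‖p‖ < 1) (k : ℤ) : theta (p ^ k) p = 0 :=
  (theta_eq_zero_iff hp0 hp (zpow_ne_zero k hp0)).2 ⟨k, rfl⟩

/-- The product `θ(t x; p) θ(t / x; p)`. -/
def thetaPM (t x p : ℂ) : ℂ := theta (t * x) p * theta (t * x⁻¹) p

theorem ellGamma_comm (z p q : ℂ) : ellGamma z p q = ellGamma z q p := by
  rw [ellGamma, ellGamma, pqPoch_comm, pqPoch_comm z, mul_comm p q]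

theorem Nomes.ellGamma_q_mul (H : Nomes p q) (hz0 : z ≠ 0) (hz : pqPoch z p q ≠ 0) :
    ellGamma (q * z) p q = theta z p * ellGamma z p q := by
  unfold ellGamma theta
  have hq := H.q_ne
  have h1 : p * q * (q * z)⁻¹ = p * z⁻¹ := by field_simp
  rw [h1, H.pqPoch_eq_mul (p * z⁻¹), H.pqPoch_eq_mul z, mul_comm q z,
    show p * z⁻¹ * q = p * q * z⁻¹ by ring]
  rw [H.pqPoch_eq_mul] at hz
  have := left_ne_zero_of_mul hz
  have := right_ne_zero_of_mul hz
  field_simp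

theorem Nomes.ellGamma_mul_reflect (H : Nomes p q) (hz0 : z ≠ 0) (hz : pqPoch z p q ≠ 0)
    (hz' : pqPoch (p * q * z⁻¹) p q ≠ 0) : ellGamma z p q * ellGamma (p * q * z⁻¹) p q = 1 := by
  have := H.p_ne
  have := H.q_ne
  unfold ellGamma
  rw [show p * q * (p * q * z⁻¹)⁻¹ = z by field_simp]
  exact div_mul_div_cancel₀' hz' _ _ |>.trans (div_self hz)

/-- `Γ(z)⁻¹ Γ(z⁻¹)⁻¹ = θ(z; p) θ(z⁻¹; q)`, away from the zeros of `Γ(z)` and `Γ(z⁻¹)`, where the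
left hand side is a removable singularity. -/
theorem Nomes.inv_ellGamma_mul_inv (H : Nomes p q) (hz0 : z ≠ 0)
    (h1 : pqPoch (p * q * z) p q ≠ 0) (h2 : pqPoch (p * q * z⁻¹) p q ≠ 0) :
    (ellGamma z p q * ellGamma z⁻¹ p q)⁻¹ = theta z p * theta z⁻¹ q := by
  unfold ellGamma theta
  rw [inv_inv, H.pqPoch_eq_mul z, H.pqPoch_eq_mul z⁻¹, H.pqPoch_eq_mul' (z * q),
    H.pqPoch_eq_mul' (z⁻¹ * q), qPoch_eq_mul H.p_lt z⁻¹, qPoch_eq_mul H.q_lt z⁻¹,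
    show z * q * p = p * q * z by ring, show z⁻¹ * q * p = p * q * z⁻¹ by ring,
    mul_comm p z⁻¹, mul_comm q z]
  generalize pqPoch (p * q * z) p q = u at *
  generalize pqPoch (p * q * z⁻¹) p q = v at *
  field_simp

/-- The regular part `(z; p, q)_∞ / (1 - z)` of the denominator of the elliptic gamma function. -/
def pqTail (z p q : ℂ) : ℂ := qPoch (z * p) p * pqPoch (z * q) p q

theorem Nomes.pqPoch_eq_one_sub_mul (H : Nomes p q) (z : ℂ) :
    pqPoch z p q = (1 - z) * pqTail z p q := by
  rw [H.pqPoch_eq_mul, qPoch_eq_mul H.p_lt, pqTail, mul_assoc]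

theorem Nomes.differentiable_pqTail (H : Nomes p q) : Differentiable ℂ fun z => pqTail z p q := by
  unfold pqTail
  exact ((differentiable_qPoch H.p_lt).comp (differentiable_id.mul_const p)).mul
    (H.differentiable_pqPoch.comp (differentiable_id.mul_const q))

theorem Nomes.pqTail_one (H : Nomes p q) :
    pqTail 1 p q = qPoch p p * qPoch q q * pqPoch (p * q) p q := by
  rw [pqTail, H.pqPoch_eq_mul' (1 * q)]
  ring_nf

theorem qPoch_self_ne_zero (hq : ‖q‖ < 1) : qPoch q q ≠ 0 := by
  rw [Ne, qPoch_eq_zero_iff hq]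
  rintro ⟨j, hj⟩
  have : ‖q * q ^ j‖ < 1 := by
    rw [← pow_succ', norm_pow]; exact pow_lt_one₀ (norm_nonneg _) hq (by simp)
  rw [hj] at this
  simp at this

theorem Nomes.pqPoch_ne_zero_of_norm_lt (H : Nomes p q) (hz : ‖z‖ < 1) : pqPoch z p q ≠ 0 := by
  rw [Ne, H.pqPoch_eq_zero_iff]
  rintro ⟨a, b, h⟩
  have : ‖z * p ^ a * q ^ b‖ < 1 := by
    rw [norm_mul, norm_mul, norm_pow, norm_pow]
    have h1 := pow_le_one₀ (norm_nonneg p) H.p_lt.le (n := a)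
    have h2 := pow_le_one₀ (norm_nonneg q) H.q_lt.le (n := b)
    calc ‖z‖ * ‖p‖ ^ a * ‖q‖ ^ b ≤ ‖z‖ * 1 * 1 := by gcongr
      _ < 1 := by simpa using hz
  rw [h] at this
  simp at this

theorem Nomes.pqTail_ne_zero_of_norm_lt (H : Nomes p q) (hp : ‖z * p‖ < 1) (hq : ‖z * q‖ < 1) :
    pqTail z p q ≠ 0 := by
  refine mul_ne_zero ?_ (H.pqPoch_ne_zero_of_norm_lt hq)
  rw [Ne, qPoch_eq_zero_iff H.p_lt]
  rintro ⟨j, hj⟩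
  have : ‖z * p * p ^ j‖ < 1 := by
    rw [norm_mul, norm_pow]
    calc ‖z * p‖ * ‖p‖ ^ j ≤ ‖z * p‖ * 1 := by
          gcongr; exact pow_le_one₀ (norm_nonneg p) H.p_lt.le
      _ < 1 := by simpa using hp
  rw [hj] at this
  simp at this

variable {p q z : ℂ}

/-! ### Theta functions: division by zeros and interpolation -/

/-- The zeros of `θ(·; p)` are simple. -/
theorem deriv_theta_zpow_ne_zero (hp0 : p ≠ 0) (hp : ‖p‖ < 1) (k : ℤ) :
    deriv (fun z => theta z p) (p ^ k) ≠ 0 := by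
  have step (k : ℤ) : p * deriv (fun z => theta z p) (p ^ (k + 1)) =
      -(p ^ k)⁻¹ * deriv (fun z => theta z p) (p ^ k) := by
    have hz := zpow_ne_zero k hp0
    have hz1 := zpow_ne_zero (k + 1) hp0
    have e : p ^ (k + 1) = p * p ^ k := by rw [zpow_add₀ hp0, zpow_one, mul_comm]
    have h1 : HasDerivAt (fun z => theta (p * z) p)
        (deriv (fun z => theta z p) (p * p ^ k) * (p * 1)) (p ^ k) :=
      HasDerivAt.comp (p ^ k) (h₂ := fun z => theta z p)
        (differentiableAt_theta hp (e ▸ hz1)).hasDerivAt ((hasDerivAt_id (p ^ k)).const_mul p)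
    have h2 : HasDerivAt (fun z => -z⁻¹ * theta z p)
        (- -((p ^ k) ^ 2)⁻¹ * theta (p ^ k) p + -(p ^ k)⁻¹ * deriv (fun z => theta z p) (p ^ k))
        (p ^ k) :=
      ((hasDerivAt_inv hz).neg).mul (differentiableAt_theta hp hz).hasDerivAt
    have h3 := h1.unique (h2.congr_of_eventuallyEq
      ((eventually_ne_nhds hz).mono fun z hz => theta_mul_p hp0 hp hz))
    rw [theta_zpow hp0 hp, mul_zero, zero_add] at h3
    rw [e, ← h3]; ring
  have h0 : deriv (fun z => theta z p) (p ^ (0 : ℤ)) ≠ 0 := by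
    have h : HasDerivAt (fun z => (1 - z) * (qPoch (z * p) p * qPoch (p * z⁻¹) p))
        (-1 * (qPoch (1 * p) p * qPoch (p * 1⁻¹) p) + (1 - 1) *
          deriv (fun z => qPoch (z * p) p * qPoch (p * z⁻¹) p) 1) 1 := by
      refine ((hasDerivAt_id (1 : ℂ)).const_sub 1).mul (DifferentiableAt.hasDerivAt ?_)
      exact ((differentiable_qPoch hp _).comp (1 : ℂ) (differentiableAt_id.mul_const p)).mul
        ((differentiable_qPoch hp _).comp (1 : ℂ)
          ((differentiableAt_const p).mul (differentiableAt_id.inv one_ne_zero)))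
    have e : (fun z => theta z p) = fun z => (1 - z) * (qPoch (z * p) p * qPoch (p * z⁻¹) p) := by
      funext z; rw [theta, qPoch_eq_mul hp z, mul_assoc]
    rw [zpow_zero, e, h.deriv]
    simpa using qPoch_self_ne_zero hp
  induction k with
  | zero => exact h0
  | succ k ih =>
    intro h
    have := step k
    rw [h, mul_zero] at this
    exact mul_ne_zero (neg_ne_zero.2 (inv_ne_zero (zpow_ne_zero _ hp0))) ih this.symm
  | pred k ih =>
    intro h
    have := step (-k - 1)
    rw [h, mul_zero, sub_add_cancel] at this
    exact mul_ne_zero hp0 ih this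

/-- On `ℂ ∖ {0}`, a holomorphic function which vanishes at the zeros of a function `h` with only
simple zeros is divisible by `h`. -/
theorem exists_eq_mul_of_simple_zeros {f h : ℂ → ℂ} (hf : ∀ z ≠ 0, DifferentiableAt ℂ f z)
    (hh : ∀ z ≠ 0, DifferentiableAt ℂ h z) (h0 : ∀ z ≠ 0, h z = 0 → deriv h z ≠ 0 ∧ f z = 0) :
    ∃ g : ℂ → ℂ, (∀ z ≠ 0, DifferentiableAt ℂ g z) ∧ ∀ z ≠ 0, f z = h z * g z := by
  classical
  refine ⟨fun z => if h z = 0 then deriv f z / deriv h z else f z / h z, fun z hz => ?_,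
    fun z hz => ?_⟩
  · have hnhd : {0}ᶜ ∈ 𝓝 z := isOpen_compl_singleton.mem_nhds hz
    have hfd : DifferentiableOn ℂ f {0}ᶜ := fun w hw => (hf w hw).differentiableWithinAt
    have hhd : DifferentiableOn ℂ h {0}ᶜ := fun w hw => (hh w hw).differentiableWithinAt
    by_cases hz0 : h z = 0
    · obtain ⟨hd, hfz⟩ := h0 z hz hz0
      have h1 : DifferentiableAt ℂ (dslope f z) z :=
        ((Complex.differentiableOn_dslope hnhd).2 hfd).differentiableAt hnhd
      have h2 : DifferentiableAt ℂ (dslope h z) z :=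
        ((Complex.differentiableOn_dslope hnhd).2 hhd).differentiableAt hnhd
      have h3 : DifferentiableAt ℂ (fun w => dslope f z w / dslope h z w) z :=
        h1.div h2 (by rwa [dslope_same])
      refine h3.congr_of_eventuallyEq ?_
      have hne : ∀ᶠ w in 𝓝[≠] z, h w ≠ h z := (hh z hz).hasDerivAt.eventually_ne hd
      rw [eventually_nhdsWithin_iff] at hne
      filter_upwards [hne] with w hw
      by_cases hwz : w = z
      · subst hwz
        simp [hz0]
      · have := hw hwz
        rw [hz0] at this
        rw [if_neg this, dslope_of_ne _ hwz, dslope_of_ne _ hwz, slope_def_field, slope_def_field,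
          hz0, hfz, sub_zero, sub_zero, div_div_div_cancel_right₀ (sub_ne_zero.2 hwz)]
    · refine ((hf z hz).div (hh z hz) hz0).congr_of_eventuallyEq ?_
      filter_upwards [(hh z hz).continuousAt.eventually_ne hz0] with w hw
      simp [hw]
  · by_cases hz0 : h z = 0
    · rw [hz0, zero_mul, (h0 z hz hz0).2]
    · simp only [if_neg hz0]
      field_simp

theorem eq_of_mul_eq_mul_of_simple_zeros {h u v : ℂ → ℂ} (hh : ∀ z ≠ 0, DifferentiableAt ℂ h z)
    (h0 : ∀ z ≠ 0, h z = 0 → deriv h z ≠ 0) (hu : ∀ z ≠ 0, ContinuousAt u z)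
    (hv : ∀ z ≠ 0, ContinuousAt v z) (e : ∀ z ≠ 0, h z * u z = h z * v z) :
    ∀ z ≠ 0, u z = v z := by
  intro z hz
  by_cases hz0 : h z = 0
  · have hne : ∀ᶠ w in 𝓝[≠] z, h w ≠ h z := (hh z hz).hasDerivAt.eventually_ne (h0 z hz hz0)
    have h1 : ∀ᶠ w in 𝓝[≠] z, w ≠ 0 := (eventually_ne_nhds hz).filter_mono nhdsWithin_le_nhds
    have h2 : u =ᶠ[𝓝[≠] z] v := by
      filter_upwards [hne, h1] with w hw hw0
      rw [hz0] at hw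
      exact mul_left_cancel₀ hw (e w hw0)
    exact tendsto_nhds_unique ((hu z hz).tendsto.mono_left nhdsWithin_le_nhds)
      (((hv z hz).tendsto.mono_left nhdsWithin_le_nhds).congr' h2.symm)
  · exact mul_left_cancel₀ hz0 (e z hz)

theorem frontier_annulus_subset (r R : ℝ) :
    frontier {z : ℂ | r < ‖z‖ ∧ ‖z‖ < R} ⊆ {z | ‖z‖ = r ∨ ‖z‖ = R} := by
  intro z hz
  have ho : IsOpen {z : ℂ | r < ‖z‖ ∧ ‖z‖ < R} :=
    (isOpen_lt continuous_const continuous_norm).inter (isOpen_lt continuous_norm continuous_const)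
  have hc : IsClosed {z : ℂ | r ≤ ‖z‖ ∧ ‖z‖ ≤ R} :=
    (isClosed_le continuous_const continuous_norm).inter
      (isClosed_le continuous_norm continuous_const)
  rw [ho.frontier_eq] at hz
  have hsub : {z : ℂ | r < ‖z‖ ∧ ‖z‖ < R} ⊆ {z : ℂ | r ≤ ‖z‖ ∧ ‖z‖ ≤ R} :=
    fun w hw => ⟨hw.1.le, hw.2.le⟩
  have h1 : r ≤ ‖z‖ ∧ ‖z‖ ≤ R := closure_minimal hsub hc hz.1
  have h2 : ¬(r < ‖z‖ ∧ ‖z‖ < R) := hz.2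
  rw [not_and_or, not_lt, not_lt] at h2
  rcases h2 with h | h
  · exact Or.inl (le_antisymm h h1.1)
  · exact Or.inr (le_antisymm h1.2 h)

theorem isPreconnected_compl_zero : IsPreconnected ({0}ᶜ : Set ℂ) :=
  (isConnected_compl_singleton_of_one_lt_rank (by simp) 0).isPreconnected

/-- There is no nonzero theta function of degree `-1`: its maximum modulus on the circle with
`|c z| = |p|^{1/2}` would exceed its values on the two neighbouring circles. -/
theorem eq_zero_of_quasi_neg_degree (hp0 : p ≠ 0) (hp : ‖p‖ < 1) {g : ℂ → ℂ} {c : ℂ}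
    (hg : ∀ z ≠ 0, DifferentiableAt ℂ g z) (hq : ∀ z ≠ 0, g (p * z) = c * z * g z) :
    ∀ z ≠ 0, g z = 0 := by
  have hpp : 0 < ‖p‖ := norm_pos_iff.2 hp0
  by_cases hc : c = 0
  · intro z hz
    have := hq (p⁻¹ * z) (mul_ne_zero (inv_ne_zero hp0) hz)
    rwa [mul_inv_cancel_left₀ hp0, hc, zero_mul, zero_mul] at this
  have hcc : 0 < ‖c‖ := norm_pos_iff.2 hc
  set s : ℝ := √‖p‖ with hs
  have hs0 : 0 < s := Real.sqrt_pos.2 hpp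
  have hs1 : s < 1 := by rw [hs, Real.sqrt_lt' one_pos]; simpa using hp
  have hss : s * s = ‖p‖ := Real.mul_self_sqrt hpp.le
  set ρ : ℝ := s / ‖c‖ with hρ
  have hρ0 : 0 < ρ := by positivity
  have hcρ : ‖c‖ * ρ = s := by rw [hρ]; field_simp
  obtain ⟨z₀, hz₀, hmax⟩ := (isCompact_sphere (0 : ℂ) ρ).exists_isMaxOn
    (NormedSpace.sphere_nonempty.2 hρ0.le) (f := fun z => ‖g z‖) (fun z hz =>
      ((hg z (by rintro rfl; simp at hz; exact hρ0.ne hz)).continuousAt.norm.continuousWithinAt))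
  set M := ‖g z₀‖ with hM
  have hM0 : 0 ≤ M := norm_nonneg _
  have hle (z : ℂ) (hz : ‖z‖ = ρ) : ‖g z‖ ≤ M := hmax (by simpa using hz)
  have hz₀' : ‖z₀‖ = ρ := by simpa using hz₀
  have hdo : ∀ z ∈ closure {z : ℂ | ‖p‖ * ρ < ‖z‖ ∧ ‖z‖ < ρ / ‖p‖}, z ≠ 0 := by
    intro z hz
    have hc : IsClosed {z : ℂ | ‖p‖ * ρ ≤ ‖z‖} := isClosed_le continuous_const continuous_norm
    have := closure_minimal (fun w (hw : ‖p‖ * ρ < ‖w‖ ∧ ‖w‖ < ρ / ‖p‖) => hw.1.le) hc hz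
    rw [← norm_pos_iff]
    exact lt_of_lt_of_le (by positivity) this
  have key : ‖g z₀‖ ≤ s * M := by
    refine Complex.norm_le_of_forall_mem_frontier_norm_le
      (U := {z : ℂ | ‖p‖ * ρ < ‖z‖ ∧ ‖z‖ < ρ / ‖p‖}) ?_ ?_ ?_ (subset_closure ?_)
    · exact (Metric.isBounded_ball (x := (0 : ℂ)) (r := ρ / ‖p‖)).subset fun z hz => by
        simpa using hz.2
    · exact ⟨fun z hz => (hg z (hdo z (subset_closure hz))).differentiableWithinAt,
        fun z hz => (hg z (hdo z hz)).continuousAt.continuousWithinAt⟩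
    · intro z hz
      rcases frontier_annulus_subset _ _ hz with h | h
      · have hz0 : z ≠ 0 := by rw [← norm_pos_iff, h]; positivity
        have hw : ‖p⁻¹ * z‖ = ρ := by rw [norm_mul, norm_inv, h]; field_simp
        have := hq (p⁻¹ * z) (mul_ne_zero (inv_ne_zero hp0) hz0)
        rw [mul_inv_cancel_left₀ hp0] at this
        rw [this, norm_mul, norm_mul, hw, hcρ]
        exact mul_le_mul_of_nonneg_left (hle _ hw) hs0.le
      · have hz0 : z ≠ 0 := by rw [← norm_pos_iff, h]; positivity
        have hw : ‖p * z‖ = ρ := by rw [norm_mul, h]; field_simp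
        have h2 := hle _ hw
        rw [hq z hz0, norm_mul, norm_mul, h] at h2
        have h3 : ‖c‖ * (ρ / ‖p‖) = s⁻¹ := by
          rw [← mul_div_assoc, hcρ, ← hss]; field_simp
        rw [h3] at h2
        calc ‖g z‖ = s * (s⁻¹ * ‖g z‖) := by field_simp
          _ ≤ s * M := mul_le_mul_of_nonneg_left h2 hs0.le
    · refine ⟨?_, ?_⟩
      · rw [hz₀']; nlinarith
      · rw [hz₀', lt_div_iff₀ hpp]; nlinarith
  have hMz : M = 0 := by nlinarith
  have hzero (z : ℂ) (hz : ‖z‖ = ρ) : g z = 0 :=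
    norm_le_zero_iff.1 (hMz ▸ hle z hz)
  have han : AnalyticOnNhd ℂ g {0}ᶜ :=
    DifferentiableOn.analyticOnNhd (fun w hw => (hg w hw).differentiableWithinAt)
      isOpen_compl_singleton
  have hfreq : ∃ᶠ z in 𝓝[≠] z₀, g z = 0 := by
    have hz00 : z₀ ≠ 0 := by rw [← norm_pos_iff, hz₀']; exact hρ0
    have ht : Tendsto (fun t : ℝ => z₀ * exp (t * I)) (𝓝[≠] 0) (𝓝[≠] z₀) := by
      have hd : HasDerivAt (fun t : ℝ => z₀ * exp (t * I)) (z₀ * (exp ((0 : ℝ) * I) * (1 * I))) 0 :=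
        (((Complex.ofRealCLM.hasDerivAt (x := (0 : ℝ))).mul_const I).cexp).const_mul z₀
      have h1 := hd.eventually_ne (c := z₀) (by simp [hz00])
      have h2 : Tendsto (fun t : ℝ => z₀ * exp (t * I)) (𝓝[≠] 0) (𝓝 z₀) := by
        have := hd.continuousAt.tendsto
        simp only [ofReal_zero, zero_mul, exp_zero, mul_one] at this
        exact this.mono_left nhdsWithin_le_nhds
      exact tendsto_nhdsWithin_iff.2 ⟨h2, h1⟩
    refine ht.frequently (Eventually.frequently (Eventually.of_forall fun t => hzero _ ?_))
    rw [norm_mul, norm_exp_ofReal_mul_I, mul_one, hz₀']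
  have := han.eqOn_zero_of_preconnected_of_frequently_eq_zero isPreconnected_compl_zero
    (show z₀ ∈ ({0}ᶜ : Set ℂ) by
      intro h; simp at h; rw [h] at hz₀'; simp at hz₀'; exact hρ0.ne hz₀') hfreq
  exact fun z hz => this hz

/-- A theta function of degree `k` with `k + 1` zeros that are distinct modulo `p^ℤ` vanishes.
The degree is encoded in the length of the list of zeros. -/
theorem eq_zero_of_quasi_of_zeros (hp0 : p ≠ 0) (hp : ‖p‖ < 1) (l : List ℂ) :
    ∀ {f : ℂ → ℂ} {c : ℂ}, (∀ z ≠ 0, DifferentiableAt ℂ f z) →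
    (∀ z ≠ 0, f (p * z) * z ^ l.length = c * z * f z) → (∀ a ∈ l, a ≠ 0 ∧ f a = 0) →
    l.Pairwise (fun a b => theta (b * a⁻¹) p ≠ 0) → ∀ z ≠ 0, f z = 0 := by
  induction l with
  | nil =>
    intro f c hf hq _ _
    exact eq_zero_of_quasi_neg_degree hp0 hp (c := c) hf (by simpa using hq)
  | cons a l ih =>
    intro f c hf hq h0 hl
    obtain ⟨ha, hfa⟩ := h0 a (by simp)
    have hai := inv_ne_zero ha
    rw [List.pairwise_cons] at hl
    have hd (z : ℂ) (hz : z ≠ 0) : HasDerivAt (fun z => theta (z * a⁻¹) p)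
        (deriv (fun z => theta z p) (z * a⁻¹) * (1 * a⁻¹)) z :=
      HasDerivAt.comp z (h₂ := fun z => theta z p)
        (differentiableAt_theta hp (mul_ne_zero hz hai)).hasDerivAt
        ((hasDerivAt_id z).mul_const a⁻¹)
    have hsimple (z : ℂ) (hz : z ≠ 0) (h : theta (z * a⁻¹) p = 0) :
        deriv (fun z => theta (z * a⁻¹) p) z ≠ 0 := by
      rw [(hd z hz).deriv]
      obtain ⟨k, hk⟩ := (theta_eq_zero_iff hp0 hp (mul_ne_zero hz hai)).1 h
      rw [hk]
      exact mul_ne_zero (deriv_theta_zpow_ne_zero hp0 hp k) (by simpa using ha)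
    have hz_iff (z : ℂ) (hz : z ≠ 0) : f (p * z) = 0 ↔ f z = 0 := by
      have h := hq z hz
      by_cases hc : c = 0
      · have hall (w : ℂ) (hw : w ≠ 0) : f w = 0 := by
          have h2 := hq (p⁻¹ * w) (mul_ne_zero (inv_ne_zero hp0) hw)
          rw [mul_inv_cancel_left₀ hp0, hc, zero_mul, zero_mul] at h2
          exact (mul_eq_zero.1 h2).resolve_right
            (pow_ne_zero _ (mul_ne_zero (inv_ne_zero hp0) hw))
        simp [hall z hz, hall _ (mul_ne_zero hp0 hz)]
      · constructor
        · intro h3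
          rw [h3, zero_mul] at h
          exact (mul_eq_zero.1 h.symm).resolve_left (mul_ne_zero hc hz)
        · intro h3
          rw [h3, mul_zero] at h
          exact (mul_eq_zero.1 h).resolve_right (pow_ne_zero _ hz)
    have hvan (k : ℤ) : f (p ^ k * a) = 0 := by
      induction k with
      | zero => simpa using hfa
      | succ k ihk =>
        rw [zpow_add₀ hp0, zpow_one, mul_comm (p ^ (k : ℤ)) p, mul_assoc]
        exact (hz_iff _ (mul_ne_zero (zpow_ne_zero _ hp0) ha)).2 ihk
      | pred k ihk =>
        refine (hz_iff _ (mul_ne_zero (zpow_ne_zero _ hp0) ha)).1 ?_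
        rwa [← mul_assoc, ← zpow_one_add₀ hp0, add_sub_cancel]
    obtain ⟨g, hg, hfg⟩ := exists_eq_mul_of_simple_zeros hf
      (fun z hz => (hd z hz).differentiableAt) (fun z hz h => ⟨hsimple z hz h, by
        obtain ⟨k, hk⟩ := (theta_eq_zero_iff hp0 hp (mul_ne_zero hz hai)).1 h
        rw [show z = p ^ k * a by rw [← hk]; field_simp]
        exact hvan k⟩)
    have hcont (z : ℂ) (hz : z ≠ 0) : ContinuousAt (fun z => g (p * z)) z :=
      ContinuousAt.comp (g := g) (hg _ (mul_ne_zero hp0 hz)).continuousAt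
        (continuousAt_const.mul continuousAt_id)
    have hgq := eq_of_mul_eq_mul_of_simple_zeros (h := fun z => theta (z * a⁻¹) p)
      (u := fun z => g (p * z) * z ^ l.length) (v := fun z => -(c * a⁻¹) * z * g z)
      (fun z hz => (hd z hz).differentiableAt) hsimple
      (fun z hz => (hcont z hz).mul (continuousAt_id.pow _))
      (fun z hz => (continuousAt_const.mul continuousAt_id).mul (hg z hz).continuousAt)
      (fun z hz => by
        have h1 := hq z hz
        rw [hfg z hz, hfg _ (mul_ne_zero hp0 hz), mul_assoc p, theta_mul_p hp0 hp
          (mul_ne_zero hz hai), List.length_cons, pow_succ] at h1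
        field_simp at h1 ⊢
        linear_combination -h1)
    have hg0 := ih (c := -(c * a⁻¹)) hg hgq (fun b hb => by
      obtain ⟨hb0, hfb⟩ := h0 b (by simp [hb])
      refine ⟨hb0, ?_⟩
      rw [hfg b hb0] at hfb
      exact (mul_eq_zero.1 hfb).resolve_left (hl.1 b hb)) hl.2
    intro z hz
    rw [hfg z hz, hg0 z hz, mul_zero]

/-- Even theta functions of degree `N` for the nome `p`: the holomorphic functions on `ℂ ∖ {0}`
with `f(z⁻¹) = f(z)` and `f(p z) = (p z²)^{-N} f(z)`. -/
structure IsEvenTheta (p : ℂ) (N : ℕ) (f : ℂ → ℂ) : Prop where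
  diff : ∀ z ≠ 0, DifferentiableAt ℂ f z
  quasi : ∀ z ≠ 0, f (p * z) = ((p * z ^ 2) ^ N)⁻¹ * f z
  even : ∀ z ≠ 0, f z⁻¹ = f z

namespace IsEvenTheta

variable {N M : ℕ} {f g : ℂ → ℂ}

theorem add (hf : IsEvenTheta p N f) (hg : IsEvenTheta p N g) :
    IsEvenTheta p N fun z => f z + g z where
  diff z hz := (hf.diff z hz).add (hg.diff z hz)
  quasi z hz := by rw [hf.quasi z hz, hg.quasi z hz, mul_add]
  even z hz := by rw [hf.even z hz, hg.even z hz]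

theorem const_mul (hf : IsEvenTheta p N f) (c : ℂ) : IsEvenTheta p N fun z => c * f z where
  diff z hz := (hf.diff z hz).const_mul c
  quasi z hz := by rw [hf.quasi z hz, mul_left_comm]
  even z hz := by rw [hf.even z hz]

theorem sub (hf : IsEvenTheta p N f) (hg : IsEvenTheta p N g) :
    IsEvenTheta p N fun z => f z - g z := by
  simpa [sub_eq_add_neg] using hf.add (hg.const_mul (-1))

theorem mul (hf : IsEvenTheta p N f) (hg : IsEvenTheta p M g) :
    IsEvenTheta p (N + M) fun z => f z * g z where
  diff z hz := (hf.diff z hz).mul (hg.diff z hz)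
  quasi z hz := by rw [hf.quasi z hz, hg.quasi z hz, pow_add, mul_inv]; ring
  even z hz := by rw [hf.even z hz, hg.even z hz]

theorem zero : IsEvenTheta p N fun _ => 0 :=
  ⟨fun _ _ => differentiableAt_const _, fun _ _ => by simp, fun _ _ => rfl⟩

theorem one : IsEvenTheta p 0 fun _ => 1 :=
  ⟨fun _ _ => differentiableAt_const _, fun _ _ => by simp, fun _ _ => rfl⟩

theorem sum {ι : Type*} (s : Finset ι) {F : ι → ℂ → ℂ} (h : ∀ i ∈ s, IsEvenTheta p N (F i)) :
    IsEvenTheta p N fun z => ∑ i ∈ s, F i z := by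
  classical
  induction s using Finset.induction_on with
  | empty => simpa using zero
  | insert i s hi ih =>
    simp_rw [Finset.sum_insert hi]
    exact (h i (by simp)).add (ih fun j hj => h j (by simp [hj]))

theorem prod {ι : Type*} (s : Finset ι) {F : ι → ℂ → ℂ} (h : ∀ i ∈ s, IsEvenTheta p 1 (F i)) :
    IsEvenTheta p s.card fun z => ∏ i ∈ s, F i z := by
  classical
  induction s using Finset.induction_on with
  | empty => simpa using one
  | insert i s hi ih =>
    simp_rw [Finset.prod_insert hi, Finset.card_insert_of_notMem hi, add_comm s.card]
    exact (h i (by simp)).mul (ih fun j hj => h j (by simp [hj]))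

end IsEvenTheta

theorem hasDerivAt_thetaPM (hp : ‖p‖ < 1) {a z : ℂ} (ha : a ≠ 0) (hz : z ≠ 0) :
    HasDerivAt (fun z => thetaPM a z p)
      (deriv (fun z => theta z p) (a * z) * a * theta (a * z⁻¹) p +
        theta (a * z) p * (deriv (fun z => theta z p) (a * z⁻¹) * (a * -(z ^ 2)⁻¹))) z := by
  have h1 : HasDerivAt (fun z => theta (a * z) p)
      (deriv (fun z => theta z p) (a * z) * (a * 1)) z :=
    HasDerivAt.comp z (h₂ := fun z => theta z p)
      (differentiableAt_theta hp (mul_ne_zero ha hz)).hasDerivAt ((hasDerivAt_id z).const_mul a)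
  have h2 : HasDerivAt (fun z => theta (a * z⁻¹) p)
      (deriv (fun z => theta z p) (a * z⁻¹) * (a * -(z ^ 2)⁻¹)) z :=
    HasDerivAt.comp z (h₂ := fun z => theta z p)
      (differentiableAt_theta hp (mul_ne_zero ha (inv_ne_zero hz))).hasDerivAt
      ((hasDerivAt_inv hz).const_mul a)
  have h := h1.mul h2
  rw [mul_one] at h
  exact h

theorem theta_div_p (hp0 : p ≠ 0) (hp : ‖p‖ < 1) (hz : z ≠ 0) :
    theta (p⁻¹ * z) p = -(p⁻¹ * z) * theta z p := by
  have h := theta_mul_p hp0 hp (mul_ne_zero (inv_ne_zero hp0) hz)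
  rw [mul_inv_cancel_left₀ hp0] at h
  rw [h]
  field_simp

theorem isEvenTheta_thetaPM (hp0 : p ≠ 0) (hp : ‖p‖ < 1) {a : ℂ} (ha : a ≠ 0) :
    IsEvenTheta p 1 fun z => thetaPM a z p where
  diff z hz := (hasDerivAt_thetaPM hp ha hz).differentiableAt
  quasi z hz := by
    unfold thetaPM
    rw [show a * (p * z) = p * (a * z) by ring, theta_mul_p hp0 hp (mul_ne_zero ha hz),
      show a * (p * z)⁻¹ = p⁻¹ * (a * z⁻¹) by field_simp,
      theta_div_p hp0 hp (mul_ne_zero ha (inv_ne_zero hz)), pow_one]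
    field_simp
  even z hz := by simp [thetaPM, mul_comm]

theorem thetaPM_simple_zeros (hp0 : p ≠ 0) (hp : ‖p‖ < 1) {a : ℂ} (ha : a ≠ 0)
    (ha2 : theta (a ^ 2) p ≠ 0) {z : ℂ} (hz : z ≠ 0) (h : thetaPM a z p = 0) :
    deriv (fun z => thetaPM a z p) z ≠ 0 := by
  rw [(hasDerivAt_thetaPM hp ha hz).deriv]
  have haz := mul_ne_zero ha hz
  have haz' := mul_ne_zero ha (inv_ne_zero hz)
  have hnot (k l : ℤ) (h1 : a * z = p ^ k) (h2 : a * z⁻¹ = p ^ l) : False := by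
    refine ha2 ?_
    rw [show a ^ 2 = p ^ (k + l) by rw [zpow_add₀ hp0, ← h1, ← h2]; field_simp]
    exact theta_zpow hp0 hp _
  rcases mul_eq_zero.1 h with h | h
  · obtain ⟨k, hk⟩ := (theta_eq_zero_iff hp0 hp haz).1 h
    rw [h, zero_mul, add_zero]
    refine mul_ne_zero (mul_ne_zero (hk ▸ deriv_theta_zpow_ne_zero hp0 hp k) ha) fun h2 => ?_
    obtain ⟨l, hl⟩ := (theta_eq_zero_iff hp0 hp haz').1 h2
    exact hnot k l hk hl
  · obtain ⟨l, hl⟩ := (theta_eq_zero_iff hp0 hp haz').1 h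
    rw [h, mul_zero, zero_add]
    refine mul_ne_zero (fun h2 => ?_) (mul_ne_zero (hl ▸ deriv_theta_zpow_ne_zero hp0 hp l)
      (mul_ne_zero ha (by simpa using hz)))
    obtain ⟨k, hk⟩ := (theta_eq_zero_iff hp0 hp haz).1 h2
    exact hnot k l hk hl

namespace IsEvenTheta

variable {N M : ℕ} {f g : ℂ → ℂ}

theorem eq_zero_zpow_mul (hp0 : p ≠ 0) (hf : IsEvenTheta p N f) {a : ℂ} (ha : a ≠ 0)
    (hfa : f a = 0) (k : ℤ) : f (p ^ k * a) = 0 := by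
  have hz_iff (z : ℂ) (hz : z ≠ 0) : f (p * z) = 0 ↔ f z = 0 := by
    rw [hf.quasi z hz, mul_eq_zero]
    simp [hp0, hz]
  induction k with
  | zero => simpa using hfa
  | succ k ihk =>
    rw [zpow_add₀ hp0, zpow_one, mul_comm (p ^ (k : ℤ)) p, mul_assoc]
    exact (hz_iff _ (mul_ne_zero (zpow_ne_zero _ hp0) ha)).2 ihk
  | pred k ihk =>
    refine (hz_iff _ (mul_ne_zero (zpow_ne_zero _ hp0) ha)).1 ?_
    rwa [← mul_assoc, ← zpow_one_add₀ hp0, add_sub_cancel]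

/-- Division of an even theta function by a zero. -/
theorem exists_eq_thetaPM_mul (hp0 : p ≠ 0) (hp : ‖p‖ < 1) (hf : IsEvenTheta p (N + 1) f) {a : ℂ}
    (ha : a ≠ 0) (ha2 : theta (a ^ 2) p ≠ 0) (hfa : f a = 0) :
    ∃ g, IsEvenTheta p N g ∧ ∀ z ≠ 0, f z = thetaPM a z p * g z := by
  have hθ := isEvenTheta_thetaPM hp0 hp ha
  obtain ⟨g, hg, hfg⟩ := exists_eq_mul_of_simple_zeros hf.diff hθ.diff (fun z hz h =>
    ⟨thetaPM_simple_zeros hp0 hp ha ha2 hz h, by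
      rcases mul_eq_zero.1 h with h | h
      · obtain ⟨k, hk⟩ := (theta_eq_zero_iff hp0 hp (mul_ne_zero ha hz)).1 h
        rw [show z = p ^ k * a⁻¹ by rw [← hk]; field_simp]
        exact hf.eq_zero_zpow_mul hp0 (inv_ne_zero ha) (by rw [hf.even a ha, hfa]) k
      · obtain ⟨k, hk⟩ := (theta_eq_zero_iff hp0 hp (mul_ne_zero ha (inv_ne_zero hz))).1 h
        rw [show z = p ^ (-k) * a by rw [zpow_neg, ← hk]; field_simp]
        exact hf.eq_zero_zpow_mul hp0 ha hfa _⟩)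
  refine ⟨g, ⟨hg, ?_, ?_⟩, hfg⟩
  · refine eq_of_mul_eq_mul_of_simple_zeros (h := fun z => thetaPM a z p) hθ.diff
      (fun z hz h => thetaPM_simple_zeros hp0 hp ha ha2 hz h)
      (fun z hz => ContinuousAt.comp (g := g) (hg _ (mul_ne_zero hp0 hz)).continuousAt
        (continuousAt_const.mul continuousAt_id))
      (fun z hz => ContinuousAt.mul (ContinuousAt.inv₀ (by fun_prop) (by simp [hp0, hz]))
        (hg z hz).continuousAt) (fun z hz => ?_)
    have h1 := hf.quasi z hz
    rw [hfg z hz, hfg _ (mul_ne_zero hp0 hz), hθ.quasi z hz, pow_succ] at h1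
    have hne : p * z ^ 2 ≠ 0 := mul_ne_zero hp0 (pow_ne_zero 2 hz)
    field_simp at h1 ⊢
    refine mul_left_cancel₀ hne ?_
    linear_combination h1
  · refine eq_of_mul_eq_mul_of_simple_zeros (h := fun z => thetaPM a z p) hθ.diff
      (fun z hz h => thetaPM_simple_zeros hp0 hp ha ha2 hz h)
      (fun z hz => ContinuousAt.comp (g := g) (hg _ (inv_ne_zero hz)).continuousAt
        (continuousAt_inv₀ hz)) (fun z hz => (hg z hz).continuousAt) (fun z hz => ?_)
    have h1 := hf.even z hz
    rw [hfg z hz, hfg _ (inv_ne_zero hz), hθ.even z hz] at h1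
    exact h1

theorem eq_zero_of_zero (hp0 : p ≠ 0) (hp : ‖p‖ < 1) (hf : IsEvenTheta p 0 f) {a : ℂ}
    (ha : a ≠ 0) (hfa : f a = 0) : ∀ z ≠ 0, f z = 0 :=
  eq_zero_of_quasi_of_zeros hp0 hp [a] (c := 1) hf.diff
    (fun z hz => by rw [hf.quasi z hz]; simp [mul_comm]) (by simp [ha, hfa]) (by simp)

/-- An even theta function of degree `N` with `N + 1` independent zeros vanishes. -/
theorem eq_zero_of_zeros (hp0 : p ≠ 0) (hp : ‖p‖ < 1) {ι : Type*} {x : ι → ℂ} (s : Finset ι) :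
    ∀ {N : ℕ} {f : ℂ → ℂ}, IsEvenTheta p N f → s.card = N + 1 → (∀ i ∈ s, x i ≠ 0 ∧ f (x i) = 0) →
    (∀ i ∈ s, theta (x i ^ 2) p ≠ 0) →
    (∀ i ∈ s, ∀ j ∈ s, i ≠ j → thetaPM (x i) (x j) p ≠ 0) → ∀ z ≠ 0, f z = 0 := by
  classical
  induction s using Finset.induction_on with
  | empty => intro N f _ h; simp at h
  | insert i s hi ih =>
    intro N f hf hN h0 h2 hd
    obtain ⟨hx, hfx⟩ := h0 i (by simp)
    rw [Finset.card_insert_of_notMem hi, Nat.add_right_cancel_iff] at hN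
    cases N with
    | zero => exact hf.eq_zero_of_zero hp0 hp hx hfx
    | succ N =>
      obtain ⟨g, hg, hfg⟩ := hf.exists_eq_thetaPM_mul hp0 hp hx (h2 i (by simp)) hfx
      have := ih hg hN (fun j hj => by
        obtain ⟨hj0, hfj⟩ := h0 j (by simp [hj])
        refine ⟨hj0, ?_⟩
        rw [hfg _ hj0] at hfj
        exact (mul_eq_zero.1 hfj).resolve_left
          (hd i (by simp) j (by simp [hj]) (by rintro rfl; exact hi hj)))
        (fun j hj => h2 j (by simp [hj]))
        (fun j hj k hk => hd j (by simp [hj]) k (by simp [hk]))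
      intro z hz
      rw [hfg z hz, this z hz, mul_zero]

/-- Lagrange interpolation of even theta functions. -/
theorem lagrange (hp0 : p ≠ 0) (hp : ‖p‖ < 1) {ι : Type*} [DecidableEq ι] {x : ι → ℂ}
    {s : Finset ι} (hf : IsEvenTheta p N f) (hs : s.card = N + 1) (hx : ∀ i ∈ s, x i ≠ 0)
    (h2 : ∀ i ∈ s, theta (x i ^ 2) p ≠ 0)
    (hd : ∀ i ∈ s, ∀ j ∈ s, i ≠ j → thetaPM (x i) (x j) p ≠ 0) {y : ℂ} (hy : y ≠ 0) :
    f y = ∑ k ∈ s, f (x k) *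
      ∏ j ∈ s.erase k, thetaPM (x j) y p / thetaPM (x j) (x k) p := by
  have hsum : IsEvenTheta p N fun y => ∑ k ∈ s, (f (x k) *
      ∏ j ∈ s.erase k, thetaPM (x j) y p / thetaPM (x j) (x k) p) := by
    refine sum s fun k hk => const_mul ?_ _
    have hc : (s.erase k).card = N := by rw [Finset.card_erase_of_mem hk, hs]; rfl
    rw [← hc]
    refine prod _ fun j hj => ?_
    simp_rw [div_eq_inv_mul]
    exact (isEvenTheta_thetaPM hp0 hp (hx j (Finset.mem_of_mem_erase hj))).const_mul _
  refine sub_eq_zero.1 ((hf.sub hsum).eq_zero_of_zeros hp0 hp s hs (fun i hi => ⟨hx i hi, ?_⟩)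
    h2 hd y hy)
  rw [Finset.sum_eq_single_of_mem i hi]
  · rw [Finset.prod_congr rfl (fun j hj => div_self ?_), Finset.prod_const_one, mul_one, sub_self]
    exact hd j (Finset.mem_of_mem_erase hj) i hi (Finset.ne_of_mem_erase hj)
  · intro k hk hki
    rw [Finset.prod_eq_zero (i := i) (Finset.mem_erase.2 ⟨hki.symm, hi⟩), mul_zero]
    rw [show thetaPM (x i) (x i) p = 0 by
      rw [thetaPM, mul_inv_cancel₀ (hx i hi), theta_one hp, mul_zero], zero_div]

end IsEvenTheta

/-- The product `θ(t x, t / x)_n`. -/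
def ellPochPM (t x : ℂ) (n : ℕ) (q p : ℂ) : ℂ := ∏ j ∈ Finset.range n, thetaPM (t * q ^ j) x p

theorem ellPochPM_eq (t x : ℂ) (n : ℕ) (q p : ℂ) :
    ellPochPM t x n q p = ellPoch (t * x) n q p * ellPoch (t * x⁻¹) n q p := by
  simp only [ellPochPM, ellPoch, thetaPM, ← Finset.prod_mul_distrib]
  refine Finset.prod_congr rfl fun j _ => ?_
  congr 2 <;> ring

theorem isEvenTheta_ellPochPM (hp0 : p ≠ 0) (hp : ‖p‖ < 1) (hq : q ≠ 0) {a : ℂ} (ha : a ≠ 0)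
    (n : ℕ) : IsEvenTheta p n fun z => ellPochPM a z n q p := by
  have := IsEvenTheta.prod (p := p) (Finset.range n) (F := fun j z => thetaPM (a * q ^ j) z p)
    fun j _ => isEvenTheta_thetaPM hp0 hp (mul_ne_zero ha (pow_ne_zero j hq))
  simpa [ellPochPM] using this

theorem ellPochPM_succ' (a x : ℂ) (n : ℕ) (q p : ℂ) :
    ellPochPM a x (n + 1) q p = thetaPM a x p * ellPochPM (a * q) x n q p := by
  rw [ellPochPM, Finset.prod_range_succ', mul_comm]
  simp [ellPochPM, pow_succ', mul_assoc]

/-- For generic `a, b` the products `θ(a x^±)_i θ(b x^±)_{N-i}` span the even theta functions of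
degree `N`. -/
theorem IsEvenTheta.exists_expansion (hp0 : p ≠ 0) (hp : ‖p‖ < 1) (hq : q ≠ 0) {b : ℂ}
    (hb : b ≠ 0) (N : ℕ) : ∀ {f : ℂ → ℂ} {a : ℂ}, IsEvenTheta p N f → a ≠ 0 →
    (∀ i < N, theta ((a * q ^ i) ^ 2) p ≠ 0) →
    (∀ i < N, ∀ j < N, thetaPM (b * q ^ j) (a * q ^ i) p ≠ 0) →
    ∃ c : ℕ → ℂ, ∀ z ≠ 0, f z =
      ∑ i ∈ Finset.range (N + 1), c i * (ellPochPM a z i q p * ellPochPM b z (N - i) q p) := by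
  induction N with
  | zero =>
    intro f a hf ha _ _
    refine ⟨fun _ => f 1, fun z hz => ?_⟩
    have h1 : IsEvenTheta p 0 fun _ => f 1 := by simpa using IsEvenTheta.one.const_mul (f 1)
    have := (hf.sub h1).eq_zero_of_zero hp0 hp one_ne_zero (sub_self _) z hz
    simpa [ellPochPM] using sub_eq_zero.1 this
  | succ N ih =>
    intro f a hf ha h2 hd
    have hB := isEvenTheta_ellPochPM hp0 hp hq hb (N + 1)
    have hBa : ellPochPM b a (N + 1) q p ≠ 0 := Finset.prod_ne_zero_iff.2 fun j hj => by
      simpa using hd 0 (Nat.succ_pos N) j (Finset.mem_range.1 hj)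
    obtain ⟨g, hg, hfg⟩ := (hf.sub (hB.const_mul (f a / ellPochPM b a (N + 1) q p))
      ).exists_eq_thetaPM_mul hp0 hp ha (by simpa using h2 0 (Nat.succ_pos N))
      (by rw [div_mul_cancel₀ _ hBa, sub_self])
    obtain ⟨c, hc⟩ := ih (a := a * q) hg (mul_ne_zero ha hq)
      (fun i hi => by simpa [pow_succ', mul_assoc] using h2 (i + 1) (by lia))
      (fun i hi j hj => by
        simpa [pow_succ', mul_assoc] using hd (i + 1) (by lia) j (by lia))
    refine ⟨fun i => if i = 0 then f a / ellPochPM b a (N + 1) q p else c (i - 1),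
      fun z hz => ?_⟩
    rw [Finset.sum_range_succ', sub_eq_iff_eq_add.1 (hfg z hz), hc z hz, Finset.mul_sum]
    congr 1
    · refine Finset.sum_congr rfl fun i _ => ?_
      simp only [Nat.add_eq_zero_iff, one_ne_zero, and_false, if_false]
      rw [ellPochPM_succ', Nat.add_sub_add_right i 1 0, Nat.add_sub_add_right N 1 i, Nat.sub_zero]
      ring
    · simp [ellPochPM]

/-! ### Contours, winding numbers and residues -/

section Contours

variable {γ : ℝ → ℂ} {f g : ℂ → ℂ}

theorem IsContour.exists_differentiableAt (h : IsContour γ) :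
    ∃ P : Finset ℝ, ∀ t ∈ Set.Ioo (0 : ℝ) 1 \ P, DifferentiableAt ℝ γ t := by
  obtain ⟨P, hP⟩ := h.piecewise
  refine ⟨P, fun t ht => ?_⟩
  have hn : Set.Ioo (0 : ℝ) 1 ∩ (P : Set ℝ)ᶜ ∈ 𝓝 t :=
    (isOpen_Ioo.inter P.finite_toSet.isClosed.isOpen_compl).mem_nhds ht
  obtain ⟨a, b, hab, hsub⟩ := mem_nhds_iff_exists_Ioo_subset.1 hn
  have hc : ContDiffOn ℝ 1 γ (Set.Icc ((a + t) / 2) ((t + b) / 2)) := by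
    have h1 := hsub (show (a + t) / 2 ∈ Set.Ioo a b from ⟨by linarith [hab.1], by
      linarith [hab.1, hab.2]⟩)
    have h2 := hsub (show (t + b) / 2 ∈ Set.Ioo a b from ⟨by linarith [hab.1, hab.2], by
      linarith [hab.2]⟩)
    refine hP _ _ h1.1.1.le (by linarith [hab.1, hab.2]) h2.1.2.le ?_
    refine Set.disjoint_left.2 fun x hx hxP => (hsub (?_ : x ∈ Set.Ioo a b)).2 hxP
    exact ⟨by linarith [hx.1, hab.1], by linarith [hx.2, hab.2]⟩
  exact (hc.differentiableOn one_ne_zero).differentiableAt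
    (Icc_mem_nhds (by linarith [hab.1]) (by linarith [hab.2]))

theorem IsContour.intervalIntegrable_deriv (h : IsContour γ) :
    IntervalIntegrable (deriv γ) volume 0 1 := by
  classical
  obtain ⟨P, hP⟩ := h.piecewise
  have key : ∀ n : ℕ, ∀ a b : ℝ, 0 ≤ a → a < b → b ≤ 1 →
      (P.filter (· ∈ Set.Ioo a b)).card = n → IntervalIntegrable (deriv γ) volume a b := by
    intro n
    induction n using Nat.strong_induction_on with
    | _ n ih =>
      intro a b ha hab hb hn
      by_cases hd : Disjoint (Set.Ioo a b) (P : Set ℝ)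
      · have hc := (hP a b ha hab hb hd).continuousOn_derivWithin (uniqueDiffOn_Icc hab) le_rfl
        have hi : IntervalIntegrable (derivWithin γ (Set.Icc a b)) volume a b :=
          (hc.mono (by rw [Set.uIcc_of_le hab.le])).intervalIntegrable
        rw [intervalIntegrable_iff_integrableOn_Ioo_of_le hab.le] at hi ⊢
        refine hi.congr_fun (fun t ht => ?_) measurableSet_Ioo
        exact derivWithin_of_mem_nhds (Icc_mem_nhds ht.1 ht.2)
      · obtain ⟨x, hx, hxP⟩ := Set.not_disjoint_iff.1 hd
        have hxP' : x ∈ P := hxP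
        have hlt (c d : ℝ) (hcd : Set.Ioo c d ⊆ Set.Ioo a b) (hxn : x ∉ Set.Ioo c d) :
            (P.filter (· ∈ Set.Ioo c d)).card < n := by
          rw [← hn]
          refine Finset.card_lt_card (Finset.ssubset_iff_of_subset ?_ |>.2 ⟨x, ?_, ?_⟩)
          · exact Finset.monotone_filter_right _ fun y _ hy => hcd hy
          · exact Finset.mem_filter.2 ⟨hxP', hx⟩
          · exact fun hc => hxn (Finset.mem_filter.1 hc).2
        exact (ih _ (hlt a x (Set.Ioo_subset_Ioo_right hx.2.le) (by simp)) a x ha hx.1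
          (hx.2.le.trans hb) rfl).trans (ih _ (hlt x b (Set.Ioo_subset_Ioo_left hx.1.le) (by simp))
          x b (ha.trans hx.1.le) hx.2 hb rfl)
  exact key _ 0 1 le_rfl one_pos le_rfl rfl

theorem IsContour.continuousOn_comp (h : IsContour γ)
    (hf : ∀ t ∈ Set.Icc (0 : ℝ) 1, ContinuousAt f (γ t)) :
    ContinuousOn (fun t => f (γ t)) (Set.Icc 0 1) := fun t ht =>
  ContinuousAt.comp_continuousWithinAt (g := f) (hf t ht) (h.continuousOn t ht)

theorem IsContour.intervalIntegrable_pullback (h : IsContour γ)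
    (hf : ∀ t ∈ Set.Icc (0 : ℝ) 1, ContinuousAt f (γ t)) :
    IntervalIntegrable (pullback f γ) volume 0 1 :=
  h.intervalIntegrable_deriv.continuousOn_mul
    ((h.continuousOn_comp hf).mono (by rw [Set.uIcc_of_le zero_le_one]))

theorem IsContour.contourIntegral_add (h : IsContour γ)
    (hf : ∀ t ∈ Set.Icc (0 : ℝ) 1, ContinuousAt f (γ t))
    (hg : ∀ t ∈ Set.Icc (0 : ℝ) 1, ContinuousAt g (γ t)) :
    contourIntegral (fun z => f z + g z) γ = contourIntegral f γ + contourIntegral g γ := by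
  unfold contourIntegral
  rw [← intervalIntegral.integral_add (h.intervalIntegrable_pullback hf)
    (h.intervalIntegrable_pullback hg)]
  simp [pullback, add_mul]

theorem contourIntegral_const_mul (c : ℂ) (f : ℂ → ℂ) (γ : ℝ → ℂ) :
    contourIntegral (fun z => c * f z) γ = c * contourIntegral f γ := by
  unfold contourIntegral
  rw [← intervalIntegral.integral_const_mul]
  simp [pullback, mul_assoc]

theorem IsContour.contourIntegral_sum (h : IsContour γ) {ι : Type*} (s : Finset ι)
    {F : ι → ℂ → ℂ} (hF : ∀ i ∈ s, ∀ t ∈ Set.Icc (0 : ℝ) 1, ContinuousAt (F i) (γ t)) :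
    contourIntegral (fun z => ∑ i ∈ s, F i z) γ = ∑ i ∈ s, contourIntegral (F i) γ := by
  unfold contourIntegral
  rw [← intervalIntegral.integral_finsetSum fun i hi => h.intervalIntegrable_pullback (hF i hi)]
  simp [pullback, Finset.sum_mul]

theorem contourIntegral_congr (h : ∀ t ∈ Set.Icc (0 : ℝ) 1, f (γ t) = g (γ t)) :
    contourIntegral f γ = contourIntegral g γ :=
  intervalIntegral.integral_congr fun t ht => by
    rw [Set.uIcc_of_le zero_le_one] at ht
    simp [pullback, h t ht]

/-- A function with a primitive has integral zero along a closed contour. -/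
theorem IsContour.contourIntegral_eq_zero_of_hasDerivAt (h : IsContour γ) {F : ℂ → ℂ}
    (hf : ∀ t ∈ Set.Icc (0 : ℝ) 1, ContinuousAt f (γ t))
    (hF : ∀ t ∈ Set.Icc (0 : ℝ) 1, HasDerivAt F (f (γ t)) (γ t)) :
    contourIntegral f γ = 0 := by
  obtain ⟨P, hP⟩ := h.exists_differentiableAt
  have := integral_eq_of_hasDerivAt_off_countable_of_le (fun t => F (γ t)) (pullback f γ)
    zero_le_one P.countable_toSet (h.continuousOn_comp fun t ht => (hF t ht).continuousAt)
    (fun t ht => (hF t ⟨ht.1.1.le, ht.1.2.le⟩).comp_of_eq t (hP t ht).hasDerivAt rfl)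
    (h.intervalIntegrable_pullback hf)
  rw [contourIntegral, this, h.closed, sub_self]

/-- Values at countably many points do not influence a contour integral: a curve passes through
a given point with nonzero speed only at isolated times. -/
theorem pullback_ae_eq (γ : ℝ → ℂ) {E : Set ℂ} (hE : E.Countable)
    (hfg : ∀ t ∈ Set.Icc (0 : ℝ) 1, γ t ∉ E → f (γ t) = g (γ t)) :
    pullback f γ =ᵐ[volume.restrict (Set.uIoc 0 1)] pullback g γ := by
  have hcount : {t | γ t ∈ E ∧ deriv γ t ≠ 0}.Countable := by
    have hsub : {t | γ t ∈ E ∧ deriv γ t ≠ 0} ⊆ ⋃ e ∈ E, {t | γ t = e ∧ deriv γ t ≠ 0} := by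
      rintro t ⟨h1, h2⟩
      exact Set.mem_biUnion h1 ⟨rfl, h2⟩
    refine (hE.biUnion fun e _ => ?_).mono hsub
    have hdisc : DiscreteTopology {t | γ t = e ∧ deriv γ t ≠ 0} := by
      refine discreteTopology_subtype_iff.2 fun t ht => ?_
      have hd : DifferentiableAt ℝ γ t := by
        by_contra hd
        exact ht.2 (deriv_zero_of_not_differentiableAt hd)
      have h1 := hd.hasDerivAt.eventually_ne (c := e) ht.2
      rw [← disjoint_iff, disjoint_principal_right]
      exact h1.mono fun s hs hs' => hs hs'.1
    exact Set.countable_coe_iff.1 (countable_of_Lindelof_of_discrete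
      (X := {t | γ t = e ∧ deriv γ t ≠ 0}))
  rw [Set.uIoc_of_le zero_le_one]
  refine (ae_restrict_iff' measurableSet_Ioc).2 ?_
  filter_upwards [hcount.ae_notMem volume] with t ht htI
  by_cases hγ : γ t ∈ E
  · have : deriv γ t = 0 := by
      by_contra hd
      exact ht ⟨hγ, hd⟩
    simp [pullback, this]
  · simp [pullback, hfg t ⟨htI.1.le, htI.2⟩ hγ]


theorem IsContour.windingNumber_eq (h : IsContour γ) {c w w' : ℂ} {r : ℝ}
    (hγ : ∀ t ∈ Set.Icc (0 : ℝ) 1, γ t ∉ Metric.ball c r) (hw : w ∈ Metric.ball c r)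
    (hw' : w' ∈ Metric.ball c r) : windingNumber γ w = windingNumber γ w' := by
  have hne (v : ℂ) (hv : v ∈ Metric.ball c r) (t : ℝ) (ht : t ∈ Set.Icc (0 : ℝ) 1) :
      γ t - v ≠ 0 := sub_ne_zero.2 fun e => hγ t ht (e ▸ hv)
  have hcont (v : ℂ) (hv : v ∈ Metric.ball c r) (t : ℝ) (ht : t ∈ Set.Icc (0 : ℝ) 1) :
      ContinuousAt (fun z => (z - v)⁻¹) (γ t) :=
    ContinuousAt.inv₀ (by fun_prop) (hne v hv t ht)
  have h0 : contourIntegral (fun z => (z - w)⁻¹ + (-1) * (z - w')⁻¹) γ = 0 := by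
    refine h.contourIntegral_eq_zero_of_hasDerivAt
      (F := fun z => log ((z - w) / (z - w'))) (fun t ht => (hcont w hw t ht).add
        (continuousAt_const.mul (hcont w' hw' t ht))) (fun t ht => ?_)
    have h1 := hne w hw t ht
    have h2 := hne w' hw' t ht
    have hs : (γ t - w) / (γ t - w') ∈ slitPlane := by
      by_contra hs
      rw [mem_slitPlane_iff_not_le_zero, not_not] at hs
      -- a nonpositive quotient puts `γ t` on the segment from `w` to `w'`
      obtain ⟨s, hs0, hs⟩ : ∃ s : ℝ, 0 ≤ s ∧ (γ t - w) / (γ t - w') = -(s : ℂ) := by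
        obtain ⟨hre, him⟩ := le_def.1 hs
        refine ⟨-((γ t - w) / (γ t - w')).re, by simpa using hre, ?_⟩
        apply Complex.ext <;> simp [him]
      rw [div_eq_iff h2] at hs
      have hmem := (convex_ball c r) hw hw' (a := 1 / (1 + s)) (b := s / (1 + s))
        (by positivity) (by positivity) (by field_simp)
      refine hγ t ht ?_
      have h3 : (1 + s : ℂ) ≠ 0 := by
        have : (0 : ℝ) < 1 + s := by linarith
        exact_mod_cast this.ne'
      have e : γ t = (1 / (1 + s) : ℝ) • w + (s / (1 + s) : ℝ) • w' := by
        simp only [real_smul]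
        push_cast
        field_simp
        linear_combination hs
      rwa [e]
    have hd : HasDerivAt (fun z => (z - w) / (z - w'))
        ((1 * (γ t - w') - (γ t - w) * 1) / (γ t - w') ^ 2) (γ t) :=
      ((hasDerivAt_id _).sub_const w).div ((hasDerivAt_id _).sub_const w') h2
    convert hd.clog hs using 1
    field_simp
    ring
  rw [h.contourIntegral_add (g := fun z => (-1) * (z - w')⁻¹) (hcont w hw)
    (fun t ht => continuousAt_const.mul (hcont w' hw' t ht)), contourIntegral_const_mul] at h0
  unfold windingNumber
  rw [show contourIntegral (fun z => (z - w)⁻¹) γ = contourIntegral (fun z => (z - w')⁻¹) γ by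
    linear_combination h0]

theorem windingNumber_mul (γ : ℝ → ℂ) (w : ℂ) :
    contourIntegral (fun z => (z - w)⁻¹) γ = 2 * Real.pi * I * windingNumber γ w := by
  rw [windingNumber, mul_inv_cancel_left₀ (by simp)]

/-- A holomorphic function on an annulus is the derivative of a function plus a multiple of
`z⁻¹`: lift to the logarithmic strip, where primitives exist and change by a constant under the
period `2πi`. -/
theorem exists_primitive_annulus {r R : ℝ} (hr : 0 < r)
    (hf : ∀ z, r < ‖z‖ → ‖z‖ < R → DifferentiableAt ℂ f z) :
    ∃ (c : ℂ) (F : ℂ → ℂ), ∀ z, r < ‖z‖ → ‖z‖ < R → HasDerivAt F (f z - c * z⁻¹) z := by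
  rcases le_or_gt R r with hRr | hRr
  · exact ⟨0, 0, fun z h1 h2 => absurd (h1.trans h2) hRr.not_gt⟩
  set V : Set ℂ := {u | r < ‖exp u‖ ∧ ‖exp u‖ < R} with hV
  have hVo : IsOpen V := (isOpen_lt continuous_const continuous_exp.norm).inter
    (isOpen_lt continuous_exp.norm continuous_const)
  have hVc : Convex ℝ V := by
    have : V = reLm ⁻¹' Set.Ioo (Real.log r) (Real.log R) := by
      ext u
      simp only [hV, norm_exp, Set.mem_preimage, Set.mem_Ioo, reLm_coe]
      rw [Real.log_lt_iff_lt_exp hr, Real.lt_log_iff_exp_lt (hr.trans hRr)]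
      rfl
    rw [this]
    exact (convex_Ioo _ _).linear_preimage _
  have hVp (u : ℂ) (hu : u ∈ V) : u + 2 * Real.pi * I ∈ V := by
    simpa [hV, exp_periodic u] using hu
  obtain ⟨H, hH'⟩ := hVc.exists_forall_hasDerivWithinAt (f := fun u => f (exp u) * exp u)
    (fun u hu => ((hf _ hu.1 hu.2).comp u differentiable_exp.differentiableAt
      |>.mul differentiable_exp.differentiableAt).differentiableWithinAt)
  have hH (u : ℂ) (hu : u ∈ V) : HasDerivAt H (f (exp u) * exp u) u :=
    (hH' u hu).hasDerivAt (hVo.mem_nhds hu)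
  obtain ⟨K, hK⟩ : ∃ K, ∀ u ∈ V, H (u + 2 * Real.pi * I) - H u = K := by
    have hd (u : ℂ) (hu : u ∈ V) :
        HasDerivAt (fun u => H (u + 2 * Real.pi * I) - H u) 0 u := by
      have h1 := (hH _ (hVp u hu)).comp_add_const u (2 * Real.pi * I)
      have h2 := h1.sub (hH u hu)
      rwa [exp_periodic u, sub_self] at h2
    obtain ⟨K, hK⟩ := hVo.exists_is_const_of_deriv_eq_zero hVc.isPreconnected
      (fun u hu => (hd u hu).differentiableAt.differentiableWithinAt)
      (fun u hu => (hd u hu).deriv)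
    exact ⟨K, hK⟩
  set c := K / (2 * Real.pi * I) with hc
  have hcK : c * (2 * Real.pi * I) = K := div_mul_cancel₀ _ (by simp)
  set G : ℂ → ℂ := fun u => H u - c * u with hG
  have hG1 (u : ℂ) (hu : u ∈ V) : G (u + 2 * Real.pi * I) = G u := by
    simp only [hG]
    linear_combination hK u hu - hcK
  have hGn (n : ℕ) : ∀ u ∈ V, G (u + n * (2 * Real.pi * I)) = G u := by
    induction n with
    | zero => simp
    | succ n ih =>
      intro u hu
      have := ih _ (hVp u hu)
      rw [hG1 u hu] at this
      rw [← this]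
      congr 1
      push_cast
      ring
  have hGe (u v : ℂ) (hu : u ∈ V) (huv : exp u = exp v) : G u = G v := by
    have hv : v ∈ V := by simpa [hV, ← huv] using hu
    obtain ⟨n, hn⟩ := exp_eq_exp_iff_exists_int.1 huv
    obtain ⟨m, rfl | rfl⟩ := n.eq_nat_or_neg
    · rw [hn]
      exact_mod_cast hGn m v hv
    · rw [← hGn m u hu, hn]
      push_cast
      congr 1
      ring
  refine ⟨c, fun z => G (log z), fun z hz1 hz2 => ?_⟩
  have hz : z ≠ 0 := norm_pos_iff.1 (hr.trans hz1)
  have hzV : log z ∈ V := by simp [hV, exp_log hz, hz1, hz2]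
  -- near `z` the branch `log (w / z) + log z` of the logarithm is holomorphic
  have hb : HasDerivAt (fun w => log (w / z) + log z) z⁻¹ z := by
    have h1 : HasDerivAt (fun w => w / z) (1 / z) z := (hasDerivAt_id z).div_const z
    have h2 := (h1.clog (by rw [div_self hz]; exact one_mem_slitPlane)).add_const (log z)
    simpa [div_self hz] using h2
  have hbz : log (z / z) + log z = log z := by simp [div_self hz]
  have hGd : HasDerivAt G (f (exp (log z)) * exp (log z) - c * 1) (log z) :=
    (hH _ hzV).sub ((hasDerivAt_id _).const_mul c)
  have hcomp := hGd.comp_of_eq z hb hbz.symm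
  rw [exp_log hz] at hcomp
  have e : (f z * z - c * 1) * z⁻¹ = f z - c * z⁻¹ := by field_simp
  rw [e] at hcomp
  refine hcomp.congr_of_eventuallyEq ?_
  have hmem : ∀ᶠ w in 𝓝 z, log (w / z) + log z ∈ V :=
    hb.continuousAt.eventually_mem (hVo.mem_nhds (by rw [hbz]; exact hzV))
  filter_upwards [hmem, eventually_ne_nhds hz] with w hw hw0
  refine (hGe _ _ hw ?_).symm
  rw [exp_add, exp_log (div_ne_zero hw0 hz), exp_log hz, exp_log hw0, div_mul_cancel₀ _ hz]

/-- The principal part at a pole of order at most `n`. -/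
theorem exists_principal_part_of_order {w : ℂ} (n : ℕ) : ∀ {f g : ℂ → ℂ}, AnalyticAt ℂ g w →
    (∀ᶠ z in 𝓝[≠] w, f z * (z - w) ^ n = g z) →
    ∃ (c : ℕ → ℂ) (G : ℂ → ℂ), AnalyticAt ℂ G w ∧
      ∀ᶠ z in 𝓝[≠] w, f z - ∑ k ∈ Finset.range n, c k * ((z - w) ^ (k + 1))⁻¹ = G z := by
  induction n with
  | zero => exact fun {f g} hg h => ⟨0, g, hg, by simpa using h⟩
  | succ n ih =>
    intro f g hg h
    have hd : AnalyticAt ℂ (dslope g w) w := by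
      obtain ⟨s, hs, hgs⟩ := hg.exists_mem_nhds_analyticOnNhd
      exact ((Complex.differentiableOn_dslope (c := w) hs).2 hgs.differentiableOn).analyticAt hs
    obtain ⟨c, G, hG, hc⟩ := ih (f := fun z => f z - g w * ((z - w) ^ (n + 1))⁻¹) hd (by
      filter_upwards [h, self_mem_nhdsWithin] with z hz hzw
      have hzw' : z - w ≠ 0 := sub_ne_zero.2 hzw
      rw [dslope_of_ne _ hzw, slope_def_field, ← hz]
      field_simp
      ring)
    refine ⟨Function.update c n (g w), G, hG, ?_⟩
    filter_upwards [hc] with z hz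
    rw [Finset.sum_range_succ, Function.update_self, Finset.sum_congr rfl (g := fun k =>
      c k * ((z - w) ^ (k + 1))⁻¹) (fun k hk => by
        rw [Function.update_of_ne (Finset.mem_range.1 hk).ne]), ← hz]
    ring

theorem exists_principal_part {w : ℂ} (hf : MeromorphicAt f w) :
    ∃ (n : ℕ) (c : ℕ → ℂ) (G : ℂ → ℂ), AnalyticAt ℂ G w ∧
      ∀ᶠ z in 𝓝[≠] w, f z - ∑ k ∈ Finset.range n, c k * ((z - w) ^ (k + 1))⁻¹ = G z := by
  obtain ⟨n, hn⟩ := hf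
  obtain ⟨c, G, h⟩ := exists_principal_part_of_order n (f := f) hn
    (Eventually.of_forall fun z => by rw [smul_eq_mul, mul_comm])
  exact ⟨n, c, G, h⟩

theorem IsContour.contourIntegral_sub_pow_inv (h : IsContour γ) {w : ℂ}
    (hγ : ∀ t ∈ Set.Icc (0 : ℝ) 1, γ t ≠ w) (k : ℕ) :
    contourIntegral (fun z => ((z - w) ^ (k + 1))⁻¹) γ =
      if k = 0 then 2 * Real.pi * I * windingNumber γ w else 0 := by
  split_ifs with hk
  · simp [hk, windingNumber_mul]
  · have hk' : (k : ℂ) ≠ 0 := by exact_mod_cast hk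
    refine h.contourIntegral_eq_zero_of_hasDerivAt (F := fun z => -(k : ℂ)⁻¹ * ((z - w) ^ k)⁻¹)
      (fun t ht => ContinuousAt.inv₀ (by fun_prop) (pow_ne_zero _ (sub_ne_zero.2 (hγ t ht))))
      (fun t ht => ?_)
    have hne : γ t - w ≠ 0 := sub_ne_zero.2 (hγ t ht)
    obtain ⟨m, rfl⟩ := Nat.exists_eq_add_one_of_ne_zero hk
    have h1 : HasDerivAt (fun z => (z - w) ^ (m + 1)) (((m + 1 : ℕ) : ℂ) * (γ t - w) ^ m)
        (γ t) := by
      simpa using ((hasDerivAt_id (γ t)).sub_const w).fun_pow (m + 1)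
    have h2 := (h1.fun_inv (pow_ne_zero _ hne)).const_mul (-((m + 1 : ℕ) : ℂ)⁻¹)
    refine h2.congr_deriv ?_
    have e1 : (γ t - w) ^ (m + 1) = (γ t - w) ^ m * (γ t - w) := pow_succ _ _
    have e2 : (γ t - w) ^ (m + 1 + 1) = (γ t - w) ^ m * (γ t - w) ^ 2 := by ring
    have e3 : (γ t - w) ^ m ≠ 0 := pow_ne_zero _ hne
    simp only [e1, e2]
    generalize (γ t - w) ^ m = u at *
    field_simp

/-- The residue theorem on an annulus, in the form that the integral of a meromorphic function
along a closed curve is a linear combination of the winding numbers about its poles and about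
`0`, with coefficients that do not depend on the curve. -/
theorem exists_contourIntegral_eq_sum_windingNumber {r R : ℝ} (hr : 0 < r) (S : Finset ℂ) :
    ∀ {f : ℂ → ℂ}, (∀ w ∈ S, MeromorphicAt f w) →
    (∀ z, r < ‖z‖ → ‖z‖ < R → z ∉ S → DifferentiableAt ℂ f z) →
    ∃ (c₀ : ℂ) (c : ℂ → ℂ), ∀ γ, IsContour γ →
      (∀ t ∈ Set.Icc (0 : ℝ) 1, r < ‖γ t‖ ∧ ‖γ t‖ < R ∧ γ t ∉ S) →
      contourIntegral f γ = c₀ * windingNumber γ 0 + ∑ w ∈ S, c w * windingNumber γ w := by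
  classical
  induction S using Finset.induction_on with
  | empty =>
    intro f _ hf
    obtain ⟨c, F, hF⟩ := exists_primitive_annulus hr fun z h1 h2 => hf z h1 h2 (by simp)
    refine ⟨c * (2 * Real.pi * I), 0, fun γ h hγ => ?_⟩
    have hne (t : ℝ) (ht : t ∈ Set.Icc (0 : ℝ) 1) : γ t ≠ 0 :=
      norm_pos_iff.1 (hr.trans (hγ t ht).1)
    have hci (t : ℝ) (ht : t ∈ Set.Icc (0 : ℝ) 1) : ContinuousAt (fun z => c * (z - 0)⁻¹) (γ t) :=
      continuousAt_const.mul (ContinuousAt.inv₀ (by fun_prop) (by simpa using hne t ht))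
    have hcf (t : ℝ) (ht : t ∈ Set.Icc (0 : ℝ) 1) : ContinuousAt f (γ t) :=
      (hf _ (hγ t ht).1 (hγ t ht).2.1 (by simp)).continuousAt
    have h0 : contourIntegral (fun z => f z - c * z⁻¹) γ = 0 :=
      h.contourIntegral_eq_zero_of_hasDerivAt (fun t ht => (hcf t ht).sub (by
        simpa using hci t ht)) (fun t ht => hF _ (hγ t ht).1 (hγ t ht).2.1)
    have h1 := h.contourIntegral_add (f := fun z => f z - c * z⁻¹) (g := fun z => c * (z - 0)⁻¹)
      (fun t ht => (hcf t ht).sub (by simpa using hci t ht)) hci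
    rw [h0, contourIntegral_const_mul, windingNumber_mul] at h1
    simp only [sub_zero, sub_add_cancel, zero_add] at h1
    rw [h1]
    simp
    ring
  | insert w S hw ih =>
    intro f hm hf
    obtain ⟨n, c, G, hG, hfG⟩ := exists_principal_part (hm w (by simp))
    set s : ℂ → ℂ := fun z => ∑ k ∈ Finset.range n, c k * ((z - w) ^ (k + 1))⁻¹ with hs
    have hsan (z : ℂ) (hz : z ≠ w) : AnalyticAt ℂ s z :=
      Finset.analyticAt_fun_sum _ fun k _ => analyticAt_const.mul
        (((analyticAt_id.sub analyticAt_const).pow _).inv (pow_ne_zero _ (sub_ne_zero.2 hz)))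
    set f₁ : ℂ → ℂ := Function.update (fun z => f z - s z) w (G w) with hf₁
    have hf₁w : f₁ =ᶠ[𝓝 w] G := by
      rw [eventually_nhdsWithin_iff] at hfG
      filter_upwards [hfG] with z hz
      by_cases hzw : z = w
      · subst hzw; simp [hf₁]
      · rw [hf₁, Function.update_of_ne hzw]; exact hz hzw
    have hf₁z (z : ℂ) (hz : z ≠ w) : f₁ =ᶠ[𝓝 z] fun z => f z - s z := by
      filter_upwards [eventually_ne_nhds hz] with y hy
      rw [hf₁, Function.update_of_ne hy]
    obtain ⟨c₀, c', hc'⟩ := ih (f := f₁)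
      (fun v hv => by
        have hvw : v ≠ w := fun e => hw (e ▸ hv)
        exact ((hm v (by simp [hv])).sub (hsan v hvw).meromorphicAt).congr
          ((hf₁z v hvw).symm.filter_mono nhdsWithin_le_nhds))
      (fun z h1 h2 hz => by
        by_cases hzw : z = w
        · exact hzw ▸ hG.differentiableAt.congr_of_eventuallyEq hf₁w
        · exact ((hf z h1 h2 (by simp [hz, hzw])).sub
            (hsan z hzw).differentiableAt).congr_of_eventuallyEq (hf₁z z hzw))
    refine ⟨c₀, Function.update c' w (if n = 0 then 0 else c 0 * (2 * Real.pi * I)),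
      fun γ h hγ => ?_⟩
    have hγw (t : ℝ) (ht : t ∈ Set.Icc (0 : ℝ) 1) : γ t ≠ w := fun e =>
      (hγ t ht).2.2 (by simp [e])
    have hγS (t : ℝ) (ht : t ∈ Set.Icc (0 : ℝ) 1) : γ t ∉ S := fun e =>
      (hγ t ht).2.2 (by simp [e])
    have hcs (t : ℝ) (ht : t ∈ Set.Icc (0 : ℝ) 1) : ContinuousAt s (γ t) :=
      (hsan _ (hγw t ht)).continuousAt
    have hcf (t : ℝ) (ht : t ∈ Set.Icc (0 : ℝ) 1) : ContinuousAt f (γ t) :=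
      (hf _ (hγ t ht).1 (hγ t ht).2.1 (hγ t ht).2.2).continuousAt
    have hcf₁ (t : ℝ) (ht : t ∈ Set.Icc (0 : ℝ) 1) : ContinuousAt f₁ (γ t) :=
      ((hcf t ht).sub (hcs t ht)).congr (hf₁z _ (hγw t ht)).symm
    have h1 : contourIntegral f γ = contourIntegral f₁ γ + contourIntegral s γ := by
      rw [← h.contourIntegral_add hcf₁ hcs]
      refine contourIntegral_congr fun t ht => ?_
      rw [(hf₁z _ (hγw t ht)).self_of_nhds, sub_add_cancel]
    have h2 : contourIntegral s γ =
        (if n = 0 then 0 else c 0 * (2 * Real.pi * I)) * windingNumber γ w := by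
      rw [h.contourIntegral_sum (Finset.range n)
        (F := fun k z => c k * ((z - w) ^ (k + 1))⁻¹) fun k _ t ht => continuousAt_const.mul
          (ContinuousAt.inv₀ (by fun_prop) (pow_ne_zero _ (sub_ne_zero.2 (hγw t ht))))]
      simp_rw [contourIntegral_const_mul, h.contourIntegral_sub_pow_inv hγw]
      cases n with
      | zero => simp
      | succ n =>
        rw [Finset.sum_eq_single_of_mem 0 (by simp) (fun k _ hk => by simp [hk])]
        simp
        ring
    have h3 : ∑ v ∈ S, Function.update c' w (if n = 0 then 0 else c 0 * (2 * Real.pi * I)) v *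
        windingNumber γ v = ∑ v ∈ S, c' v * windingNumber γ v :=
      Finset.sum_congr rfl fun v hv => by
        rw [Function.update_of_ne (fun e : v = w => hw (e ▸ hv))]
    rw [h1, h2, hc' γ h (fun t ht => ⟨(hγ t ht).1, (hγ t ht).2.1, hγS t ht⟩),
      Finset.sum_insert hw, Function.update_self, h3]
    ring

end Contours

/-! ### Cycles separating points from their reciprocals -/

section Cycles

variable {γ : ℝ → ℂ} {f g : ℂ → ℂ}

/-- The positively oriented circle of centre `c` and radius `R`, parametrized by `[0, 1]`. -/
def circleContour (c : ℂ) (R : ℝ) (t : ℝ) : ℂ := circleMap c R (2 * Real.pi * t)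

theorem hasDerivAt_circleContour (c : ℂ) (R t : ℝ) :
    HasDerivAt (circleContour c R) ((2 * Real.pi : ℝ) • deriv (circleMap c R) (2 * Real.pi * t)) t := by
  have h := HasDerivAt.scomp t (h := fun t : ℝ => 2 * Real.pi * t)
    (differentiable_circleMap c R (2 * Real.pi * t)).hasDerivAt
    ((hasDerivAt_id t).const_mul (2 * Real.pi))
  refine (show HasDerivAt (circleContour c R) _ t from h).congr_deriv ?_
  rw [mul_one]

theorem isContour_circleContour (c : ℂ) (R : ℝ) : IsContour (circleContour c R) where
  continuousOn := fun t _ => (hasDerivAt_circleContour c R t).continuousAt.continuousWithinAt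
  closed := by
    have := periodic_circleMap c R 0
    simp only [zero_add] at this
    simp [circleContour, this]
  piecewise := ⟨∅, fun a b _ _ _ _ =>
    ((contDiff_circleMap c R).comp (contDiff_const.mul contDiff_id)).contDiffOn⟩

theorem contourIntegral_circleContour (f : ℂ → ℂ) (c : ℂ) (R : ℝ) :
    contourIntegral f (circleContour c R) = ∮ z in C(c, R), f z := by
  have h := intervalIntegral.smul_integral_comp_mul_left (a := 0) (b := 1)
    (fun θ => deriv (circleMap c R) θ • f (circleMap c R θ)) (2 * Real.pi)
  rw [mul_zero, mul_one] at h
  rw [circleIntegral, ← h, contourIntegral, ← intervalIntegral.integral_smul]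
  refine intervalIntegral.integral_congr fun t _ => ?_
  simp only [pullback, (hasDerivAt_circleContour c R t).deriv]
  simp only [circleContour, smul_eq_mul, real_smul]
  ring

theorem circleContour_mem_sphere (c : ℂ) {R : ℝ} (hR : 0 ≤ R) (t : ℝ) :
    circleContour c R t ∈ Metric.sphere c R := circleMap_mem_sphere c hR _

theorem windingNumber_circleContour {c w : ℂ} {R : ℝ} (hw : w ∈ Metric.ball c R) :
    windingNumber (circleContour c R) w = 1 := by
  rw [windingNumber, contourIntegral_circleContour, circleIntegral.integral_sub_inv_of_mem_ball hw,
    inv_mul_cancel₀ (by simp)]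

/-- The winding number of a closed curve in a disc about a point outside the disc is zero. -/
theorem IsContour.windingNumber_eq_zero (h : IsContour γ) {c w : ℂ} {R : ℝ}
    (hγ : ∀ t ∈ Set.Icc (0 : ℝ) 1, γ t ∈ Metric.ball c R) (hw : w ∉ Metric.ball c R) :
    windingNumber γ w = 0 := by
  have hne (z : ℂ) (hz : z ∈ Metric.ball c R) : z - w ≠ 0 := sub_ne_zero.2 fun e => hw (e ▸ hz)
  have hd : DifferentiableOn ℂ (fun z => (z - w)⁻¹) (Metric.ball c R) := fun z hz =>
    ((differentiableAt_id.sub_const w).inv (hne z hz)).differentiableWithinAt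
  obtain ⟨F, hF⟩ := hd.isExactOn_ball
  rw [windingNumber, h.contourIntegral_eq_zero_of_hasDerivAt (f := fun z => (z - w)⁻¹)
    (fun t ht => ContinuousAt.inv₀ (by fun_prop) (hne _ (hγ t ht)))
    (fun t ht => hF _ (hγ t ht)), mul_zero]

theorem windingNumber_circleContour_of_lt {c w : ℂ} {R : ℝ} (hR : 0 ≤ R) (hw : R < dist w c) :
    windingNumber (circleContour c R) w = 0 := by
  refine (isContour_circleContour c R).windingNumber_eq_zero (c := c) (R := dist w c)
    (fun t _ => ?_) (by simp)
  have := circleContour_mem_sphere c hR t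
  rw [Metric.mem_sphere] at this
  rwa [Metric.mem_ball, this]

/-- The integral along a cycle, that is, a finite sum of closed curves. -/
def cycleIntegral (f : ℂ → ℂ) (Z : List (ℝ → ℂ)) : ℂ := (Z.map fun γ => contourIntegral f γ).sum

/-- The winding number of a cycle. -/
def cycleWinding (Z : List (ℝ → ℂ)) (w : ℂ) : ℂ := (Z.map fun γ => windingNumber γ w).sum

/-- The cycle `Z` in `ℂ ∖ {0}` separates the points of `P` from their reciprocals, with winding
number `1` about `0` and the points of `P`, and `0` about their reciprocals. -/
structure CycleSeparates (Z : List (ℝ → ℂ)) (P : Set ℂ) : Prop where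
  isContour : ∀ γ ∈ Z, IsContour γ
  ne_zero : ∀ γ ∈ Z, ∀ t ∈ Set.Icc (0 : ℝ) 1, γ t ≠ 0
  winding_zero : cycleWinding Z 0 = 1
  ne : ∀ w ∈ P, ∀ γ ∈ Z, ∀ t ∈ Set.Icc (0 : ℝ) 1, γ t ≠ w
  winding : ∀ w ∈ P, cycleWinding Z w = 1
  ne_inv : ∀ w ∈ P, ∀ γ ∈ Z, ∀ t ∈ Set.Icc (0 : ℝ) 1, γ t ≠ w⁻¹
  inv_winding : ∀ w ∈ P, cycleWinding Z w⁻¹ = 0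

theorem Separates.cycleSeparates {P : Set ℂ} (h : Separates γ P) : CycleSeparates [γ] P where
  isContour := by simpa using h.isContour
  ne_zero := by simpa using h.ne_zero
  winding_zero := by simpa [cycleWinding] using h.winding_zero
  ne w hw γ' hγ' t ht e := by
    rw [List.mem_singleton] at hγ'
    exact h.notMem w hw ⟨t, ht, hγ' ▸ e⟩
  winding w hw := by simpa [cycleWinding] using h.winding w hw
  ne_inv w hw γ' hγ' t ht e := by
    rw [List.mem_singleton] at hγ'
    exact h.inv_notMem w hw ⟨t, ht, hγ' ▸ e⟩
  inv_winding w hw := by simpa [cycleWinding] using h.inv_winding w hw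

theorem CycleSeparates.mono {Z : List (ℝ → ℂ)} {P Q : Set ℂ} (h : CycleSeparates Z Q)
    (hPQ : P ⊆ Q) : CycleSeparates Z P where
  isContour := h.isContour
  ne_zero := h.ne_zero
  winding_zero := h.winding_zero
  ne w hw := h.ne w (hPQ hw)
  winding w hw := h.winding w (hPQ hw)
  ne_inv w hw := h.ne_inv w (hPQ hw)
  inv_winding w hw := h.inv_winding w (hPQ hw)

theorem CycleSeparates.exists_annulus {Z : List (ℝ → ℂ)} {P : Set ℂ} (h : CycleSeparates Z P) :
    ∃ r R : ℝ, 0 < r ∧ 0 < R ∧ ∀ γ ∈ Z, ∀ t ∈ Set.Icc (0 : ℝ) 1, r < ‖γ t‖ ∧ ‖γ t‖ < R := by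
  have key : ∀ Z : List (ℝ → ℂ), (∀ γ ∈ Z, IsContour γ) →
      (∀ γ ∈ Z, ∀ t ∈ Set.Icc (0 : ℝ) 1, γ t ≠ 0) →
      ∃ r R : ℝ, 0 < r ∧ 0 < R ∧ ∀ γ ∈ Z, ∀ t ∈ Set.Icc (0 : ℝ) 1, r < ‖γ t‖ ∧ ‖γ t‖ < R := by
    intro Z
    induction Z with
    | nil => exact fun _ _ => ⟨1, 1, one_pos, one_pos, by simp⟩
    | cons γ Z ih =>
      intro h1 h2
      obtain ⟨r, R, hr, hR, hrR⟩ := ih (fun γ' h => h1 γ' (by simp [h]))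
        (fun γ' h => h2 γ' (by simp [h]))
      have hc := (h1 γ (by simp)).continuousOn.norm
      have hne : (Set.Icc (0 : ℝ) 1).Nonempty := ⟨0, by simp⟩
      obtain ⟨a, ha, ha'⟩ := isCompact_Icc.exists_isMinOn hne hc
      obtain ⟨b, hb, hb'⟩ := isCompact_Icc.exists_isMaxOn hne hc
      have hpos : 0 < ‖γ a‖ := norm_pos_iff.2 (h2 γ (by simp) a ha)
      refine ⟨min r (‖γ a‖ / 2), max R (‖γ b‖ + 1), lt_min hr (by positivity),
        lt_max_of_lt_left hR, fun γ' hγ' t ht => ?_⟩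
      rcases List.mem_cons.1 hγ' with rfl | hγ'
      · have h3 : ‖γ' a‖ ≤ ‖γ' t‖ := ha' ht
        have h4 : ‖γ' t‖ ≤ ‖γ' b‖ := hb' ht
        exact ⟨(min_le_right _ _).trans_lt (by linarith), lt_max_of_lt_right (by linarith)⟩
      · exact ⟨(min_le_left _ _).trans_lt (hrR γ' hγ' t ht).1,
          lt_max_of_lt_left (hrR γ' hγ' t ht).2⟩
  exact key Z h.isContour h.ne_zero

/-- Two cycles which separate the same points give the same integrals of functions with poles at
these points and their reciprocals. -/
theorem CycleSeparates.cycleIntegral_eq {Z Z' : List (ℝ → ℂ)} {P : Set ℂ}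
    (h : CycleSeparates Z P) (h' : CycleSeparates Z' P)
    (hP : ∀ r : ℝ, 0 < r → {w ∈ P | r ≤ ‖w‖}.Finite)
    (hm : ∀ z ≠ 0, MeromorphicAt f z)
    (hf : ∀ z ≠ 0, z ∉ P → z⁻¹ ∉ P → DifferentiableAt ℂ f z) :
    cycleIntegral f Z = cycleIntegral f Z' := by
  classical
  obtain ⟨r, R, hr, hR, hrR⟩ := h.exists_annulus
  obtain ⟨r', R', hr', hR', hrR'⟩ := h'.exists_annulus
  set ρ := min r r' with hρ
  have hρ0 : 0 < ρ := lt_min hr hr'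
  set σ := max R R' with hσ
  have hσ0 : 0 < σ := lt_max_of_lt_left hR
  set S₁ := (hP ρ hρ0).toFinset with hS₁
  set S₂ := (hP σ⁻¹ (by positivity)).toFinset.image (fun w => w⁻¹) with hS₂
  set S := (S₁ ∪ S₂).filter (· ≠ 0) with hS
  have hSP (w : ℂ) (hw : w ∈ S) : w ∈ P ∨ w⁻¹ ∈ P := by
    rw [hS, Finset.mem_filter, Finset.mem_union] at hw
    rcases hw.1 with hw | hw
    · exact Or.inl ((hP ρ hρ0).mem_toFinset.1 hw).1
    · obtain ⟨v, hv, rfl⟩ := Finset.mem_image.1 hw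
      right
      rw [inv_inv]
      exact ((hP σ⁻¹ (by positivity)).mem_toFinset.1 hv).1
  obtain ⟨c₀, c, hc⟩ := exists_contourIntegral_eq_sum_windingNumber (R := σ) hρ0 S (f := f)
    (fun w hw => hm w (Finset.mem_filter.1 hw).2) (fun z h1 h2 hz => by
      have hz0 : z ≠ 0 := norm_pos_iff.1 (hρ0.trans h1)
      refine hf z hz0 (fun hzP => hz ?_) (fun hzP => hz ?_)
      · exact Finset.mem_filter.2 ⟨Finset.mem_union_left _
          ((hP ρ hρ0).mem_toFinset.2 ⟨hzP, h1.le⟩), hz0⟩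
      · refine Finset.mem_filter.2 ⟨Finset.mem_union_right _ (Finset.mem_image.2 ⟨z⁻¹,
          (hP σ⁻¹ (by positivity)).mem_toFinset.2 ⟨hzP, ?_⟩, inv_inv z⟩), hz0⟩
        rw [norm_inv]
        exact inv_anti₀ (norm_pos_iff.2 hz0) h2.le)
  have key (Y : List (ℝ → ℂ)) (hY : ∀ γ ∈ Y, IsContour γ ∧
      ∀ t ∈ Set.Icc (0 : ℝ) 1, ρ < ‖γ t‖ ∧ ‖γ t‖ < σ ∧ γ t ∉ S) :
      cycleIntegral f Y = c₀ * cycleWinding Y 0 + ∑ w ∈ S, c w * cycleWinding Y w := by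
    induction Y with
    | nil => simp [cycleIntegral, cycleWinding]
    | cons γ Y ih =>
      obtain ⟨h1, h2⟩ := hY γ (by simp)
      have e1 : cycleIntegral f (γ :: Y) = contourIntegral f γ + cycleIntegral f Y := by
        simp [cycleIntegral]
      have e2 (w : ℂ) : cycleWinding (γ :: Y) w = windingNumber γ w + cycleWinding Y w := by
        simp [cycleWinding]
      rw [e1, hc γ h1 h2, ih fun γ' h => hY γ' (by simp [h])]
      simp only [e2, mul_add, Finset.sum_add_distrib]
      ring
  have hval (Y : List (ℝ → ℂ)) (hY : CycleSeparates Y P) (w : ℂ) (hw : w ∈ S) (hwP : w ∈ P) :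
      cycleWinding Y w = 1 := hY.winding w hwP
  have havoid (Y : List (ℝ → ℂ)) (hY : CycleSeparates Y P) (γ : ℝ → ℂ) (hγ : γ ∈ Y) (t : ℝ)
      (ht : t ∈ Set.Icc (0 : ℝ) 1) : γ t ∉ S := fun hmem => by
    rcases hSP _ hmem with h | h
    · exact hY.ne _ h γ hγ t ht rfl
    · exact hY.ne_inv _ h γ hγ t ht (inv_inv _).symm
  rw [key Z fun γ hγ => ⟨h.isContour γ hγ, fun t ht =>
      ⟨(min_le_left _ _).trans_lt (hrR γ hγ t ht).1,
        (hrR γ hγ t ht).2.trans_le (le_max_left _ _), havoid Z h γ hγ t ht⟩⟩,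
    key Z' fun γ hγ => ⟨h'.isContour γ hγ, fun t ht =>
      ⟨(min_le_right _ _).trans_lt (hrR' γ hγ t ht).1,
        (hrR' γ hγ t ht).2.trans_le (le_max_right _ _), havoid Z' h' γ hγ t ht⟩⟩,
    h.winding_zero, h'.winding_zero]
  congr 1
  refine Finset.sum_congr rfl fun w hw => ?_
  rcases hSP w hw with hw | hw
  · rw [h.winding w hw, h'.winding w hw]
  · have h1 := h.inv_winding _ hw
    have h2 := h'.inv_winding _ hw
    rw [inv_inv] at h1 h2
    rw [h1, h2]

/-- A set which accumulates only at `0` and does not meet its set of reciprocals is separated from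
the latter by a cycle: a small circle about `0` together with small circles about the points
outside it. -/
theorem exists_cycleSeparates {P : Set ℂ} (hP0 : 0 ∉ P)
    (hP : ∀ r : ℝ, 0 < r → {w ∈ P | r ≤ ‖w‖}.Finite) (hinv : ∀ w ∈ P, w⁻¹ ∉ P) :
    ∃ Z, CycleSeparates Z P := by
  classical
  obtain ⟨M, hM1, hM⟩ : ∃ M : ℝ, 1 ≤ M ∧ ∀ w ∈ P, ‖w‖ ≤ M := by
    obtain ⟨M, hM⟩ := ((hP 1 one_pos).image fun w => ‖w‖).bddAbove
    refine ⟨max M 1, le_max_right _ _, fun w hw => ?_⟩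
    rcases le_total 1 ‖w‖ with h | h
    · exact (hM ⟨w, ⟨hw, h⟩, rfl⟩).trans (le_max_left _ _)
    · exact h.trans (le_max_right _ _)
  have hM0 : 0 < M := one_pos.trans_le hM1
  obtain ⟨ρ, hρ, hρn⟩ : ∃ ρ ∈ Set.Ioo (M⁻¹ / 2) M⁻¹, ∀ w ∈ P, ‖w‖ ≠ ρ := by
    have hlt : M⁻¹ / 2 < M⁻¹ := half_lt_self (by positivity)
    obtain ⟨ρ, hρ, hρ'⟩ := (Set.Ioo_infinite hlt).exists_notMem_finite
      ((hP (M⁻¹ / 2) (by positivity)).image fun w => ‖w‖)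
    exact ⟨ρ, hρ, fun w hw e => hρ' ⟨w, ⟨hw, e ▸ hρ.1.le⟩, e⟩⟩
  have hρ0 : 0 < ρ := lt_trans (by positivity) hρ.1
  have hρinv (w : ℂ) (hw : w ∈ P) : ρ < ‖w⁻¹‖ := by
    rw [norm_inv]
    exact hρ.2.trans_le (inv_anti₀ (norm_pos_iff.2 fun e => hP0 (e ▸ hw)) (hM w hw))
  have hδ (w : ℂ) (hw : w ∈ P) (hwρ : ρ < ‖w‖) : ∃ δ : ℝ, 0 < δ ∧ δ < ‖w‖ - ρ ∧ δ < ‖w‖ ∧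
      (∀ v ∈ P, v ≠ w → δ < dist v w) ∧ ∀ v ∈ P, δ < dist v⁻¹ w := by
    have hw0 : 0 < ‖w‖ := hρ0.trans hwρ
    set F := ((hP (‖w‖ / 2) (by positivity)).toFinset ∪
      (hP (2 * ‖w‖)⁻¹ (by positivity)).toFinset.image fun v => v⁻¹).erase w with hF
    obtain ⟨δ, hδ0, hδ⟩ : ∃ δ : ℝ, 0 < δ ∧ ∀ v ∈ F, δ < dist v w := by
      rcases F.eq_empty_or_nonempty with h | h
      · exact ⟨1, one_pos, by simp [h]⟩
      · obtain ⟨u, hu, hu'⟩ := F.exists_min_image (fun v => dist v w) h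
        have : 0 < dist u w := dist_pos.2 (Finset.ne_of_mem_erase hu)
        exact ⟨dist u w / 2, by positivity, fun v hv => by linarith [hu' v hv]⟩
    have hfar (v : ℂ) (h : ‖v‖ < ‖w‖ / 2 ∨ 2 * ‖w‖ < ‖v‖) : ‖w‖ / 2 ≤ dist v w := by
      have h1 := abs_norm_sub_norm_le v w
      rw [← dist_eq_norm] at h1
      rcases h with h | h
      · have := neg_le_abs (‖v‖ - ‖w‖); linarith
      · have := le_abs_self (‖v‖ - ‖w‖); linarith
    refine ⟨min δ (min ((‖w‖ - ρ) / 2) (‖w‖ / 4)), lt_min hδ0 (lt_min (by linarith)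
      (by positivity)), ?_, ?_, fun v hv hvw => ?_, fun v hv => ?_⟩
    · exact (min_le_right _ _).trans_lt ((min_le_left _ _).trans_lt (by linarith))
    · exact (min_le_right _ _).trans_lt ((min_le_right _ _).trans_lt (by linarith))
    · by_cases h : ‖w‖ / 2 ≤ ‖v‖
      · exact (min_le_left _ _).trans_lt (hδ v (Finset.mem_erase.2 ⟨hvw,
          Finset.mem_union_left _ ((hP (‖w‖ / 2) (by positivity)).mem_toFinset.2 ⟨hv, h⟩)⟩))
      · exact (min_le_right _ _).trans_lt ((min_le_right _ _).trans_lt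
          (by linarith [hfar v (Or.inl (not_le.1 h))]))
    · have hvw : v⁻¹ ≠ w := fun e => hinv v hv (e ▸ hw)
      have hv0 : 0 < ‖v‖ := norm_pos_iff.2 fun e => hP0 (e ▸ hv)
      by_cases h : (2 * ‖w‖)⁻¹ ≤ ‖v‖
      · exact (min_le_left _ _).trans_lt (hδ v⁻¹ (Finset.mem_erase.2 ⟨hvw,
          Finset.mem_union_right _ (Finset.mem_image_of_mem _
            ((hP (2 * ‖w‖)⁻¹ (by positivity)).mem_toFinset.2 ⟨hv, h⟩))⟩))
      · have h2 : 2 * ‖w‖ < ‖v⁻¹‖ := by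
          rw [norm_inv, lt_inv_comm₀ (by positivity) hv0]
          exact not_le.1 h
        exact (min_le_right _ _).trans_lt ((min_le_right _ _).trans_lt
          (by linarith [hfar v⁻¹ (Or.inr h2)]))
  choose! δ hδ0 hδ1 hδ2 hδ3 hδ4 using hδ
  set F := (hP ρ hρ0).toFinset with hF
  have hFmem (w : ℂ) (hw : w ∈ F) : w ∈ P ∧ ρ < ‖w‖ := by
    have := (hP ρ hρ0).mem_toFinset.1 hw
    exact ⟨this.1, lt_of_le_of_ne this.2 (hρn w this.1).symm⟩
  have hFmem' (w : ℂ) (hw : w ∈ P) (h : ρ < ‖w‖) : w ∈ F :=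
    (hP ρ hρ0).mem_toFinset.2 ⟨hw, h.le⟩
  set Z := circleContour 0 ρ :: F.toList.map fun w => circleContour w (δ w) with hZ
  have hW (v : ℂ) : cycleWinding Z v = windingNumber (circleContour 0 ρ) v +
      ∑ w ∈ F, windingNumber (circleContour w (δ w)) v := by
    rw [hZ, cycleWinding, List.map_cons, List.sum_cons, List.map_map]
    exact congrArg _ (Finset.sum_map_toList F fun w => windingNumber (circleContour w (δ w)) v)
  have hin (v : ℂ) (hv : ‖v‖ < ρ) : windingNumber (circleContour 0 ρ) v = 1 :=
    windingNumber_circleContour (by simpa using hv)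
  have hout (v : ℂ) (hv : ρ < ‖v‖) : windingNumber (circleContour 0 ρ) v = 0 :=
    windingNumber_circleContour_of_lt hρ0.le (by simpa using hv)
  have hsmall (v : ℂ) (h : ∀ w ∈ F, δ w < dist v w) :
      ∑ w ∈ F, windingNumber (circleContour w (δ w)) v = 0 :=
    Finset.sum_eq_zero fun w hw => windingNumber_circleContour_of_lt
      (hδ0 w (hFmem w hw).1 (hFmem w hw).2).le (h w hw)
  have hcases {p : (ℝ → ℂ) → Prop} (h1 : p (circleContour 0 ρ))
      (h2 : ∀ w ∈ F, p (circleContour w (δ w))) : ∀ γ ∈ Z, p γ := by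
    intro γ hγ
    rcases List.mem_cons.1 hγ with rfl | hγ
    · exact h1
    · obtain ⟨w, hw, rfl⟩ := List.mem_map.1 hγ
      exact h2 w (Finset.mem_toList.1 hw)
  have hnorm (t : ℝ) : ‖circleContour 0 ρ t‖ = ρ := by
    simpa using circleContour_mem_sphere 0 hρ0.le t
  have hdist (w : ℂ) (hw : w ∈ F) (t : ℝ) : dist (circleContour w (δ w) t) w = δ w :=
    circleContour_mem_sphere w (hδ0 w (hFmem w hw).1 (hFmem w hw).2).le t
  refine ⟨Z, hcases (isContour_circleContour _ _) fun w _ => isContour_circleContour _ _,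
    hcases (fun t _ e => ?_) (fun w hw t _ e => ?_), ?_, fun v hv => hcases (fun t _ e => ?_)
      (fun w hw t _ e => ?_), fun v hv => ?_, fun v hv => hcases (fun t _ e => ?_)
      (fun w hw t _ e => ?_), fun v hv => ?_⟩
  · have := hnorm t
    rw [e, norm_zero] at this
    exact hρ0.ne this
  · have := hdist w hw t
    rw [e, dist_zero_left] at this
    exact (hδ2 w (hFmem w hw).1 (hFmem w hw).2).ne this.symm
  · rw [hW, hin 0 (by simpa using hρ0), hsmall 0 (fun w hw => by
      rw [dist_zero_left]; exact hδ2 w (hFmem w hw).1 (hFmem w hw).2), add_zero]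
  · exact hρn v hv (e ▸ hnorm t)
  · have h1 := hdist w hw t
    rw [e] at h1
    by_cases hvw : v = w
    · rw [hvw, dist_self] at h1
      exact (hδ0 w (hFmem w hw).1 (hFmem w hw).2).ne h1
    · exact (hδ3 w (hFmem w hw).1 (hFmem w hw).2 v hv hvw).ne h1.symm
  · rw [hW]
    rcases lt_or_gt_of_ne (hρn v hv) with h | h
    · rw [hin v h, hsmall v (fun w hw => hδ3 w (hFmem w hw).1 (hFmem w hw).2 v hv (by
        rintro rfl; exact (hFmem v hw).2.not_gt h)), add_zero]
    · rw [hout v h, zero_add, Finset.sum_eq_single_of_mem v (hFmem' v hv h) (fun w hw hwv =>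
        windingNumber_circleContour_of_lt (hδ0 w (hFmem w hw).1 (hFmem w hw).2).le
          (hδ3 w (hFmem w hw).1 (hFmem w hw).2 v hv hwv.symm))]
      exact windingNumber_circleContour (by simpa using hδ0 v hv h)
  · have := hρinv v hv
    rw [← e, hnorm t] at this
    exact lt_irrefl _ this
  · have h1 := hdist w hw t
    rw [e] at h1
    exact (hδ4 w (hFmem w hw).1 (hFmem w hw).2 v hv).ne h1.symm
  · rw [hW, hout _ (hρinv v hv), hsmall _ (fun w hw => hδ4 w (hFmem w hw).1 (hFmem w hw).2 v hv),
      add_zero]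

/-- The points `t_j p^a q^b` with `a, b ≥ 0`. -/
def latticePoints {ι : Type*} (t : ι → ℂ) (p q : ℂ) : Set ℂ :=
  {x | ∃ (j : ι) (a b : ℕ), x = t j * p ^ a * q ^ b}

theorem Nomes.exists_pow_lt {p q : ℂ} (H : Nomes p q) (M : ℝ) {r : ℝ} (hr : 0 < r) :
    ∃ N : ℕ, ∀ a b : ℕ, N ≤ a ∨ N ≤ b → M * (‖p‖ ^ a * ‖q‖ ^ b) < r := by
  have h1 := (tendsto_pow_atTop_nhds_zero_of_lt_one (norm_nonneg p) H.p_lt).const_mul |M|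
  have h2 := (tendsto_pow_atTop_nhds_zero_of_lt_one (norm_nonneg q) H.q_lt).const_mul |M|
  rw [mul_zero] at h1 h2
  obtain ⟨N, hN⟩ := eventually_atTop.1 ((h1.eventually (gt_mem_nhds hr)).and
    (h2.eventually (gt_mem_nhds hr)))
  refine ⟨N, fun a b hab => ?_⟩
  have ha := pow_le_one₀ (norm_nonneg p) H.p_lt.le (n := a)
  have hb := pow_le_one₀ (norm_nonneg q) H.q_lt.le (n := b)
  have ha0 : 0 ≤ ‖p‖ ^ a := by positivity
  have hb0 : 0 ≤ ‖q‖ ^ b := by positivity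
  have h0 : M * (‖p‖ ^ a * ‖q‖ ^ b) ≤ |M| * (‖p‖ ^ a * ‖q‖ ^ b) := by
    gcongr; exact le_abs_self M
  refine h0.trans_lt ?_
  rcases hab with h | h
  · refine lt_of_le_of_lt ?_ (hN a h).1
    gcongr
    exact mul_le_of_le_one_right ha0 hb
  · refine lt_of_le_of_lt ?_ (hN b h).2
    gcongr
    exact mul_le_of_le_one_left hb0 ha

theorem Nomes.finite_latticePoints {p q : ℂ} (H : Nomes p q) {ι : Type*} [Finite ι] (t : ι → ℂ)
    {r : ℝ} (hr : 0 < r) : {w ∈ latticePoints t p q | r ≤ ‖w‖}.Finite := by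
  classical
  have := Fintype.ofFinite ι
  obtain ⟨N, hN⟩ := H.exists_pow_lt (∑ j, ‖t j‖) hr
  refine (Set.toFinite (Set.range fun x : ι × Fin N × Fin N =>
    t x.1 * p ^ (x.2.1 : ℕ) * q ^ (x.2.2 : ℕ))).subset ?_
  rintro w ⟨⟨j, a, b, rfl⟩, hw⟩
  have hab : a < N ∧ b < N := by
    by_contra hab
    have h1 := hN a b (by lia)
    rw [norm_mul, norm_mul, norm_pow, norm_pow, mul_assoc] at hw
    have h2 : ‖t j‖ ≤ ∑ j, ‖t j‖ :=
      Finset.single_le_sum (f := fun j => ‖t j‖) (fun _ _ => norm_nonneg _) (Finset.mem_univ j)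
    have h3 : ‖t j‖ * (‖p‖ ^ a * ‖q‖ ^ b) ≤ (∑ j, ‖t j‖) * (‖p‖ ^ a * ‖q‖ ^ b) := by gcongr
    linarith
  exact ⟨(j, ⟨a, hab.1⟩, ⟨b, hab.2⟩), rfl⟩

theorem CycleSeparates.eventually_winding_eq {Z : List (ℝ → ℂ)} {P : Set ℂ}
    (h : CycleSeparates Z P) {w : ℂ} (hw : ∀ γ ∈ Z, ∀ t ∈ Set.Icc (0 : ℝ) 1, γ t ≠ w) :
    ∀ᶠ v in 𝓝 w, (∀ γ ∈ Z, ∀ t ∈ Set.Icc (0 : ℝ) 1, γ t ≠ v) ∧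
      cycleWinding Z v = cycleWinding Z w := by
  have key : ∀ Z : List (ℝ → ℂ), (∀ γ ∈ Z, IsContour γ) →
      (∀ γ ∈ Z, ∀ t ∈ Set.Icc (0 : ℝ) 1, γ t ≠ w) →
      ∀ᶠ v in 𝓝 w, (∀ γ ∈ Z, ∀ t ∈ Set.Icc (0 : ℝ) 1, γ t ≠ v) ∧
        cycleWinding Z v = cycleWinding Z w := by
    intro Z
    induction Z with
    | nil => exact fun _ _ => Eventually.of_forall fun v => by simp [cycleWinding]
    | cons γ Z ih =>
      intro h1 h2
      have hγ := h1 γ (by simp)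
      have hcl : IsClosed (γ '' Set.Icc 0 1) :=
        (isCompact_Icc.image_of_continuousOn hγ.continuousOn).isClosed
      have hmem : (γ '' Set.Icc 0 1)ᶜ ∈ 𝓝 w := hcl.isOpen_compl.mem_nhds (by
        rintro ⟨t, ht, e⟩
        exact h2 γ (by simp) t ht e)
      obtain ⟨r, hr, hball⟩ := Metric.mem_nhds_iff.1 hmem
      filter_upwards [Metric.ball_mem_nhds w hr, ih (fun γ' h => h1 γ' (by simp [h]))
        (fun γ' h => h2 γ' (by simp [h]))] with v hv hv'
      refine ⟨fun γ' hγ' t ht e => ?_, ?_⟩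
      · rcases List.mem_cons.1 hγ' with rfl | hγ'
        · exact hball hv ⟨t, ht, e⟩
        · exact hv'.1 γ' hγ' t ht e
      · have e := hγ.windingNumber_eq (c := w) (r := r) (fun t ht hb => hball hb ⟨t, ht, rfl⟩) hv
          (Metric.mem_ball_self hr)
        have e' := hv'.2
        simp only [cycleWinding, List.map_cons, List.sum_cons] at e' ⊢
        rw [e, e']
  exact key Z h.isContour hw

/-- Separation of the points `t_j p^a q^b` from their reciprocals by a fixed cycle is an open
condition on the parameters `t_j`. -/
theorem CycleSeparates.eventually_latticePoints {p q : ℂ} (H : Nomes p q) {ι X : Type*} [Finite ι]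
    [TopologicalSpace X] {t : X → ι → ℂ} {u₀ : X} (ht : ∀ j, ContinuousAt (fun u => t u j) u₀)
    (ht0 : ∀ j, t u₀ j ≠ 0) {Z : List (ℝ → ℂ)} (h : CycleSeparates Z (latticePoints (t u₀) p q)) :
    ∀ᶠ u in 𝓝 u₀, CycleSeparates Z (latticePoints (t u) p q) := by
  classical
  have := Fintype.ofFinite ι
  obtain ⟨r, R, hr, hR, hrR⟩ := h.exists_annulus
  set s := min r R⁻¹ with hs
  have hs0 : 0 < s := lt_min hr (by positivity)
  obtain ⟨N, hN⟩ := H.exists_pow_lt (∑ j, (‖t u₀ j‖ + 1)) hs0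
  have hne (j : ι) : ∀ᶠ u in 𝓝 u₀, t u j ≠ 0 := (ht j).eventually_ne (ht0 j)
  have hlt (j : ι) : ∀ᶠ u in 𝓝 u₀, ‖t u j‖ < ‖t u₀ j‖ + 1 :=
    (ht j).norm.eventually (gt_mem_nhds (by simp))
  have hcont (j : ι) (a b : ℕ) : ContinuousAt (fun u => t u j * p ^ a * q ^ b) u₀ :=
    ((ht j).mul continuousAt_const).mul continuousAt_const
  have hmem (j : ι) (a b : ℕ) : t u₀ j * p ^ a * q ^ b ∈ latticePoints (t u₀) p q :=
    ⟨j, a, b, rfl⟩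
  have hpt0 (j : ι) (a b : ℕ) : t u₀ j * p ^ a * q ^ b ≠ 0 :=
    mul_ne_zero (mul_ne_zero (ht0 j) (pow_ne_zero _ H.p_ne)) (pow_ne_zero _ H.q_ne)
  have hin (j : ι) (a b : ℕ) : ∀ᶠ u in 𝓝 u₀,
      (∀ γ ∈ Z, ∀ x ∈ Set.Icc (0 : ℝ) 1, γ x ≠ t u j * p ^ a * q ^ b) ∧
      cycleWinding Z (t u j * p ^ a * q ^ b) = cycleWinding Z (t u₀ j * p ^ a * q ^ b) :=
    (hcont j a b).eventually (h.eventually_winding_eq (h.ne _ (hmem j a b)))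
  have hout (j : ι) (a b : ℕ) : ∀ᶠ u in 𝓝 u₀,
      (∀ γ ∈ Z, ∀ x ∈ Set.Icc (0 : ℝ) 1, γ x ≠ (t u j * p ^ a * q ^ b)⁻¹) ∧
      cycleWinding Z (t u j * p ^ a * q ^ b)⁻¹ = cycleWinding Z (t u₀ j * p ^ a * q ^ b)⁻¹ :=
    ((hcont j a b).inv₀ (hpt0 j a b)).eventually
      (h.eventually_winding_eq (h.ne_inv _ (hmem j a b)))
  have hall : ∀ᶠ u in 𝓝 u₀, ∀ j, t u j ≠ 0 ∧ ‖t u j‖ < ‖t u₀ j‖ + 1 ∧ ∀ a b : Fin N,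
      ((∀ γ ∈ Z, ∀ x ∈ Set.Icc (0 : ℝ) 1, γ x ≠ t u j * p ^ (a : ℕ) * q ^ (b : ℕ)) ∧
      cycleWinding Z (t u j * p ^ (a : ℕ) * q ^ (b : ℕ)) =
        cycleWinding Z (t u₀ j * p ^ (a : ℕ) * q ^ (b : ℕ))) ∧
      ((∀ γ ∈ Z, ∀ x ∈ Set.Icc (0 : ℝ) 1, γ x ≠ (t u j * p ^ (a : ℕ) * q ^ (b : ℕ))⁻¹) ∧
      cycleWinding Z (t u j * p ^ (a : ℕ) * q ^ (b : ℕ))⁻¹ =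
        cycleWinding Z (t u₀ j * p ^ (a : ℕ) * q ^ (b : ℕ))⁻¹) := by
    simp only [eventually_all]
    exact fun j => (hne j).and ((hlt j).and (by
      simp only [eventually_all]
      exact fun a b => (hin j a b).and (hout j a b)))
  filter_upwards [hall] with u hu
  have hnear (j : ι) (a b : ℕ) (hab : ¬(a < N ∧ b < N)) : ‖t u j * p ^ a * q ^ b‖ < s := by
    have h1 := hN a b (by lia)
    rw [norm_mul, norm_mul, norm_pow, norm_pow, mul_assoc]
    have h2 : ‖t u₀ j‖ + 1 ≤ ∑ j, (‖t u₀ j‖ + 1) :=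
      Finset.single_le_sum (f := fun j => ‖t u₀ j‖ + 1) (fun _ _ => by positivity)
        (Finset.mem_univ j)
    have h3 : ‖t u j‖ * (‖p‖ ^ a * ‖q‖ ^ b) ≤ (∑ j, (‖t u₀ j‖ + 1)) * (‖p‖ ^ a * ‖q‖ ^ b) := by
      gcongr; linarith [(hu j).2.1]
    linarith
  have hpt (j : ι) (a b : ℕ) : t u j * p ^ a * q ^ b ≠ 0 :=
    mul_ne_zero (mul_ne_zero (hu j).1 (pow_ne_zero _ H.p_ne)) (pow_ne_zero _ H.q_ne)
  have hfar (j : ι) (a b : ℕ) (hab : ¬(a < N ∧ b < N)) : R < ‖(t u j * p ^ a * q ^ b)⁻¹‖ := by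
    have := (hnear j a b hab).trans_le (min_le_right _ _)
    rwa [norm_inv, lt_inv_comm₀ hR (norm_pos_iff.2 (hpt j a b))]
  refine ⟨h.isContour, h.ne_zero, h.winding_zero, ?_, ?_, ?_, ?_⟩
  · rintro w ⟨j, a, b, rfl⟩ γ hγ x hx
    by_cases hab : a < N ∧ b < N
    · exact ((hu j).2.2 ⟨a, hab.1⟩ ⟨b, hab.2⟩).1.1 γ hγ x hx
    · intro e
      have h1 := (hnear j a b hab).trans_le (min_le_left _ _)
      rw [← e] at h1
      exact (hrR γ hγ x hx).1.not_gt h1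
  · rintro w ⟨j, a, b, rfl⟩
    by_cases hab : a < N ∧ b < N
    · rw [((hu j).2.2 ⟨a, hab.1⟩ ⟨b, hab.2⟩).1.2]
      exact h.winding _ (hmem j a b)
    · rw [← h.winding_zero, cycleWinding, cycleWinding]
      refine congrArg _ (List.map_congr_left fun γ hγ => ?_)
      refine (h.isContour γ hγ).windingNumber_eq (c := 0) (r := s) (fun x hx hb => ?_)
        (by simpa using hnear j a b hab) (by simpa using hs0)
      exact (hrR γ hγ x hx).1.not_gt ((mem_ball_zero_iff.1 hb).trans_le (min_le_left _ _))
  · rintro w ⟨j, a, b, rfl⟩ γ hγ x hx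
    by_cases hab : a < N ∧ b < N
    · exact ((hu j).2.2 ⟨a, hab.1⟩ ⟨b, hab.2⟩).2.1 γ hγ x hx
    · intro e
      have h1 := hfar j a b hab
      rw [← e] at h1
      exact (hrR γ hγ x hx).2.not_gt h1
  · rintro w ⟨j, a, b, rfl⟩
    by_cases hab : a < N ∧ b < N
    · rw [((hu j).2.2 ⟨a, hab.1⟩ ⟨b, hab.2⟩).2.2]
      exact h.inv_winding _ (hmem j a b)
    · rw [cycleWinding]
      refine List.sum_eq_zero fun y hy => ?_
      obtain ⟨γ, hγ, rfl⟩ := List.mem_map.1 hy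
      refine (h.isContour γ hγ).windingNumber_eq_zero (c := 0) (R := R) (fun x hx => ?_) ?_
      · simpa using (hrR γ hγ x hx).2
      · rw [mem_ball_zero_iff, not_lt]
        exact (hfar j a b hab).le

end Cycles

/-! ### A theta function identity -/

section ThetaIdentity

variable {p q : ℂ}

theorem ne_zero_of_prod_eq {a b c d e f P : ℂ} (hP : P ≠ 0) (hprod : a * b * c * d * e * f = P) :
    a ≠ 0 ∧ b ≠ 0 ∧ c ≠ 0 ∧ d ≠ 0 ∧ e ≠ 0 ∧ f ≠ 0 := by
  have hne : a * b * c * d * e * f ≠ 0 := by rwa [hprod]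
  simp only [ne_eq, mul_eq_zero, not_or] at hne
  obtain ⟨⟨⟨⟨⟨ha, hb⟩, hc⟩, hd⟩, he⟩, hf⟩ := hne
  exact ⟨ha, hb, hc, hd, he, hf⟩

/-- Two functions which are continuous at a point and agree off a countable set agree there. -/
theorem eq_of_countable_compl {f g : ℂ → ℂ} {S : Set ℂ} (hS : S.Countable) {z : ℂ}
    (hf : ContinuousAt f z) (hg : ContinuousAt g z) (h : ∀ᶠ w in 𝓝 z, w ∉ S → f w = g w) :
    f z = g z := by
  have hd : Dense Sᶜ := hS.dense_compl ℝ
  have : (𝓝[Sᶜ] z).NeBot := mem_closure_iff_nhdsWithin_neBot.1 (hd z)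
  refine tendsto_nhds_unique_of_eventuallyEq (l := 𝓝[Sᶜ] z) (hf.mono_left nhdsWithin_le_nhds)
    (hg.mono_left nhdsWithin_le_nhds) ?_
  filter_upwards [h.filter_mono nhdsWithin_le_nhds, self_mem_nhdsWithin] with w h1 h2
  exact h1 h2

theorem theta_mul_p_mul (hp0 : p ≠ 0) (hp : ‖p‖ < 1) {a z : ℂ} (ha : a ≠ 0) (hz : z ≠ 0) :
    theta (a * (p * z)) p = -(a * z)⁻¹ * theta (a * z) p := by
  rw [← theta_mul_p hp0 hp (mul_ne_zero ha hz)]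
  ring_nf

theorem theta_mul_p_mul_inv (hp0 : p ≠ 0) (hp : ‖p‖ < 1) {a z : ℂ} (ha : a ≠ 0) (hz : z ≠ 0) :
    theta (a * (p * z)⁻¹) p = -(p⁻¹ * (a * z⁻¹)) * theta (a * z⁻¹) p := by
  rw [← theta_div_p hp0 hp (mul_ne_zero ha (inv_ne_zero hz)), mul_inv]
  ring_nf

theorem theta_sq_mul_p (hp0 : p ≠ 0) (hp : ‖p‖ < 1) {z : ℂ} (hz : z ≠ 0) :
    theta ((p * z) ^ 2) p = p⁻¹ * (z ^ 4)⁻¹ * theta (z ^ 2) p := by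
  have : (p * z) ^ 2 = p * (p * z ^ 2) := by ring
  rw [this, theta_mul_p hp0 hp (by positivity), theta_mul_p hp0 hp (by positivity)]
  field_simp

theorem theta_swap (hp : ‖p‖ < 1) {a b : ℂ} (ha : a ≠ 0) (hb : b ≠ 0) :
    theta (a * b⁻¹) p = -(a * b⁻¹) * theta (b * a⁻¹) p := by
  have := theta_inv hp (z := b * a⁻¹) (by positivity)
  rw [mul_inv, inv_inv, mul_comm] at this
  exact this

/-- A six-parameter theta function identity, for parameters with product `p`. -/
theorem theta_six_identity_of_generic (hp0 : p ≠ 0) (hp : ‖p‖ < 1) {a b c d e f : ℂ}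
    (hprod : a * b * c * d * e * f = p) (ha2 : theta (a ^ 2) p ≠ 0) (hf2 : theta (f ^ 2) p ≠ 0)
    (haf : theta (f * a) p ≠ 0) (haf' : theta (f * a⁻¹) p ≠ 0) {x : ℂ} (hx : x ≠ 0) :
    theta (x ^ 2) p *
      (theta (a * x) p * theta (a * x⁻¹) p *
        (theta (f * b) p * theta (f * c) p * theta (f * d) p * theta (f * e) p) -
      theta (f * x) p * theta (f * x⁻¹) p *
        (theta (a * b) p * theta (a * c) p * theta (a * d) p * theta (a * e) p)) =
    a * theta (f * a⁻¹) p *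
      (x ^ 3 * (theta (a * x⁻¹) p * theta (b * x⁻¹) p * theta (c * x⁻¹) p * theta (d * x⁻¹) p *
        theta (e * x⁻¹) p * theta (f * x⁻¹) p) -
      x⁻¹ * (theta (a * x) p * theta (b * x) p * theta (c * x) p * theta (d * x) p *
        theta (e * x) p * theta (f * x) p)) := by
  obtain ⟨ha, hb, hc, hd, he, hf⟩ := ne_zero_of_prod_eq hp0 hprod
  rw [← sub_eq_zero]
  set F : ℂ → ℂ := fun x => theta (x ^ 2) p *
      (theta (a * x) p * theta (a * x⁻¹) p *
        (theta (f * b) p * theta (f * c) p * theta (f * d) p * theta (f * e) p) -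
      theta (f * x) p * theta (f * x⁻¹) p *
        (theta (a * b) p * theta (a * c) p * theta (a * d) p * theta (a * e) p)) -
    a * theta (f * a⁻¹) p *
      (x ^ 3 * (theta (a * x⁻¹) p * theta (b * x⁻¹) p * theta (c * x⁻¹) p * theta (d * x⁻¹) p *
        theta (e * x⁻¹) p * theta (f * x⁻¹) p) -
      x⁻¹ * (theta (a * x) p * theta (b * x) p * theta (c * x) p * theta (d * x) p *
        theta (e * x) p * theta (f * x) p)) with hF
  obtain ⟨r, hr⟩ : ∃ r : ℂ, r ^ 2 = p := IsAlgClosed.exists_pow_nat_eq p two_pos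
  have hr0 : r ≠ 0 := by rintro rfl; exact hp0 (by rw [← hr]; simp)
  have hsq (x : ℂ) (hx : x ≠ 0) : F (p * x) * x ^ 6 = (p ^ 2)⁻¹ * F x := by
    simp only [hF]
    rw [theta_sq_mul_p hp0 hp hx]
    simp only [theta_mul_p_mul hp0 hp ha hx, theta_mul_p_mul hp0 hp hb hx,
      theta_mul_p_mul hp0 hp hc hx, theta_mul_p_mul hp0 hp hd hx, theta_mul_p_mul hp0 hp he hx,
      theta_mul_p_mul hp0 hp hf hx, theta_mul_p_mul_inv hp0 hp ha hx,
      theta_mul_p_mul_inv hp0 hp hb hx, theta_mul_p_mul_inv hp0 hp hc hx,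
      theta_mul_p_mul_inv hp0 hp hd hx, theta_mul_p_mul_inv hp0 hp he hx,
      theta_mul_p_mul_inv hp0 hp hf hx]
    clear_value F
    clear hF haf' haf hf2 ha2 hr
    generalize theta (f * a⁻¹) p = K
    generalize theta (f * b) p * theta (f * c) p * theta (f * d) p * theta (f * e) p = M1
    generalize theta (a * b) p * theta (a * c) p * theta (a * d) p * theta (a * e) p = M2
    generalize theta (a * x) p = a1, theta (b * x) p = b1, theta (c * x) p = c1,
      theta (d * x) p = d1, theta (e * x) p = e1, theta (f * x) p = f1,
      theta (a * x⁻¹) p = a2, theta (b * x⁻¹) p = b2, theta (c * x⁻¹) p = c2,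
      theta (d * x⁻¹) p = d2, theta (e * x⁻¹) p = e2, theta (f * x⁻¹) p = f2,
      theta (x ^ 2) p = X
    subst hprod
    field_simp
  have h1 (x : ℂ) (hx : x ^ 2 = 1) : F x = 0 := by
    have hx0 : x ≠ 0 := by rintro rfl; simp at hx
    have hxi : x⁻¹ = x := by field_simp; exact hx.symm
    simp only [hF, hx, theta_one hp, hxi]
    linear_combination (-a * theta (f * a⁻¹) p * (x * (theta (a * x) p * theta (b * x) p *
      theta (c * x) p * theta (d * x) p * theta (e * x) p * theta (f * x) p))) * hx
  have h2 (x : ℂ) (hx : x ^ 2 = p) : F x = 0 := by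
    have hx0 : x ≠ 0 := by rintro rfl; exact hp0 (by rw [← hx]; simp)
    have hs (t : ℂ) (ht : t ≠ 0) : theta (t * x) p = -(t * x⁻¹)⁻¹ * theta (t * x⁻¹) p := by
      rw [← theta_mul_p hp0 hp (by positivity), ← hx]
      congr 1
      field_simp
    have hθp : theta p p = 0 := by simpa using theta_zpow hp0 hp 1
    simp only [hF, hx, hθp, hs _ ha, hs _ hb, hs _ hc, hs _ hd, hs _ he, hs _ hf]
    clear_value F
    clear hF haf' haf hf2 ha2 hr hs hθp
    generalize theta (f * a⁻¹) p = K
    generalize theta (a * x⁻¹) p = a2, theta (b * x⁻¹) p = b2, theta (c * x⁻¹) p = c2,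
      theta (d * x⁻¹) p = d2, theta (e * x⁻¹) p = e2, theta (f * x⁻¹) p = f2
    have hx6 : x ^ 2 = a * b * c * d * e * f := hx.trans hprod.symm
    field_simp
    rw [hx6]
    ring
  have h3 : F a = 0 := by
    simp only [hF, mul_inv_cancel₀ ha, theta_one hp]
    rw [← pow_two, mul_comm b a, mul_comm c a, mul_comm d a, mul_comm e a]
    clear_value F
    clear hF haf' haf hf2 ha2
    generalize theta (f * a⁻¹) p = K
    field_simp
    ring
  have h5 : F f = 0 := by
    simp only [hF, mul_inv_cancel₀ hf, theta_one hp, theta_swap hp ha hf]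
    rw [← pow_two, mul_comm b f, mul_comm c f, mul_comm d f, mul_comm e f]
    clear_value F
    clear hF haf' haf hf2 ha2
    generalize theta (f * a⁻¹) p = K
    field_simp
    ring
  have h4 : F a⁻¹ = 0 := by
    have : F a⁻¹ = -(a ^ 2)⁻¹ * F a := by
      have e1 : theta (a⁻¹ ^ 2) p = -(a ^ 2)⁻¹ * theta (a ^ 2) p := by
        rw [inv_pow, theta_inv hp (by positivity)]
      simp only [hF, inv_inv, e1]
      ring_nf
      field_simp
    rw [this, h3, mul_zero]
  have hdθ (t x : ℂ) (ht : t ≠ 0) (hx : x ≠ 0) : DifferentiableAt ℂ (fun x => theta (t * x) p) x :=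
    (differentiableAt_theta hp (z := t * x) (by positivity)).comp x (by fun_prop)
  have hdθ' (t x : ℂ) (ht : t ≠ 0) (hx : x ≠ 0) :
      DifferentiableAt ℂ (fun x => theta (t * x⁻¹) p) x :=
    (differentiableAt_theta hp (z := t * x⁻¹) (by positivity)).comp x (f := fun x => t * x⁻¹)
      ((differentiableAt_id.inv hx).const_mul t)
  have hFd (x : ℂ) (hx : x ≠ 0) : DifferentiableAt ℂ F x := by
    have hX : DifferentiableAt ℂ (fun x => theta (x ^ 2) p) x :=
      (differentiableAt_theta hp (z := x ^ 2) (by positivity)).comp x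
        (f := fun x => x ^ 2) (differentiableAt_id.pow 2)
    have i1 : DifferentiableAt ℂ (fun x : ℂ => x⁻¹) x := differentiableAt_id.inv hx
    have a1 := hdθ a x ha hx
    have b1 := hdθ b x hb hx
    have c1 := hdθ c x hc hx
    have d1 := hdθ d x hd hx
    have e1 := hdθ e x he hx
    have f1 := hdθ f x hf hx
    have a2 := hdθ' a x ha hx
    have b2 := hdθ' b x hb hx
    have c2 := hdθ' c x hc hx
    have d2 := hdθ' d x hd hx
    have e2 := hdθ' e x he hx
    have f2 := hdθ' f x hf hx
    simp only [hF]
    exact (hX.mul (((a1.mul a2).mul_const _).sub ((f1.mul f2).mul_const _))).sub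
      (((((differentiableAt_id.pow 3).mul (((((a2.mul b2).mul c2).mul d2).mul e2).mul f2)).sub
        (i1.mul (((((a1.mul b1).mul c1).mul d1).mul e1).mul f1))).const_mul _))
  have key := eq_zero_of_quasi_of_zeros hp0 hp [1, -1, r, -r, a, a⁻¹, f] (f := F) (c := (p ^ 2)⁻¹)
    hFd (fun z hz => by
      have := hsq z hz
      simp only [List.length_cons, List.length_nil]
      linear_combination z * this) (by
      simp only [List.mem_cons, List.not_mem_nil, or_false]
      rintro z (rfl | rfl | rfl | rfl | rfl | rfl | rfl)
      · exact ⟨one_ne_zero, h1 1 (by norm_num)⟩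
      · exact ⟨by norm_num, h1 (-1) (by norm_num)⟩
      · exact ⟨hr0, h2 _ hr⟩
      · exact ⟨neg_ne_zero.2 hr0, h2 _ (by rw [neg_sq, hr])⟩
      · exact ⟨ha, h3⟩
      · exact ⟨inv_ne_zero ha, h4⟩
      · exact ⟨hf, h5⟩) ?_ x hx
  · exact key
  -- a theta function which vanishes at `z` also vanishes at `z²`
  have hθsq {z w : ℂ} (hz : z ≠ 0) (k : ℤ) (hw : w = z ^ 2 * p ^ k) (hw' : theta w p ≠ 0) :
      theta z p ≠ 0 := fun h => by
    obtain ⟨m, rfl⟩ := (theta_eq_zero_iff hp0 hp hz).1 h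
    apply hw'
    rw [hw, ← zpow_natCast, ← zpow_mul, ← zpow_add₀ hp0]
    exact theta_zpow hp0 hp _
  have hm1 : theta (-1) p ≠ 0 := fun h => by
    obtain ⟨k, hk⟩ := (theta_eq_zero_iff hp0 hp (by norm_num)).1 h
    have hn : ‖p‖ ^ k = 1 := by rw [← norm_zpow, ← hk]; simp
    have hk0 : k = 0 := by
      by_contra hk0
      rcases lt_or_gt_of_ne hk0 with h | h
      · exact ((one_lt_zpow_iff_right_of_lt_one₀ (norm_pos_iff.2 hp0) hp).2 h).ne' hn
      · exact ((zpow_lt_one_iff_right_of_lt_one₀ (norm_pos_iff.2 hp0) hp).2 h).ne hn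
    rw [hk0, zpow_zero] at hk
    norm_num at hk
  have hθr (z : ℂ) (hz : z ^ 2 = p) : theta z p ≠ 0 := fun h => by
    have hz0 : z ≠ 0 := by rintro rfl; exact hp0 (by rw [← hz]; simp)
    obtain ⟨k, hk⟩ := (theta_eq_zero_iff hp0 hp hz0).1 h
    have h2 : p ^ (k * 2 - 1) = 1 := by
      rw [zpow_sub₀ hp0, zpow_mul, ← hk, zpow_one, div_eq_one_iff_eq hp0]; exact hz
    have hn : ‖p‖ ^ (k * 2 - 1) = 1 := by rw [← norm_zpow, h2]; simp
    rcases lt_or_gt_of_ne (show k * 2 - 1 ≠ 0 by lia) with h | h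
    · exact ((one_lt_zpow_iff_right_of_lt_one₀ (norm_pos_iff.2 hp0) hp).2 h).ne' hn
    · exact ((zpow_lt_one_iff_right_of_lt_one₀ (norm_pos_iff.2 hp0) hp).2 h).ne hn
  have hainv : theta ((a ^ 2)⁻¹) p ≠ 0 := by
    rw [theta_inv hp (by positivity)]
    exact mul_ne_zero (neg_ne_zero.2 (by positivity)) ha2
  simp only [List.pairwise_cons, List.mem_cons, List.not_mem_nil, or_false, forall_eq_or_imp,
    forall_eq, List.Pairwise.nil, and_true, inv_one, mul_one, inv_inv, IsEmpty.forall_iff,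
    implies_true]
  have hr2 : r⁻¹ ^ 2 = p ^ (-1 : ℤ) := by rw [inv_pow, hr, zpow_neg_one]
  refine ⟨⟨hm1, hθr r hr, hθr _ (by rw [neg_sq, hr]), hθsq ha 0 (by simp) ha2,
    hθsq (inv_ne_zero ha) 0 (by simp) hainv, hθsq hf 0 (by simp) hf2⟩, ⟨?_, ?_, ?_, ?_, ?_⟩,
    ⟨?_, ?_, ?_, ?_⟩, ⟨?_, ?_, ?_⟩, ⟨?_, ?_⟩, haf⟩
  · exact hθr _ (by rw [mul_pow, hr]; norm_num)
  · exact hθr _ (by rw [mul_pow, neg_sq, hr]; norm_num)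
  · exact hθsq (mul_ne_zero ha (by norm_num)) 0 (by rw [mul_pow]; norm_num) ha2
  · exact hθsq (mul_ne_zero (inv_ne_zero ha) (by norm_num)) 0 (by rw [mul_pow]; norm_num) hainv
  · exact hθsq (mul_ne_zero hf (by norm_num)) 0 (by rw [mul_pow]; norm_num) hf2
  · rw [neg_mul, mul_inv_cancel₀ hr0]; exact hm1
  · refine hθsq (mul_ne_zero ha (inv_ne_zero hr0)) 1 ?_ ha2
    rw [mul_pow, hr2, mul_assoc, ← zpow_add₀ hp0]; simp
  · refine hθsq (mul_ne_zero (inv_ne_zero ha) (inv_ne_zero hr0)) 1 ?_ hainv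
    rw [mul_pow, hr2, mul_assoc, ← zpow_add₀ hp0]; simp
  · refine hθsq (mul_ne_zero hf (inv_ne_zero hr0)) 1 ?_ hf2
    rw [mul_pow, hr2, mul_assoc, ← zpow_add₀ hp0]; simp
  · refine hθsq (mul_ne_zero ha (inv_ne_zero (neg_ne_zero.2 hr0))) 1 ?_ ha2
    rw [mul_pow, inv_neg, neg_sq, hr2, mul_assoc, ← zpow_add₀ hp0]; simp
  · refine hθsq (mul_ne_zero (inv_ne_zero ha) (inv_ne_zero (neg_ne_zero.2 hr0))) 1 ?_ hainv
    rw [mul_pow, inv_neg, neg_sq, hr2, mul_assoc, ← zpow_add₀ hp0]; simp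
  · refine hθsq (mul_ne_zero hf (inv_ne_zero (neg_ne_zero.2 hr0))) 1 ?_ hf2
    rw [mul_pow, inv_neg, neg_sq, hr2, mul_assoc, ← zpow_add₀ hp0]; simp
  · rw [← mul_inv, ← pow_two]; exact hainv
  · exact haf'

theorem countable_sq_mem {T : Set ℂ} (hT : T.Countable) : {z : ℂ | z ^ 2 ∈ T}.Countable := by
  have : {z : ℂ | z ^ 2 ∈ T} ⊆ ⋃ c ∈ T, {z : ℂ | z ^ 2 = c} := fun z hz => by
    simp only [Set.mem_iUnion]
    exact ⟨z ^ 2, hz, rfl⟩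
  refine (hT.biUnion fun c _ => ?_).mono this
  obtain ⟨s, hs⟩ := IsAlgClosed.exists_pow_nat_eq c two_pos
  refine (Set.toFinite {s, -s}).countable.mono fun z hz => ?_
  have hz' : z ^ 2 = c := hz
  rw [← hs] at hz'
  rcases sq_eq_sq_iff_eq_or_eq_neg.1 hz' with h | h <;> simp [h]

/-- A six-parameter theta function identity, for parameters with product `p`. -/
theorem theta_six_identity (hp0 : p ≠ 0) (hp : ‖p‖ < 1) {a b c d e f : ℂ}
    (hprod : a * b * c * d * e * f = p) (haf : theta (f * a) p ≠ 0) {x : ℂ} (hx : x ≠ 0) :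
    theta (x ^ 2) p *
      (theta (a * x) p * theta (a * x⁻¹) p *
        (theta (f * b) p * theta (f * c) p * theta (f * d) p * theta (f * e) p) -
      theta (f * x) p * theta (f * x⁻¹) p *
        (theta (a * b) p * theta (a * c) p * theta (a * d) p * theta (a * e) p)) =
    a * theta (f * a⁻¹) p *
      (x ^ 3 * (theta (a * x⁻¹) p * theta (b * x⁻¹) p * theta (c * x⁻¹) p * theta (d * x⁻¹) p *
        theta (e * x⁻¹) p * theta (f * x⁻¹) p) -
      x⁻¹ * (theta (a * x) p * theta (b * x) p * theta (c * x) p * theta (d * x) p *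
        theta (e * x) p * theta (f * x) p)) := by
  obtain ⟨ha, hb, hc, hd, he, hf⟩ := ne_zero_of_prod_eq hp0 hprod
  obtain ⟨P, hP⟩ : ∃ P, P = f * a := ⟨_, rfl⟩
  have hP0 : P ≠ 0 := by rw [hP]; positivity
  obtain rfl : f = P * a⁻¹ := by rw [hP]; field_simp
  set S : Set ℂ := {z | z ^ 2 ∈ Set.range (fun k : ℤ => p ^ k) ∪
    (Set.range (fun k : ℤ => P ^ 2 / p ^ k) ∪ Set.range (fun k : ℤ => P / p ^ k))} with hS
  have hSc : S.Countable := countable_sq_mem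
    ((Set.countable_range _).union ((Set.countable_range _).union (Set.countable_range _)))
  refine eq_of_countable_compl hSc (z := a)
    (f := fun a => theta (x ^ 2) p *
      (theta (a * x) p * theta (a * x⁻¹) p *
        (theta (P * a⁻¹ * b) p * theta (P * a⁻¹ * c) p * theta (P * a⁻¹ * d) p *
          theta (P * a⁻¹ * e) p) -
      theta (P * a⁻¹ * x) p * theta (P * a⁻¹ * x⁻¹) p *
        (theta (a * b) p * theta (a * c) p * theta (a * d) p * theta (a * e) p)))
    (g := fun a => a * theta (P * a⁻¹ * a⁻¹) p *
      (x ^ 3 * (theta (a * x⁻¹) p * theta (b * x⁻¹) p * theta (c * x⁻¹) p * theta (d * x⁻¹) p *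
        theta (e * x⁻¹) p * theta (P * a⁻¹ * x⁻¹) p) -
      x⁻¹ * (theta (a * x) p * theta (b * x) p * theta (c * x) p * theta (d * x) p *
        theta (e * x) p * theta (P * a⁻¹ * x) p))) ?_ ?_ ?_
  · have h1 (t : ℂ) (ht : t ≠ 0) : ContinuousAt (fun a => theta (a * t) p) a :=
      ContinuousAt.comp (f := fun a => a * t) (g := fun z => theta z p)
        (differentiableAt_theta hp (by positivity)).continuousAt (by fun_prop)
    have h2 (t : ℂ) (ht : t ≠ 0) : ContinuousAt (fun a => theta (P * a⁻¹ * t) p) a :=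
      ContinuousAt.comp (f := fun a => P * a⁻¹ * t) (g := fun z => theta z p)
        (differentiableAt_theta hp (by positivity)).continuousAt
        (((continuousAt_inv₀ ha).const_mul P).mul_const t)
    have hxi := inv_ne_zero hx
    exact continuousAt_const.mul ((((h1 x hx).mul (h1 _ hxi)).mul
      ((((h2 b hb).mul (h2 c hc)).mul (h2 d hd)).mul (h2 e he))).sub
      (((h2 x hx).mul (h2 _ hxi)).mul ((((h1 b hb).mul (h1 c hc)).mul (h1 d hd)).mul (h1 e he))))
  · have h1 (t : ℂ) (ht : t ≠ 0) : ContinuousAt (fun a => theta (a * t) p) a :=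
      ContinuousAt.comp (f := fun a => a * t) (g := fun z => theta z p)
        (differentiableAt_theta hp (by positivity)).continuousAt (by fun_prop)
    have h2 (t : ℂ) (ht : t ≠ 0) : ContinuousAt (fun a => theta (P * a⁻¹ * t) p) a :=
      ContinuousAt.comp (f := fun a => P * a⁻¹ * t) (g := fun z => theta z p)
        (differentiableAt_theta hp (by positivity)).continuousAt
        (((continuousAt_inv₀ ha).const_mul P).mul_const t)
    have h3 : ContinuousAt (fun a => theta (P * a⁻¹ * a⁻¹) p) a :=
      ContinuousAt.comp (f := fun a => P * a⁻¹ * a⁻¹) (g := fun z => theta z p)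
        (differentiableAt_theta hp (by positivity)).continuousAt
        (((continuousAt_inv₀ ha).const_mul P).mul (continuousAt_inv₀ ha))
    have hxi := inv_ne_zero hx
    exact (continuousAt_id.mul h3).mul ((continuousAt_const.mul ((((((h1 _ hxi).mul
      continuousAt_const).mul continuousAt_const).mul continuousAt_const).mul
      continuousAt_const).mul (h2 _ hxi))).sub (continuousAt_const.mul ((((((h1 x hx).mul
      continuousAt_const).mul continuousAt_const).mul continuousAt_const).mul
      continuousAt_const).mul (h2 x hx))))
  · filter_upwards [isOpen_ne.mem_nhds ha] with y hy hyS
    have hy0 : y ≠ 0 := hy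
    have hnot (w : ℂ) (hw : w ≠ 0) (h : ∀ k : ℤ, w ≠ p ^ k) : theta w p ≠ 0 := fun h0 => by
      obtain ⟨k, hk⟩ := (theta_eq_zero_iff hp0 hp hw).1 h0
      exact h k hk
    have hS' : (∀ k : ℤ, p ^ k ≠ y ^ 2) ∧ (∀ k : ℤ, P ^ 2 / p ^ k ≠ y ^ 2) ∧
        ∀ k : ℤ, P / p ^ k ≠ y ^ 2 := by
      refine ⟨fun k hk => hyS (Or.inl ⟨k, hk⟩), fun k hk => hyS (Or.inr (Or.inl ⟨k, hk⟩)),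
        fun k hk => hyS (Or.inr (Or.inr ⟨k, hk⟩))⟩
    refine theta_six_identity_of_generic hp0 hp ?_ (hnot _ (by positivity) fun k hk =>
      hS'.1 k hk.symm) (hnot _ (by positivity) fun k hk => hS'.2.1 k ?_) ?_ (hnot _ (by positivity)
      fun k hk => hS'.2.2 k ?_) hx
    · rw [← hprod]; field_simp
    · rw [← hk]; field_simp
    · have : P * y⁻¹ * y = P * a⁻¹ * a := by field_simp
      rwa [this]
    · rw [← hk]; field_simp

end ThetaIdentity

/-! ### The kernel of the elliptic beta integral -/

section BetaKernel

variable {p q : ℂ}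

/-- An integral along a contour depends holomorphically on parameters. -/
theorem IsContour.differentiableAt_contourIntegral {γ : ℝ → ℂ} (hγ : IsContour γ) {F : ℂ → ℂ → ℂ}
    {s₀ : ℂ} (hF : ∀ t ∈ Set.Icc (0 : ℝ) 1, AnalyticAt ℂ (fun y : ℂ × ℂ => F y.1 y.2) (s₀, γ t)) :
    DifferentiableAt ℂ (fun s => contourIntegral (F s) γ) s₀ := by
  set G : ℂ × ℂ → ℂ := fun y => F y.1 y.2 with hG
  set K := γ '' Set.Icc 0 1 with hK
  have hKc : IsCompact K := isCompact_Icc.image_of_continuousOn hγ.continuousOn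
  have hev : ∀ᶠ s in 𝓝 s₀, ∀ x ∈ K, AnalyticAt ℂ G (s, x) := by
    refine hKc.eventually_forall_of_forall_eventually (P := fun s x => AnalyticAt ℂ G (s, x)) ?_
    rintro x ⟨t, ht, rfl⟩
    exact (hF t ht).eventually_analyticAt
  obtain ⟨r, hr, hball⟩ := Metric.nhds_basis_closedBall.mem_iff.1 hev
  have hmemK (t : ℝ) (ht : t ∈ Set.Icc (0 : ℝ) 1) : γ t ∈ K := ⟨t, ht, rfl⟩
  have han (s : ℂ) (hs : s ∈ Metric.closedBall s₀ r) (x : ℂ) (hx : x ∈ K) :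
      AnalyticAt ℂ G (s, x) := hball hs x hx
  obtain ⟨M, hM⟩ := ((isCompact_closedBall s₀ r).prod hKc).exists_bound_of_continuousOn
    (f := fderiv ℂ G) fun y hy => (han y.1 hy.1 y.2 hy.2).fderiv.continuousAt.continuousWithinAt
  have hint (s : ℂ) (hs : s ∈ Metric.closedBall s₀ r) :
      IntervalIntegrable (pullback (F s) γ) volume 0 1 :=
    hγ.intervalIntegrable_pullback fun t ht =>
      (han s hs _ (hmemK t ht)).continuousAt.comp (f := fun x => (s, x)) (by fun_prop)
  have hsub : Set.uIoc (0 : ℝ) 1 ⊆ Set.Icc 0 1 := by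
    rw [Set.uIoc_of_le zero_le_one]; exact Set.Ioc_subset_Icc_self
  have hF' : IntervalIntegrable (fun t => fderiv ℂ G (s₀, γ t) (1, 0) * deriv γ t) volume 0 1 := by
    refine hγ.intervalIntegrable_deriv.continuousOn_mul ?_
    rw [Set.uIcc_of_le zero_le_one]
    intro t ht
    have h1 : ContinuousAt (fun y => fderiv ℂ G y (1, 0)) (s₀, γ t) :=
      (hF t ht).fderiv.continuousAt.clm_apply continuousAt_const
    exact h1.comp_continuousWithinAt (f := fun t => (s₀, γ t))
      (continuousWithinAt_const.prodMk (hγ.continuousOn t ht))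
  refine (intervalIntegral.hasDerivAt_integral_of_dominated_loc_of_deriv_le
    (F := fun s t => pullback (F s) γ t)
    (F' := fun s t => fderiv ℂ G (s, γ t) (1, 0) * deriv γ t)
    (bound := fun t => M * ‖((1 : ℂ), (0 : ℂ))‖ * ‖deriv γ t‖)
    (Metric.closedBall_mem_nhds s₀ hr) ?_ (hint s₀ (Metric.mem_closedBall_self hr.le))
    hF'.def'.aestronglyMeasurable ?_ (hγ.intervalIntegrable_deriv.norm.const_mul _)
    ?_).2.differentiableAt
  · filter_upwards [Metric.closedBall_mem_nhds s₀ hr] with s hs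
    exact (hint s hs).def'.aestronglyMeasurable
  · refine Eventually.of_forall fun t ht s hs => ?_
    rw [norm_mul]
    gcongr
    exact (ContinuousLinearMap.le_opNorm _ _).trans (by
      gcongr; exact hM (s, γ t) ⟨hs, hmemK t (hsub ht)⟩)
  · refine Eventually.of_forall fun t ht s hs => ?_
    have h1 := (han s hs _ (hmemK t (hsub ht))).differentiableAt.hasFDerivAt
    have h2 : HasDerivAt (fun s : ℂ => (s, γ t)) (1, 0) s :=
      (hasDerivAt_id s).prodMk (hasDerivAt_const s (γ t))
    exact (h1.comp_hasDerivAt s h2).mul_const _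

/-- The integrand of the elliptic beta integral: the factor `1 / Γ(x^{±2}; p, q)` is written as
`θ(x²; p) θ(x⁻²; q)`, so that the only poles are those of `Γ(t_j x^{±1}; p, q)`. -/
def betaKernel (t : Fin 6 → ℂ) (p q x : ℂ) : ℂ :=
  (∏ j, ellGammaPM (t j) x p q) * (theta (x ^ 2) p * theta (x ^ 2)⁻¹ q)

theorem Nomes.pqPoch_mul_inv_ne_zero (H : Nomes p q) {ι : Type*} {t : ι → ℂ} {x : ℂ} (hx : x ≠ 0)
    (h : x ∉ latticePoints t p q) (j : ι) : pqPoch (t j * x⁻¹) p q ≠ 0 := fun h0 => by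
  obtain ⟨a, b, hab⟩ := H.pqPoch_eq_zero_iff.1 h0
  refine h ⟨j, a, b, ?_⟩
  field_simp at hab
  exact hab.symm

theorem Nomes.pqPoch_mul_ne_zero (H : Nomes p q) {ι : Type*} {t : ι → ℂ} {x : ℂ} (hx : x ≠ 0)
    (h : x⁻¹ ∉ latticePoints t p q) (j : ι) : pqPoch (t j * x) p q ≠ 0 := by
  simpa using H.pqPoch_mul_inv_ne_zero (inv_ne_zero hx) h j

section Analytic

variable {E : Type*} [NormedAddCommGroup E] [NormedSpace ℂ E] {g : E → ℂ} {e : E}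

theorem Nomes.analyticAt_pqPoch (H : Nomes p q) (hg : AnalyticAt ℂ g e) :
    AnalyticAt ℂ (fun e => pqPoch (g e) p q) e :=
  (H.differentiable_pqPoch.analyticAt (g e)).comp hg

theorem Nomes.analyticAt_ellGamma (H : Nomes p q) (hg : AnalyticAt ℂ g e) (h0 : g e ≠ 0)
    (h : pqPoch (g e) p q ≠ 0) : AnalyticAt ℂ (fun e => ellGamma (g e) p q) e :=
  (H.analyticAt_pqPoch (analyticAt_const.mul (hg.inv h0))).div (H.analyticAt_pqPoch hg) h

theorem analyticAt_theta (hp : ‖p‖ < 1) (hg : AnalyticAt ℂ g e) (h0 : g e ≠ 0) :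
    AnalyticAt ℂ (fun e => theta (g e) p) e :=
  (((differentiable_qPoch hp).analyticAt (g e)).comp hg).mul
    (((differentiable_qPoch hp).analyticAt (p * (g e)⁻¹)).comp
      (f := fun e => p * (g e)⁻¹) (analyticAt_const.mul (hg.inv h0)))

theorem Nomes.analyticAt_betaKernel (H : Nomes p q) {t : E → Fin 6 → ℂ}
    (ht : ∀ j, AnalyticAt ℂ (fun e => t e j) e) (hg : AnalyticAt ℂ g e) (ht0 : ∀ j, t e j ≠ 0)
    (h0 : g e ≠ 0) (h1 : ∀ j, pqPoch (t e j * g e) p q ≠ 0)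
    (h2 : ∀ j, pqPoch (t e j * (g e)⁻¹) p q ≠ 0) :
    AnalyticAt ℂ (fun e => betaKernel (t e) p q (g e)) e := by
  unfold betaKernel ellGammaPM
  refine AnalyticAt.mul (Finset.analyticAt_fun_prod _ fun j _ => AnalyticAt.mul ?_ ?_)
    (AnalyticAt.mul ?_ ?_)
  · exact H.analyticAt_ellGamma ((ht j).mul hg) (mul_ne_zero (ht0 j) h0) (h1 j)
  · exact H.analyticAt_ellGamma ((ht j).mul (hg.inv h0)) (mul_ne_zero (ht0 j) (inv_ne_zero h0))
      (h2 j)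
  · exact analyticAt_theta H.p_lt (hg.pow 2) (pow_ne_zero 2 h0)
  · exact analyticAt_theta H.q_lt ((hg.pow 2).inv (pow_ne_zero 2 h0))
      (inv_ne_zero (pow_ne_zero 2 h0))

end Analytic

theorem Nomes.differentiableAt_betaKernel (H : Nomes p q) {t : Fin 6 → ℂ} (ht : ∀ j, t j ≠ 0)
    {x : ℂ} (hx : x ≠ 0) (h1 : x ∉ latticePoints t p q) (h2 : x⁻¹ ∉ latticePoints t p q) :
    DifferentiableAt ℂ (betaKernel t p q) x :=
  (H.analyticAt_betaKernel (t := fun _ => t) (g := fun x => x) (fun _ => analyticAt_const)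
    analyticAt_id ht hx (H.pqPoch_mul_ne_zero hx h2) (H.pqPoch_mul_inv_ne_zero hx h1)).differentiableAt

theorem Nomes.meromorphicAt_ellGamma (H : Nomes p q) {g : ℂ → ℂ} {x : ℂ} (hg : AnalyticAt ℂ g x)
    (h0 : g x ≠ 0) : MeromorphicAt (fun x => ellGamma (g x) p q) x :=
  (H.analyticAt_pqPoch (analyticAt_const.mul (hg.inv h0))).meromorphicAt.div
    (H.analyticAt_pqPoch hg).meromorphicAt

theorem Nomes.meromorphicAt_betaKernel (H : Nomes p q) {t : Fin 6 → ℂ} (ht : ∀ j, t j ≠ 0)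
    {x : ℂ} (hx : x ≠ 0) : MeromorphicAt (betaKernel t p q) x := by
  have hid : AnalyticAt ℂ (fun x : ℂ => x) x := analyticAt_id
  unfold betaKernel ellGammaPM
  refine MeromorphicAt.mul (MeromorphicAt.fun_prod fun j _ => MeromorphicAt.mul ?_ ?_)
    (MeromorphicAt.mul ?_ ?_)
  · exact H.meromorphicAt_ellGamma (analyticAt_const.mul hid) (mul_ne_zero (ht j) hx)
  · exact H.meromorphicAt_ellGamma (analyticAt_const.mul (hid.inv hx))
      (mul_ne_zero (ht j) (inv_ne_zero hx))
  · exact (analyticAt_theta H.p_lt (hid.pow 2) (pow_ne_zero 2 hx)).meromorphicAt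
  · exact (analyticAt_theta H.q_lt ((hid.pow 2).inv (pow_ne_zero 2 hx))
      (inv_ne_zero (pow_ne_zero 2 hx))).meromorphicAt

/-- The integral of `betaKernel` over the unit circle, normalized by its length. -/
def betaCircle (t : Fin 6 → ℂ) (p q : ℂ) : ℂ := Real.circleAverage (betaKernel t p q) 0 1

theorem circleAverage_eq_contourIntegral (f : ℂ → ℂ) {R : ℝ} (hR : R ≠ 0) :
    Real.circleAverage f 0 R =
      (2 * Real.pi * I)⁻¹ * contourIntegral (fun x => f x * x⁻¹) (circleContour 0 R) := by
  rw [Real.circleAverage_eq_circleIntegral hR, contourIntegral_circleContour, smul_eq_mul]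
  simp [mul_comm]

theorem Nomes.differentiableAt_betaCircle (H : Nomes p q) {t : ℂ → Fin 6 → ℂ} {s : ℂ}
    (ht : ∀ j, AnalyticAt ℂ (fun s => t s j) s) (ht0 : ∀ j, t s j ≠ 0) (ht1 : ∀ j, ‖t s j‖ < 1) :
    DifferentiableAt ℂ (fun s => betaCircle (t s) p q) s := by
  have hc (f : ℂ → ℂ) := circleAverage_eq_contourIntegral f (R := 1) one_ne_zero
  unfold betaCircle
  simp only [hc]
  refine ((isContour_circleContour 0 1).differentiableAt_contourIntegral
    (F := fun s x => betaKernel (t s) p q x * x⁻¹) fun θ _ => ?_).const_mul _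
  have hx : ‖circleContour 0 1 θ‖ = 1 := by
    simpa using circleContour_mem_sphere 0 zero_le_one θ
  have hx0 : circleContour 0 1 θ ≠ 0 := norm_ne_zero_iff.1 (by rw [hx]; exact one_ne_zero)
  have hsnd : AnalyticAt ℂ (fun y : ℂ × ℂ => y.2) (s, circleContour 0 1 θ) := analyticAt_snd
  refine (H.analyticAt_betaKernel (t := fun y : ℂ × ℂ => t y.1) (fun j => ?_) hsnd ht0 hx0
    (fun j => ?_) (fun j => ?_)).mul (hsnd.inv hx0)
  · exact AnalyticAt.comp (f := fun y : ℂ × ℂ => y.1) (x := (s, circleContour 0 1 θ)) (ht j)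
      analyticAt_fst
  · exact H.pqPoch_ne_zero_of_norm_lt (by rw [norm_mul, hx, mul_one]; exact ht1 j)
  · exact H.pqPoch_ne_zero_of_norm_lt (by rw [norm_mul, norm_inv, hx, inv_one, mul_one]; exact ht1 j)

end BetaKernel

/-! ### Integrals over circles -/

section CircleAverage

theorem isPreconnected_annulus {r R : ℝ} (hr : 0 < r) (hR : 0 < R) :
    IsPreconnected {z : ℂ | r < ‖z‖ ∧ ‖z‖ < R} := by
  have h : {z : ℂ | r < ‖z‖ ∧ ‖z‖ < R} = exp '' (reCLM ⁻¹' Set.Ioo (Real.log r) (Real.log R)) := by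
    ext z
    constructor
    · rintro ⟨h1, h2⟩
      have h0 : 0 < ‖z‖ := hr.trans h1
      refine ⟨log z, ?_, exp_log (norm_pos_iff.1 h0)⟩
      rw [Set.mem_preimage, reCLM_apply, log_re]
      exact ⟨Real.log_lt_log hr h1, Real.log_lt_log h0 h2⟩
    · rintro ⟨w, ⟨h1, h2⟩, rfl⟩
      rw [reCLM_apply] at h1 h2
      show r < ‖exp w‖ ∧ ‖exp w‖ < R
      rw [norm_exp]
      exact ⟨(Real.log_lt_iff_lt_exp hr).1 h1, (Real.lt_log_iff_exp_lt hR).1 h2⟩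
  rw [h]
  exact (((convex_Ioo _ _).linear_preimage reCLM.toLinearMap).isPreconnected).image _
    continuous_exp.continuousOn

theorem isOpen_annulus (r R : ℝ) : IsOpen {z : ℂ | r < ‖z‖ ∧ ‖z‖ < R} :=
  (isOpen_lt continuous_const continuous_norm).inter (isOpen_lt continuous_norm continuous_const)

/-- A holomorphic function on an annulus which is invariant under multiplication by `q` is constant,
provided that the annulus contains a fundamental domain: by invariance its modulus has a maximum. -/
theorem eq_of_invariant_of_annulus {f : ℂ → ℂ} {q : ℂ} {r R : ℝ} (hr : 0 < r) (hq0 : q ≠ 0)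
    (hq : ‖q‖ < 1) (hrR : r / ‖q‖ < R) (hf : ∀ z : ℂ, r < ‖z‖ → ‖z‖ < R → DifferentiableAt ℂ f z)
    (hinv : ∀ z : ℂ, r / ‖q‖ < ‖z‖ → ‖z‖ < R → f (q * z) = f z) {z w : ℂ} (hz : r < ‖z‖)
    (hz' : ‖z‖ < R) (hw : r < ‖w‖) (hw' : ‖w‖ < R) : f z = f w := by
  have hq0' : 0 < ‖q‖ := norm_pos_iff.2 hq0
  have hR : 0 < R := (div_pos hr hq0').trans hrR
  obtain ⟨ρ, hρ1, hρ2⟩ := exists_between hrR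
  have hρ0 : 0 < ρ := (div_pos hr hq0').trans hρ1
  have hrρ : r < ‖q‖ * ρ := by rwa [div_lt_iff₀ hq0', mul_comm] at hρ1
  have hqρ : ‖q‖ * ρ < ρ := mul_lt_of_lt_one_left hρ0 hq
  set U := {z : ℂ | ‖q‖ * ρ < ‖z‖ ∧ ‖z‖ < min R (ρ / ‖q‖)} with hU
  set K := {z : ℂ | ‖q‖ * ρ ≤ ‖z‖ ∧ ‖z‖ ≤ ρ} with hK
  have hKc : IsCompact K := by
    refine (isCompact_closedBall (0 : ℂ) ρ).of_isClosed_subset ?_ fun z hz => by simpa using hz.2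
    exact (isClosed_le continuous_const continuous_norm).inter
      (isClosed_le continuous_norm continuous_const)
  have hρU : ρ < min R (ρ / ‖q‖) := lt_min hρ2 ((lt_div_iff₀ hq0').2 (by rwa [mul_comm]))
  have hnρ : ‖(ρ : ℂ)‖ = ρ := by simp [abs_of_pos hρ0]
  obtain ⟨c, hc, hmax⟩ := hKc.exists_isMaxOn ⟨(ρ : ℂ), by rw [hnρ]; exact hqρ.le, hnρ.le⟩
    (f := fun z => ‖f z‖) fun z hz =>
      (hf z (hrρ.trans_le hz.1) (hz.2.trans_lt hρ2)).continuousAt.norm.continuousWithinAt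
  -- a value on the inner boundary circle is also attained on the outer one
  obtain ⟨c', hc'U, hc'⟩ : ∃ c' ∈ U, f c' = f c := by
    rcases hc.1.eq_or_lt with h | h
    · have hn : ‖q⁻¹ * c‖ = ρ := by rw [norm_mul, norm_inv, ← h, inv_mul_cancel_left₀ hq0'.ne']
      refine ⟨q⁻¹ * c, ⟨by rw [hn]; exact hqρ, by rw [hn]; exact hρU⟩, ?_⟩
      rw [← hinv _ (by rw [hn]; exact hρ1) (by rw [hn]; exact hρ2), mul_inv_cancel_left₀ hq0]
    · exact ⟨c, ⟨h, hc.2.trans_lt hρU⟩, rfl⟩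
  have hmaxU : IsMaxOn (norm ∘ f) U c' := fun z hz => by
    show ‖f z‖ ≤ ‖f c'‖
    rw [hc']
    rcases le_total ‖z‖ ρ with h | h
    · exact hmax ⟨hz.1.le, h⟩
    · rw [← hinv z (hρ1.trans_le h) (hz.2.trans_le (min_le_left _ _))]
      refine hmax ⟨?_, ?_⟩
      · rw [norm_mul]; gcongr
      · rw [norm_mul, mul_comm, ← le_div_iff₀ hq0']
        exact hz.2.le.trans (min_le_right _ _)
  have hUd : DifferentiableOn ℂ f U := fun z hz =>
    (hf z (hrρ.trans hz.1) (hz.2.trans_le (min_le_left _ _))).differentiableWithinAt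
  have hUo : IsOpen U := isOpen_annulus _ _
  have hUc := eqOn_of_isPreconnected_of_isMaxOn_norm (isPreconnected_annulus (by positivity)
    (lt_min hR (by positivity))) hUo hUd hc'U hmaxU
  have hD : AnalyticOnNhd ℂ f {z | r < ‖z‖ ∧ ‖z‖ < R} :=
    DifferentiableOn.analyticOnNhd (fun z hz => (hf z hz.1 hz.2).differentiableWithinAt)
      (isOpen_annulus r R)
  have hEq := hD.eqOn_of_preconnected_of_eventuallyEq (g := fun _ => f c') (z₀ := c')
    (fun _ _ => analyticAt_const) (isPreconnected_annulus hr hR)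
    ⟨hrρ.trans hc'U.1, hc'U.2.trans_le (min_le_left _ _)⟩
    (by filter_upwards [hUo.mem_nhds hc'U] with z hz using hUc hz)
  exact (hEq ⟨hz, hz'⟩).trans (hEq ⟨hw, hw'⟩).symm

theorem circleAverage_eq_of_annulus {f : ℂ → ℂ} {r R : ℝ} (hr : 0 < r) (hrR : r ≤ R)
    (hf : ∀ z : ℂ, r ≤ ‖z‖ → ‖z‖ ≤ R → DifferentiableAt ℂ f z) :
    Real.circleAverage f 0 R = Real.circleAverage f 0 r := by
  rw [Real.circleAverage_eq_circleIntegral hr.ne',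
    Real.circleAverage_eq_circleIntegral (hr.trans_le hrR).ne']
  congr 1
  refine circleIntegral_sub_center_inv_smul_eq_of_differentiable_on_annulus_off_countable hr hrR
    Set.countable_empty (fun z hz => ?_) fun z hz => ?_
  · simp only [Set.mem_sdiff, mem_closedBall_zero_iff, mem_ball_zero_iff, not_lt] at hz
    exact (hf z hz.2 hz.1).continuousAt.continuousWithinAt
  · simp only [Set.mem_sdiff, mem_closedBall_zero_iff, mem_ball_zero_iff, not_le] at hz
    exact hf z hz.1.2.le hz.1.1.le

theorem circleIntegrable_of_continuousAt {f : ℂ → ℂ} {R : ℝ} (hR : 0 ≤ R)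
    (hf : ∀ z : ℂ, ‖z‖ = R → ContinuousAt f z) : CircleIntegrable f 0 R :=
  ContinuousOn.circleIntegrable hR fun z hz => (hf z (by simpa using hz)).continuousWithinAt

theorem circleAverage_congr {f g : ℂ → ℂ} {R : ℝ} (hR : 0 ≤ R) (h : ∀ z : ℂ, ‖z‖ = R → f z = g z) :
    Real.circleAverage f 0 R = Real.circleAverage g 0 R :=
  Real.circleAverage_congr_sphere fun z hz => h z (by simpa [abs_of_nonneg hR] using hz)

theorem circleAverage_const_mul (c : ℂ) (f : ℂ → ℂ) (R : ℝ) :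
    Real.circleAverage (fun z => c * f z) 0 R = c * Real.circleAverage f 0 R :=
  Real.circleAverage_fun_smul (a := c)

theorem circleAverage_comp_mul (f : ℂ → ℂ) (l : ℂ) :
    Real.circleAverage (fun z => f (l * z)) 0 1 = Real.circleAverage f 0 ‖l‖ := by
  rw [Real.circleAverage_eq_integral_add (R := ‖l‖) l.arg, Real.circleAverage]
  congr 2
  ext θ
  simp only [circleMap, zero_add, ofReal_one, one_mul]
  conv_lhs => rw [← norm_mul_exp_arg_mul_I l]
  rw [mul_assoc, ← exp_add]
  push_cast
  ring_nf

theorem differentiableAt_circleAverage {F : ℂ → ℂ → ℂ} {s₀ : ℂ} {R : ℝ} (hR : 0 < R)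
    (hF : ∀ x : ℂ, ‖x‖ = R → AnalyticAt ℂ (fun y : ℂ × ℂ => F y.1 y.2) (s₀, x)) :
    DifferentiableAt ℂ (fun s => Real.circleAverage (F s) 0 R) s₀ := by
  simp only [circleAverage_eq_contourIntegral _ hR.ne']
  refine ((isContour_circleContour 0 R).differentiableAt_contourIntegral
    (F := fun s x => F s x * x⁻¹) fun θ _ => ?_).const_mul _
  have hx : ‖circleContour 0 R θ‖ = R := by simpa using circleContour_mem_sphere 0 hR.le θ
  exact (hF _ hx).mul (AnalyticAt.inv analyticAt_snd (norm_ne_zero_iff.1 (by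
    show ‖circleContour 0 R θ‖ ≠ 0
    rw [hx]; exact hR.ne')))

/-- The limit of the integrals of `g_r(x) / ((1 + r² x²) (1 + r² x⁻²))` over the unit circle when the
poles at `± i r` and `± i / r` pinch it. By symmetry the integral equals an expression in which only
the poles outside the unit circle are left, and there the circle can be moved inside. -/
theorem tendsto_circleAverage_pinch {g : ℂ → ℂ → ℂ} {ρ : ℝ} (hρ0 : 0 < ρ) (hρ1 : ρ < 1)
    (hg : ∀ x : ℂ, ρ ≤ ‖x‖ → ‖x‖ ≤ ρ⁻¹ → AnalyticAt ℂ (fun y : ℂ × ℂ => g y.1 y.2) (1, x))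
    (hsymm : ∀ s x : ℂ, g s x⁻¹ = g s x) :
    Tendsto (fun r : ℝ => (1 - (r : ℂ) ^ 4) * Real.circleAverage (fun x => g r x *
      ((1 + (r : ℂ) ^ 2 * x ^ 2) * (1 + (r : ℂ) ^ 2 * (x ^ 2)⁻¹))⁻¹) 0 1) (𝓝[<] 1) (𝓝 (g 1 I)) := by
  have hρi : 1 < ρ⁻¹ := (one_lt_inv₀ hρ0).2 hρ1
  set F : ℂ → ℂ := fun s => 2 * Real.circleAverage (fun x => g s x * (1 + s ^ 2 * x ^ 2)⁻¹) 0 ρ -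
    Real.circleAverage (g s) 0 1 with hF
  have hsq (s x : ℂ) (hs : ‖s‖ ≤ 1) (hx : ‖x‖ ≤ 1) (h : ‖s‖ * ‖x‖ < 1) :
      1 + s ^ 2 * x ^ 2 ≠ 0 := fun h0 => by
    have h1 : ‖(s * x) ^ 2‖ < 1 := by
      rw [norm_pow, norm_mul]; exact pow_lt_one₀ (by positivity) h two_ne_zero
    have h2 : (s * x) ^ 2 = -1 := by linear_combination h0
    rw [h2] at h1
    simp at h1
  have hFc : ContinuousAt F 1 := by
    refine ContinuousAt.sub (continuousAt_const.mul ?_) ?_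
    · refine (differentiableAt_circleAverage hρ0
        (F := fun s x => g s x * (1 + s ^ 2 * x ^ 2)⁻¹) fun x hx => ?_).continuousAt
      refine (hg x hx.ge (hx.le.trans (hρ1.trans hρi).le)).mul (AnalyticAt.inv ?_ ?_)
      · exact analyticAt_const.add ((analyticAt_fst.pow 2).mul (analyticAt_snd.pow 2))
      · exact hsq 1 x (by simp) (by rw [hx]; exact hρ1.le) (by rw [hx]; simpa using hρ1)
    · exact (differentiableAt_circleAverage one_pos fun x hx =>
        hg x (hρ1.le.trans hx.ge) (hx.le.trans hρi.le)).continuousAt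
  have hK : IsCompact {x : ℂ | ρ ≤ ‖x‖ ∧ ‖x‖ ≤ ρ⁻¹} := by
    refine (isCompact_closedBall (0 : ℂ) ρ⁻¹).of_isClosed_subset ?_ fun z hz => by simpa using hz.2
    exact (isClosed_le continuous_const continuous_norm).inter
      (isClosed_le continuous_norm continuous_const)
  have hev : ∀ᶠ s in 𝓝 (1 : ℂ), ∀ x ∈ {x : ℂ | ρ ≤ ‖x‖ ∧ ‖x‖ ≤ ρ⁻¹},
      AnalyticAt ℂ (fun y : ℂ × ℂ => g y.1 y.2) (s, x) :=
    hK.eventually_forall_of_forall_eventually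
      (P := fun s x => AnalyticAt ℂ (fun y : ℂ × ℂ => g y.1 y.2) (s, x))
      fun x hx => (hg x hx.1 hx.2).eventually_analyticAt
  have hgd {s : ℂ} (hs : ∀ x ∈ {x : ℂ | ρ ≤ ‖x‖ ∧ ‖x‖ ≤ ρ⁻¹},
      AnalyticAt ℂ (fun y : ℂ × ℂ => g y.1 y.2) (s, x)) (x : ℂ) (h1 : ρ ≤ ‖x‖) (h2 : ‖x‖ ≤ ρ⁻¹) :
      DifferentiableAt ℂ (g s) x :=
    (hs x ⟨h1, h2⟩).differentiableAt.comp x (f := fun x => (s, x))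
      ((differentiableAt_const s).prodMk differentiableAt_id)
  have hcast : Tendsto (fun r : ℝ => (r : ℂ)) (𝓝[<] 1) (𝓝 1) :=
    (Complex.continuous_ofReal.tendsto' 1 1 (by simp)).mono_left nhdsWithin_le_nhds
  -- the expression for `r < 1`
  have hEq : ∀ᶠ r : ℝ in 𝓝[<] 1, F r = (1 - (r : ℂ) ^ 4) * Real.circleAverage (fun x => g r x *
      ((1 + (r : ℂ) ^ 2 * x ^ 2) * (1 + (r : ℂ) ^ 2 * (x ^ 2)⁻¹))⁻¹) 0 1 := by
    filter_upwards [hcast.eventually hev, self_mem_nhdsWithin,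
      mem_nhdsWithin_of_mem_nhds (Ioi_mem_nhds (zero_lt_one (α := ℝ)))] with r hr hr1 hr0
    have hr1 : r < 1 := hr1
    have hr0 : 0 < r := hr0
    have hnr : ‖(r : ℂ)‖ = r := by simp [abs_of_pos hr0]
    have hgr := hgd hr
    have hden (x : ℂ) (hx : ‖x‖ ≤ 1) : 1 + (r : ℂ) ^ 2 * x ^ 2 ≠ 0 :=
      hsq r x (by rw [hnr]; exact hr1.le) hx (by
        rw [hnr]; exact (mul_le_of_le_one_right hr0.le hx).trans_lt hr1)
    set h : ℂ → ℂ := fun x => g r x * (1 + (r : ℂ) ^ 2 * x ^ 2)⁻¹ with hh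
    have hhd (x : ℂ) (h1 : ρ ≤ ‖x‖) (h2 : ‖x‖ ≤ 1) : DifferentiableAt ℂ h x :=
      (hgr x h1 (h2.trans hρi.le)).mul (DifferentiableAt.inv (by fun_prop) (hden x h2))
    have hxn (x : ℂ) (hx : ‖x‖ = 1) : x ≠ 0 := norm_ne_zero_iff.1 (by rw [hx]; exact one_ne_zero)
    have c1 : CircleIntegrable h 0 1 := circleIntegrable_of_continuousAt zero_le_one fun x hx =>
      (hhd x (hρ1.le.trans hx.ge) hx.le).continuousAt
    have c2 : CircleIntegrable (fun x => h x⁻¹) 0 1 :=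
      circleIntegrable_of_continuousAt zero_le_one fun x hx =>
        ContinuousAt.comp (f := fun x : ℂ => x⁻¹) (g := h) (hhd x⁻¹ (by
          rw [norm_inv, hx, inv_one]; exact hρ1.le) (by rw [norm_inv, hx, inv_one])).continuousAt
          (continuousAt_inv₀ (hxn x hx))
    have c3 : CircleIntegrable (fun x => -1 * g r x) 0 1 :=
      circleIntegrable_of_continuousAt zero_le_one fun x hx =>
        ((hgr x (hρ1.le.trans hx.ge) (hx.le.trans hρi.le)).const_mul (-1)).continuousAt
    rw [← circleAverage_const_mul, circleAverage_congr (g := fun x => (h x + h x⁻¹) + -1 * g r x)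
      zero_le_one, Real.circleAverage_fun_add (c1.fun_add c2) c3, Real.circleAverage_fun_add c1 c2,
      Real.circleAverage_zero_one_congr_inv, circleAverage_const_mul,
      circleAverage_eq_of_annulus hρ0 hρ1.le hhd, hF]
    · ring
    · intro x hx
      have d1 := hden x hx.le
      have d2 := hden x⁻¹ (by rw [norm_inv, hx, inv_one])
      simp only [hh, hsymm]
      rw [inv_pow] at d2 ⊢
      have hx0 := hxn x hx
      generalize hu : (x ^ 2)⁻¹ = u at *
      have hxu : x ^ 2 * u = 1 := by rw [← hu]; field_simp
      generalize x ^ 2 = v at *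
      field_simp
      linear_combination (g r x * r ^ 4) * hxu
  have hF1 : F 1 = g 1 I := by
    have hg1 := hgd hev.self_of_nhds
    set c := g 1 I with hc
    set h : ℂ → ℂ := fun x => g 1 x - c with hh
    have hI : h I = 0 := by simp [hh, hc]
    have hI' : h (-I) = 0 := by simp [hh, hc, ← hsymm 1 I]
    set k := dslope (dslope h I) (-I) with hk
    have hII : -I ≠ I := fun e => by
      have := congrArg im e
      norm_num at this
    have hk1 (x : ℂ) : h x = (x - I) * dslope h I x := by
      have := sub_smul_dslope h I x
      rw [hI, sub_zero, smul_eq_mul] at this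
      exact this.symm
    have hk0 : dslope h I (-I) = 0 := by
      have := hk1 (-I)
      rw [hI'] at this
      exact (mul_eq_zero.1 this.symm).resolve_left (sub_ne_zero.2 hII)
    have hhk (x : ℂ) : h x = (1 + x ^ 2) * k x := by
      have := sub_smul_dslope (dslope h I) (-I) x
      rw [hk0, sub_zero, smul_eq_mul] at this
      rw [hk1, ← this, ← hk]
      linear_combination (-(k x)) * I_sq
    have hUo := isOpen_annulus ρ ρ⁻¹
    have hmemI : I ∈ {z : ℂ | ρ < ‖z‖ ∧ ‖z‖ < ρ⁻¹} := ⟨by simpa using hρ1, by simpa using hρi⟩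
    have hmemI' : -I ∈ {z : ℂ | ρ < ‖z‖ ∧ ‖z‖ < ρ⁻¹} := ⟨by simpa using hρ1, by simpa using hρi⟩
    have hkd : DifferentiableOn ℂ k {z : ℂ | ρ < ‖z‖ ∧ ‖z‖ < ρ⁻¹} := by
      rw [hk, Complex.differentiableOn_dslope (hUo.mem_nhds hmemI'),
        Complex.differentiableOn_dslope (hUo.mem_nhds hmemI)]
      exact fun z hz => ((hg1 z hz.1.le hz.2.le).sub_const c).differentiableWithinAt
    have hkd' (x : ℂ) (h1 : ρ < ‖x‖) (h2 : ‖x‖ < ρ⁻¹) : DifferentiableAt ℂ k x :=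
      (hkd x ⟨h1, h2⟩).differentiableAt (hUo.mem_nhds ⟨h1, h2⟩)
    have hxn (x : ℂ) (hx : ‖x‖ = 1) : x ≠ 0 := norm_ne_zero_iff.1 (by rw [hx]; exact one_ne_zero)
    have hksymm (x : ℂ) (hx : ‖x‖ = 1) : x ^ 2 * k x = k x⁻¹ := by
      have hx0 := hxn x hx
      refine eq_of_countable_compl (Set.toFinite {I, -I}).countable (z := x)
        (f := fun x => x ^ 2 * k x) (g := fun x => k x⁻¹) ?_ ?_ ?_
      · exact (continuousAt_id.pow 2).mul
          (hkd' x (by rwa [hx]) (by rwa [hx])).continuousAt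
      · exact ContinuousAt.comp (f := fun x : ℂ => x⁻¹) (g := k) (hkd' x⁻¹
          (by rwa [norm_inv, hx, inv_one]) (by rwa [norm_inv, hx, inv_one])).continuousAt
          (continuousAt_inv₀ hx0)
      · filter_upwards [isOpen_ne.mem_nhds hx0] with y hy hyS
        have hy0 : y ≠ 0 := hy
        have e1 := hhk y
        have e2 := hhk y⁻¹
        rw [show h y⁻¹ = h y by simp [hh, hsymm], e1, inv_pow] at e2
        have hne : 1 + y ^ 2 ≠ 0 := fun h0 => by
          have : (y - I) * (y + I) = 0 := by linear_combination h0 - I_sq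
          rcases mul_eq_zero.1 this with h | h
          · exact hyS (Or.inl (sub_eq_zero.1 h))
          · exact hyS (Or.inr (eq_neg_of_add_eq_zero_left h))
        generalize k y⁻¹ = k' at *
        field_simp at e2
        refine mul_left_cancel₀ hne ?_
        linear_combination e2
    have hρd (x : ℂ) (hx : ‖x‖ < 1) : 1 + x ^ 2 ≠ 0 := by
      have := hsq 1 x (by simp) hx.le (by simpa using hx)
      simpa using this
    obtain ⟨σ, hσ1, hσ2⟩ := exists_between hρ1
    have hσ0 : 0 < σ := hρ0.trans hσ1
    have hinvd (x : ℂ) (hx : ‖x‖ < 1) : DifferentiableAt ℂ (fun x : ℂ => (1 + x ^ 2)⁻¹) x :=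
      DifferentiableAt.inv (by fun_prop) (hρd x hx)
    have e1 : Real.circleAverage (fun x => g 1 x * (1 + 1 ^ 2 * x ^ 2)⁻¹) 0 ρ =
        Real.circleAverage k 0 1 + c := by
      rw [← circleAverage_eq_of_annulus (f := fun x => g 1 x * (1 + 1 ^ 2 * x ^ 2)⁻¹) hρ0 hσ1.le
        (fun x h1 h2 =>
        (hg1 x h1 (h2.trans (hσ2.trans hρi).le)).mul (by
          simpa using hinvd x (h2.trans_lt hσ2))), circleAverage_eq_of_annulus (f := k) hσ0 hσ2.le
        (fun x h1 h2 => hkd' x (hσ1.trans_le h1) (h2.trans_lt hρi)),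
        circleAverage_congr (f := fun x => g 1 x * (1 + 1 ^ 2 * x ^ 2)⁻¹)
          (g := fun x => k x + c * (1 + x ^ 2)⁻¹) hσ0.le,
        Real.circleAverage_fun_add, circleAverage_const_mul,
        DiffContOnCl.circleAverage (f := fun x : ℂ => (1 + x ^ 2)⁻¹)]
      · simp
      · refine DifferentiableOn.diffContOnCl fun x hx => (hinvd x ?_).differentiableWithinAt
        rw [closure_ball _ (abs_pos.2 hσ0.ne').ne', mem_closedBall_zero_iff, abs_of_pos hσ0] at hx
        exact hx.trans_lt hσ2
      · exact circleIntegrable_of_continuousAt hσ0.le fun x hx =>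
          (hkd' x (by rwa [hx]) (by rw [hx]; exact hσ2.trans hρi)).continuousAt
      · exact circleIntegrable_of_continuousAt hσ0.le fun x hx =>
          ((hinvd x (by rwa [hx])).const_mul c).continuousAt
      · intro x hx
        have hne := hρd x (by rwa [hx])
        have : g 1 x = (1 + x ^ 2) * k x + c := by rw [← hhk, hh]; ring
        rw [this]
        field_simp
    have i1 : CircleIntegrable k 0 1 := circleIntegrable_of_continuousAt zero_le_one fun x hx =>
      (hkd' x (by rwa [hx]) (by rwa [hx])).continuousAt
    have i2 : CircleIntegrable (fun x => k x⁻¹) 0 1 :=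
      circleIntegrable_of_continuousAt zero_le_one fun x hx =>
        ContinuousAt.comp (f := fun x : ℂ => x⁻¹) (g := k) (hkd' x⁻¹
          (by rwa [norm_inv, hx, inv_one]) (by rwa [norm_inv, hx, inv_one])).continuousAt
          (continuousAt_inv₀ (hxn x hx))
    have e2 : Real.circleAverage (g 1) 0 1 = 2 * Real.circleAverage k 0 1 + c := by
      rw [circleAverage_congr (f := g 1) (g := fun x => (k x + k x⁻¹) + c) zero_le_one,
        Real.circleAverage_fun_add (i1.fun_add i2) (circleIntegrable_const _ _ _),
        Real.circleAverage_fun_add i1 i2, Real.circleAverage_zero_one_congr_inv,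
        Real.circleAverage_const]
      · ring
      · intro x hx
        rw [← hksymm x hx]
        have : g 1 x = (1 + x ^ 2) * k x + c := by rw [← hhk, hh]; ring
        rw [this]
        ring
    simp only [hF]
    rw [e1, e2]
    ring
  have := (hFc.tendsto.comp hcast).congr' hEq
  rwa [hF1] at this

end CircleAverage

/-! ### The difference equation of the elliptic beta integral -/

section BetaCircle

variable {p q : ℂ}

/-- The product `∏_{j<k} Γ(t_j t_k; p, q)`, which is the value of the elliptic beta integral. -/
def betaProd (t : Fin 6 → ℂ) (p q : ℂ) : ℂ := ∏ j, ∏ k ∈ Finset.Ioi j, ellGamma (t j * t k) p q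

theorem betaProd_vec (a b c d e f : ℂ) : betaProd ![a, b, c, d, e, f] p q =
    ellGamma (a * b) p q * ellGamma (a * c) p q * ellGamma (a * d) p q * ellGamma (a * e) p q *
    ellGamma (a * f) p q * (ellGamma (b * c) p q * ellGamma (b * d) p q * ellGamma (b * e) p q *
    ellGamma (b * f) p q) * (ellGamma (c * d) p q * ellGamma (c * e) p q * ellGamma (c * f) p q) *
    (ellGamma (d * e) p q * ellGamma (d * f) p q) * ellGamma (e * f) p q := by
  have h0 : Finset.Ioi (0 : Fin 6) = {1, 2, 3, 4, 5} := by decide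
  have h1 : Finset.Ioi (1 : Fin 6) = {2, 3, 4, 5} := by decide
  have h2 : Finset.Ioi (2 : Fin 6) = {3, 4, 5} := by decide
  have h3 : Finset.Ioi (3 : Fin 6) = {4, 5} := by decide
  have h4 : Finset.Ioi (4 : Fin 6) = {5} := by decide
  have h5 : Finset.Ioi (5 : Fin 6) = ∅ := by decide
  rw [betaProd, Fin.prod_univ_six, h0, h1, h2, h3, h4, h5]
  simp [-mul_eq_mul_left_iff, -mul_eq_mul_right_iff]
  ring

theorem betaKernel_vec (a b c d e f x : ℂ) : betaKernel ![a, b, c, d, e, f] p q x =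
    ellGammaPM a x p q * ellGammaPM b x p q * ellGammaPM c x p q * ellGammaPM d x p q *
    ellGammaPM e x p q * ellGammaPM f x p q * (theta (x ^ 2) p * theta (x ^ 2)⁻¹ q) := by
  rw [betaKernel, Fin.prod_univ_six]
  rfl

theorem theta_inv_sq_mul (hq0 : q ≠ 0) (hq : ‖q‖ < 1) {x : ℂ} (hx : x ≠ 0) :
    theta ((q⁻¹ * x) ^ 2)⁻¹ q = q⁻¹ * x ^ 4 * theta (x ^ 2)⁻¹ q := by
  have := theta_sq_mul_p hq0 hq (inv_ne_zero hx)
  rw [inv_pow, inv_pow, inv_inv] at this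
  rw [← this]
  congr 1
  field_simp

/-- The function whose difference under `x ↦ x / q` relates the integrands of two beta integrals
with parameters differing by a factor `q`. -/
def betaShift (t : Fin 6 → ℂ) (p q x : ℂ) : ℂ :=
  x⁻¹ * theta (x ^ 2)⁻¹ q *
    ∏ j, ellGamma (q * (t j * x)) p q * ellGamma (t j * x⁻¹) p q

theorem betaShift_div (H : Nomes p q) (t : Fin 6 → ℂ) {x : ℂ} (hx : x ≠ 0) :
    betaShift t p q (q⁻¹ * x) = -betaShift t p q x⁻¹ := by
  have hq0 := H.q_ne
  have h1 (j : Fin 6) : ellGamma (q * (t j * (q⁻¹ * x))) p q = ellGamma (t j * x) p q := by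
    congr 1; field_simp
  have h2 (j : Fin 6) : ellGamma (t j * (q⁻¹ * x)⁻¹) p q = ellGamma (q * (t j * x⁻¹)) p q := by
    congr 1; field_simp
  have h3 : theta (x ^ 2) q = -x ^ 2 * theta (x ^ 2)⁻¹ q := by
    have := theta_inv H.q_lt (z := (x ^ 2)⁻¹) (by positivity)
    rwa [inv_inv] at this
  unfold betaShift
  simp only [h1, h2, theta_inv_sq_mul hq0 H.q_lt hx, inv_inv, inv_pow, h3,
    mul_comm (ellGamma (t _ * x) p q)]
  field_simp

theorem betaKernel_sub (H : Nomes p q) {a b c d e f : ℂ} (hprod : a * b * c * d * e * f = p)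
    (haf : theta (f * a) p ≠ 0) {x : ℂ} (hx : x ≠ 0)
    (h1 : ∀ j, pqPoch (![a, b, c, d, e, f] j * x) p q ≠ 0)
    (h2 : ∀ j, pqPoch (![a, b, c, d, e, f] j * x⁻¹) p q ≠ 0) :
    betaKernel ![q * a, b, c, d, e, f] p q x *
        (theta (f * b) p * theta (f * c) p * theta (f * d) p * theta (f * e) p) -
      betaKernel ![a, b, c, d, e, q * f] p q x *
        (theta (a * b) p * theta (a * c) p * theta (a * d) p * theta (a * e) p) =
    -(a * theta (f * a⁻¹) p) * betaShift ![a, b, c, d, e, f] p q x⁻¹ +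
      -(a * theta (f * a⁻¹) p) * betaShift ![a, b, c, d, e, f] p q x := by
  obtain ⟨ha, hb, hc, hd, he, hf⟩ := ne_zero_of_prod_eq H.p_ne hprod
  have hxi := inv_ne_zero hx
  simp only [Fin.forall_fin_succ, IsEmpty.forall_iff, and_true, Matrix.cons_val_zero,
    Matrix.cons_val_succ] at h1 h2
  obtain ⟨a1, b1, c1, d1, e1, f1⟩ := h1
  obtain ⟨a2, b2, c2, d2, e2, f2⟩ := h2
  have id := theta_six_identity H.p_ne H.p_lt hprod haf hx
  have h3 : theta (x ^ 2) q = -x ^ 2 * theta (x ^ 2)⁻¹ q := by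
    have := theta_inv H.q_lt (z := (x ^ 2)⁻¹) (by positivity)
    rwa [inv_inv] at this
  simp only [betaKernel_vec, betaShift, Fin.prod_univ_six, ellGammaPM, Matrix.cons_val, inv_inv,
    inv_pow, mul_assoc q]
  rw [H.ellGamma_q_mul (mul_ne_zero ha hx) a1, H.ellGamma_q_mul (mul_ne_zero hb hx) b1,
    H.ellGamma_q_mul (mul_ne_zero hc hx) c1, H.ellGamma_q_mul (mul_ne_zero hd hx) d1,
    H.ellGamma_q_mul (mul_ne_zero he hx) e1, H.ellGamma_q_mul (mul_ne_zero hf hx) f1,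
    H.ellGamma_q_mul (mul_ne_zero ha hxi) a2, H.ellGamma_q_mul (mul_ne_zero hb hxi) b2,
    H.ellGamma_q_mul (mul_ne_zero hc hxi) c2, H.ellGamma_q_mul (mul_ne_zero hd hxi) d2,
    H.ellGamma_q_mul (mul_ne_zero he hxi) e2, H.ellGamma_q_mul (mul_ne_zero hf hxi) f2, h3]
  linear_combination (theta (x ^ 2)⁻¹ q * (ellGamma (a * x) p q * ellGamma (b * x) p q *
    ellGamma (c * x) p q * ellGamma (d * x) p q * ellGamma (e * x) p q * ellGamma (f * x) p q) *
    (ellGamma (a * x⁻¹) p q * ellGamma (b * x⁻¹) p q * ellGamma (c * x⁻¹) p q *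
    ellGamma (d * x⁻¹) p q * ellGamma (e * x⁻¹) p q * ellGamma (f * x⁻¹) p q)) * id

theorem differentiableAt_betaShift (H : Nomes p q) {t : Fin 6 → ℂ} (ht0 : ∀ j, t j ≠ 0)
    (ht : ∀ j, ‖t j‖ < 1) {x : ℂ} (h1 : 1 ≤ ‖x‖) (h2 : ‖x‖ ≤ ‖q⁻¹‖) :
    DifferentiableAt ℂ (betaShift t p q) x := by
  have hqp : 0 < ‖q‖ := norm_pos_iff.2 H.q_ne
  have hx : x ≠ 0 := norm_pos_iff.1 (one_pos.trans_le h1)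
  have hid : AnalyticAt ℂ (fun x : ℂ => x) x := analyticAt_id
  refine AnalyticAt.differentiableAt ?_
  refine ((hid.inv hx).mul (analyticAt_theta H.q_lt ((hid.pow 2).inv (pow_ne_zero 2 hx))
    (inv_ne_zero (pow_ne_zero 2 hx)))).mul
    (Finset.analyticAt_fun_prod _ fun j _ => AnalyticAt.mul ?_ ?_)
  · refine H.analyticAt_ellGamma (analyticAt_const.mul (analyticAt_const.mul hid))
      (mul_ne_zero H.q_ne (mul_ne_zero (ht0 j) hx)) (H.pqPoch_ne_zero_of_norm_lt ?_)
    rw [norm_mul, norm_mul]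
    rw [norm_inv] at h2
    calc ‖q‖ * (‖t j‖ * ‖x‖) ≤ ‖q‖ * (‖t j‖ * ‖q‖⁻¹) := by gcongr
      _ = ‖t j‖ := by field_simp
      _ < 1 := ht j
  · refine H.analyticAt_ellGamma (analyticAt_const.mul (hid.inv hx))
      (mul_ne_zero (ht0 j) (inv_ne_zero hx)) (H.pqPoch_ne_zero_of_norm_lt ?_)
    rw [norm_mul, norm_inv]
    exact (mul_le_of_le_one_right (norm_nonneg _) (inv_le_one_of_one_le₀ h1)).trans_lt (ht j)

theorem circleAverage_betaShift (H : Nomes p q) {t : Fin 6 → ℂ} (ht0 : ∀ j, t j ≠ 0)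
    (ht : ∀ j, ‖t j‖ < 1) : Real.circleAverage (betaShift t p q) 0 1 = 0 := by
  have hqp : 0 < ‖q‖ := norm_pos_iff.2 H.q_ne
  have h1 := circleAverage_eq_of_annulus one_pos (by
    rw [norm_inv]; exact (one_le_inv₀ hqp).2 H.q_lt.le)
    fun x => differentiableAt_betaShift H ht0 ht (x := x)
  rw [← circleAverage_comp_mul, circleAverage_congr (f := fun z => betaShift t p q (q⁻¹ * z))
    (g := fun z => -1 * betaShift t p q z⁻¹) zero_le_one (fun z hz => by
      rw [betaShift_div H t (norm_ne_zero_iff.1 (by rw [hz]; exact one_ne_zero))]; ring),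
    circleAverage_const_mul, Real.circleAverage_zero_one_congr_inv] at h1
  linear_combination (-1 / 2) * h1

theorem Nomes.continuousAt_betaKernel_circle (H : Nomes p q) {t : Fin 6 → ℂ} (ht0 : ∀ j, t j ≠ 0)
    (ht : ∀ j, ‖t j‖ < 1) {x : ℂ} (hx : ‖x‖ = 1) : ContinuousAt (betaKernel t p q) x :=
  (H.analyticAt_betaKernel (t := fun _ => t) (g := fun x => x) (fun _ => analyticAt_const)
    analyticAt_id ht0 (norm_ne_zero_iff.1 (by rw [hx]; exact one_ne_zero))
    (fun j => H.pqPoch_ne_zero_of_norm_lt (by rw [norm_mul, hx, mul_one]; exact ht j))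
    (fun j => H.pqPoch_ne_zero_of_norm_lt (by
      rw [norm_mul, norm_inv, hx, inv_one, mul_one]; exact ht j))).continuousAt

/-- The difference equation of the beta integral: the combination of the two integrands is a multiple
of the difference of `betaShift` under `x ↦ x / q`, which integrates to zero because `betaShift` has
no poles between the unit circle and its image. -/
theorem betaCircle_shift (H : Nomes p q) {a b c d e f : ℂ} (hprod : a * b * c * d * e * f = p)
    (hn : ∀ j, ‖![a, b, c, d, e, f] j‖ < 1) (haf : theta (f * a) p ≠ 0) :
    betaCircle ![q * a, b, c, d, e, f] p q *
        (theta (f * b) p * theta (f * c) p * theta (f * d) p * theta (f * e) p) =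
      betaCircle ![a, b, c, d, e, q * f] p q *
        (theta (a * b) p * theta (a * c) p * theta (a * d) p * theta (a * e) p) := by
  obtain ⟨ha, hb, hc, hd, he, hf⟩ := ne_zero_of_prod_eq H.p_ne hprod
  have h0 : ∀ j, ![a, b, c, d, e, f] j ≠ 0 := by
    simp [Fin.forall_fin_succ, ha, hb, hc, hd, he, hf]
  have hqn := H.q_ne
  have h01 : ∀ j, ![q * a, b, c, d, e, f] j ≠ 0 := by
    simp [Fin.forall_fin_succ, ha, hb, hc, hd, he, hf, hqn]
  have h02 : ∀ j, ![a, b, c, d, e, q * f] j ≠ 0 := by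
    simp [Fin.forall_fin_succ, ha, hb, hc, hd, he, hf, hqn]
  have hqlt {z : ℂ} (hz : ‖z‖ < 1) : ‖q‖ * ‖z‖ < 1 :=
    (mul_le_of_le_one_left (norm_nonneg _) H.q_lt.le).trans_lt hz
  have hn' := hn
  simp only [Fin.forall_fin_succ, IsEmpty.forall_iff, and_true, Matrix.cons_val_zero,
    Matrix.cons_val_succ] at hn'
  obtain ⟨na, nb, nc, nd, ne, nf⟩ := hn'
  have hn1 : ∀ j, ‖![q * a, b, c, d, e, f] j‖ < 1 := by
    simp [Fin.forall_fin_succ, hqlt na, nb, nc, nd, ne, nf]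
  have hn2 : ∀ j, ‖![a, b, c, d, e, q * f] j‖ < 1 := by
    simp [Fin.forall_fin_succ, na, nb, nc, nd, ne, hqlt nf]
  set M := theta (f * b) p * theta (f * c) p * theta (f * d) p * theta (f * e) p
  set N := theta (a * b) p * theta (a * c) p * theta (a * d) p * theta (a * e) p
  have i1 : CircleIntegrable (fun x => M * betaKernel ![q * a, b, c, d, e, f] p q x) 0 1 :=
    circleIntegrable_of_continuousAt zero_le_one fun x hx =>
      continuousAt_const.mul (H.continuousAt_betaKernel_circle h01 hn1 hx)
  have i2 : CircleIntegrable (fun x => -N * betaKernel ![a, b, c, d, e, q * f] p q x) 0 1 :=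
    circleIntegrable_of_continuousAt zero_le_one fun x hx =>
      continuousAt_const.mul (H.continuousAt_betaKernel_circle h02 hn2 hx)
  have hS (x : ℂ) (hx : ‖x‖ = 1) : ContinuousAt (betaShift ![a, b, c, d, e, f] p q) x :=
    (differentiableAt_betaShift H h0 hn hx.ge (by
      rw [hx, norm_inv]; exact (one_le_inv₀ (norm_pos_iff.2 hqn)).2 H.q_lt.le)).continuousAt
  set K := -(a * theta (f * a⁻¹) p)
  have i3 : CircleIntegrable (fun x => K * betaShift ![a, b, c, d, e, f] p q x⁻¹) 0 1 :=
    circleIntegrable_of_continuousAt zero_le_one fun x hx => continuousAt_const.mul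
      (ContinuousAt.comp (f := fun x : ℂ => x⁻¹) (hS x⁻¹ (by rw [norm_inv, hx, inv_one]))
        (continuousAt_inv₀ (norm_ne_zero_iff.1 (by rw [hx]; exact one_ne_zero))))
  have i4 : CircleIntegrable (fun x => K * betaShift ![a, b, c, d, e, f] p q x) 0 1 :=
    circleIntegrable_of_continuousAt zero_le_one fun x hx => continuousAt_const.mul (hS x hx)
  have key := circleAverage_congr
    (f := fun x => M * betaKernel ![q * a, b, c, d, e, f] p q x +
      -N * betaKernel ![a, b, c, d, e, q * f] p q x)
    (g := fun x => K * betaShift ![a, b, c, d, e, f] p q x⁻¹ +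
      K * betaShift ![a, b, c, d, e, f] p q x) (R := 1) zero_le_one (fun x hx => by
      rw [← betaKernel_sub H hprod haf (norm_ne_zero_iff.1 (by rw [hx]; exact one_ne_zero))
        (fun j => H.pqPoch_ne_zero_of_norm_lt (by rw [norm_mul, hx, mul_one]; exact hn j))
        (fun j => H.pqPoch_ne_zero_of_norm_lt (by
          rw [norm_mul, norm_inv, hx, inv_one, mul_one]; exact hn j))]
      ring)
  rw [Real.circleAverage_fun_add i1 i2, Real.circleAverage_fun_add i3 i4, circleAverage_const_mul,
    circleAverage_const_mul, circleAverage_const_mul, circleAverage_const_mul,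
    Real.circleAverage_zero_one_congr_inv, circleAverage_betaShift H h0 hn] at key
  unfold betaCircle
  linear_combination key

end BetaCircle

/-! ### Evaluation of the elliptic beta integral over the unit circle -/

section BetaEvaluation

variable {p q : ℂ}

/-- The quotient of the two sides of the beta integral evaluation. -/
def betaRatio (t : Fin 6 → ℂ) (p q : ℂ) : ℂ := betaCircle t p q / betaProd t p q

theorem Nomes.ellGamma_ne_zero (_H : Nomes p q) {z : ℂ} (h1 : pqPoch z p q ≠ 0)
    (h2 : pqPoch (p * q * z⁻¹) p q ≠ 0) : ellGamma z p q ≠ 0 := div_ne_zero h2 h1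

theorem Nomes.ellGamma_pair_ne_zero (H : Nomes p q) {t : Fin 6 → ℂ} (hprod : ∏ j, t j = p * q)
    (hn : ∀ j, ‖t j‖ < 1) {j k : Fin 6} (hjk : j ≠ k) : ellGamma (t j * t k) p q ≠ 0 := by
  have ht0 (j : Fin 6) : t j ≠ 0 := fun h => mul_ne_zero H.p_ne H.q_ne (by
    rw [← hprod, Finset.prod_eq_zero (Finset.mem_univ j) h])
  refine H.ellGamma_ne_zero (H.pqPoch_ne_zero_of_norm_lt ?_) (H.pqPoch_ne_zero_of_norm_lt ?_)
  · rw [norm_mul]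
    exact mul_lt_one_of_nonneg_of_lt_one_left (norm_nonneg _) (hn j) (hn k).le
  · have h1 : p * q = t j * (t k * ∏ i ∈ (Finset.univ.erase j).erase k, t i) := by
      rw [Finset.mul_prod_erase _ _ (Finset.mem_erase.2 ⟨hjk.symm, Finset.mem_univ k⟩),
        Finset.mul_prod_erase _ _ (Finset.mem_univ j), hprod]
    have h2 : p * q * (t j * t k)⁻¹ = ∏ i ∈ (Finset.univ.erase j).erase k, t i := by
      rw [h1]
      have := ht0 j
      have := ht0 k
      field_simp
    rw [h2, norm_prod]
    have hne : ((Finset.univ.erase j).erase k).Nonempty := by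
      rw [← Finset.card_pos, Finset.card_erase_of_mem (Finset.mem_erase.2 ⟨hjk.symm,
        Finset.mem_univ k⟩), Finset.card_erase_of_mem (Finset.mem_univ j)]
      simp
    have := Finset.prod_lt_prod_of_nonempty (f := fun i => ‖t i‖) (g := fun _ => (1 : ℝ))
      (fun i _ => norm_pos_iff.2 (ht0 i)) (fun i _ => hn i) hne
    simpa using this

theorem Nomes.betaProd_ne_zero (H : Nomes p q) {t : Fin 6 → ℂ} (hprod : ∏ j, t j = p * q)
    (hn : ∀ j, ‖t j‖ < 1) : betaProd t p q ≠ 0 :=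
  Finset.prod_ne_zero_iff.2 fun _ _ => Finset.prod_ne_zero_iff.2 fun _ hk =>
    H.ellGamma_pair_ne_zero hprod hn (Finset.mem_Ioi.1 hk).ne

theorem Nomes.differentiableAt_betaRatio (H : Nomes p q) {t : ℂ → Fin 6 → ℂ} {s : ℂ}
    (ht : ∀ j, AnalyticAt ℂ (fun s => t s j) s) (hprod : ∏ j, t s j = p * q)
    (hn : ∀ j, ‖t s j‖ < 1) : DifferentiableAt ℂ (fun s => betaRatio (t s) p q) s := by
  have ht0 (j : Fin 6) : t s j ≠ 0 := fun h => mul_ne_zero H.p_ne H.q_ne (by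
    rw [← hprod, Finset.prod_eq_zero (Finset.mem_univ j) h])
  refine (H.differentiableAt_betaCircle ht ht0 hn).div ?_ (H.betaProd_ne_zero hprod hn)
  refine AnalyticAt.differentiableAt ?_
  refine Finset.analyticAt_fun_prod _ fun j _ => Finset.analyticAt_fun_prod _ fun k _ => ?_
  refine H.analyticAt_ellGamma ((ht j).mul (ht k)) (mul_ne_zero (ht0 j) (ht0 k))
    (H.pqPoch_ne_zero_of_norm_lt ?_)
  rw [norm_mul]
  exact mul_lt_one_of_nonneg_of_lt_one_left (norm_nonneg _) (hn j) (hn k).le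

theorem norm_lt_one_fin_six {a b c d e f : ℂ} (ha : ‖a‖ < 1) (hb : ‖b‖ < 1) (hc : ‖c‖ < 1)
    (hd : ‖d‖ < 1) (he : ‖e‖ < 1) (hf : ‖f‖ < 1) : ∀ j, ‖![a, b, c, d, e, f] j‖ < 1 := by
  simp [Fin.forall_fin_succ, *]

theorem prod_fin_six (a b c d e f : ℂ) : ∏ j, ![a, b, c, d, e, f] j = a * b * c * d * e * f := by
  simp [Fin.prod_univ_six]

theorem betaRatio_swap (a b c d e f : ℂ) :
    betaRatio ![a, b, c, d, e, f] p q = betaRatio ![b, a, c, d, e, f] p q := by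
  have h : betaKernel ![a, b, c, d, e, f] p q = betaKernel ![b, a, c, d, e, f] p q := by
    ext x; simp only [betaKernel_vec]; ring
  unfold betaRatio betaCircle
  rw [h]
  congr 1
  simp only [betaProd_vec, mul_comm b a]
  ring

theorem betaRatio_shift (H : Nomes p q) {a b c d e f : ℂ} (hprod : a * b * c * d * e * f = p)
    (ha : ‖a‖ < 1) (hb : ‖b‖ < 1) (hc : ‖c‖ < 1) (hd : ‖d‖ < 1) (he : ‖e‖ < 1) (hf : ‖f‖ < 1) :
    betaRatio ![q * a, b, c, d, e, f] p q = betaRatio ![a, b, c, d, e, q * f] p q := by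
  obtain ⟨ha0, hb0, hc0, hd0, he0, hf0⟩ := ne_zero_of_prod_eq H.p_ne hprod
  have hqlt {z : ℂ} (hz : ‖z‖ < 1) : ‖q * z‖ < 1 := by
    rw [norm_mul]
    exact (mul_le_of_le_one_left (norm_nonneg _) H.q_lt.le).trans_lt hz
  have hR1 := H.betaProd_ne_zero (t := ![q * a, b, c, d, e, f])
    (by rw [prod_fin_six, ← hprod]; ring) (norm_lt_one_fin_six (hqlt ha) hb hc hd he hf)
  have hR2 := H.betaProd_ne_zero (t := ![a, b, c, d, e, q * f])
    (by rw [prod_fin_six, ← hprod]; ring) (norm_lt_one_fin_six ha hb hc hd he (hqlt hf))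
  have hΓ {y z : ℂ} (hy : y ≠ 0) (hz : z ≠ 0) (hy1 : ‖y‖ < 1) (hz1 : ‖z‖ < 1) :
      ellGamma (q * (y * z)) p q = theta (y * z) p * ellGamma (y * z) p q := by
    refine H.ellGamma_q_mul (mul_ne_zero hy hz) (H.pqPoch_ne_zero_of_norm_lt ?_)
    rw [norm_mul]
    exact mul_lt_one_of_nonneg_of_lt_one_left (norm_nonneg _) hy1 hz1.le
  have hfa : theta (f * a) p ≠ 0 := fun h => by
    refine hR1 ?_
    rw [betaProd_vec, mul_assoc q a f, hΓ ha0 hf0 ha hf, mul_comm a f, h]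
    ring
  have key := betaCircle_shift H hprod (norm_lt_one_fin_six ha hb hc hd he hf) hfa
  unfold betaRatio
  rw [div_eq_div_iff hR1 hR2]
  simp only [betaProd_vec, mul_assoc q, mul_left_comm _ q]
  rw [hΓ ha0 hb0 ha hb, hΓ ha0 hc0 ha hc, hΓ ha0 hd0 ha hd, hΓ ha0 he0 ha he,
    hΓ hb0 hf0 hb hf, hΓ hc0 hf0 hc hf, hΓ hd0 hf0 hd hf, hΓ he0 hf0 he hf]
  simp only [mul_comm _ f] at key ⊢
  linear_combination (ellGamma (a * b) p q * ellGamma (a * c) p q * ellGamma (a * d) p q *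
    ellGamma (a * e) p q * ellGamma (q * (f * a)) p q * (ellGamma (b * c) p q *
    ellGamma (b * d) p q * ellGamma (b * e) p q * ellGamma (c * d) p q * ellGamma (c * e) p q *
    ellGamma (d * e) p q) * (ellGamma (f * b) p q * ellGamma (f * c) p q * ellGamma (f * d) p q *
    ellGamma (f * e) p q)) * key

/-- The quotient of the two sides does not change when two parameters move with constant product. -/
theorem betaRatio_move (H : Nomes p q) {a b c d e f z : ℂ} (hprod : a * b * c * d * e * f = p * q)
    (ha : ‖a‖ < 1) (hb : ‖b‖ < 1) (hc : ‖c‖ < 1) (hd : ‖d‖ < 1) (he : ‖e‖ < 1) (hf : ‖f‖ < 1)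
    (haf : ‖a * f‖ < ‖q‖) (hz : ‖a * f‖ < ‖z‖) (hz1 : ‖z‖ < 1) :
    betaRatio ![a, b, c, d, e, f] p q = betaRatio ![z, b, c, d, e, a * f * z⁻¹] p q := by
  obtain ⟨ha0, hb0, hc0, hd0, he0, hf0⟩ := ne_zero_of_prod_eq (mul_ne_zero H.p_ne H.q_ne) hprod
  have hP : 0 < ‖a * f‖ := norm_pos_iff.2 (mul_ne_zero ha0 hf0)
  have hqp : 0 < ‖q‖ := norm_pos_iff.2 H.q_ne
  have haP : ‖a * f‖ < ‖a‖ := by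
    rw [norm_mul]; exact mul_lt_of_lt_one_right (norm_pos_iff.2 ha0) hf
  have h1 := eq_of_invariant_of_annulus
    (f := fun z => betaRatio ![z, b, c, d, e, a * f * z⁻¹] p q) hP H.q_ne H.q_lt
    ((div_lt_one hqp).2 haf) (fun z h1 h2 => ?_) (fun z h1 h2 => ?_) haP ha hz hz1
  · simp only [mul_comm a f, mul_assoc, mul_inv_cancel₀ ha0, mul_one] at h1
    rw [h1]
    simp only [mul_comm a f, mul_assoc]
  · have hz0 : z ≠ 0 := norm_pos_iff.1 (hP.trans h1)
    have hid : AnalyticAt ℂ (fun x : ℂ => x) z := analyticAt_id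
    refine H.differentiableAt_betaRatio (t := fun z => ![z, b, c, d, e, a * f * z⁻¹]) ?_ ?_ ?_
    · simp only [Fin.forall_fin_succ, Matrix.cons_val_zero, Matrix.cons_val_succ]
      exact ⟨hid, analyticAt_const, analyticAt_const, analyticAt_const, analyticAt_const,
        analyticAt_const.mul (hid.inv hz0), by simp⟩
    · rw [prod_fin_six, ← hprod]; field_simp
    · refine norm_lt_one_fin_six h2 hb hc hd he ?_
      rw [norm_mul, norm_inv, ← div_eq_mul_inv, div_lt_one (hP.trans h1)]
      exact h1
  · have hz0 : z ≠ 0 := norm_pos_iff.1 ((div_pos hP hqp).trans h1)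
    have hqn := H.q_ne
    have e1 : a * f * z⁻¹ = q * (a * f * (q * z)⁻¹) := by field_simp
    rw [e1]
    refine betaRatio_shift H ?_ h2 hb hc hd he ?_
    · have : a * b * c * d * e * f * q⁻¹ = p := by rw [hprod]; field_simp
      rw [← this]; field_simp
    · rw [norm_mul, norm_inv, ← div_eq_mul_inv, norm_mul q z,
        div_lt_one (mul_pos hqp ((div_pos hP hqp).trans h1)), mul_comm ‖q‖, ← div_lt_iff₀ hqp]
      exact h1

/-- The elliptic gamma function without its pole at `1`: `Γ(z; p, q) (1 - z)`. -/
def ellGammaTail (z p q : ℂ) : ℂ := pqPoch (p * q * z⁻¹) p q / pqTail z p q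

theorem ellGamma_eq_tail (H : Nomes p q) (z : ℂ) :
    ellGamma z p q = (1 - z)⁻¹ * ellGammaTail z p q := by
  rw [ellGamma, ellGammaTail, H.pqPoch_eq_one_sub_mul z, div_eq_mul_inv, div_eq_mul_inv, mul_inv]
  ring

theorem Nomes.analyticAt_ellGammaTail (H : Nomes p q) {E : Type*} [NormedAddCommGroup E]
    [NormedSpace ℂ E] {g : E → ℂ} {e : E} (hg : AnalyticAt ℂ g e) (h0 : g e ≠ 0)
    (h : pqTail (g e) p q ≠ 0) : AnalyticAt ℂ (fun e => ellGammaTail (g e) p q) e :=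
  (H.analyticAt_pqPoch (analyticAt_const.mul (hg.inv h0))).div
    ((H.differentiable_pqTail.analyticAt (g e)).comp hg) h

theorem Nomes.ellGammaTail_one (H : Nomes p q) :
    ellGammaTail 1 p q * (qPoch p p * qPoch q q) = 1 := by
  have h : pqPoch (p * q) p q ≠ 0 := H.pqPoch_ne_zero_of_norm_lt (by
    rw [norm_mul]; exact mul_lt_one_of_nonneg_of_lt_one_left (norm_nonneg _) H.p_lt H.q_lt.le)
  have := qPoch_self_ne_zero H.p_lt
  have := qPoch_self_ne_zero H.q_lt
  rw [ellGammaTail, H.pqTail_one, inv_one, mul_one]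
  field_simp

theorem ellGammaPM_inv (t x p q : ℂ) : ellGammaPM t x⁻¹ p q = ellGammaPM t x p q := by
  rw [ellGammaPM, ellGammaPM, inv_inv, mul_comm]

theorem theta_sq_symm (hp : ‖p‖ < 1) (hq : ‖q‖ < 1) (x : ℂ) :
    theta (x⁻¹ ^ 2) p * theta (x⁻¹ ^ 2)⁻¹ q = theta (x ^ 2) p * theta (x ^ 2)⁻¹ q := by
  rcases eq_or_ne x 0 with rfl | hx
  · simp
  · have h1 := theta_inv hp (z := x ^ 2) (by positivity)
    have h2 := theta_inv hq (z := (x ^ 2)⁻¹) (by positivity)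
    rw [inv_pow, inv_inv, h1]
    rw [inv_inv] at h2
    rw [h2]
    field_simp

/-- The integrand of a beta integral with two parameters `± i s`, without the factors with poles
near the points `± i`. -/
def betaPinch (c d e g p q s x : ℂ) : ℂ :=
  ellGammaTail (I * s * x) p q * ellGammaTail (I * s * x⁻¹) p q *
    (ellGammaTail (-I * s * x) p q * ellGammaTail (-I * s * x⁻¹) p q) *
    (ellGammaPM c x p q * ellGammaPM d x p q * ellGammaPM e x p q *
      ellGammaPM (g * (s ^ 2)⁻¹) x p q) * (theta (x ^ 2) p * theta (x ^ 2)⁻¹ q)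

theorem betaKernel_pinch (H : Nomes p q) (c d e g s x : ℂ) :
    betaKernel ![I * s, -I * s, c, d, e, g * (s ^ 2)⁻¹] p q x = betaPinch c d e g p q s x *
      ((1 + s ^ 2 * x ^ 2) * (1 + s ^ 2 * (x ^ 2)⁻¹))⁻¹ := by
  have h1 : 1 + s ^ 2 * x ^ 2 = (1 - I * s * x) * (1 - -I * s * x) := by
    linear_combination (s ^ 2 * x ^ 2) * I_sq
  have h2 : 1 + s ^ 2 * (x ^ 2)⁻¹ = (1 - I * s * x⁻¹) * (1 - -I * s * x⁻¹) := by
    rw [← inv_pow]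
    linear_combination (s ^ 2 * x⁻¹ ^ 2) * I_sq
  rw [betaKernel_vec, betaPinch, h1, h2, ellGammaPM, ellGammaPM, ellGamma_eq_tail H (I * s * x),
    ellGamma_eq_tail H (I * s * x⁻¹), ellGamma_eq_tail H (-I * s * x),
    ellGamma_eq_tail H (-I * s * x⁻¹)]
  simp only [mul_inv]
  ring

theorem analyticAt_betaPinch (H : Nomes p q) {c d e g : ℂ} (hc : c ≠ 0) (hd : d ≠ 0) (he : e ≠ 0)
    (hg : g ≠ 0) {ρ : ℝ} (hρ0 : 0 < ρ) (hp : ‖p‖ < ρ) (hq : ‖q‖ < ρ) (hcρ : ‖c‖ < ρ) (hdρ : ‖d‖ < ρ)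
    (heρ : ‖e‖ < ρ) (hgρ : ‖g‖ < ρ) {x : ℂ} (h1 : ρ ≤ ‖x‖) (h2 : ‖x‖ ≤ ρ⁻¹) :
    AnalyticAt ℂ (fun y : ℂ × ℂ => betaPinch c d e g p q y.1 y.2) (1, x) := by
  have hx : x ≠ 0 := norm_pos_iff.1 (hρ0.trans_le h1)
  have h1' : ‖x⁻¹‖ ≤ ρ⁻¹ := by rw [norm_inv]; exact inv_anti₀ hρ0 h1
  have hxi := inv_ne_zero hx
  have hfst : AnalyticAt ℂ (fun y : ℂ × ℂ => y.1) (1, x) := analyticAt_fst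
  have hsnd : AnalyticAt ℂ (fun y : ℂ × ℂ => y.2) (1, x) := analyticAt_snd
  have hsnd' : AnalyticAt ℂ (fun y : ℂ × ℂ => y.2⁻¹) (1, x) := hsnd.inv hx
  have hlt {u v : ℂ} (hu : ‖u‖ < ρ) (hv : ‖v‖ ≤ ρ⁻¹) : ‖u * v‖ < 1 := by
    rw [norm_mul]
    calc ‖u‖ * ‖v‖ ≤ ‖u‖ * ρ⁻¹ := by gcongr
      _ < ρ * ρ⁻¹ := by gcongr
      _ = 1 := mul_inv_cancel₀ hρ0.ne'
  have hT {w : ℂ × ℂ → ℂ} (hw : AnalyticAt ℂ w (1, x)) (hw0 : w (1, x) ≠ 0)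
      (hwn : ‖w (1, x)‖ ≤ ρ⁻¹) : AnalyticAt ℂ (fun y => ellGammaTail (w y) p q) (1, x) :=
    H.analyticAt_ellGammaTail hw hw0 (H.pqTail_ne_zero_of_norm_lt
      (by rw [mul_comm]; exact hlt hp hwn) (by rw [mul_comm]; exact hlt hq hwn))
  have hG {w : ℂ × ℂ → ℂ} (hw : AnalyticAt ℂ w (1, x)) (hw0 : w (1, x) ≠ 0)
      (hwn : ‖w (1, x)‖ < ρ) : AnalyticAt ℂ (fun y => ellGammaPM (w y) y.2 p q) (1, x) :=
    (H.analyticAt_ellGamma (hw.mul hsnd) (mul_ne_zero hw0 hx)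
      (H.pqPoch_ne_zero_of_norm_lt (hlt hwn h2))).mul
    (H.analyticAt_ellGamma (hw.mul hsnd') (mul_ne_zero hw0 hxi)
      (H.pqPoch_ne_zero_of_norm_lt (hlt hwn h1')))
  have hI : ‖I * 1 * x‖ ≤ ρ⁻¹ := by simpa using h2
  have hI' : ‖I * 1 * x⁻¹‖ ≤ ρ⁻¹ := by simpa using h1'
  have hJ : ‖-I * 1 * x‖ ≤ ρ⁻¹ := by simpa using h2
  have hJ' : ‖-I * 1 * x⁻¹‖ ≤ ρ⁻¹ := by simpa using h1'
  unfold betaPinch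
  refine AnalyticAt.mul (AnalyticAt.mul (AnalyticAt.mul (AnalyticAt.mul
    (hT ((analyticAt_const.mul hfst).mul hsnd) (by simp [hx]) hI)
    (hT ((analyticAt_const.mul hfst).mul hsnd') (by simp [hx]) hI')) (AnalyticAt.mul
    (hT ((analyticAt_const.mul hfst).mul hsnd) (by simp [hx]) hJ)
    (hT ((analyticAt_const.mul hfst).mul hsnd') (by simp [hx]) hJ')))
    (AnalyticAt.mul (AnalyticAt.mul (AnalyticAt.mul (hG analyticAt_const hc hcρ)
      (hG analyticAt_const hd hdρ)) (hG analyticAt_const he heρ))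
      (hG (analyticAt_const.mul ((hfst.pow 2).inv (by simp))) (by simpa using hg)
        (by simpa using hgρ)))) (AnalyticAt.mul
    (analyticAt_theta H.p_lt (hsnd.pow 2) (pow_ne_zero 2 hx))
    (analyticAt_theta H.q_lt ((hsnd.pow 2).inv (pow_ne_zero 2 hx))
      (inv_ne_zero (pow_ne_zero 2 hx))))

theorem betaRatio_eq_pinch (H : Nomes p q) {a b c d e f : ℂ}
    (hprod : a * b * c * d * e * f = p * q) (ha : ‖a‖ < 1) (hb : ‖b‖ < 1) (hc : ‖c‖ < 1)
    (hd : ‖d‖ < 1) (he : ‖e‖ < 1) (hf : ‖f‖ < 1) {r : ℝ} (hr0 : 0 < r) (hr1 : r < 1)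
    (haf : ‖a * f‖ < r * ‖q‖) (haf' : ‖a * f‖ < r ^ 2) :
    betaRatio ![a, b, c, d, e, f] p q =
      betaRatio ![I * r, -I * r, c, d, e, a * b * f * ((r : ℂ) ^ 2)⁻¹] p q := by
  have hqp : 0 < ‖q‖ := norm_pos_iff.2 H.q_ne
  have hrn : ‖(r : ℂ)‖ = r := by simp [abs_of_pos hr0]
  have hI : ‖I * (r : ℂ)‖ = r := by rw [norm_mul, norm_I, one_mul, hrn]
  have hJ : ‖-I * (r : ℂ)‖ = r := by rw [norm_mul, norm_neg, norm_I, one_mul, hrn]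
  have hrc : (r : ℂ) ≠ 0 := by exact_mod_cast hr0.ne'
  have hIr : I * (r : ℂ) ≠ 0 := mul_ne_zero I_ne_zero hrc
  have hlt : ‖a * f‖ < r := haf'.trans (by nlinarith)
  have hf' : ‖a * f * (I * r)⁻¹‖ = ‖a * f‖ / r := by rw [norm_mul, norm_inv, hI, div_eq_mul_inv]
  have hbf : ‖b * (a * f * (I * r)⁻¹)‖ ≤ ‖a * f‖ / r := by
    rw [norm_mul, hf']
    exact mul_le_of_le_one_left (by positivity) hb.le
  have h1 : ‖a * f‖ / r < ‖q‖ := by rwa [div_lt_iff₀ hr0, mul_comm ‖q‖]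
  have h2 : ‖a * f‖ / r < r := by rwa [div_lt_iff₀ hr0, ← pow_two]
  rw [betaRatio_move H hprod ha hb hc hd he hf (haf.trans (mul_lt_of_lt_one_left hqp hr1))
    (z := I * r) (by rwa [hI]) (by rwa [hI]), betaRatio_swap,
    betaRatio_move H (z := -I * r) ?_ hb (by rwa [hI]) hc hd he (by rw [hf']; linarith)
      (hbf.trans_lt h1) (by rw [hJ]; exact hbf.trans_lt h2) (by rwa [hJ]), betaRatio_swap]
  · congr 2
    have : b * (a * f * (I * r)⁻¹) * (-I * r)⁻¹ = a * b * f * ((r : ℂ) ^ 2)⁻¹ := by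
      have e1 : (I * (r : ℂ))⁻¹ * (-I * r)⁻¹ = ((r : ℂ) ^ 2)⁻¹ := by
        rw [← mul_inv]; congr 1; linear_combination (-(r : ℂ) ^ 2) * I_sq
      rw [← e1]; ring
    rw [this]
  · rw [← hprod]; field_simp

/-- The elliptic beta integral over the unit circle, for small parameters. The quotient of the two
sides does not depend on the parameters, and its value is found by pinching. -/
theorem betaCircle_eq (H : Nomes p q) {a b c d e f : ℂ} (hprod : a * b * c * d * e * f = p * q)
    (ha : ‖a‖ < 1) (hb : ‖b‖ < 1) (hc : ‖c‖ < 1) (hd : ‖d‖ < 1) (he : ‖e‖ < 1) (hf : ‖f‖ < 1)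
    (haf : ‖a * f‖ < ‖q‖) :
    qPoch p p * qPoch q q / 2 * betaCircle ![a, b, c, d, e, f] p q =
      betaProd ![a, b, c, d, e, f] p q := by
  obtain ⟨ha0, hb0, hc0, hd0, he0, hf0⟩ := ne_zero_of_prod_eq (mul_ne_zero H.p_ne H.q_ne) hprod
  have hqp : 0 < ‖q‖ := norm_pos_iff.2 H.q_ne
  obtain ⟨g, hg⟩ : ∃ g, g = a * b * f := ⟨_, rfl⟩
  have hg0 : g ≠ 0 := by rw [hg]; positivity
  have hcdeg : c * d * e * g = p * q := by rw [hg, ← hprod]; ring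
  have hmul {u v : ℂ} (hu : ‖u‖ < 1) (hv : ‖v‖ < 1) : ‖u * v‖ < 1 := by
    rw [norm_mul]; exact mul_lt_one_of_nonneg_of_lt_one_left (norm_nonneg _) hu hv.le
  have hgn : ‖g‖ < 1 := by rw [hg]; exact hmul (hmul ha hb) hf
  have hprod_ne := H.betaProd_ne_zero (t := ![a, b, c, d, e, f]) (by rw [prod_fin_six, hprod])
    (norm_lt_one_fin_six ha hb hc hd he hf)
  obtain ⟨ρ, hρ, hρ1⟩ : ∃ ρ : ℝ, max (max (max ‖p‖ ‖q‖) (max ‖c‖ ‖d‖)) (max ‖e‖ ‖g‖) < ρ ∧ ρ < 1 :=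
    exists_between (by simp [H.p_lt, H.q_lt, hc, hd, he, hgn])
  simp only [max_lt_iff] at hρ
  have hρ0 : 0 < ρ := hqp.trans hρ.1.1.2
  have hlim := tendsto_circleAverage_pinch (g := betaPinch c d e g p q) hρ0 hρ1
    (fun x h1 h2 => analyticAt_betaPinch H hc0 hd0 he0 hg0 hρ0 hρ.1.1.1 hρ.1.1.2 hρ.1.2.1 hρ.1.2.2
      hρ.2.1 hρ.2.2 h1 h2) (fun s x => by
      simp only [betaPinch, ellGammaPM_inv, theta_sq_symm H.p_lt H.q_lt, inv_inv]
      ring)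
  set X : ℂ → ℂ := fun s =>
    (ellGamma (I * s * c) p q * ellGamma (I * s * d) p q * ellGamma (I * s * e) p q *
    ellGamma (I * s * (g * (s ^ 2)⁻¹)) p q * (ellGamma (-I * s * c) p q * ellGamma (-I * s * d) p q *
    ellGamma (-I * s * e) p q * ellGamma (-I * s * (g * (s ^ 2)⁻¹)) p q)) *
    (ellGamma (c * d) p q * ellGamma (c * e) p q * ellGamma (c * (g * (s ^ 2)⁻¹)) p q *
    (ellGamma (d * e) p q * ellGamma (d * (g * (s ^ 2)⁻¹)) p q) *
    ellGamma (e * (g * (s ^ 2)⁻¹)) p q) with hX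
  set D : ℂ → ℂ := fun s => (1 + s ^ 2) * (ellGammaTail (s ^ 2) p q * X s) with hD
  have hDprod (r : ℝ) (hr0 : 0 < r) (hr1 : r < 1) : D r = (1 - (r : ℂ) ^ 4) *
      betaProd ![I * r, -I * r, c, d, e, g * ((r : ℂ) ^ 2)⁻¹] p q := by
    have h1 : I * (r : ℂ) * (-I * r) = r ^ 2 := by linear_combination (-(r : ℂ) ^ 2) * I_sq
    have h2 : 1 - (r : ℂ) ^ 2 ≠ 0 := by
      have : r ^ 2 ≠ 1 := by nlinarith
      rw [sub_ne_zero]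
      exact_mod_cast this.symm
    have h3 := mul_inv_cancel₀ h2
    have h4 : betaProd ![I * r, -I * r, c, d, e, g * ((r : ℂ) ^ 2)⁻¹] p q =
        ellGamma (r ^ 2) p q * X r := by
      rw [betaProd_vec, h1, hX]; ring
    rw [h4, ellGamma_eq_tail H ((r : ℂ) ^ 2), hD]
    linear_combination (-(1 + (r : ℂ) ^ 2) * (ellGammaTail ((r : ℂ) ^ 2) p q * X r)) * h3
  have hp1 : ‖(1 : ℂ) ^ 2 * p‖ < 1 := by simpa using H.p_lt
  have hq1 : ‖(1 : ℂ) ^ 2 * q‖ < 1 := by simpa using H.q_lt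
  have hG {w : ℂ → ℂ} (hw : AnalyticAt ℂ w 1) (hw0 : w 1 ≠ 0) (hwn : ‖w 1‖ < 1) :
      AnalyticAt ℂ (fun y => ellGamma (w y) p q) 1 :=
    H.analyticAt_ellGamma hw hw0 (H.pqPoch_ne_zero_of_norm_lt hwn)
  have hid : AnalyticAt ℂ (fun s : ℂ => s) 1 := analyticAt_id
  have hgs : AnalyticAt ℂ (fun s : ℂ => g * (s ^ 2)⁻¹) 1 :=
    analyticAt_const.mul ((hid.pow 2).inv (by simp))
  have hi : AnalyticAt ℂ (fun s : ℂ => I * s) 1 := analyticAt_const.mul hid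
  have hj : AnalyticAt ℂ (fun s : ℂ => -I * s) 1 := analyticAt_const.mul hid
  have cc {u : ℂ} : AnalyticAt ℂ (fun _ : ℂ => u) 1 := analyticAt_const
  have hi1 {u : ℂ} (hu : u ≠ 0) (hun : ‖u‖ < 1) :
      AnalyticAt ℂ (fun s => ellGamma (I * s * u) p q) 1 :=
    hG (hi.mul cc) (by simp [hu]) (by simpa using hun)
  have hj1 {u : ℂ} (hu : u ≠ 0) (hun : ‖u‖ < 1) :
      AnalyticAt ℂ (fun s => ellGamma (-I * s * u) p q) 1 :=
    hG (hj.mul cc) (by simp [hu]) (by simpa using hun)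
  have hg1 {u : ℂ} (hu : u ≠ 0) (hun : ‖u‖ < 1) :
      AnalyticAt ℂ (fun s => ellGamma (u * (g * (s ^ 2)⁻¹)) p q) 1 :=
    hG (cc.mul hgs) (by simp [hu, hg0]) (by simpa using hmul hun hgn)
  have hXa : AnalyticAt ℂ X 1 :=
    ((((hi1 hc0 hc).mul (hi1 hd0 hd)).mul (hi1 he0 he)).mul
      (hG (hi.mul hgs) (by simp [hg0]) (by simpa using hgn))).mul
      ((((hj1 hc0 hc).mul (hj1 hd0 hd)).mul (hj1 he0 he)).mul
      (hG (hj.mul hgs) (by simp [hg0]) (by simpa using hgn))) |>.mul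
      ((((cc.mul cc).mul (hg1 hc0 hc)).mul (cc.mul (hg1 hd0 hd))).mul (hg1 he0 he))
  have hDa : AnalyticAt ℂ D 1 := (analyticAt_const.add (hid.pow 2)).mul
    ((H.analyticAt_ellGammaTail (hid.pow 2) (by simp)
      (H.pqTail_ne_zero_of_norm_lt hp1 hq1)).mul hXa)
  have hcast : Tendsto (fun r : ℝ => (r : ℂ)) (𝓝[<] 1) (𝓝 1) :=
    (Complex.continuous_ofReal.tendsto' 1 1 (by simp)).mono_left nhdsWithin_le_nhds
  have hlim' := (hDa.continuousAt.tendsto.comp hcast).const_mul (betaRatio ![a, b, c, d, e, f] p q)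
  have haf1 : ‖a * f‖ < 1 := hmul ha hf
  have hev : ∀ᶠ r : ℝ in 𝓝[<] 1, 0 < r ∧ ‖a * f‖ < r * ‖q‖ ∧ ‖a * f‖ < r ^ 2 := by
    have h1 : ∀ᶠ r : ℝ in 𝓝 1, 0 < r := Ioi_mem_nhds one_pos
    have h2 : ∀ᶠ r : ℝ in 𝓝 1, ‖a * f‖ < r * ‖q‖ :=
      (show ContinuousAt (fun r : ℝ => r * ‖q‖) 1 by fun_prop).eventually
        (lt_mem_nhds (by simpa using haf))
    have h3 : ∀ᶠ r : ℝ in 𝓝 1, ‖a * f‖ < r ^ 2 :=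
      (show ContinuousAt (fun r : ℝ => r ^ 2) 1 by fun_prop).eventually
        (lt_mem_nhds (by simpa using haf1))
    exact ((h1.and (h2.and h3))).filter_mono nhdsWithin_le_nhds
  have hval := tendsto_nhds_unique hlim (hlim'.congr' (by
    filter_upwards [hev, self_mem_nhdsWithin] with r hr hr1
    have hr1 : r < 1 := hr1
    obtain ⟨hr0, h1, h2⟩ := hr
    have hrn : ‖(r : ℂ)‖ = r := by simp [abs_of_pos hr0]
    have hrc : (r : ℂ) ≠ 0 := by exact_mod_cast hr0.ne'
    have hne := H.betaProd_ne_zero (t := ![I * r, -I * r, c, d, e, g * ((r : ℂ) ^ 2)⁻¹]) (by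
      rw [prod_fin_six, ← hcdeg]
      field_simp
      linear_combination (-1) * I_sq) (norm_lt_one_fin_six
      (by rw [norm_mul, norm_I, one_mul, hrn]; exact hr1)
      (by rw [norm_mul, norm_neg, norm_I, one_mul, hrn]; exact hr1) hc hd he (by
        rw [norm_mul, norm_inv, norm_pow, hrn, ← div_eq_mul_inv, div_lt_one (by positivity)]
        refine lt_of_le_of_lt ?_ h2
        rw [hg, mul_right_comm, norm_mul]
        exact mul_le_of_le_one_right (norm_nonneg _) hb.le))
    simp only [Function.comp]
    rw [hDprod r hr0 hr1, betaRatio_eq_pinch H hprod ha hb hc hd he hf hr0 hr1 h1 h2, ← hg,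
      betaRatio, betaCircle]
    simp only [← betaKernel_pinch H]
    rw [mul_left_comm, div_mul_cancel₀ _ hne]))
  have hmir {u v w y : ℂ} (h : u * v * w * y = p * q) (hu : u ≠ 0) (hu1 : ‖u‖ < 1) (hv1 : ‖v‖ < 1)
      (hw1 : ‖w‖ < 1) (hy1 : ‖y‖ < 1) {η : ℂ} (hη : ‖η‖ = 1) : ellGamma (η * u) p q ≠ 0 := by
    have hη0 : η ≠ 0 := norm_ne_zero_iff.1 (by rw [hη]; exact one_ne_zero)
    refine H.ellGamma_ne_zero (H.pqPoch_ne_zero_of_norm_lt (by rwa [norm_mul, hη, one_mul]))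
      (H.pqPoch_ne_zero_of_norm_lt ?_)
    have : p * q * (η * u)⁻¹ = η⁻¹ * (v * w * y) := by rw [← h]; field_simp
    rw [this, norm_mul, norm_inv, hη, inv_one, one_mul]
    exact hmul (hmul hv1 hw1) hy1
  have hrefl {u v : ℂ} (h : u * v = p * q) (hu : u ≠ 0) (hu1 : ‖u‖ < 1) (hv1 : ‖v‖ < 1) :
      ellGamma u p q * ellGamma v p q = 1 := by
    have hv : v = p * q * u⁻¹ := by rw [← h]; field_simp
    rw [hv]
    exact H.ellGamma_mul_reflect hu (H.pqPoch_ne_zero_of_norm_lt hu1)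
      (H.pqPoch_ne_zero_of_norm_lt (by rwa [← hv]))
  have r1 := hrefl (u := c * d) (v := e * g) (by rw [← hcdeg]; ring) (by positivity) (hmul hc hd)
    (hmul he hgn)
  have r2 := hrefl (u := c * e) (v := d * g) (by rw [← hcdeg]; ring) (by positivity) (hmul hc he)
    (hmul hd hgn)
  have r3 := hrefl (u := c * g) (v := d * e) (by rw [← hcdeg]; ring) (by positivity) (hmul hc hgn)
    (hmul hd he)
  have hIn : ‖I‖ = 1 := norm_I
  have hJn : ‖-I‖ = 1 := by rw [norm_neg, norm_I]
  have c1 := hmir hcdeg hc0 hc hd he hgn hIn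
  have c2 := hmir hcdeg hc0 hc hd he hgn hJn
  have hd' : d * c * e * g = p * q := by rw [← hcdeg]; ring
  have d1 := hmir hd' hd0 hd hc he hgn hIn
  have d2 := hmir hd' hd0 hd hc he hgn hJn
  have he' : e * c * d * g = p * q := by rw [← hcdeg]; ring
  have e1 := hmir he' he0 he hc hd hgn hIn
  have e2 := hmir he' he0 he hc hd hgn hJn
  have hg' : g * c * d * e = p * q := by rw [← hcdeg]; ring
  have g1 := hmir hg' hg0 hgn hc hd he hIn
  have g2 := hmir hg' hg0 hgn hc hd he hJn
  have hm1 : (ellGamma (-1) p q * ellGamma (-1) p q) * (theta (-1) p * theta (-1) q) = 1 := by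
    have hpq : ‖p * q‖ < 1 := hmul H.p_lt H.q_lt
    have hP : pqPoch (p * q * -1) p q ≠ 0 :=
      H.pqPoch_ne_zero_of_norm_lt (by simpa using hpq)
    have hi : (-1 : ℂ)⁻¹ = -1 := by norm_num
    have h1 := H.inv_ellGamma_mul_inv (z := -1) (by norm_num) hP (by rwa [hi])
    rw [hi] at h1
    rw [← h1, mul_inv_cancel₀]
    have h0 : pqPoch (-1) p q ≠ 0 := by
      rw [H.pqPoch_eq_one_sub_mul]
      exact mul_ne_zero (by norm_num) (H.pqTail_ne_zero_of_norm_lt (by simpa using H.p_lt)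
        (by simpa using H.q_lt))
    have := H.ellGamma_ne_zero h0 (by rwa [hi])
    exact mul_ne_zero this this
  have htail : ellGammaTail (-1) p q = 2 * ellGamma (-1) p q := by
    rw [ellGamma_eq_tail H]; norm_num; ring
  have hone := H.ellGammaTail_one
  have hT : ellGammaTail 1 p q ≠ 0 := left_ne_zero_of_mul_eq_one hone
  simp only [betaPinch, hD, hX, ellGammaPM] at hval
  norm_num [mul_comm _ I] at hval
  rw [neg_mul] at c2 d2 e2 g2
  have hJ : betaRatio ![a, b, c, d, e, f] p q = 2 * ellGammaTail 1 p q := by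
    have hY := mul_ne_zero (mul_ne_zero (mul_ne_zero c1 c2) (mul_ne_zero d1 d2))
      (mul_ne_zero (mul_ne_zero e1 e2) (mul_ne_zero g1 g2))
    rw [htail] at hval
    refine mul_right_cancel₀ (mul_ne_zero hT hY) ?_
    have hR : ellGamma (c * d) p q * ellGamma (e * g) p q * (ellGamma (c * e) p q *
        ellGamma (d * g) p q) * (ellGamma (c * g) p q * ellGamma (d * e) p q) = 1 := by
      rw [r1, r2, r3]; norm_num
    generalize betaRatio ![a, b, c, d, e, f] p q = J at *
    obtain ⟨Y, hYY⟩ : ∃ Y, Y = ellGamma (I * c) p q * ellGamma (-(I * c)) p q *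
      (ellGamma (I * d) p q * ellGamma (-(I * d)) p q) *
      (ellGamma (I * e) p q * ellGamma (-(I * e)) p q *
      (ellGamma (I * g) p q * ellGamma (-(I * g)) p q)) := ⟨_, rfl⟩
    rw [← hYY]
    have hval' : 2 * ellGamma (-1) p q * ellGammaTail 1 p q * (ellGammaTail 1 p q *
        (2 * ellGamma (-1) p q)) * Y * (theta (-1) p * theta (-1) q) =
        J * (2 * (ellGammaTail 1 p q * (Y * (ellGamma (c * d) p q * ellGamma (e * g) p q *
        (ellGamma (c * e) p q * ellGamma (d * g) p q) *
        (ellGamma (c * g) p q * ellGamma (d * e) p q))))) := by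
      rw [hYY]; linear_combination hval
    rw [hR] at hval'
    linear_combination (-1 / 2) * hval' + 2 * ellGammaTail 1 p q ^ 2 * Y * hm1
  rw [betaRatio, div_eq_iff hprod_ne] at hJ
  rw [hJ]
  linear_combination (betaProd ![a, b, c, d, e, f] p q) * hone

end BetaEvaluation

/-! ### The elliptic beta integral along a cycle -/

section BetaContour

variable {p q : ℂ}

theorem CycleSeparates.inv_notMem {Z : List (ℝ → ℂ)} {P : Set ℂ} (h : CycleSeparates Z P) {w : ℂ}
    (hw : w ∈ P) : w⁻¹ ∉ P := fun hw' => by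
  have h1 := h.winding _ hw'
  rw [h.inv_winding w hw] at h1
  exact zero_ne_one h1

theorem differentiableAt_list_sum_map {α : Type*} {F : α → ℂ → ℂ} {s : ℂ} (l : List α)
    (h : ∀ a ∈ l, DifferentiableAt ℂ (F a) s) :
    DifferentiableAt ℂ (fun s => (l.map fun a => F a s).sum) s := by
  induction l with
  | nil => simp
  | cons a l ih =>
    simp only [List.map_cons, List.sum_cons]
    exact (h a (by simp)).add (ih fun b hb => h b (by simp [hb]))

/-- The elliptic beta integral along a cycle. -/
def betaIntegral (t : Fin 6 → ℂ) (p q : ℂ) (Z : List (ℝ → ℂ)) : ℂ :=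
  cycleIntegral (fun x => betaKernel t p q x * x⁻¹) Z

theorem Nomes.betaIntegral_eq_of_separates (H : Nomes p q) {t : Fin 6 → ℂ} (ht : ∀ j, t j ≠ 0)
    {Z Z' : List (ℝ → ℂ)} (hZ : CycleSeparates Z (latticePoints t p q))
    (hZ' : CycleSeparates Z' (latticePoints t p q)) :
    betaIntegral t p q Z = betaIntegral t p q Z' := by
  refine hZ.cycleIntegral_eq hZ' (fun r hr => H.finite_latticePoints t hr) (fun z hz => ?_)
    (fun z hz h1 h2 => ?_)
  · exact (H.meromorphicAt_betaKernel ht hz).mul (analyticAt_id.inv hz).meromorphicAt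
  · exact (H.differentiableAt_betaKernel ht hz h1 h2).mul (differentiableAt_id.inv hz)

theorem Nomes.differentiableAt_betaIntegral (H : Nomes p q) {t : ℂ → Fin 6 → ℂ} {s : ℂ}
    (ht : ∀ j, AnalyticAt ℂ (fun s => t s j) s) (ht0 : ∀ j, t s j ≠ 0) {Z : List (ℝ → ℂ)}
    (hZ : CycleSeparates Z (latticePoints (t s) p q)) :
    DifferentiableAt ℂ (fun s => betaIntegral (t s) p q Z) s := by
  refine differentiableAt_list_sum_map Z fun γ hγ => ?_
  refine (hZ.isContour γ hγ).differentiableAt_contourIntegral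
    (F := fun s x => betaKernel (t s) p q x * x⁻¹) fun θ hθ => ?_
  have hx0 := hZ.ne_zero γ hγ θ hθ
  have hsnd : AnalyticAt ℂ (fun y : ℂ × ℂ => y.2) (s, γ θ) := analyticAt_snd
  refine (H.analyticAt_betaKernel (t := fun y : ℂ × ℂ => t y.1) (fun j => ?_) hsnd ht0 hx0
    (H.pqPoch_mul_ne_zero hx0 fun h => ?_) (H.pqPoch_mul_inv_ne_zero hx0 fun h => ?_)).mul
    (hsnd.inv hx0)
  · exact AnalyticAt.comp (f := fun y : ℂ × ℂ => y.1) (x := (s, γ θ)) (ht j) analyticAt_fst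
  · exact hZ.ne_inv _ h γ hγ θ hθ (inv_inv _).symm
  · exact hZ.ne _ h γ hγ θ hθ rfl

theorem countable_exp_mul_eq {β c : ℂ} (h : β ≠ 0 ∨ c ≠ 1) : {s : ℂ | c * exp (β * s) = 1}.Countable := by
  by_cases hβ : β = 0
  · have : {s : ℂ | c * exp (β * s) = 1} = ∅ := by
      ext s
      simp [hβ, h.resolve_left (not_not.2 hβ)]
    rw [this]
    exact Set.countable_empty
  · rcases Set.eq_empty_or_nonempty {s : ℂ | c * exp (β * s) = 1} with h0 | ⟨s₀, hs₀⟩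
    · rw [h0]; exact Set.countable_empty
    · refine (Set.countable_range fun n : ℤ => s₀ + n * (2 * Real.pi * I) / β).mono fun s hs => ?_
      have h1 : c * exp (β * s) = c * exp (β * s₀) := Eq.trans hs (Eq.symm hs₀)
      have hc : c ≠ 0 := fun h => by
        have : c * exp (β * s) = 1 := hs
        rw [h, zero_mul] at this
        exact zero_ne_one this
      obtain ⟨n, hn⟩ := exp_eq_exp_iff_exists_int.1 (mul_left_cancel₀ hc h1)
      refine ⟨n, ?_⟩
      field_simp
      linear_combination -hn

theorem cycleSeparates_unit_circle (H : Nomes p q) {t : Fin 6 → ℂ} (hn : ∀ j, ‖t j‖ < 1)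
    (ht : ∀ j, t j ≠ 0) : CycleSeparates [circleContour 0 1] (latticePoints t p q) := by
  have hlt {w : ℂ} (hw : w ∈ latticePoints t p q) : ‖w‖ < 1 := by
    obtain ⟨j, a, b, rfl⟩ := hw
    rw [norm_mul, norm_mul, norm_pow, norm_pow]
    have ha := pow_le_one₀ (norm_nonneg p) H.p_lt.le (n := a)
    have hb := pow_le_one₀ (norm_nonneg q) H.q_lt.le (n := b)
    exact mul_lt_one_of_nonneg_of_lt_one_left (by positivity)
      (mul_lt_one_of_nonneg_of_lt_one_left (norm_nonneg _) (hn j) ha) hb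
  have hne {w : ℂ} (hw : w ∈ latticePoints t p q) : w ≠ 0 := by
    obtain ⟨j, a, b, rfl⟩ := hw
    exact mul_ne_zero (mul_ne_zero (ht j) (pow_ne_zero _ H.p_ne)) (pow_ne_zero _ H.q_ne)
  have hlt' {w : ℂ} (hw : w ∈ latticePoints t p q) : 1 < ‖w⁻¹‖ := by
    rw [norm_inv]; exact (one_lt_inv₀ (norm_pos_iff.2 (hne hw))).2 (hlt hw)
  have hnorm (θ : ℝ) : ‖circleContour 0 1 θ‖ = 1 := by
    simpa using circleContour_mem_sphere 0 zero_le_one θ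
  have hin {w : ℂ} (hw : ‖w‖ < 1) : windingNumber (circleContour 0 1) w = 1 :=
    windingNumber_circleContour (by simpa using hw)
  refine ⟨by simp [isContour_circleContour], ?_, by simp [cycleWinding, hin], ?_, ?_, ?_, ?_⟩
  · simp only [List.mem_singleton, forall_eq]
    exact fun θ _ => norm_ne_zero_iff.1 (by rw [hnorm]; exact one_ne_zero)
  · simp only [List.mem_singleton, forall_eq]
    exact fun w hw θ _ e => (hlt hw).ne (e ▸ hnorm θ)
  · exact fun w hw => by simp [cycleWinding, hin (hlt hw)]
  · simp only [List.mem_singleton, forall_eq]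
    exact fun w hw θ _ e => (hlt' hw).ne' (e ▸ hnorm θ)
  · intro w hw
    simp [cycleWinding, windingNumber_circleContour_of_lt zero_le_one
      (by simpa using hlt' hw : (1 : ℝ) < dist w⁻¹ 0)]

/-- The elliptic beta integral, along any cycle which separates the two sequences of poles. Both
sides are continued analytically along a curve of parameters ending at parameters for which the
unit circle can be taken; the parameters for which no separating cycle exists form a countable set
on the curve. -/
theorem betaIntegral_eq (H : Nomes p q) {t : Fin 6 → ℂ} (hprod : ∏ j, t j = p * q)
    {Z : List (ℝ → ℂ)} (hZ : CycleSeparates Z (latticePoints t p q)) :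
    qPoch p p * qPoch q q / 2 * ((2 * Real.pi * I)⁻¹ * betaIntegral t p q Z) = betaProd t p q := by
  have ht0 (j : Fin 6) : t j ≠ 0 := fun h => mul_ne_zero H.p_ne H.q_ne (by
    rw [← hprod, Finset.prod_eq_zero (Finset.mem_univ j) h])
  have hpp : 0 < ‖p‖ := norm_pos_iff.2 H.p_ne
  have hqp : 0 < ‖q‖ := norm_pos_iff.2 H.q_ne
  obtain ⟨r, hr0, hr1, hr4⟩ : ∃ r : ℝ, 0 < r ∧ r < 1 ∧ ‖p‖ < r ^ 4 := by
    have h1 : ∀ᶠ r : ℝ in 𝓝[<] 1, ‖p‖ < r ^ 4 :=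
      ((show ContinuousAt (fun r : ℝ => r ^ 4) 1 by fun_prop).eventually
        (lt_mem_nhds (by simpa using H.p_lt))).filter_mono nhdsWithin_le_nhds
    have h2 : ∀ᶠ r : ℝ in 𝓝[<] 1, 0 < r :=
      (show ∀ᶠ r : ℝ in 𝓝 1, 0 < r from Ioi_mem_nhds one_pos).filter_mono nhdsWithin_le_nhds
    obtain ⟨r, h1, h2, h3⟩ := (h1.and (h2.and self_mem_nhdsWithin)).exists
    exact ⟨r, h2, h3, h1⟩
  set u : ℝ := √(‖p * q‖ / r ^ 4) with hu
  have hpq : 0 < ‖p * q‖ / r ^ 4 := by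
    rw [norm_mul]; positivity
  have hu0 : 0 < u := Real.sqrt_pos.2 hpq
  have hu2 : u * u = ‖p * q‖ / r ^ 4 := Real.mul_self_sqrt hpq.le
  have huq : u * u < ‖q‖ := by
    rw [hu2, norm_mul, div_lt_iff₀ (by positivity), mul_comm]
    gcongr
  have hu1 : u < 1 := by
    by_contra h
    have : 1 ≤ u * u := one_le_mul_of_one_le_of_one_le (not_lt.1 h) (not_lt.1 h)
    linarith [H.q_lt]
  set ρ : Fin 6 → ℝ := ![u, r, r, r, r, u] with hρ
  have hρ0 (j : Fin 6) : 0 < ρ j := by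
    fin_cases j <;> simp [hρ, hu0, hr0]
  have hρ1 (j : Fin 6) : ρ j < 1 := by
    fin_cases j <;> simp [hρ, hu1, hr1]
  have hρprod : ∏ j, ρ j = ‖p * q‖ := by
    have : ‖p * q‖ = u * u * r ^ 4 := by rw [hu2]; field_simp
    simp only [hρ, Fin.prod_univ_six, Matrix.cons_val, this]
    ring
  set α : Fin 6 → ℝ := fun j => Real.log (ρ j / ‖t j‖) with hα
  have hαsum : ∑ j, α j = 0 := by
    have hne (j : Fin 6) : ρ j / ‖t j‖ ≠ 0 :=
      (div_pos (hρ0 j) (norm_pos_iff.2 (ht0 j))).ne'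
    rw [hα, ← Real.log_prod (fun j _ => hne j), Finset.prod_div_distrib, hρprod, ← norm_prod, hprod,
      div_self (norm_ne_zero_iff.2 (mul_ne_zero H.p_ne H.q_ne)), Real.log_one]
  set T : ℂ → Fin 6 → ℂ := fun s j => t j * exp (α j * s) with hT
  have hTa (s : ℂ) (j : Fin 6) : AnalyticAt ℂ (fun s => T s j) s :=
    analyticAt_const.mul (analyticAt_cexp.comp (f := fun s => (α j : ℂ) * s) (analyticAt_const.mul analyticAt_id))
  have hT0 (s : ℂ) (j : Fin 6) : T s j ≠ 0 := mul_ne_zero (ht0 j) (exp_ne_zero _)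
  have hTprod (s : ℂ) : ∏ j, T s j = p * q := by
    rw [hT, Finset.prod_mul_distrib, hprod, ← exp_sum, ← Finset.sum_mul, ← ofReal_sum, hαsum]
    simp
  have hTzero : T 0 = t := by ext j; simp [hT]
  have hTone (j : Fin 6) : ‖T 1 j‖ = ρ j := by
    have h1 := norm_pos_iff.2 (ht0 j)
    have := div_pos (hρ0 j) h1
    rw [hT]
    simp only [norm_mul, mul_one, norm_exp, ofReal_re, hα]
    rw [Real.exp_log this]
    field_simp
  set B : Set ℂ := ⋃ x : Fin 6 × Fin 6 × ℕ × ℕ, {s : ℂ | t x.1 * t x.2.1 * p ^ x.2.2.1 *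
    q ^ x.2.2.2 * exp (((α x.1 + α x.2.1 : ℝ) : ℂ) * s) = 1} with hB
  have hmemB (s : ℂ) : s ∈ B ↔ ∃ (j k : Fin 6) (a b : ℕ), T s j * T s k * p ^ a * q ^ b = 1 := by
    have e (j k : Fin 6) (a b : ℕ) : T s j * T s k * p ^ a * q ^ b =
        t j * t k * p ^ a * q ^ b * exp (((α j + α k : ℝ) : ℂ) * s) := by
      rw [ofReal_add, add_mul, exp_add, hT]; ring
    simp only [hB, Set.mem_iUnion, Prod.exists, e]
    rfl
  have hBsep {s : ℂ} {Y : List (ℝ → ℂ)} (hY : CycleSeparates Y (latticePoints (T s) p q)) :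
      s ∉ B := fun hs => by
    obtain ⟨j, k, a, b, h⟩ := (hmemB s).1 hs
    refine hY.inv_notMem (w := T s j * p ^ a * q ^ b) ⟨j, a, b, rfl⟩ ⟨k, 0, 0, ?_⟩
    rw [pow_zero, pow_zero, mul_one, mul_one]
    exact inv_eq_of_mul_eq_one_right (by rw [← h]; ring)
  have h0B : (0 : ℂ) ∉ B := hBsep (by rw [hTzero]; exact hZ)
  have hBc : B.Countable := by
    refine Set.countable_iUnion fun x => countable_exp_mul_eq ?_
    by_contra! h
    refine h0B (Set.mem_iUnion.2 ⟨x, ?_⟩)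
    show _ * exp _ = 1
    rw [h.2, mul_zero, exp_zero, one_mul]
  have hex (s : ℂ) (hs : s ∉ B) : ∃ Y, CycleSeparates Y (latticePoints (T s) p q) := by
    refine exists_cycleSeparates ?_ (fun r hr => H.finite_latticePoints _ hr) ?_
    · rintro ⟨j, a, b, h⟩
      exact mul_ne_zero (mul_ne_zero (hT0 s j) (pow_ne_zero a H.p_ne)) (pow_ne_zero b H.q_ne) h.symm
    · rintro w ⟨j, a, b, rfl⟩ ⟨k, a', b', h⟩
      refine hs ((hmemB s).2 ⟨j, k, a + a', b + b', ?_⟩)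
      have hne := mul_ne_zero (mul_ne_zero (hT0 s j) (pow_ne_zero a H.p_ne)) (pow_ne_zero b H.q_ne)
      have := mul_inv_cancel₀ hne
      rw [h] at this
      rw [pow_add, pow_add]
      linear_combination this
  choose! Y hY using hex
  have hlocal {s : ℂ} {W : List (ℝ → ℂ)} (hW : CycleSeparates W (latticePoints (T s) p q)) :
      ∀ᶠ v in 𝓝 s, CycleSeparates W (latticePoints (T v) p q) :=
    hW.eventually_latticePoints H (fun j => (hTa s j).continuousAt) (hT0 s)
  have hBo : IsOpen Bᶜ := isOpen_iff_eventually.2 fun s hs =>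
    (hlocal (hY s hs)).mono fun v hv => hBsep hv
  have hBconn : IsPreconnected Bᶜ := (hBc.isConnected_compl_of_one_lt_rank (by simp)).isPreconnected
  set c : ℂ := qPoch p p * qPoch q q / 2 * (2 * Real.pi * I)⁻¹ with hc
  set D : ℂ → ℂ := fun s => c * betaIntegral (T s) p q (Y s) - betaProd (T s) p q with hD
  have hDeq {s : ℂ} {W : List (ℝ → ℂ)} (hW : CycleSeparates W (latticePoints (T s) p q)) :
      D s = c * betaIntegral (T s) p q W - betaProd (T s) p q := by
    rw [hD]
    simp only
    rw [H.betaIntegral_eq_of_separates (hT0 s) (hY s (hBsep hW)) hW]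
  have hDd : DifferentiableOn ℂ D Bᶜ := fun s hs => by
    have h1 : DifferentiableAt ℂ
        (fun v => c * betaIntegral (T v) p q (Y s) - betaProd (T v) p q) s := by
      refine ((H.differentiableAt_betaIntegral (hTa s) (hT0 s) (hY s hs)).const_mul c).sub
        (AnalyticAt.differentiableAt ?_)
      refine Finset.analyticAt_fun_prod _ fun j _ => Finset.analyticAt_fun_prod _ fun k _ => ?_
      refine H.analyticAt_ellGamma ((hTa s j).mul (hTa s k)) (mul_ne_zero (hT0 s j) (hT0 s k))
        fun h => ?_
      obtain ⟨a, b, hab⟩ := H.pqPoch_eq_zero_iff.1 h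
      exact hs ((hmemB s).2 ⟨j, k, a, b, hab⟩)
    exact (h1.congr_of_eventuallyEq ((hlocal (hY s hs)).mono fun v hv => hDeq hv)).differentiableWithinAt
  have hn1 (j : Fin 6) : ‖T 1 j‖ < 1 := by rw [hTone]; exact hρ1 j
  have hnear : ∀ᶠ v in 𝓝 (1 : ℂ), D v = 0 := by
    have h1 : ∀ᶠ v in 𝓝 (1 : ℂ), ∀ j, ‖T v j‖ < 1 := eventually_all.2 fun j =>
      (hTa 1 j).continuousAt.norm.eventually (gt_mem_nhds (hn1 j))
    have h2 : ∀ᶠ v in 𝓝 (1 : ℂ), ‖T v 0 * T v 5‖ < ‖q‖ :=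
      ((hTa 1 0).continuousAt.mul (hTa 1 5).continuousAt).norm.eventually (gt_mem_nhds (by
        show ‖T 1 0 * T 1 5‖ < ‖q‖
        rw [norm_mul, hTone, hTone]; simpa [hρ] using huq))
    filter_upwards [h1, h2] with v hv1 hv2
    have hvec : T v = ![T v 0, T v 1, T v 2, T v 3, T v 4, T v 5] := by
      ext j; fin_cases j <;> rfl
    have hp6 := hTprod v
    rw [Fin.prod_univ_six] at hp6
    have key := betaCircle_eq H hp6 (hv1 0) (hv1 1) (hv1 2) (hv1 3) (hv1 4) (hv1 5) hv2
    rw [← hvec] at key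
    rw [hDeq (cycleSeparates_unit_circle H hv1 (hT0 v)), ← key, betaCircle,
      circleAverage_eq_contourIntegral _ one_ne_zero, betaIntegral, cycleIntegral, List.map_singleton,
      List.sum_singleton, hc]
    ring
  have h1B : (1 : ℂ) ∉ B := hBsep (cycleSeparates_unit_circle H hn1 (hT0 1))
  have hzero := (hDd.analyticOnNhd hBo).eqOn_zero_of_preconnected_of_eventuallyEq_zero hBconn h1B
    hnear h0B
  rw [hDeq (W := Z) (by rw [hTzero]; exact hZ), hTzero] at hzero
  rw [← sub_eq_zero, ← mul_assoc]
  exact hzero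

end BetaContour

/-! ### Generic parameters and the beta functional -/

section BetaFunctional

variable {p q z w x : ℂ}

/-- `z` is nonzero and not of the form `p^i q^j` with integers `i` and `j`. -/
def NonRes (p q z : ℂ) : Prop := z ≠ 0 ∧ ∀ i j : ℤ, z ≠ p ^ i * q ^ j

namespace NonRes

theorem symm (h : NonRes p q z) : NonRes q p z :=
  ⟨h.1, fun i j e => h.2 j i (by rw [e, mul_comm])⟩

theorem inv (h : NonRes p q z) : NonRes p q z⁻¹ :=
  ⟨inv_ne_zero h.1, fun i j e => h.2 (-i) (-j) (by
    rw [zpow_neg, zpow_neg, ← mul_inv, ← e, inv_inv])⟩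

theorem of_eq_mul (H : Nomes p q) (h : NonRes p q z) (i j : ℤ) (e : w = z * (p ^ i * q ^ j)) :
    NonRes p q w := by
  have hp := zpow_ne_zero i H.p_ne
  have hq := zpow_ne_zero j H.q_ne
  refine ⟨by rw [e]; exact mul_ne_zero h.1 (mul_ne_zero hp hq), fun i' j' e' => h.2 (i' - i) (j' - j) ?_⟩
  rw [zpow_sub₀ H.p_ne, zpow_sub₀ H.q_ne]
  rw [e] at e'
  field_simp
  linear_combination e'

theorem theta_ne_zero (H : Nomes p q) (h : NonRes p q z) : theta z p ≠ 0 := fun h0 => by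
  obtain ⟨k, hk⟩ := (theta_eq_zero_iff H.p_ne H.p_lt h.1).1 h0
  exact h.2 k 0 (by simpa using hk)

theorem pqPoch_ne_zero (H : Nomes p q) (h : NonRes p q z) : pqPoch z p q ≠ 0 := fun h0 => by
  obtain ⟨a, b, hab⟩ := H.pqPoch_eq_zero_iff.1 h0
  refine h.2 (-a) (-b) ?_
  have := pow_ne_zero a H.p_ne
  have := pow_ne_zero b H.q_ne
  rw [zpow_neg, zpow_neg, zpow_natCast, zpow_natCast]
  field_simp
  linear_combination hab

theorem pqPoch_reflect_ne_zero (H : Nomes p q) (h : NonRes p q z) : pqPoch (p * q * z⁻¹) p q ≠ 0 :=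
  pqPoch_ne_zero H (h.inv.of_eq_mul H 1 1 (by rw [zpow_one, zpow_one, mul_comm]))

theorem ellPoch_ne_zero (H : Nomes p q) (h : NonRes p q z) (n : ℕ) : ellPoch z n q p ≠ 0 :=
  Finset.prod_ne_zero_iff.2 fun j _ => theta_ne_zero H (h.of_eq_mul H 0 j (by simp))

end NonRes

theorem countable_not_nonRes (p q : ℂ) : {z | ¬ NonRes p q z}.Countable := by
  have : {z | ¬ NonRes p q z} ⊆ insert 0 (Set.range fun x : ℤ × ℤ => p ^ x.1 * q ^ x.2) := by
    intro z hz
    simp only [NonRes, Set.mem_ofPred_eq, not_and_or, not_not, not_forall] at hz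
    rcases hz with h | ⟨i, j, h⟩
    · exact Or.inl h
    · exact Or.inr ⟨(i, j), h.symm⟩
  exact ((Set.countable_range _).insert 0).mono this

/-- All products `t_j t_k` and all quotients `t_j / t_k`, `j ≠ k`, are off the lattice
`p^ℤ q^ℤ`. -/
structure Generic (p q : ℂ) (t : Fin 6 → ℂ) : Prop where
  ne_zero : ∀ j, t j ≠ 0
  mul : ∀ j k, NonRes p q (t j * t k)
  div : ∀ j k, j ≠ k → NonRes p q (t j * (t k)⁻¹)

namespace Generic

variable {t t' : Fin 6 → ℂ}

theorem symm (h : Generic p q t) : Generic q p t :=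
  ⟨h.ne_zero, fun j k => (h.mul j k).symm, fun j k hjk => (h.div j k hjk).symm⟩

theorem shift (H : Nomes p q) (h : Generic p q t) (ht : ∀ j, ∃ i k : ℤ, t' j = t j * (p ^ i * q ^ k)) :
    Generic p q t' := by
  choose i k e using ht
  have hp (j : ℤ) := zpow_ne_zero j H.p_ne
  have hq (j : ℤ) := zpow_ne_zero j H.q_ne
  refine ⟨fun j => ?_, fun j l => (h.mul j l).of_eq_mul H (i j + i l) (k j + k l) ?_,
    fun j l hjl => (h.div j l hjl).of_eq_mul H (i j - i l) (k j - k l) ?_⟩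
  · rw [e]
    exact mul_ne_zero (h.ne_zero j) (mul_ne_zero (hp _) (hq _))
  · rw [e, e, zpow_add₀ H.p_ne, zpow_add₀ H.q_ne]; ring
  · rw [e, e, zpow_sub₀ H.p_ne, zpow_sub₀ H.q_ne, mul_inv, mul_inv]; ring

theorem perm (h : Generic p q t) (σ : Equiv.Perm (Fin 6)) : Generic p q (t ∘ σ) :=
  ⟨fun _ => h.ne_zero _, fun _ _ => h.mul _ _, fun _ _ hjk => h.div _ _ (σ.injective.ne hjk)⟩

theorem exists_cycle (H : Nomes p q) (h : Generic p q t) :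
    ∃ Z, CycleSeparates Z (latticePoints t p q) := by
  refine exists_cycleSeparates ?_ (fun r hr => H.finite_latticePoints t hr) ?_
  · rintro ⟨j, a, b, e⟩
    exact mul_ne_zero (mul_ne_zero (h.ne_zero j) (pow_ne_zero a H.p_ne)) (pow_ne_zero b H.q_ne)
      e.symm
  · rintro w ⟨j, a, b, rfl⟩ ⟨k, a', b', e⟩
    refine (h.mul j k).2 (-(a + a' : ℕ)) (-(b + b' : ℕ)) ?_
    have hne := mul_ne_zero (mul_ne_zero (h.ne_zero j) (pow_ne_zero a H.p_ne))
      (pow_ne_zero b H.q_ne)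
    have h1 := mul_inv_cancel₀ hne
    rw [e] at h1
    have := pow_ne_zero (a + a') H.p_ne
    have := pow_ne_zero (b + b') H.q_ne
    rw [zpow_neg, zpow_neg, zpow_natCast, zpow_natCast]
    field_simp
    rw [pow_add, pow_add]
    linear_combination h1

end Generic

/-- `x` is off the (two-sided) lattices through the parameters and their reciprocals, and `x²` is
off the lattice `p^ℤ q^ℤ`. -/
def OffPoles (p q : ℂ) (t : Fin 6 → ℂ) (x : ℂ) : Prop :=
  NonRes p q (x ^ 2) ∧ ∀ j, NonRes p q (t j * x) ∧ NonRes p q (t j * x⁻¹)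

theorem OffPoles.ne_zero {t : Fin 6 → ℂ} (h : OffPoles p q t x) : x ≠ 0 := fun h0 =>
  h.1.1 (by rw [h0]; simp)

theorem OffPoles.symm {t : Fin 6 → ℂ} (h : OffPoles p q t x) : OffPoles q p t x :=
  ⟨h.1.symm, fun j => ⟨(h.2 j).1.symm, (h.2 j).2.symm⟩⟩

theorem countable_not_offPoles {t : Fin 6 → ℂ} (ht : ∀ j, t j ≠ 0) :
    {x | ¬ OffPoles p q t x}.Countable := by
  have hc := countable_not_nonRes p q
  have : {x | ¬ OffPoles p q t x} ⊆ {x | x ^ 2 ∈ {z | ¬ NonRes p q z}} ∪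
      ⋃ j, ((fun z => (t j)⁻¹ * z) '' {z | ¬ NonRes p q z} ∪
        (fun z => t j * z⁻¹) '' {z | ¬ NonRes p q z}) := by
    intro x hx
    by_contra h
    simp only [Set.mem_union, Set.mem_iUnion, not_or, not_exists] at h
    refine hx ⟨by simpa using h.1, fun j => ⟨?_, ?_⟩⟩
    · by_contra h1
      exact (h.2 j).1 ⟨_, h1, inv_mul_cancel_left₀ (ht j) x⟩
    · by_contra h1
      refine (h.2 j).2 ⟨_, h1, ?_⟩
      have := ht j
      simp only [mul_inv, inv_inv]
      field_simp
  exact ((countable_sq_mem hc).union (Set.countable_iUnion fun j =>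
    (hc.image _).union (hc.image _))).mono this

theorem ellPoch_succ (t : ℂ) (n : ℕ) (q p : ℂ) :
    ellPoch t (n + 1) q p = ellPoch t n q p * theta (t * q ^ n) p := Finset.prod_range_succ _ _

@[simp] theorem ellPoch_zero (t q p : ℂ) : ellPoch t 0 q p = 1 := rfl

theorem ellPoch_succ' (t : ℂ) (n : ℕ) (q p : ℂ) :
    ellPoch t (n + 1) q p = theta t p * ellPoch (t * q) n q p := by
  rw [ellPoch, Finset.prod_range_succ', mul_comm]
  simp [ellPoch, pow_succ', mul_assoc]

theorem ellPoch_add (t : ℂ) (m n : ℕ) (q p : ℂ) :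
    ellPoch t (m + n) q p = ellPoch t m q p * ellPoch (t * q ^ m) n q p := by
  simp [ellPoch, Finset.prod_range_add, pow_add, mul_assoc]

@[simp] theorem ellPochPM_zero (t x q p : ℂ) : ellPochPM t x 0 q p = 1 := rfl

theorem ellPochPM_add (t x : ℂ) (m n : ℕ) (q p : ℂ) :
    ellPochPM t x (m + n) q p = ellPochPM t x m q p * ellPochPM (t * q ^ m) x n q p := by
  simp [ellPochPM, Finset.prod_range_add, pow_add, mul_assoc]

theorem pqPoch_mul_pow_ne_zero (H : Nomes p q) (hz : pqPoch z p q ≠ 0) (n : ℕ) :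
    pqPoch (z * q ^ n) p q ≠ 0 := fun h => by
  obtain ⟨a, b, hab⟩ := H.pqPoch_eq_zero_iff.1 h
  exact hz (H.pqPoch_eq_zero_iff.2 ⟨a, n + b, by rw [← hab, pow_add]; ring⟩)

theorem Nomes.ellGamma_mul_pow (H : Nomes p q) (hz0 : z ≠ 0) (hz : pqPoch z p q ≠ 0) (n : ℕ) :
    ellGamma (z * q ^ n) p q = ellPoch z n q p * ellGamma z p q := by
  induction n with
  | zero => simp
  | succ n ih =>
    rw [pow_succ', show z * (q * q ^ n) = q * (z * q ^ n) by ring,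
      H.ellGamma_q_mul (mul_ne_zero hz0 (pow_ne_zero _ H.q_ne)) (pqPoch_mul_pow_ne_zero H hz n), ih,
      ellPoch_succ]
    ring

/-- Multiplication of the parameters by nonnegative powers of `q` multiplies the kernel by theta
functions. -/
theorem Nomes.betaKernel_mul_pow (H : Nomes p q) {t t' : Fin 6 → ℂ} (n : Fin 6 → ℕ)
    (ht : ∀ j, t j ≠ 0) (e : ∀ j, t' j = t j * q ^ n j) (hx : x ≠ 0)
    (h1 : ∀ j, pqPoch (t j * x) p q ≠ 0) (h2 : ∀ j, pqPoch (t j * x⁻¹) p q ≠ 0) :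
    betaKernel t' p q x = (∏ j, ellPochPM (t j) x (n j) q p) * betaKernel t p q x := by
  rw [betaKernel, betaKernel, ← mul_assoc (∏ j, ellPochPM (t j) x (n j) q p),
    ← Finset.prod_mul_distrib]
  congr 1
  refine Finset.prod_congr rfl fun j _ => ?_
  rw [e, ellGammaPM, ellGammaPM, ellPochPM_eq, mul_right_comm, mul_right_comm _ _ x⁻¹,
    H.ellGamma_mul_pow (mul_ne_zero (ht j) hx) (h1 j),
    H.ellGamma_mul_pow (mul_ne_zero (ht j) (inv_ne_zero hx)) (h2 j)]
  ring

theorem Nomes.betaKernel_comm (H : Nomes p q) (t : Fin 6 → ℂ) (hx : x ≠ 0) :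
    betaKernel t p q x = betaKernel t q p x := by
  have h2 : x ^ 2 ≠ 0 := pow_ne_zero 2 hx
  simp only [betaKernel, ellGammaPM, ellGamma_comm _ p q]
  rw [theta_inv H.p_lt h2, theta_inv H.q_lt h2]
  ring

theorem betaProd_comm (t : Fin 6 → ℂ) (p q : ℂ) : betaProd t p q = betaProd t q p := by
  simp only [betaProd, ellGamma_comm _ p q]

/-- The linear functional `F ↦ (p; p)_∞ (q; q)_∞ / (4 π i) ∫_Z F(x) Δ(x) dx/x` with the kernel
`Δ` of the elliptic beta integral. -/
def betaFun (p q : ℂ) (t : Fin 6 → ℂ) (Z : List (ℝ → ℂ)) (F : ℂ → ℂ) : ℂ :=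
  qPoch p p * qPoch q q / 2 *
    ((2 * Real.pi * I)⁻¹ * cycleIntegral (fun x => F x * betaKernel t p q x * x⁻¹) Z)

theorem cycleIntegral_congr_of_countable {Z : List (ℝ → ℂ)} {E : Set ℂ} (hE : E.Countable)
    {f g : ℂ → ℂ} (h0 : ∀ γ ∈ Z, ∀ t ∈ Set.Icc (0 : ℝ) 1, γ t ≠ 0)
    (hfg : ∀ x ≠ 0, x ∉ E → f x = g x) : cycleIntegral f Z = cycleIntegral g Z := by
  rw [cycleIntegral, cycleIntegral]
  congr 1
  refine List.map_congr_left fun γ hγ => ?_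
  exact intervalIntegral.integral_congr_ae_restrict
    (pullback_ae_eq γ hE fun t ht hE => hfg _ (h0 γ hγ t ht) hE)

/-- The functional depends only on the values of `F Δ` off a countable set. -/
theorem betaFun_congr {t t' : Fin 6 → ℂ} {Z : List (ℝ → ℂ)} {P : Set ℂ} (hZ : CycleSeparates Z P)
    {E : Set ℂ} (hE : E.Countable) {F G : ℂ → ℂ}
    (h : ∀ x ≠ 0, x ∉ E → F x * betaKernel t p q x = G x * betaKernel t' p q x) :
    betaFun p q t Z F = betaFun p q t' Z G := by
  rw [betaFun, betaFun, cycleIntegral_congr_of_countable hE hZ.ne_zero fun x hx hxE => by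
    rw [h x hx hxE]]

theorem betaFun_const_mul (t : Fin 6 → ℂ) (Z : List (ℝ → ℂ)) (c : ℂ) (F : ℂ → ℂ) :
    betaFun p q t Z (fun x => c * F x) = c * betaFun p q t Z F := by
  have : cycleIntegral (fun x => c * F x * betaKernel t p q x * x⁻¹) Z =
      c * cycleIntegral (fun x => F x * betaKernel t p q x * x⁻¹) Z := by
    simp only [cycleIntegral, mul_assoc, contourIntegral_const_mul, List.sum_map_mul_left]
  rw [betaFun, betaFun, this]
  ring

theorem Nomes.differentiableAt_mul_betaKernel (H : Nomes p q) {t : Fin 6 → ℂ}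
    (ht : ∀ j, t j ≠ 0) {F : ℂ → ℂ} (hF : ∀ z ≠ 0, DifferentiableAt ℂ F z) (hx : x ≠ 0)
    (h1 : x ∉ latticePoints t p q) (h2 : x⁻¹ ∉ latticePoints t p q) :
    DifferentiableAt ℂ (fun x => F x * betaKernel t p q x * x⁻¹) x :=
  ((hF x hx).mul (H.differentiableAt_betaKernel ht hx h1 h2)).mul (differentiableAt_id.inv hx)

theorem Nomes.betaFun_sum (H : Nomes p q) {t : Fin 6 → ℂ} (ht : ∀ j, t j ≠ 0)
    {Z : List (ℝ → ℂ)} (hZ : CycleSeparates Z (latticePoints t p q)) {ι : Type*} (s : Finset ι)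
    {F : ι → ℂ → ℂ} (hF : ∀ i ∈ s, ∀ z ≠ 0, DifferentiableAt ℂ (F i) z) :
    betaFun p q t Z (fun x => ∑ i ∈ s, F i x) = ∑ i ∈ s, betaFun p q t Z (F i) := by
  have : cycleIntegral (fun x => (∑ i ∈ s, F i x) * betaKernel t p q x * x⁻¹) Z =
      ∑ i ∈ s, cycleIntegral (fun x => F i x * betaKernel t p q x * x⁻¹) Z := by
    simp only [cycleIntegral, Finset.sum_mul]
    have key : ∀ l : List (ℝ → ℂ), (∀ γ ∈ l, γ ∈ Z) →
        (l.map fun γ => contourIntegral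
          (fun x => ∑ i ∈ s, F i x * betaKernel t p q x * x⁻¹) γ).sum =
        ∑ i ∈ s, (l.map fun γ => contourIntegral
          (fun x => F i x * betaKernel t p q x * x⁻¹) γ).sum := by
      intro l
      induction l with
      | nil => simp
      | cons γ l ih =>
        intro hl
        have hγ := hl γ List.mem_cons_self
        simp only [List.map_cons, List.sum_cons, Finset.sum_add_distrib]
        rw [ih fun γ' h' => hl γ' (List.mem_cons_of_mem _ h')]
        congr 1
        refine (hZ.isContour γ hγ).contourIntegral_sum s fun i hi θ hθ => ?_
        refine (H.differentiableAt_mul_betaKernel ht (hF i hi) (hZ.ne_zero γ hγ θ hθ)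
          (fun h => ?_) fun h => ?_).continuousAt
        · exact hZ.ne _ h γ hγ θ hθ rfl
        · exact hZ.ne_inv _ h γ hγ θ hθ (inv_inv _).symm
    exact key Z fun _ h => h
  simp only [betaFun, this, Finset.mul_sum]

theorem Nomes.betaFun_eq_of_separates (H : Nomes p q) {t : Fin 6 → ℂ} (ht : ∀ j, t j ≠ 0)
    {Z Z' : List (ℝ → ℂ)} (hZ : CycleSeparates Z (latticePoints t p q))
    (hZ' : CycleSeparates Z' (latticePoints t p q)) {F : ℂ → ℂ}
    (hF : ∀ z ≠ 0, DifferentiableAt ℂ F z) : betaFun p q t Z F = betaFun p q t Z' F := by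
  have hFa (z : ℂ) (hz : z ≠ 0) : AnalyticAt ℂ F z :=
    (DifferentiableOn.analyticOnNhd (s := {0}ᶜ) (fun w hw => (hF w hw).differentiableWithinAt)
      isOpen_compl_singleton) z hz
  have := hZ.cycleIntegral_eq (f := fun x => F x * betaKernel t p q x * x⁻¹) hZ'
    (fun r hr => H.finite_latticePoints t hr)
    (fun z hz => ((hFa z hz).meromorphicAt.mul (H.meromorphicAt_betaKernel ht hz)).mul
      (analyticAt_id.inv hz).meromorphicAt)
    (fun z hz h1 h2 => H.differentiableAt_mul_betaKernel ht hF hz h1 h2)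
  rw [betaFun, betaFun, this]

/-- The theta factors of `betaKernel_mul_pow` can be absorbed into the parameters. -/
theorem Nomes.betaFun_prod_mul (H : Nomes p q) {t t' : Fin 6 → ℂ} (n : Fin 6 → ℕ)
    (ht : ∀ j, t j ≠ 0) (e : ∀ j, t' j = t j * q ^ n j)
    {Z : List (ℝ → ℂ)} {P : Set ℂ} (hZ : CycleSeparates Z P) {F G : ℂ → ℂ}
    (hG : ∀ z ≠ 0, G z = (∏ j, ellPochPM (t j) z (n j) q p) * F z) :
    betaFun p q t Z G = betaFun p q t' Z F := by
  refine betaFun_congr hZ (countable_not_offPoles (p := p) (q := q) ht) fun x hx hxE => ?_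
  have hxE : OffPoles p q t x := by simpa using hxE
  rw [H.betaKernel_mul_pow n ht e hx (fun j => (hxE.2 j).1.pqPoch_ne_zero H)
    (fun j => (hxE.2 j).2.pqPoch_ne_zero H), hG x hx]
  ring

theorem latticePoints_subset {t t' : Fin 6 → ℂ} {m n : Fin 6 → ℕ}
    (e : ∀ j, t' j = t j * (p ^ m j * q ^ n j)) : latticePoints t' p q ⊆ latticePoints t p q := by
  rintro x ⟨j, a, b, rfl⟩
  exact ⟨j, m j + a, n j + b, by rw [e, pow_add, pow_add]; ring⟩

theorem Nomes.betaFun_one (H : Nomes p q) {t : Fin 6 → ℂ} (hprod : ∏ j, t j = p * q)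
    {Z : List (ℝ → ℂ)} (hZ : CycleSeparates Z (latticePoints t p q)) :
    betaFun p q t Z (fun _ => 1) = betaProd t p q := by
  rw [← betaIntegral_eq H hprod hZ, betaFun, betaIntegral]
  simp only [one_mul]

theorem Nomes.betaFun_comm (H : Nomes p q) (t : Fin 6 → ℂ) {Z : List (ℝ → ℂ)} {P : Set ℂ}
    (hZ : CycleSeparates Z P) (F : ℂ → ℂ) : betaFun p q t Z F = betaFun q p t Z F := by
  rw [betaFun, betaFun, mul_comm (qPoch p p), cycleIntegral_congr_of_countable Set.countable_empty
    hZ.ne_zero fun x hx _ => by rw [H.betaKernel_comm t hx]]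

theorem latticePoints_comm (t : Fin 6 → ℂ) (p q : ℂ) :
    latticePoints t p q = latticePoints t q p := by
  ext x
  constructor
  · rintro ⟨j, a, b, rfl⟩; exact ⟨j, b, a, mul_right_comm _ _ _⟩
  · rintro ⟨j, a, b, rfl⟩; exact ⟨j, b, a, mul_right_comm _ _ _⟩

end BetaFunctional

/-! ### The biorthogonal rational functions -/

section Rational

variable {p q z : ℂ}

/-- `q^{n (n - 1) / 2}`, written as a product. -/
def triPow (q : ℂ) (n : ℕ) : ℂ := ∏ k ∈ Finset.range n, q ^ k

theorem triPow_ne_zero (hq : q ≠ 0) (n : ℕ) : triPow q n ≠ 0 :=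
  Finset.prod_ne_zero_iff.2 fun k _ => pow_ne_zero k hq

theorem ellPoch_p_mul (H : Nomes p q) (hz : z ≠ 0) (n : ℕ) :
    ellPoch (p * z) n q p = (-z⁻¹) ^ n * (triPow q n)⁻¹ * ellPoch z n q p := by
  have e (k : ℕ) : theta (p * z * q ^ k) p = -z⁻¹ * (q ^ k)⁻¹ * theta (z * q ^ k) p := by
    rw [mul_assoc, theta_mul_p H.p_ne H.p_lt (mul_ne_zero hz (pow_ne_zero k H.q_ne)), mul_inv]
    ring
  simp only [ellPoch, triPow, e, Finset.prod_mul_distrib, Finset.prod_const, Finset.card_range,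
    Finset.prod_inv_distrib]

theorem ellPoch_p_inv_mul (H : Nomes p q) (hz : z ≠ 0) (n : ℕ) :
    ellPoch (p⁻¹ * z) n q p = (-(p⁻¹ * z)) ^ n * triPow q n * ellPoch z n q p := by
  have e (k : ℕ) : theta (p⁻¹ * z * q ^ k) p = -(p⁻¹ * z) * q ^ k * theta (z * q ^ k) p := by
    rw [mul_assoc, theta_div_p H.p_ne H.p_lt (mul_ne_zero hz (pow_ne_zero k H.q_ne))]
    ring
  simp only [ellPoch, triPow, e, Finset.prod_mul_distrib, Finset.prod_const, Finset.card_range]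

theorem ellPoch_reflect (H : Nomes p q) (hz : z ≠ 0) (n : ℕ) :
    ellPoch (q * z⁻¹) n q p = ellPoch (p * z * (q ^ n)⁻¹) n q p := by
  rw [ellPoch, ellPoch, ← Finset.prod_range_reflect]
  refine Finset.prod_congr rfl fun k hk => ?_
  have hk := Finset.mem_range.1 hk
  have hq := H.q_ne
  rw [← theta_p_div p (p * z * (q ^ n)⁻¹ * q ^ k) H.p_ne]
  congr 1
  obtain ⟨m, rfl⟩ : ∃ m, n = k + 1 + m := ⟨n - (k + 1), by omega⟩
  have : k + 1 + m - 1 - k = m := by omega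
  have hp := H.p_ne
  rw [this, pow_add, pow_add]
  field_simp

theorem ellPoch_reverse (H : Nomes p q) (hz : z ≠ 0) (n : ℕ) :
    ellPoch (q * z⁻¹) n q p =
      (-(q * z⁻¹)) ^ n * triPow q n * ellPoch (z * (q ^ n)⁻¹) n q p := by
  have hq := H.q_ne
  have h : ellPoch (q * z⁻¹) n q p = (-(q * z⁻¹)) ^ n * triPow q n *
      ∏ k ∈ Finset.range n, theta (z * (q ^ (k + 1))⁻¹) p := by
    rw [ellPoch, triPow, ← Finset.card_range n, ← Finset.prod_const, Finset.card_range,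
      ← Finset.prod_mul_distrib, ← Finset.prod_mul_distrib]
    refine Finset.prod_congr rfl fun k _ => ?_
    have e : q * z⁻¹ * q ^ k = (z * (q ^ (k + 1))⁻¹)⁻¹ := by
      rw [pow_succ]; field_simp
    rw [e, theta_inv H.p_lt (mul_ne_zero hz (inv_ne_zero (pow_ne_zero _ hq))), ← e]
    ring
  rw [h, ellPoch, ← Finset.prod_range_reflect]
  congr 1
  refine Finset.prod_congr rfl fun k hk => ?_
  have hk := Finset.mem_range.1 hk
  congr 1
  obtain ⟨m, rfl⟩ : ∃ m, n = k + 1 + m := ⟨n - (k + 1), by omega⟩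
  have : k + 1 + m - 1 - k = m := by omega
  rw [this, pow_add, pow_add]
  field_simp
  ring

theorem ellPochPM_reflect (H : Nomes p q) {t x : ℂ} (ht : t ≠ 0) (hx : x ≠ 0) (n : ℕ) :
    ellPochPM (q * t⁻¹) x n q p = ellPochPM (p * t * (q ^ n)⁻¹) x n q p := by
  have h1 := ellPoch_reflect H (mul_ne_zero ht hx) n
  have h2 := ellPoch_reflect H (mul_ne_zero ht (inv_ne_zero hx)) n
  rw [mul_inv, inv_inv, ← mul_assoc] at h2
  rw [mul_inv, ← mul_assoc] at h1
  rw [ellPochPM_eq, ellPochPM_eq, h1, h2, mul_comm,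
    show p * (t * x) * (q ^ n)⁻¹ = p * t * (q ^ n)⁻¹ * x by ring,
    show p * (t * x⁻¹) * (q ^ n)⁻¹ = p * t * (q ^ n)⁻¹ * x⁻¹ by ring]

theorem ellPochPM_reverse (H : Nomes p q) {t x : ℂ} (ht : t ≠ 0) (hx : x ≠ 0) (n : ℕ) :
    ellPochPM (q * t⁻¹) x n q p =
      ((q * t⁻¹) ^ n * triPow q n) ^ 2 * ellPochPM (t * (q ^ n)⁻¹) x n q p := by
  rw [ellPochPM_eq, ellPochPM_eq]
  have h1 := ellPoch_reverse H (mul_ne_zero ht hx) n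
  have h2 := ellPoch_reverse H (mul_ne_zero ht (inv_ne_zero hx)) n
  rw [mul_inv, inv_inv, ← mul_assoc] at h2
  rw [mul_inv, ← mul_assoc] at h1
  have h3 : (-(q * t⁻¹ * x)) ^ n * (-(q * t⁻¹ * x⁻¹)) ^ n = ((q * t⁻¹) ^ n) ^ 2 := by
    rw [← mul_pow, ← pow_mul, mul_comm n 2, pow_mul]
    congr 1
    field_simp
  rw [h1, h2, mul_right_comm t x, mul_right_comm t x⁻¹]
  linear_combination triPow q n ^ 2 * (ellPoch (t * (q ^ n)⁻¹ * x⁻¹) n q p *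
    ellPoch (t * (q ^ n)⁻¹ * x) n q p) * h3

/-- The `x`-independent part of the `j`-th term of the terminating very-well-poised series
`bioRat`. -/
def bioCoef (n : ℕ) (a b c d s t q p : ℂ) (j : ℕ) : ℂ :=
  theta (d * s⁻¹ * q ^ (2 * j)) p / theta (d * s⁻¹) p *
    ((ellPoch (d * s⁻¹) j q p * ellPoch (q * (a * s)⁻¹) j q p * ellPoch (q * (b * s)⁻¹) j q p *
      ellPoch (q * (c * s)⁻¹) j q p * ellPoch (q ^ n)⁻¹ j q p *
      ellPoch (q ^ n * (s * t)⁻¹) j q p) /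
    (ellPoch q j q p * ellPoch (a * d) j q p * ellPoch (b * d) j q p * ellPoch (c * d) j q p *
      ellPoch (q ^ n * (q * (d * s⁻¹))) j q p * ellPoch (d * t * q * (q ^ n)⁻¹) j q p)) * q ^ j

/-- The terminating series
`₁₂V₁₁(d/s; q/(as), q/(bs), q/(cs), q⁻ⁿ, qⁿ/(st), dx, d/x; q, p)`. Both families of biorthogonal
functions are of this form: `R_n` has the parameters `s = ε₈`, `t = q / A`, and `T_n` those with
`s` and `t` interchanged. -/
def bioRat (n : ℕ) (a b c d s t q p x : ℂ) : ℂ :=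
  ∑ j ∈ Finset.range (n + 1), bioCoef n a b c d s t q p j *
    (ellPochPM d x j q p / ellPochPM (q * s⁻¹) x j q p)

/-- The numerator of `bioRat` over the denominator `θ(q x^{±1} / s)_n`. -/
def bioNum (n : ℕ) (a b c d s t q p x : ℂ) : ℂ :=
  ∑ j ∈ Finset.range (n + 1), bioCoef n a b c d s t q p j *
    (ellPochPM d x j q p * ellPochPM (q * s⁻¹ * q ^ j) x (n - j) q p)

theorem bioRat_mul {n : ℕ} (a b c d s t : ℂ) {x : ℂ} (h : ellPochPM (q * s⁻¹) x n q p ≠ 0) :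
    ellPochPM (q * s⁻¹) x n q p * bioRat n a b c d s t q p x = bioNum n a b c d s t q p x := by
  rw [bioRat, bioNum, Finset.mul_sum]
  refine Finset.sum_congr rfl fun j hj => ?_
  have hj : j ≤ n := Nat.lt_succ_iff.1 (Finset.mem_range.1 hj)
  have e := ellPochPM_add (q * s⁻¹) x j (n - j) q p
  rw [Nat.add_sub_of_le hj] at e
  have h0 : ellPochPM (q * s⁻¹) x j q p ≠ 0 := fun h0 => h (by rw [e, h0, zero_mul])
  rw [e]
  generalize ellPochPM (q * s⁻¹) x j q p = P at *
  field_simp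

theorem isEvenTheta_bioNum (H : Nomes p q) (n : ℕ) (a b c : ℂ) {d s : ℂ} (t : ℂ) (hd : d ≠ 0)
    (hs : s ≠ 0) : IsEvenTheta p n fun x => bioNum n a b c d s t q p x := by
  refine IsEvenTheta.sum _ fun j hj => IsEvenTheta.const_mul ?_ _
  have hj : j ≤ n := Nat.lt_succ_iff.1 (Finset.mem_range.1 hj)
  have := (isEvenTheta_ellPochPM H.p_ne H.p_lt H.q_ne hd j).mul
    (isEvenTheta_ellPochPM H.p_ne H.p_lt H.q_ne (a := q * s⁻¹ * q ^ j)
      (mul_ne_zero (mul_ne_zero H.q_ne (inv_ne_zero hs)) (pow_ne_zero _ H.q_ne)) (n - j))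
  rwa [Nat.add_sub_of_le hj] at this

section Invariance

variable {a b c d s t : ℂ}

theorem bioCoef_swap (n : ℕ) (a b c d s t q p : ℂ) (j : ℕ) :
    bioCoef n a b c d s t q p j = bioCoef n b a c d s t q p j := by
  simp only [bioCoef]
  ring

theorem bioRat_swap (n : ℕ) (a b c d s t q p x : ℂ) :
    bioRat n a b c d s t q p x = bioRat n b a c d s t q p x := by
  simp only [bioRat, bioCoef_swap n a b]

theorem bioCoef_p_mul_left (H : Nomes p q) (ha : a ≠ 0) (hd : d ≠ 0) (hs : s ≠ 0) (ht : t ≠ 0)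
    (n : ℕ) (b c : ℂ) (j : ℕ) :
    bioCoef n (p * a) b c d s (p⁻¹ * t) q p j = bioCoef n a b c d s t q p j := by
  have hq := H.q_ne
  have hp := H.p_ne
  have hqn := pow_ne_zero n hq
  have hT := triPow_ne_zero hq j
  rw [bioCoef, bioCoef,
    show q * (p * a * s)⁻¹ = p⁻¹ * (q * (a * s)⁻¹) by field_simp,
    show q ^ n * (s * (p⁻¹ * t))⁻¹ = p * (q ^ n * (s * t)⁻¹) by field_simp,
    show p * a * d = p * (a * d) by ring,
    show d * (p⁻¹ * t) * q * (q ^ n)⁻¹ = p⁻¹ * (d * t * q * (q ^ n)⁻¹) by ring,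
    ellPoch_p_inv_mul H (z := q * (a * s)⁻¹) (by positivity),
    ellPoch_p_mul H (z := q ^ n * (s * t)⁻¹) (by positivity),
    ellPoch_p_mul H (z := a * d) (by positivity),
    ellPoch_p_inv_mul H (z := d * t * q * (q ^ n)⁻¹) (by positivity)]
  have key : (-(p⁻¹ * (q * (a * s)⁻¹))) ^ j * (-(q ^ n * (s * t)⁻¹)⁻¹) ^ j =
      (-(a * d)⁻¹) ^ j * (-(p⁻¹ * (d * t * q * (q ^ n)⁻¹))) ^ j := by
    rw [← mul_pow, ← mul_pow]
    congr 1
    field_simp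
  have h1 : (-(a * d)⁻¹) ^ j ≠ 0 := pow_ne_zero _ (neg_ne_zero.2 (by positivity))
  have h2 : (-(p⁻¹ * (d * t * q * (q ^ n)⁻¹))) ^ j ≠ 0 :=
    pow_ne_zero _ (neg_ne_zero.2 (by positivity))
  generalize (-(p⁻¹ * (q * (a * s)⁻¹))) ^ j = u1 at *
  generalize (-(q ^ n * (s * t)⁻¹)⁻¹) ^ j = u2 at *
  generalize (-(a * d)⁻¹) ^ j = u3 at *
  generalize (-(p⁻¹ * (d * t * q * (q ^ n)⁻¹))) ^ j = u4 at *
  generalize ellPoch (d * s⁻¹) j q p = e1, ellPoch (q * (a * s)⁻¹) j q p = e2,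
    ellPoch (q * (b * s)⁻¹) j q p = e3, ellPoch (q * (c * s)⁻¹) j q p = e4,
    ellPoch (q ^ n)⁻¹ j q p = e5, ellPoch (q ^ n * (s * t)⁻¹) j q p = e6,
    ellPoch q j q p = f1, ellPoch (a * d) j q p = f2, ellPoch (b * d) j q p = f3,
    ellPoch (c * d) j q p = f4, ellPoch (q ^ n * (q * (d * s⁻¹))) j q p = f5,
    ellPoch (d * t * q * (q ^ n)⁻¹) j q p = f6
  generalize triPow q j = T at *
  rw [show e1 * (u1 * T * e2) * e3 * e4 * e5 * (u2 * T⁻¹ * e6) =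
      (u1 * u2) * (e1 * e2 * e3 * e4 * e5 * e6) by field_simp,
    show f1 * (u3 * T⁻¹ * f2) * f3 * f4 * f5 * (u4 * T * f6) =
      (u3 * u4) * (f1 * f2 * f3 * f4 * f5 * f6) by field_simp, key,
    mul_div_mul_left _ _ (mul_ne_zero h1 h2)]

theorem bioRat_p_mul_left (H : Nomes p q) (ha : a ≠ 0) (hd : d ≠ 0) (hs : s ≠ 0) (ht : t ≠ 0)
    (n : ℕ) (b c x : ℂ) :
    bioRat n (p * a) b c d s (p⁻¹ * t) q p x = bioRat n a b c d s t q p x := by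
  simp only [bioRat, bioCoef_p_mul_left H ha hd hs ht]

theorem bioRat_p_mul_right (H : Nomes p q) (hprod : a * b * c * d * s * t = q) (n : ℕ) {x : ℂ}
    (hx : x ≠ 0) :
    bioRat n a b c d (p * s) (p⁻¹ * t) q p x = bioRat n a b c d s t q p x := by
  obtain ⟨ha, hb, hc, hd, hs, ht⟩ := ne_zero_of_prod_eq H.q_ne hprod
  have hq := H.q_ne
  have hp := H.p_ne
  have hqn := pow_ne_zero n hq
  refine Finset.sum_congr rfl fun j _ => ?_
  have hT := triPow_ne_zero hq j
  have hqj := pow_ne_zero j hq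
  rw [bioCoef, bioCoef, ellPochPM_eq (q * (p * s)⁻¹), ellPochPM_eq (q * s⁻¹),
    show d * (p * s)⁻¹ * q ^ (2 * j) = p⁻¹ * (d * s⁻¹ * q ^ (2 * j)) by rw [mul_inv]; ring,
    show d * (p * s)⁻¹ = p⁻¹ * (d * s⁻¹) by rw [mul_inv]; ring,
    show q * (a * (p * s))⁻¹ = p⁻¹ * (q * (a * s)⁻¹) by field_simp,
    show q * (b * (p * s))⁻¹ = p⁻¹ * (q * (b * s)⁻¹) by field_simp,
    show q * (c * (p * s))⁻¹ = p⁻¹ * (q * (c * s)⁻¹) by field_simp,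
    show p * s * (p⁻¹ * t) = s * t by field_simp,
    show q ^ n * (q * (p⁻¹ * (d * s⁻¹))) = p⁻¹ * (q ^ n * (q * (d * s⁻¹))) by ring,
    show d * (p⁻¹ * t) * q * (q ^ n)⁻¹ = p⁻¹ * (d * t * q * (q ^ n)⁻¹) by ring,
    show q * (p * s)⁻¹ * x = p⁻¹ * (q * s⁻¹ * x) by rw [mul_inv]; ring,
    show q * (p * s)⁻¹ * x⁻¹ = p⁻¹ * (q * s⁻¹ * x⁻¹) by rw [mul_inv]; ring,
    theta_div_p hp H.p_lt (z := d * s⁻¹ * q ^ (2 * j)) (by positivity),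
    theta_div_p hp H.p_lt (z := d * s⁻¹) (by positivity),
    ellPoch_p_inv_mul H (z := d * s⁻¹) (by positivity),
    ellPoch_p_inv_mul H (z := q * (a * s)⁻¹) (by positivity),
    ellPoch_p_inv_mul H (z := q * (b * s)⁻¹) (by positivity),
    ellPoch_p_inv_mul H (z := q * (c * s)⁻¹) (by positivity),
    ellPoch_p_inv_mul H (z := q ^ n * (q * (d * s⁻¹))) (by positivity),
    ellPoch_p_inv_mul H (z := d * t * q * (q ^ n)⁻¹) (by positivity),
    ellPoch_p_inv_mul H (z := q * s⁻¹ * x) (by positivity),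
    ellPoch_p_inv_mul H (z := q * s⁻¹ * x⁻¹) (by positivity)]
  have key : q ^ (2 * j) * ((-(p⁻¹ * (d * s⁻¹))) ^ j * (-(p⁻¹ * (q * (a * s)⁻¹))) ^ j *
      (-(p⁻¹ * (q * (b * s)⁻¹))) ^ j * (-(p⁻¹ * (q * (c * s)⁻¹))) ^ j) =
      (-(p⁻¹ * (q ^ n * (q * (d * s⁻¹))))) ^ j * (-(p⁻¹ * (d * t * q * (q ^ n)⁻¹))) ^ j *
      ((-(p⁻¹ * (q * s⁻¹ * x))) ^ j * (-(p⁻¹ * (q * s⁻¹ * x⁻¹))) ^ j) := by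
    rw [pow_mul, ← mul_pow, ← mul_pow, ← mul_pow, ← mul_pow, ← mul_pow, ← mul_pow, ← mul_pow]
    congr 1
    field_simp
    linear_combination -hprod
  have h1 : (-(p⁻¹ * (q ^ n * (q * (d * s⁻¹))))) ^ j ≠ 0 :=
    pow_ne_zero _ (neg_ne_zero.2 (by positivity))
  have h2 : (-(p⁻¹ * (d * t * q * (q ^ n)⁻¹))) ^ j ≠ 0 :=
    pow_ne_zero _ (neg_ne_zero.2 (by positivity))
  have h3 : (-(p⁻¹ * (q * s⁻¹ * x))) ^ j ≠ 0 := pow_ne_zero _ (neg_ne_zero.2 (by positivity))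
  have h4 : (-(p⁻¹ * (q * s⁻¹ * x⁻¹))) ^ j ≠ 0 := pow_ne_zero _ (neg_ne_zero.2 (by positivity))
  have hv : p⁻¹ * (d * s⁻¹) ≠ 0 := by positivity
  rw [show -(p⁻¹ * (d * s⁻¹ * q ^ (2 * j))) = -(p⁻¹ * (d * s⁻¹)) * q ^ (2 * j) by ring]
  generalize (-(p⁻¹ * (d * s⁻¹))) ^ j = u1 at *
  generalize (-(p⁻¹ * (q * (a * s)⁻¹))) ^ j = u2 at *
  generalize (-(p⁻¹ * (q * (b * s)⁻¹))) ^ j = u3 at *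
  generalize (-(p⁻¹ * (q * (c * s)⁻¹))) ^ j = u4 at *
  generalize (-(p⁻¹ * (q ^ n * (q * (d * s⁻¹))))) ^ j = v1 at *
  generalize (-(p⁻¹ * (d * t * q * (q ^ n)⁻¹))) ^ j = v2 at *
  generalize (-(p⁻¹ * (q * s⁻¹ * x))) ^ j = v3 at *
  generalize (-(p⁻¹ * (q * s⁻¹ * x⁻¹))) ^ j = v4 at *
  generalize p⁻¹ * (d * s⁻¹) = v at *
  generalize ellPoch (d * s⁻¹) j q p = e1, ellPoch (q * (a * s)⁻¹) j q p = e2,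
    ellPoch (q * (b * s)⁻¹) j q p = e3, ellPoch (q * (c * s)⁻¹) j q p = e4,
    ellPoch (q ^ n)⁻¹ j q p = e5, ellPoch (q ^ n * (s * t)⁻¹) j q p = e6,
    ellPoch q j q p = f1, ellPoch (a * d) j q p = f2, ellPoch (b * d) j q p = f3,
    ellPoch (c * d) j q p = f4, ellPoch (q ^ n * (q * (d * s⁻¹))) j q p = f5,
    ellPoch (d * t * q * (q ^ n)⁻¹) j q p = f6, ellPoch (q * s⁻¹ * x) j q p = g1,
    ellPoch (q * s⁻¹ * x⁻¹) j q p = g2, ellPochPM d x j q p = X, triPow q j = T at *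
  generalize theta (d * s⁻¹ * q ^ (2 * j)) p = y1, theta (d * s⁻¹) p = y2
  have e : -v * q ^ (2 * j) * y1 / (-v * y2) *
      (u1 * T * e1 * (u2 * T * e2) * (u3 * T * e3) * (u4 * T * e4) * e5 * e6 /
        (f1 * f2 * f3 * f4 * (v1 * T * f5) * (v2 * T * f6))) * q ^ j *
      (X / (v3 * T * g1 * (v4 * T * g2))) =
      (-v * T ^ 4 * (q ^ (2 * j) * (u1 * u2 * u3 * u4)) *
        (y1 * (e1 * e2 * e3 * e4 * e5 * e6) * q ^ j * X)) /
      (-v * T ^ 4 * (v1 * v2 * (v3 * v4)) *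
        (y2 * (f1 * f2 * f3 * f4 * f5 * f6) * (g1 * g2))) := by
    rw [div_mul_div_comm, div_mul_eq_mul_div, div_mul_div_comm]
    congr 1 <;> ring
  rw [e, key, mul_div_mul_left _ _ (mul_ne_zero (mul_ne_zero (neg_ne_zero.2 hv)
    (pow_ne_zero 4 hT)) (mul_ne_zero (mul_ne_zero h1 h2) (mul_ne_zero h3 h4))), div_mul_div_comm, div_mul_eq_mul_div,
    div_mul_div_comm]

/-- The normalization `h_n(q, p)` in the parameters of `bioRat`, where `t = q / A`. -/
def bioNorm (n : ℕ) (a b c d s t q p : ℂ) : ℂ :=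
  theta (s * t)⁻¹ p * (ellPoch q n q p * ellPoch (q * (d * s⁻¹)) n q p * ellPoch (a * b) n q p *
    ellPoch (a * c) n q p * ellPoch (b * c) n q p * ellPoch (q * (d * t⁻¹)) n q p) * (q ^ n)⁻¹ /
  (theta (q ^ (2 * n) * (s * t)⁻¹) p * (ellPoch (d * s)⁻¹ n q p * ellPoch (a * d) n q p *
    ellPoch (b * d) n q p * ellPoch (c * d) n q p * ellPoch (d * t)⁻¹ n q p *
    ellPoch (s * t)⁻¹ n q p))

theorem bioNorm_swap (n : ℕ) (a b c d s t q p : ℂ) :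
    bioNorm n a b c d s t q p = bioNorm n b a c d s t q p := by
  simp only [bioNorm, mul_comm b a, mul_right_comm]

theorem bioNorm_p_mul_left (H : Nomes p q) (hprod : a * b * c * d * s * t = q) (n : ℕ) :
    bioNorm n (p * a) b c d s (p⁻¹ * t) q p = bioNorm n a b c d s t q p := by
  obtain ⟨ha, hb, hc, hd, hs, ht⟩ := ne_zero_of_prod_eq H.q_ne hprod
  have hq := H.q_ne
  have hp := H.p_ne
  have hqn := pow_ne_zero n hq
  have hT := triPow_ne_zero hq n
  rw [bioNorm, bioNorm,
    show (s * (p⁻¹ * t))⁻¹ = p * (s * t)⁻¹ by field_simp,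
    show p * a * b = p * (a * b) by ring, show p * a * c = p * (a * c) by ring,
    show p * a * d = p * (a * d) by ring,
    show q * (d * (p⁻¹ * t)⁻¹) = p * (q * (d * t⁻¹)) by field_simp,
    show q ^ (2 * n) * (p * (s * t)⁻¹) = p * (q ^ (2 * n) * (s * t)⁻¹) by ring,
    show (d * (p⁻¹ * t))⁻¹ = p * (d * t)⁻¹ by field_simp,
    theta_mul_p hp H.p_lt (z := (s * t)⁻¹) (by positivity),
    theta_mul_p hp H.p_lt (z := q ^ (2 * n) * (s * t)⁻¹) (by positivity),
    ellPoch_p_mul H (z := a * b) (by positivity), ellPoch_p_mul H (z := a * c) (by positivity),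
    ellPoch_p_mul H (z := q * (d * t⁻¹)) (by positivity),
    ellPoch_p_mul H (z := a * d) (by positivity), ellPoch_p_mul H (z := (d * t)⁻¹) (by positivity),
    ellPoch_p_mul H (z := (s * t)⁻¹) (by positivity)]
  have key : q ^ (2 * n) * ((-(a * b)⁻¹) ^ n * (-(a * c)⁻¹) ^ n * (-(q * (d * t⁻¹))⁻¹) ^ n) =
      (-(a * d)⁻¹) ^ n * (-((d * t)⁻¹)⁻¹) ^ n * (-((s * t)⁻¹)⁻¹) ^ n := by
    rw [pow_mul, ← mul_pow, ← mul_pow, ← mul_pow, ← mul_pow, ← mul_pow]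
    congr 1
    field_simp
    linear_combination hprod
  have h1 : (-(a * d)⁻¹) ^ n ≠ 0 := pow_ne_zero _ (neg_ne_zero.2 (by positivity))
  have h2 : (-((d * t)⁻¹)⁻¹) ^ n ≠ 0 := pow_ne_zero _ (neg_ne_zero.2 (by positivity))
  have h3 : (-((s * t)⁻¹)⁻¹) ^ n ≠ 0 := pow_ne_zero _ (neg_ne_zero.2 (by positivity))
  have hv : s * t ≠ 0 := by positivity
  rw [show -(q ^ (2 * n) * (s * t)⁻¹)⁻¹ = -(s * t) * (q ^ (2 * n))⁻¹ by field_simp,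
    show -((s * t)⁻¹)⁻¹ = -(s * t) by field_simp] at *
  generalize (-(a * b)⁻¹) ^ n = u1 at *
  generalize (-(a * c)⁻¹) ^ n = u2 at *
  generalize (-(q * (d * t⁻¹))⁻¹) ^ n = u3 at *
  generalize (-(a * d)⁻¹) ^ n = v1 at *
  generalize (-((d * t)⁻¹)⁻¹) ^ n = v2 at *
  generalize (-(s * t)) ^ n = v3 at *
  have hq2 : q ^ (2 * n) ≠ 0 := by positivity
  generalize ellPoch q n q p = e1, ellPoch (q * (d * s⁻¹)) n q p = e2, ellPoch (a * b) n q p = e3,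
    ellPoch (a * c) n q p = e4, ellPoch (b * c) n q p = e5, ellPoch (q * (d * t⁻¹)) n q p = e6,
    ellPoch (d * s)⁻¹ n q p = f1, ellPoch (a * d) n q p = f2, ellPoch (b * d) n q p = f3,
    ellPoch (c * d) n q p = f4, ellPoch (d * t)⁻¹ n q p = f5, ellPoch (s * t)⁻¹ n q p = f6,
    triPow q n = T at *
  generalize theta (q ^ (2 * n) * (s * t)⁻¹) p = y2, theta (s * t)⁻¹ p = y1
  generalize s * t = v at *
  have e : -v * y1 * (e1 * e2 * (u1 * T⁻¹ * e3) * (u2 * T⁻¹ * e4) * e5 * (u3 * T⁻¹ * e6)) *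
      (q ^ n)⁻¹ / (-v * (q ^ (2 * n))⁻¹ * y2 *
      (f1 * (v1 * T⁻¹ * f2) * f3 * f4 * (v2 * T⁻¹ * f5) * (v3 * T⁻¹ * f6))) =
      (-v * (T⁻¹) ^ 3 * (q ^ (2 * n) * (u1 * u2 * u3)) *
        (y1 * (e1 * e2 * e3 * e4 * e5 * e6) * (q ^ n)⁻¹)) /
      (-v * (T⁻¹) ^ 3 * (v1 * v2 * v3) * (y2 * (f1 * f2 * f3 * f4 * f5 * f6))) := by
    rw [show -v * (q ^ (2 * n))⁻¹ * y2 * (f1 * (v1 * T⁻¹ * f2) * f3 * f4 * (v2 * T⁻¹ * f5) *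
      (v3 * T⁻¹ * f6)) = (q ^ (2 * n))⁻¹ * (-v * y2 *
      (f1 * (v1 * T⁻¹ * f2) * f3 * f4 * (v2 * T⁻¹ * f5) * (v3 * T⁻¹ * f6))) by ring,
      ← div_div, div_inv_eq_mul]
    congr 1 <;> ring
  rw [e, key, mul_div_mul_left _ _ (mul_ne_zero (mul_ne_zero (neg_ne_zero.2 hv)
    (pow_ne_zero 3 (inv_ne_zero hT))) (mul_ne_zero (mul_ne_zero h1 h2) h3))]

theorem bioNorm_p_mul_right (H : Nomes p q) (ha : d ≠ 0) (hs : s ≠ 0) (ht : t ≠ 0) (n : ℕ)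
    (a b c : ℂ) :
    bioNorm n a b c d (p * s) (p⁻¹ * t) q p = bioNorm n a b c d s t q p := by
  have hq := H.q_ne
  have hp := H.p_ne
  have hqn := pow_ne_zero n hq
  have hT := triPow_ne_zero hq n
  rw [bioNorm, bioNorm,
    show p * s * (p⁻¹ * t) = s * t by field_simp,
    show q * (d * (p * s)⁻¹) = p⁻¹ * (q * (d * s⁻¹)) by rw [mul_inv]; ring,
    show q * (d * (p⁻¹ * t)⁻¹) = p * (q * (d * t⁻¹)) by field_simp,
    show (d * (p * s))⁻¹ = p⁻¹ * (d * s)⁻¹ by field_simp,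
    show (d * (p⁻¹ * t))⁻¹ = p * (d * t)⁻¹ by field_simp,
    ellPoch_p_inv_mul H (z := q * (d * s⁻¹)) (by positivity),
    ellPoch_p_mul H (z := q * (d * t⁻¹)) (by positivity),
    ellPoch_p_inv_mul H (z := (d * s)⁻¹) (by positivity),
    ellPoch_p_mul H (z := (d * t)⁻¹) (by positivity)]
  have key : (-(p⁻¹ * (q * (d * s⁻¹)))) ^ n * (-(q * (d * t⁻¹))⁻¹) ^ n =
      (-(p⁻¹ * (d * s)⁻¹)) ^ n * (-((d * t)⁻¹)⁻¹) ^ n := by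
    rw [← mul_pow, ← mul_pow]
    congr 1
    field_simp
  have h1 : (-(p⁻¹ * (d * s)⁻¹)) ^ n ≠ 0 := pow_ne_zero _ (neg_ne_zero.2 (by positivity))
  have h2 : (-((d * t)⁻¹)⁻¹) ^ n ≠ 0 := pow_ne_zero _ (neg_ne_zero.2 (by positivity))
  generalize (-(p⁻¹ * (q * (d * s⁻¹)))) ^ n = u1 at *
  generalize (-(q * (d * t⁻¹))⁻¹) ^ n = u2 at *
  generalize (-(p⁻¹ * (d * s)⁻¹)) ^ n = v1 at *
  generalize (-((d * t)⁻¹)⁻¹) ^ n = v2 at *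
  generalize ellPoch q n q p = e1, ellPoch (q * (d * s⁻¹)) n q p = e2, ellPoch (a * b) n q p = e3,
    ellPoch (a * c) n q p = e4, ellPoch (b * c) n q p = e5, ellPoch (q * (d * t⁻¹)) n q p = e6,
    ellPoch (d * s)⁻¹ n q p = f1, ellPoch (a * d) n q p = f2, ellPoch (b * d) n q p = f3,
    ellPoch (c * d) n q p = f4, ellPoch (d * t)⁻¹ n q p = f5, ellPoch (s * t)⁻¹ n q p = f6,
    triPow q n = T at *
  generalize theta (q ^ (2 * n) * (s * t)⁻¹) p = y2, theta (s * t)⁻¹ p = y1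
  rw [show y1 * (e1 * (u1 * T * e2) * e3 * e4 * e5 * (u2 * T⁻¹ * e6)) * (q ^ n)⁻¹ =
      (u1 * u2) * (y1 * (e1 * e2 * e3 * e4 * e5 * e6) * (q ^ n)⁻¹) by field_simp,
    show y2 * (v1 * T * f1 * f2 * f3 * f4 * (v2 * T⁻¹ * f5) * f6) =
      (v1 * v2) * (y2 * (f1 * f2 * f3 * f4 * f5 * f6)) by field_simp, key,
    mul_div_mul_left _ _ (mul_ne_zero h1 h2)]

end Invariance

end Rational

/-! ### The rational functions times the kernel -/

section Conversion

variable {p q z : ℂ} {a b c d s t : ℂ}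

theorem OffPoles.ellPochPM_ne_zero (H : Nomes p q) {t : Fin 6 → ℂ} {x : ℂ} (h : OffPoles p q t x)
    (j : Fin 6) (i k : ℤ) {w : ℂ} (hw : w = t j * (p ^ i * q ^ k)) (n : ℕ) :
    ellPochPM w x n q p ≠ 0 := by
  rw [ellPochPM_eq]
  exact mul_ne_zero
    (((h.2 j).1.of_eq_mul H i k (by rw [hw]; ring)).ellPoch_ne_zero H n)
    (((h.2 j).2.of_eq_mul H i k (by rw [hw]; ring)).ellPoch_ne_zero H n)

/-- The factor relating `θ(q x^{±1} / s)_n` to `θ(q⁻ⁿ s x^{±1})_n`. -/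
def bioFactor (n : ℕ) (s q : ℂ) : ℂ := (((q * s⁻¹) ^ n * triPow q n) ^ 2)⁻¹

theorem ellPochPM_mul_bioRat_left (H : Nomes p q) {n : ℕ} (hs : s ≠ 0) {x : ℂ} (hx : x ≠ 0)
    (h : ellPochPM (s * (q ^ n)⁻¹) x n q p ≠ 0) (a b c d t : ℂ) :
    ellPochPM (s * (q ^ n)⁻¹) x n q p * bioRat n a b c d s t q p x =
      bioFactor n s q * bioNum n a b c d s t q p x := by
  have h0 : ((q * s⁻¹) ^ n * triPow q n) ^ 2 ≠ 0 := pow_ne_zero 2 (mul_ne_zero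
    (pow_ne_zero n (mul_ne_zero H.q_ne (inv_ne_zero hs))) (triPow_ne_zero H.q_ne n))
  have e := ellPochPM_reverse H hs hx n
  rw [← bioRat_mul a b c d s t (by rw [e]; exact mul_ne_zero h0 h), e, bioFactor]
  generalize ((q * s⁻¹) ^ n * triPow q n) ^ 2 = B at *
  field_simp

theorem ellPochPM_mul_bioRat_right (H : Nomes p q) {n : ℕ} (ht : t ≠ 0) {x : ℂ} (hx : x ≠ 0)
    (h : ellPochPM (p * t * (q ^ n)⁻¹) x n q p ≠ 0) (a b c d s : ℂ) :
    ellPochPM (p * t * (q ^ n)⁻¹) x n q p * bioRat n a b c d t s q p x =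
      bioNum n a b c d t s q p x := by
  have e := ellPochPM_reflect H ht hx n
  rw [← bioRat_mul a b c d t s (by rw [e]; exact h), e]

theorem ellGammaPM_eq_mul (H : Nomes p q) {x : ℂ} (hx : x ≠ 0) (h1 : NonRes p q (z * x))
    (h2 : NonRes p q (z * x⁻¹)) (n : ℕ) :
    ellGammaPM z x p q =
      ellPochPM (z * (q ^ n)⁻¹) x n q p * ellGammaPM (z * (q ^ n)⁻¹) x p q := by
  have hqn := pow_ne_zero n H.q_ne
  have h1' : NonRes p q (z * (q ^ n)⁻¹ * x) := h1.of_eq_mul H 0 (-n) (by simp; ring)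
  have h2' : NonRes p q (z * (q ^ n)⁻¹ * x⁻¹) := h2.of_eq_mul H 0 (-n) (by simp; ring)
  have e1 := H.ellGamma_mul_pow h1'.1 (h1'.pqPoch_ne_zero H) n
  have e2 := H.ellGamma_mul_pow h2'.1 (h2'.pqPoch_ne_zero H) n
  rw [show z * (q ^ n)⁻¹ * x * q ^ n = z * x by field_simp] at e1
  rw [show z * (q ^ n)⁻¹ * x⁻¹ * q ^ n = z * x⁻¹ by field_simp] at e2
  rw [ellGammaPM, ellGammaPM, e1, e2, ellPochPM_eq]
  ring

/-- Off the poles, the denominators of the two rational functions are absorbed into the kernel. -/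
theorem bioRat_mul_bioRat_mul_betaKernel (H : Nomes p q) (hs : s ≠ 0) (ht : t ≠ 0) {x : ℂ}
    (hx : OffPoles p q ![a, b, c, d, s, p * t] x) (m n : ℕ) :
    bioRat n a b c d t s q p x * bioRat m a b c d s t q p x *
      betaKernel ![a, b, c, d, s, p * t] p q x =
    bioFactor m s q * (bioNum n a b c d t s q p x * bioNum m a b c d s t q p x *
      betaKernel ![a, b, c, d, s * (q ^ m)⁻¹, p * t * (q ^ n)⁻¹] p q x) := by
  have e1 := ellPochPM_mul_bioRat_left H hs hx.ne_zero
    (hx.ellPochPM_ne_zero H 4 0 (-m) (w := s * (q ^ m)⁻¹) (by simp) m) a b c d t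
  have e2 := ellPochPM_mul_bioRat_right H ht hx.ne_zero
    (hx.ellPochPM_ne_zero H 5 0 (-n) (w := p * t * (q ^ n)⁻¹) (by simp) n) a b c d s
  have e3 := ellGammaPM_eq_mul H hx.ne_zero (hx.2 4).1 (hx.2 4).2 m
  have e4 := ellGammaPM_eq_mul H hx.ne_zero (hx.2 5).1 (hx.2 5).2 n
  simp only [Matrix.cons_val] at e3 e4
  rw [betaKernel_vec, betaKernel_vec, e3, e4, ← e2]
  generalize bioRat n a b c d t s q p x = B1, bioRat m a b c d s t q p x = B2,
    ellPochPM (p * t * (q ^ n)⁻¹) x n q p = P1, ellGammaPM (p * t * (q ^ n)⁻¹) x p q = G1,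
    ellGammaPM (s * (q ^ m)⁻¹) x p q = G2 at *
  linear_combination (P1 * B1 * (ellGammaPM a x p q * ellGammaPM b x p q * ellGammaPM c x p q *
    ellGammaPM d x p q * G1 * G2) * (theta (x ^ 2) p * theta (x ^ 2)⁻¹ q)) * e1

theorem eq_of_forall_add_one {α : Type*} {f : ℤ → α} (h : ∀ i, f (i + 1) = f i) (i : ℤ) :
    f i = f 0 := by
  induction i using Int.induction_on with
  | zero => rfl
  | succ i ih => rw [h, ih]
  | pred i ih => rw [← ih, ← h (-(i : ℤ) - 1), sub_add_cancel]

/-- A function of `(a, b, s, t)` which is invariant under `(a, t) ↦ (p a, t / p)`,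
`(b, t) ↦ (p b, t / p)` and `(s, t) ↦ (p s, t / p)` is invariant under all multiplications by
powers of `p` which preserve the product. -/
theorem eq_of_p_invariant {α : Type*} (hp : p ≠ 0) {f : ℂ → ℂ → ℂ → ℂ → α} {r : ℂ}
    (h1 : ∀ a b s t, a * b * s * t = r → f (p * a) b s (p⁻¹ * t) = f a b s t)
    (h2 : ∀ a b s t, a * b * s * t = r → f a (p * b) s (p⁻¹ * t) = f a b s t)
    (h3 : ∀ a b s t, a * b * s * t = r → f a b (p * s) (p⁻¹ * t) = f a b s t)
    (hr : a * b * s * t = r) (i j k l : ℤ) (hl : i + j + k + l = 0) :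
    f (p ^ i * a) (p ^ j * b) (p ^ k * s) (p ^ l * t) = f a b s t := by
  obtain rfl : l = -(i + j + k) := by omega
  have hz (i j k : ℤ) : p ^ i * a * (p ^ j * b) * (p ^ k * s) * (p ^ (-(i + j + k)) * t) = r := by
    rw [← hr, zpow_neg, zpow_add₀ hp, zpow_add₀ hp]
    have := zpow_ne_zero i hp
    have := zpow_ne_zero j hp
    have := zpow_ne_zero k hp
    field_simp
  have s1 (i : ℤ) : p ^ (i + 1) = p * p ^ i := by rw [zpow_add_one₀ hp, mul_comm]
  have s2 (i : ℤ) : p ^ (-1 + i) = p⁻¹ * p ^ i := by rw [zpow_add₀ hp, zpow_neg_one]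
  rw [eq_of_forall_add_one (f := fun i => f (p ^ i * a) (p ^ j * b) (p ^ k * s)
      (p ^ (-(i + j + k)) * t)) (fun i => by
        rw [← h1 _ _ _ _ (hz i j k), show -(i + 1 + j + k) = -1 + -(i + j + k) by ring, s1, s2,
          mul_assoc, mul_assoc]) i,
    eq_of_forall_add_one (f := fun j => f (p ^ (0 : ℤ) * a) (p ^ j * b) (p ^ k * s)
      (p ^ (-(0 + j + k)) * t)) (fun j => by
        rw [← h2 _ _ _ _ (hz 0 j k), show -(0 + (j + 1) + k) = -1 + -(0 + j + k) by ring, s1, s2,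
          mul_assoc, mul_assoc]) j,
    eq_of_forall_add_one (f := fun k => f (p ^ (0 : ℤ) * a) (p ^ (0 : ℤ) * b) (p ^ k * s)
      (p ^ (-(0 + 0 + k)) * t)) (fun k => by
        rw [← h3 _ _ _ _ (hz 0 0 k), show -(0 + 0 + (k + 1)) = -1 + -(0 + 0 + k) by ring, s1, s2,
          mul_assoc, mul_assoc]) k]
  simp

/-- The functions `bioRat` with nome `p` are invariant under shifts of the parameters by powers of `p`
which preserve their product. -/
theorem bioRat_zpow_mul (H : Nomes p q) (hprod : a * b * c * d * s * t = q) (n : ℕ) {x : ℂ}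
    (hx : x ≠ 0) (i j k l : ℤ) (hl : i + j + k + l = 0) :
    bioRat n (p ^ i * a) (p ^ j * b) c d (p ^ k * s) (p ^ l * t) q p x =
      bioRat n a b c d s t q p x := by
  obtain ⟨ha, hb, hc, hd, hs, ht⟩ := ne_zero_of_prod_eq H.q_ne hprod
  have hprod' {a b s t : ℂ} (h : a * b * s * t = q / (c * d)) : a * b * c * d * s * t = q := by
    field_simp at h
    linear_combination h
  refine eq_of_p_invariant (f := fun a b s t => bioRat n a b c d s t q p x) (r := q / (c * d)) H.p_ne
    (fun a b s t h => ?_) (fun a b s t h => ?_) (fun a b s t h => ?_)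
    (by field_simp; linear_combination hprod) i j k l hl
  · obtain ⟨ha, hb, -, -, hs, ht⟩ := ne_zero_of_prod_eq H.q_ne (hprod' h)
    exact bioRat_p_mul_left H ha hd hs ht n b c x
  · obtain ⟨ha, hb, -, -, hs, ht⟩ := ne_zero_of_prod_eq H.q_ne (hprod' h)
    rw [bioRat_swap, bioRat_p_mul_left H hb hd hs ht, bioRat_swap]
  · exact bioRat_p_mul_right H (hprod' h) n hx

theorem bioNorm_zpow_mul (H : Nomes p q) (hprod : a * b * c * d * s * t = q) (n : ℕ)
    (i j k l : ℤ) (hl : i + j + k + l = 0) :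
    bioNorm n (p ^ i * a) (p ^ j * b) c d (p ^ k * s) (p ^ l * t) q p =
      bioNorm n a b c d s t q p := by
  obtain ⟨ha, hb, hc, hd, hs, ht⟩ := ne_zero_of_prod_eq H.q_ne hprod
  have hprod' {a b s t : ℂ} (h : a * b * s * t = q / (c * d)) : a * b * c * d * s * t = q := by
    field_simp at h
    linear_combination h
  refine eq_of_p_invariant (f := fun a b s t => bioNorm n a b c d s t q p) (r := q / (c * d)) H.p_ne
    (fun a b s t h => ?_) (fun a b s t h => ?_) (fun a b s t h => ?_)
    (by field_simp; linear_combination hprod) i j k l hl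
  · exact bioNorm_p_mul_left H (hprod' h) n
  · rw [bioNorm_swap, bioNorm_p_mul_left H (by linear_combination hprod' h), bioNorm_swap]
  · obtain ⟨ha, hb, -, -, hs, ht⟩ := ne_zero_of_prod_eq H.q_ne (hprod' h)
    exact bioNorm_p_mul_right H hd hs ht n a b c

end Conversion

/-! ### The two terminating series as biorthogonal rational functions -/

section Series

variable {p q z : ℂ}

/-- The factor of a very-well-poised series which belongs to the parameter `z`. -/
def vwpFactor (t₀ z : ℂ) (j : ℕ) (q p : ℂ) : ℂ := ellPoch z j q p / ellPoch (q * t₀ / z) j q p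

theorem vwpFactor_p_mul (H : Nomes p q) {t₀ : ℂ} (h0 : t₀ ≠ 0) (hz : z ≠ 0) (j : ℕ) :
    vwpFactor t₀ (p * z) j q p =
      ((p * (q * t₀)⁻¹) ^ j * ((triPow q j) ^ 2)⁻¹) * vwpFactor t₀ z j q p := by
  have hp := H.p_ne
  have hq := H.q_ne
  have hT := triPow_ne_zero hq j
  rw [vwpFactor, vwpFactor, ellPoch_p_mul H hz,
    show q * t₀ / (p * z) = p⁻¹ * (q * t₀ / z) by field_simp,
    ellPoch_p_inv_mul H (by positivity)]
  have h1 : (-(p⁻¹ * (q * t₀ / z))) ^ j ≠ 0 := pow_ne_zero _ (neg_ne_zero.2 (by positivity))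
  have e : (-z⁻¹) ^ j = (p * (q * t₀)⁻¹) ^ j * (-(p⁻¹ * (q * t₀ / z))) ^ j := by
    rw [← mul_pow]
    congr 1
    field_simp
  rw [e]
  generalize (-(p⁻¹ * (q * t₀ / z))) ^ j = u at *
  generalize triPow q j = T at *
  field_simp

theorem vwpFactor_mul_vwpFactor (H : Nomes p q) {t₀ z w : ℂ} (h0 : t₀ ≠ 0) (hz : z ≠ 0) (hw : w ≠ 0)
    (l j : ℕ) :
    vwpFactor t₀ (z * (p ^ l)⁻¹) j q p * vwpFactor t₀ (w * p ^ l) j q p =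
      vwpFactor t₀ z j q p * vwpFactor t₀ w j q p := by
  have hp := H.p_ne
  induction l with
  | zero => simp
  | succ l ih =>
    rw [← ih, show w * p ^ (l + 1) = p * (w * p ^ l) by ring,
      show z * (p ^ l)⁻¹ = p * (z * (p ^ (l + 1))⁻¹) by rw [pow_succ]; field_simp,
      vwpFactor_p_mul H h0 (z := w * p ^ l) (by positivity),
      vwpFactor_p_mul H h0 (z := z * (p ^ (l + 1))⁻¹) (by positivity)]
    ring

theorem ellPoch_eq_zero (H : Nomes p q) {n j : ℕ} (l : ℕ) (h : n < j) :
    ellPoch ((q ^ n)⁻¹ * (p ^ l)⁻¹) j q p = 0 := by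
  refine Finset.prod_eq_zero (Finset.mem_range.2 h) ?_
  have : (q ^ n)⁻¹ * (p ^ l)⁻¹ * q ^ n = p ^ (-(l : ℤ)) := by
    have := pow_ne_zero n H.q_ne
    rw [zpow_neg, zpow_natCast]
    field_simp
  rw [this, theta_zpow H.p_ne H.p_lt]

end Series

section Params

variable {p q : ℂ} {e : Params}

theorem Params.ne_zero (he : ∀ j, e.val j ≠ 0) :
    e.ε₁ ≠ 0 ∧ e.ε₂ ≠ 0 ∧ e.ε₃ ≠ 0 ∧ e.ε₆ ≠ 0 ∧ e.ε₈ ≠ 0 :=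
  ⟨he 0, he 1, he 2, he 3, he 4⟩

theorem Params.A_ne_zero (he : ∀ j, e.val j ≠ 0) : e.A ≠ 0 := by
  obtain ⟨h1, h2, h3, h6, h8⟩ := Params.ne_zero he
  unfold Params.A
  positivity

theorem R_eq_bioRat (H : Nomes p q) (he : ∀ j, e.val j ≠ 0) (n l : ℕ) {x : ℂ} (hx : x ≠ 0) :
    R e q p n l x = bioRat n e.ε₁ e.ε₂ e.ε₃ e.ε₆ e.ε₈ (q * e.A⁻¹) q p x := by
  obtain ⟨h1, h2, h3, h6, h8⟩ := Params.ne_zero he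
  have hA := Params.A_ne_zero he
  have hp := H.p_ne
  have hq := H.q_ne
  have e4 : q * p / (e.ε₄ q p n l * e.ε₈) = (q ^ n)⁻¹ * (p ^ l)⁻¹ := by
    rw [Params.ε₄]; field_simp; ring
  have e5 : q * p / (e.ε₅ q p n l * e.ε₈) = q ^ n * (e.ε₈ * (q * e.A⁻¹))⁻¹ * p ^ l := by
    rw [Params.ε₅, Params.ε₄, Params.ε₇, Params.A]; field_simp; ring
  rw [R, ellV, tsum_eq_sum (s := Finset.range (n + 1)), bioRat]
  · refine Finset.sum_congr rfl fun j _ => ?_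
    have key := vwpFactor_mul_vwpFactor H (t₀ := e.ε₆ / e.ε₈) (z := (q ^ n)⁻¹)
      (w := q ^ n * (e.ε₈ * (q * e.A⁻¹))⁻¹) (by positivity) (by positivity) (by positivity) l j
    rw [Fin.prod_univ_seven]
    simp only [Matrix.cons_val, e4, e5]
    simp only [vwpFactor] at key
    rw [mul_assoc (_ / _ * (_ / _) * (_ / _)) (ellPoch ((q ^ n)⁻¹ * (p ^ l)⁻¹) j q p / _), key,
      bioCoef, ellPochPM_eq, ellPochPM_eq,
      show q * (e.ε₆ / e.ε₈) / (q / (e.ε₁ * e.ε₈)) = e.ε₁ * e.ε₆ by field_simp,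
      show q * (e.ε₆ / e.ε₈) / (q / (e.ε₂ * e.ε₈)) = e.ε₂ * e.ε₆ by field_simp,
      show q * (e.ε₆ / e.ε₈) / (q / (e.ε₃ * e.ε₈)) = e.ε₃ * e.ε₆ by field_simp,
      show q * (e.ε₆ / e.ε₈) / (q ^ n)⁻¹ = q ^ n * (q * (e.ε₆ * e.ε₈⁻¹)) by field_simp,
      show q * (e.ε₆ / e.ε₈) / (q ^ n * (e.ε₈ * (q * e.A⁻¹))⁻¹) =
        e.ε₆ * (q * e.A⁻¹) * q * (q ^ n)⁻¹ by field_simp,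
      show q * (e.ε₆ / e.ε₈) / (e.ε₆ * x) = q * e.ε₈⁻¹ * x⁻¹ by field_simp,
      show q * (e.ε₆ / e.ε₈) / (e.ε₆ / x) = q * e.ε₈⁻¹ * x by field_simp]
    simp only [div_eq_mul_inv]
    ring
  · intro j hj
    have hj : n < j := by simpa [Nat.lt_succ_iff] using hj
    rw [Fin.prod_univ_seven]
    simp only [Matrix.cons_val, e4]
    rw [ellPoch_eq_zero H l hj]
    simp

theorem T_eq_bioRat (H : Nomes p q) (he : ∀ j, e.val j ≠ 0) (n l : ℕ) {x : ℂ} (hx : x ≠ 0) :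
    T e q p n l x = bioRat n e.ε₁ e.ε₂ e.ε₃ e.ε₆ (q * e.A⁻¹) e.ε₈ q p x := by
  obtain ⟨h1, h2, h3, h6, h8⟩ := Params.ne_zero he
  have hA := Params.A_ne_zero he
  have hp := H.p_ne
  have hq := H.q_ne
  have e4 : q * p / (e.ε₄ q p n l * e.ε₈) = (q ^ n)⁻¹ * (p ^ l)⁻¹ := by
    rw [Params.ε₄]; field_simp; ring
  have e5 : q * p / (e.ε₅ q p n l * e.ε₈) = q ^ n * (q * e.A⁻¹ * e.ε₈)⁻¹ * p ^ l := by
    rw [Params.ε₅, Params.ε₄, Params.ε₇, Params.A]; field_simp; ring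
  rw [T, ellV, tsum_eq_sum (s := Finset.range (n + 1)), bioRat]
  · refine Finset.sum_congr rfl fun j _ => ?_
    have key := vwpFactor_mul_vwpFactor H (t₀ := e.A * e.ε₆ / q) (z := (q ^ n)⁻¹)
      (w := q ^ n * (q * e.A⁻¹ * e.ε₈)⁻¹) (by positivity) (by positivity) (by positivity) l j
    rw [Fin.prod_univ_seven]
    simp only [Matrix.cons_val, e4, e5]
    simp only [vwpFactor] at key
    rw [mul_assoc (_ / _ * (_ / _) * (_ / _) * (_ / _) * (_ / _))
      (ellPoch ((q ^ n)⁻¹ * (p ^ l)⁻¹) j q p / _), key,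
      bioCoef, ellPochPM_eq, ellPochPM_eq,
      show q * (e.A * e.ε₆ / q) / (e.A / e.ε₁) = e.ε₁ * e.ε₆ by field_simp,
      show q * (e.A * e.ε₆ / q) / (e.A / e.ε₂) = e.ε₂ * e.ε₆ by field_simp,
      show q * (e.A * e.ε₆ / q) / (e.A / e.ε₃) = e.ε₃ * e.ε₆ by field_simp,
      show q * (e.A * e.ε₆ / q) / (q ^ n)⁻¹ = q ^ n * (q * (e.ε₆ * (q * e.A⁻¹)⁻¹)) by field_simp,
      show q * (e.A * e.ε₆ / q) / (q ^ n * (q * e.A⁻¹ * e.ε₈)⁻¹) =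
        e.ε₆ * e.ε₈ * q * (q ^ n)⁻¹ by field_simp,
      show q * (e.A * e.ε₆ / q) / (e.ε₆ * x) = q * (q * e.A⁻¹)⁻¹ * x⁻¹ by field_simp,
      show q * (e.A * e.ε₆ / q) / (e.ε₆ / x) = q * (q * e.A⁻¹)⁻¹ * x by field_simp,
      show e.A * e.ε₆ / q = e.ε₆ * (q * e.A⁻¹)⁻¹ by field_simp,
      show e.A / e.ε₁ = q * (e.ε₁ * (q * e.A⁻¹))⁻¹ by field_simp,
      show e.A / e.ε₂ = q * (e.ε₂ * (q * e.A⁻¹))⁻¹ by field_simp,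
      show e.A / e.ε₃ = q * (e.ε₃ * (q * e.A⁻¹))⁻¹ by field_simp]
    simp only [div_eq_mul_inv]
    ring
  · intro j hj
    have hj : n < j := by simpa [Nat.lt_succ_iff] using hj
    rw [Fin.prod_univ_seven]
    simp only [Matrix.cons_val, e4]
    rw [ellPoch_eq_zero H l hj]
    simp

theorem hOne_eq_bioNorm (H : Nomes p q) (he : ∀ j, e.val j ≠ 0) (n : ℕ) :
    hOne e q p n = bioNorm n e.ε₁ e.ε₂ e.ε₃ e.ε₆ e.ε₈ (q * e.A⁻¹) q p := by
  obtain ⟨h1, h2, h3, h6, h8⟩ := Params.ne_zero he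
  have hA := Params.A_ne_zero he
  have hp := H.p_ne
  have hq := H.q_ne
  rw [hOne, hNum, hDen, bioNorm,
    show (e.ε₈ * (q * e.A⁻¹))⁻¹ = e.A / (q * e.ε₈) by field_simp,
    show (e.ε₆ * (q * e.A⁻¹))⁻¹ = e.A / (q * e.ε₆) by field_simp,
    show q * (e.ε₆ * (q * e.A⁻¹)⁻¹) = e.A * e.ε₆ by field_simp,
    show q * (e.ε₆ * e.ε₈⁻¹) = q * e.ε₆ / e.ε₈ by field_simp,
    show (e.ε₆ * e.ε₈)⁻¹ = 1 / (e.ε₆ * e.ε₈) by field_simp,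
    show q ^ (2 * n) * (e.A / (q * e.ε₈)) = e.A * q ^ (2 * n) / (q * e.ε₈) by field_simp]
  simp only [ellPochs, List.map_cons, List.map_nil, List.prod_cons, List.prod_nil, mul_one]
  congr 1 <;> ring

end Params

/-! ### Terminating very-well-poised sums -/

section Weights

variable {p q z : ℂ} {a b c d s t r : ℂ}

theorem triPow_succ (q : ℂ) (n : ℕ) : triPow q (n + 1) = triPow q n * q ^ n :=
  Finset.prod_range_succ _ _

theorem triPow_sq (q : ℂ) (n : ℕ) : triPow q n ^ 2 * q ^ n = q ^ (n * n) := by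
  induction n with
  | zero => simp [triPow]
  | succ n ih =>
    rw [triPow_succ, show (n + 1) * (n + 1) = n * n + (n + n + 1) by ring, pow_add _ (n * n), ← ih]
    ring

theorem prod_range_erase (f : ℕ → ℂ) (j m : ℕ) :
    ∏ k ∈ (Finset.range (j + m + 1)).erase j, f k =
      (∏ k ∈ Finset.range j, f k) * ∏ k ∈ Finset.range m, f (j + 1 + k) := by
  have hj : j ∈ Finset.range (j + m + 1) := Finset.mem_range.2 (by omega)
  have h := Finset.prod_update_of_mem hj f 1
  rw [one_mul, Finset.sdiff_singleton_eq_erase] at h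
  rw [← h, show j + m + 1 = j + 1 + m by omega, Finset.prod_range_add, Finset.prod_range_succ,
    Function.update_self, mul_one]
  congr 1
  · exact Finset.prod_congr rfl fun k hk => Function.update_of_ne (Finset.mem_range.1 hk).ne _ _
  · exact Finset.prod_congr rfl fun k _ => Function.update_of_ne (by omega) _ _

/-- The weights of a terminating very-well-poised sum of length `n + 1` with `t₀ = r²`, without
powers of `q`. -/
def vwpWeight (n : ℕ) (r q p : ℂ) (j : ℕ) : ℂ :=
  theta (r ^ 2 * q ^ (2 * j)) p / theta (r ^ 2) p *
    ((ellPoch (r ^ 2) j q p * ellPoch (q ^ n)⁻¹ j q p) /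
      (ellPoch q j q p * ellPoch (q ^ n * (q * r ^ 2)) j q p))

/-- The very-well-poised weights are, up to a constant, those of Lagrange interpolation of even
theta functions in the nodes `r q^k`. -/
theorem vwpWeight_mul_prod (H : Nomes p q) (hr : NonRes p q (r ^ 2)) {n j : ℕ} (hj : j ≤ n)
    (hq : ellPoch q n q p ≠ 0) :
    vwpWeight n r q p j * (q ^ j) ^ n * (r * q ^ j *
      ∏ k ∈ (Finset.range (n + 1)).erase j, thetaPM (r * q ^ k) (r * q ^ j) p) =
    r * (ellPoch (q * r ^ 2) n q p * ellPoch q n q p) := by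
  obtain ⟨m, rfl⟩ := Nat.exists_eq_add_of_le hj
  have hq0 := H.q_ne
  have hr0 : r ≠ 0 := fun h => hr.1 (by rw [h]; simp)
  have hjr : j ∈ Finset.range (j + m + 1) := Finset.mem_range.2 (by omega)
  have hA := Finset.prod_erase_mul (Finset.range (j + m + 1))
    (fun k => theta (r * q ^ k * (r * q ^ j)) p) hjr
  have hA' : ∏ k ∈ Finset.range (j + m + 1), theta (r * q ^ k * (r * q ^ j)) p =
      ellPoch (r ^ 2 * q ^ j) (j + m + 1) q p :=
    Finset.prod_congr rfl fun k _ => by congr 1; ring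
  rw [hA'] at hA
  have hB := prod_range_erase (fun k => theta (r * q ^ k * (r * q ^ j)⁻¹) p) j m
  have hB1 : ∏ k ∈ Finset.range j, theta (r * q ^ k * (r * q ^ j)⁻¹) p =
      ellPoch (q ^ j)⁻¹ j q p :=
    Finset.prod_congr rfl fun k _ => by congr 1; field_simp
  have hB2 : ∏ k ∈ Finset.range m, theta (r * q ^ (j + 1 + k) * (r * q ^ j)⁻¹) p =
      ellPoch q m q p :=
    Finset.prod_congr rfl fun k _ => by congr 1; rw [pow_add, pow_add]; field_simp
  rw [hB1, hB2] at hB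
  have hC1 := ellPoch_reverse H (z := (q ^ m)⁻¹) (inv_ne_zero (pow_ne_zero m hq0)) j
  have hC2 := ellPoch_reverse H (z := 1) one_ne_zero j
  rw [inv_inv] at hC1
  rw [inv_one, mul_one, one_mul] at hC2
  have e1 : ellPoch q (j + m) q p = ellPoch q m q p * ellPoch (q * q ^ m) j q p := by
    rw [add_comm, ellPoch_add]
  have e2 : ellPoch (r ^ 2) j q p * ellPoch (r ^ 2 * q ^ j) (j + m + 1) q p =
      theta (r ^ 2) p * ellPoch (q * r ^ 2) (j + m) q p *
        ellPoch (q ^ (j + m) * (q * r ^ 2)) j q p := by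
    rw [← ellPoch_add, mul_comm q, ← ellPoch_succ',
      show q ^ (j + m) * (r ^ 2 * q) = r ^ 2 * q ^ (j + m + 1) by ring, ← ellPoch_add]
    congr 1
    ring
  have n1 : theta (r ^ 2) p ≠ 0 := hr.theta_ne_zero H
  have n2 : ellPoch q j q p ≠ 0 := by
    rw [ellPoch_add] at hq
    exact left_ne_zero_of_mul hq
  have n3 : ellPoch (q ^ (j + m) * (q * r ^ 2)) j q p ≠ 0 :=
    (hr.of_eq_mul H 0 (j + m + 1 : ℕ) (by rw [zpow_natCast]; simp; ring)).ellPoch_ne_zero H j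
  have n4 : theta (r ^ 2 * q ^ (2 * j)) p ≠ 0 :=
    (hr.of_eq_mul H 0 (2 * j : ℕ) (by rw [zpow_natCast]; simp)).theta_ne_zero H
  have n5 : ellPoch q m q p ≠ 0 := by
    rw [e1] at hq
    exact left_ne_zero_of_mul hq
  have hT := triPow_sq q j
  have hT0 := triPow_ne_zero hq0 j
  have hpow : (q ^ j) ^ (j + m) * q ^ j =
      ((-(q * q ^ m)) ^ j * triPow q j) * ((-q) ^ j * triPow q j) := by
    have : (-(q * q ^ m)) ^ j * (-q) ^ j = (q ^ m) ^ j * (q ^ j * q ^ j) := by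
      rw [← mul_pow, ← mul_pow, ← mul_pow]; congr 1; ring
    rw [show (q ^ j) ^ (j + m) = q ^ (j * j) * (q ^ m) ^ j by rw [pow_add, ← pow_mul, ← pow_mul,
      ← pow_mul, mul_comm m j], ← hT]
    linear_combination -triPow q j ^ 2 * this
  simp only [thetaPM, Finset.prod_mul_distrib]
  rw [hB, vwpWeight, e1]
  have e3 : r * q ^ j * (r * q ^ j) = r ^ 2 * q ^ (2 * j) := by ring
  rw [e3] at hA
  rw [show (q ^ m)⁻¹ * (q ^ j)⁻¹ = (q ^ (j + m))⁻¹ by rw [pow_add, mul_inv, mul_comm]] at hC1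
  have hV : ellPoch (q * q ^ m) j q p * ellPoch q j q p = (q ^ j) ^ (j + m) * q ^ j *
      (ellPoch (q ^ (j + m))⁻¹ j q p * ellPoch (q ^ j)⁻¹ j q p) := by
    rw [hpow]
    linear_combination ellPoch q j q p * hC1 + ((-(q * q ^ m)) ^ j * triPow q j *
      ellPoch (q ^ (j + m))⁻¹ j q p) * hC2
  clear hC1 hC2 hpow hT hT0 hB hB1 hB2 hA' e1 hq hr
  generalize hQ1 : (q ^ j) ^ (j + m) = Q1 at *
  generalize ∏ x ∈ (Finset.range (j + m + 1)).erase j, theta (r * q ^ x * (r * q ^ j)) p = X at *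
  generalize ellPoch (q ^ (j + m))⁻¹ j q p = V1 at *
  generalize ellPoch (q ^ j)⁻¹ j q p = V2 at *
  generalize ellPoch (q * q ^ m) j q p = V3 at *
  generalize ellPoch q j q p = V4 at *
  generalize ellPoch (r ^ 2) j q p = V5 at *
  generalize ellPoch (q ^ (j + m) * (q * r ^ 2)) j q p = V6 at *
  generalize ellPoch (q * r ^ 2) (j + m) q p = V7 at *
  generalize ellPoch (r ^ 2 * q ^ j) (j + m + 1) q p = V8 at *
  generalize ellPoch q m q p = V9 at *
  generalize theta (r ^ 2) p = Y1 at *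
  generalize theta (r ^ 2 * q ^ (2 * j)) p = Y2 at *
  rw [div_mul_div_comm, div_mul_eq_mul_div, div_mul_eq_mul_div, div_eq_iff (by positivity)]
  linear_combination (r * V9 * V5 * Q1 * q ^ j * V1 * V2) * hA - (r * V9 * V5 * V8) * hV +
    (r * V9 * V3 * V4) * e2

/-- Summation of a very-well-poised series with an arbitrary even theta function as a factor. -/
theorem sum_vwpWeight_div (H : Nomes p q) (hr : NonRes p q (r ^ 2)) {n : ℕ}
    (hq : ellPoch q n q p ≠ 0) {f : ℂ → ℂ} (hf : IsEvenTheta p n f) {γ : ℂ} (hγ : γ ≠ 0)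
    (h : ∀ j ≤ n, thetaPM γ (r * q ^ j) p ≠ 0) :
    ∑ j ∈ Finset.range (n + 1), vwpWeight n r q p j * (q ^ j) ^ n *
        (f (r * q ^ j) / thetaPM γ (r * q ^ j) p) =
      -(r * (ellPoch (q * r ^ 2) n q p * ellPoch q n q p)) * γ⁻¹ * f γ /
        ∏ k ∈ Finset.range (n + 1), thetaPM (r * q ^ k) γ p := by
  have hq0 := H.q_ne
  have hr0 : r ≠ 0 := fun h => hr.1 (by rw [h]; simp)
  have hy (j : ℕ) : r * q ^ j ≠ 0 := mul_ne_zero hr0 (pow_ne_zero j hq0)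
  have hθ (j : ℕ) (hj : 0 < j) (hjn : j ≤ n) : theta (q ^ j) p ≠ 0 := by
    have := Finset.prod_ne_zero_iff.1 hq (j - 1) (Finset.mem_range.2 (by omega))
    rwa [← pow_succ', Nat.sub_add_cancel hj] at this
  have hne (i j : ℕ) (hi : i ≤ n) (hj : j ≤ n) (hij : i ≠ j) :
      thetaPM (r * q ^ i) (r * q ^ j) p ≠ 0 := by
    refine mul_ne_zero ((hr.of_eq_mul H 0 (i + j : ℕ) ?_).theta_ne_zero H) ?_
    · rw [zpow_natCast, pow_add]; simp; ring
    · rcases lt_or_gt_of_ne hij with hlt | hlt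
      · have e : r * q ^ i * (r * q ^ j)⁻¹ = (q ^ (j - i))⁻¹ := by
          obtain ⟨m, rfl⟩ := Nat.exists_eq_add_of_lt hlt
          rw [show i + m + 1 - i = m + 1 by omega, show i + m + 1 = i + (m + 1) by omega, pow_add]
          field_simp
        rw [e, theta_inv H.p_lt (pow_ne_zero _ hq0)]
        exact mul_ne_zero (neg_ne_zero.2 (inv_ne_zero (pow_ne_zero _ hq0)))
          (hθ _ (by omega) (by omega))
      · have e : r * q ^ i * (r * q ^ j)⁻¹ = q ^ (i - j) := by
          obtain ⟨m, rfl⟩ := Nat.exists_eq_add_of_lt hlt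
          rw [show j + m + 1 - j = m + 1 by omega, show j + m + 1 = j + (m + 1) by omega, pow_add]
          field_simp
        rw [e]
        exact hθ _ (by omega) (by omega)
  have hsw (k : ℕ) : thetaPM (r * q ^ k) γ p = -(r * q ^ k * γ⁻¹) * thetaPM γ (r * q ^ k) p := by
    rw [thetaPM, thetaPM, theta_swap H.p_lt (hy k) hγ, mul_comm γ]
    ring_nf
  have hP (k : ℕ) (hk : k ∈ Finset.range (n + 1)) : thetaPM (r * q ^ k) γ p ≠ 0 := by
    rw [hsw]
    exact mul_ne_zero (neg_ne_zero.2 (mul_ne_zero (hy k) (inv_ne_zero hγ)))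
      (h k (Nat.lt_succ_iff.1 (Finset.mem_range.1 hk)))
  have hL := hf.lagrange H.p_ne H.p_lt (x := fun j => r * q ^ j) (s := Finset.range (n + 1))
    (Finset.card_range _) (fun i _ => hy i)
    (fun i _ => (hr.of_eq_mul H 0 (2 * i : ℕ) (by
      rw [zpow_natCast]; simp; ring)).theta_ne_zero H)
    (fun i hi j hj hij => hne i j (Nat.lt_succ_iff.1 (Finset.mem_range.1 hi))
      (Nat.lt_succ_iff.1 (Finset.mem_range.1 hj)) hij) hγ
  rw [hL, Finset.mul_sum, Finset.sum_div]
  refine Finset.sum_congr rfl fun j hj => ?_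
  have hj' := Nat.lt_succ_iff.1 (Finset.mem_range.1 hj)
  have hw := vwpWeight_mul_prod H hr hj' hq
  have hE : ∏ k ∈ (Finset.range (n + 1)).erase j, thetaPM (r * q ^ k) (r * q ^ j) p ≠ 0 :=
    Finset.prod_ne_zero_iff.2 fun k hk => hne k j
      (Nat.lt_succ_iff.1 (Finset.mem_range.1 (Finset.mem_of_mem_erase hk))) hj'
      (Finset.ne_of_mem_erase hk)
  have hE' : ∏ k ∈ (Finset.range (n + 1)).erase j, thetaPM (r * q ^ k) γ p ≠ 0 :=
    Finset.prod_ne_zero_iff.2 fun k hk => hP k (Finset.mem_of_mem_erase hk)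
  have h0 := h j hj'
  rw [Finset.prod_div_distrib, ← Finset.mul_prod_erase _ _ hj, hsw, ← hw]
  have hyj := hy j
  generalize r * q ^ j = y at *
  generalize ∏ k ∈ (Finset.range (n + 1)).erase j, thetaPM (r * q ^ k) y p = E1 at *
  generalize ∏ k ∈ (Finset.range (n + 1)).erase j, thetaPM (r * q ^ k) γ p = E2 at *
  field_simp

/-- The sum with `n + 2` terms vanishes on even theta functions of degree `n`: multiplied by
`θ(γ z^{±1})` they have degree `n + 1` and a zero at `γ`. -/
theorem sum_vwpWeight_eq_zero (H : Nomes p q) (hr : NonRes p q (r ^ 2)) {n : ℕ}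
    (hq : ellPoch q (n + 1) q p ≠ 0) {f : ℂ → ℂ} (hf : IsEvenTheta p n f) {γ : ℂ} (hγ : γ ≠ 0)
    (h : ∀ j ≤ n + 1, thetaPM γ (r * q ^ j) p ≠ 0) :
    ∑ j ∈ Finset.range (n + 1 + 1), vwpWeight (n + 1) r q p j * (q ^ j) ^ (n + 1) *
      f (r * q ^ j) = 0 := by
  have h0 : thetaPM γ γ p = 0 := by rw [thetaPM, mul_inv_cancel₀ hγ, theta_one H.p_lt, mul_zero]
  have := sum_vwpWeight_div H hr hq (f := fun z => f z * thetaPM γ z p)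
    (hf.mul (isEvenTheta_thetaPM H.p_ne H.p_lt hγ)) hγ h
  rw [h0, mul_zero, mul_zero, zero_div] at this
  rw [← this]
  refine Finset.sum_congr rfl fun j hj => ?_
  rw [mul_div_cancel_right₀ _ (h j (Nat.lt_succ_iff.1 (Finset.mem_range.1 hj)))]

/-- The ratio of two values of the elliptic beta integral. -/
theorem betaProd_mul_pow (H : Nomes p q) (hG : Generic p q ![a, b, c, d, s, p * t]) (j : ℕ) :
    betaProd ![a, b, c, d * q ^ j, s, p * t * (q ^ j)⁻¹] p q =
      betaProd ![a, b, c, d, s, p * t] p q *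
        (ellPoch (a * d) j q p / ellPoch (q * (a * t)⁻¹) j q p *
        (ellPoch (b * d) j q p / ellPoch (q * (b * t)⁻¹) j q p) *
        (ellPoch (c * d) j q p / ellPoch (q * (c * t)⁻¹) j q p) *
        (ellPoch (d * s) j q p / ellPoch (q * (s * t)⁻¹) j q p)) := by
  have hqj := pow_ne_zero j H.q_ne
  have h1 {y : ℂ} (h : NonRes p q (y * d)) :
      ellGamma (y * d * q ^ j) p q = ellPoch (y * d) j q p * ellGamma (y * d) p q :=
    H.ellGamma_mul_pow h.1 (h.pqPoch_ne_zero H) j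
  have h2 {y : ℂ} (h : NonRes p q (y * (p * t))) : ellPoch (q * (y * t)⁻¹) j q p ≠ 0 ∧
      ellGamma (y * (p * t)) p q =
        ellPoch (q * (y * t)⁻¹) j q p * ellGamma (y * (p * t) * (q ^ j)⁻¹) p q := by
    have hyt : y * t ≠ 0 := fun h0 => h.1 (by linear_combination p * h0)
    have h' : NonRes p q (y * (p * t) * (q ^ j)⁻¹) := h.of_eq_mul H 0 (-j) (by simp)
    have e := H.ellGamma_mul_pow h'.1 (h'.pqPoch_ne_zero H) j
    rw [inv_mul_cancel_right₀ hqj] at e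
    rw [ellPoch_reflect H hyt, show p * (y * t) = y * (p * t) by ring]
    exact ⟨h'.ellPoch_ne_zero H j, e⟩
  have a1 := h1 (y := a) (hG.mul 0 3)
  have b1 := h1 (y := b) (hG.mul 1 3)
  have c1 := h1 (y := c) (hG.mul 2 3)
  have s1 := h1 (y := s) (hG.mul 4 3)
  obtain ⟨a0, a2⟩ := h2 (y := a) (hG.mul 0 5)
  obtain ⟨b0, b2⟩ := h2 (y := b) (hG.mul 1 5)
  obtain ⟨c0, c2⟩ := h2 (y := c) (hG.mul 2 5)
  obtain ⟨s0, s2⟩ := h2 (y := s) (hG.mul 4 5)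
  rw [betaProd_vec, betaProd_vec, a2, b2, c2, s2,
    show a * (d * q ^ j) = a * d * q ^ j by ring, show b * (d * q ^ j) = b * d * q ^ j by ring,
    show c * (d * q ^ j) = c * d * q ^ j by ring, show d * q ^ j * s = s * d * q ^ j by ring,
    show d * q ^ j * (p * t * (q ^ j)⁻¹) = d * (p * t) by field_simp, a1, b1, c1, s1,
    mul_comm d s, ← mul_assoc a (p * t), ← mul_assoc b (p * t), ← mul_assoc c (p * t),
    ← mul_assoc s (p * t)]
  clear a1 b1 c1 s1 a2 b2 c2 s2 h1 h2 hG
  generalize ellPoch (q * (a * t)⁻¹) j q p = Pa, ellPoch (q * (b * t)⁻¹) j q p = Pb,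
    ellPoch (q * (c * t)⁻¹) j q p = Pc, ellPoch (q * (s * t)⁻¹) j q p = Ps at *
  generalize ellGamma (a * (p * t) * (q ^ j)⁻¹) p q = Ga,
    ellGamma (b * (p * t) * (q ^ j)⁻¹) p q = Gb, ellGamma (c * (p * t) * (q ^ j)⁻¹) p q = Gc,
    ellGamma (s * (p * t) * (q ^ j)⁻¹) p q = Gs, ellPoch (a * d) j q p = A,
    ellPoch (b * d) j q p = B, ellPoch (c * d) j q p = C, ellPoch (s * d) j q p = S
  rw [div_mul_div_comm, div_mul_div_comm, div_mul_div_comm, mul_div_assoc', eq_div_iff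
    (mul_ne_zero (mul_ne_zero (mul_ne_zero a0 b0) c0) s0)]
  ring

theorem ellPoch_div_ellPoch (H : Nomes p q) {α δ τ : ℂ} (hα : NonRes p q (α * δ))
    (hτ : NonRes p q (α * τ)) (i j : ℕ) :
    ellPoch (α * q ^ i * δ) j q p / ellPoch (q * (α * q ^ i * τ)⁻¹) j q p =
      ellPoch (α * δ) j q p / ellPoch (q * (α * τ)⁻¹) j q p *
        ((q ^ j) ^ i * (ellPoch (α * δ * q ^ j) i q p * ellPoch (α * τ * (q ^ j)⁻¹) i q p) /
          (ellPoch (α * δ) i q p * ellPoch (α * τ) i q p)) := by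
  have hq := H.q_ne
  have hqi := pow_ne_zero i hq
  have hqj := pow_ne_zero j hq
  have e1 : ellPoch (α * δ) i q p * ellPoch (α * q ^ i * δ) j q p =
      ellPoch (α * δ) j q p * ellPoch (α * δ * q ^ j) i q p := by
    rw [show α * q ^ i * δ = α * δ * q ^ i by ring, ← ellPoch_add, ← ellPoch_add, add_comm]
  set z := q * (α * q ^ i * τ)⁻¹ with hz
  have hzn : NonRes p q z := hτ.inv.of_eq_mul H 0 (1 - i) (by
    rw [hz, zpow_sub₀ hq, zpow_one, zpow_natCast]
    have := hτ.1
    have : α ≠ 0 := left_ne_zero_of_mul hτ.1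
    have : τ ≠ 0 := right_ne_zero_of_mul hτ.1
    simp
    field_simp)
  have hzi : q * (α * τ)⁻¹ = z * q ^ i := by
    rw [hz]
    have : α ≠ 0 := left_ne_zero_of_mul hτ.1
    have : τ ≠ 0 := right_ne_zero_of_mul hτ.1
    field_simp
  have e2 : ellPoch z i q p * ellPoch (z * q ^ i) j q p =
      ellPoch z j q p * ellPoch (z * q ^ j) i q p := by
    rw [← ellPoch_add, ← ellPoch_add, add_comm]
  have hw0 : α * τ * q ^ i ≠ 0 := mul_ne_zero hτ.1 hqi
  have r1 := ellPoch_reverse H hw0 i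
  have r2 := ellPoch_reverse H (z := α * τ * q ^ i * (q ^ j)⁻¹)
    (mul_ne_zero hw0 (inv_ne_zero hqj)) i
  rw [show q * (α * τ * q ^ i)⁻¹ = z by rw [hz]; congr 2; ring,
    show α * τ * q ^ i * (q ^ i)⁻¹ = α * τ by field_simp] at r1
  rw [show q * (α * τ * q ^ i * (q ^ j)⁻¹)⁻¹ = z * q ^ j by
      rw [hz, mul_inv, inv_inv, show α * τ * q ^ i = α * q ^ i * τ by ring]; ring,
    show α * τ * q ^ i * (q ^ j)⁻¹ * (q ^ i)⁻¹ = α * τ * (q ^ j)⁻¹ by field_simp,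
    ← neg_mul, mul_pow] at r2
  rw [hzi]
  have n1 := hα.ellPoch_ne_zero H i
  have n2 := hτ.ellPoch_ne_zero H i
  have n3 := hzn.ellPoch_ne_zero H j
  have n4 := (hzn.of_eq_mul H 0 i (w := z * q ^ i) (by simp)).ellPoch_ne_zero H j
  have n5 : (-z) ^ i ≠ 0 := pow_ne_zero i (neg_ne_zero.2 hzn.1)
  have hT := triPow_ne_zero hq i
  clear hz hzi
  clear_value z
  generalize ellPoch z i q p = A1 at *
  generalize ellPoch z j q p = A2 at *
  generalize ellPoch (z * q ^ i) j q p = A3 at *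
  generalize ellPoch (z * q ^ j) i q p = A4 at *
  generalize ellPoch (α * δ) i q p = A5 at *
  generalize ellPoch (α * δ) j q p = A6 at *
  generalize ellPoch (α * q ^ i * δ) j q p = A7 at *
  generalize ellPoch (α * δ * q ^ j) i q p = A8 at *
  generalize ellPoch (α * τ) i q p = A9 at *
  generalize ellPoch (α * τ * (q ^ j)⁻¹) i q p = A10 at *
  generalize triPow q i = T at *
  generalize (-z) ^ i = Z at *
  generalize (q ^ j) ^ i = Q at *
  subst r1 r2
  have e2' : A9 * A3 = A2 * (Q * A10) := by
    have h0 : Z * T ≠ 0 := mul_ne_zero n5 hT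
    refine mul_left_cancel₀ h0 ?_
    linear_combination e2
  rw [div_mul_div_comm, div_eq_div_iff n3 (by positivity)]
  linear_combination (A3 * A9) * e1 + (A6 * A8) * e2'

end Weights

/-! ### Orthogonality to theta functions -/

section Orthogonality

variable {p q z : ℂ} {a b c d s t u r : ℂ}

theorem betaFun_congr_fun {τ : Fin 6 → ℂ} {Z : List (ℝ → ℂ)} {P : Set ℂ}
    (hZ : CycleSeparates Z P) {F G : ℂ → ℂ} (h : ∀ x ≠ 0, F x = G x) :
    betaFun p q τ Z F = betaFun p q τ Z G :=
  betaFun_congr hZ Set.countable_empty fun x hx _ => by rw [h x hx]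

theorem Nomes.betaFun_ellPochPM (H : Nomes p q) (h0 : ∀ j, ![a, b, c, d, s, u] j ≠ 0)
    {i k j l : ℕ} (hprod : a * q ^ i * (b * q ^ k) * c * (d * q ^ j) * s * (u * q ^ l) = p * q)
    {Z : List (ℝ → ℂ)} (hZ : CycleSeparates Z (latticePoints ![a, b, c, d, s, u] p q)) :
    betaFun p q ![a, b, c, d, s, u] Z (fun x => ellPochPM a x i q p * ellPochPM b x k q p *
      ellPochPM d x j q p * ellPochPM u x l q p) =
    betaProd ![a * q ^ i, b * q ^ k, c, d * q ^ j, s, u * q ^ l] p q := by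
  have e : ∀ m, ![a * q ^ i, b * q ^ k, c, d * q ^ j, s, u * q ^ l] m =
      ![a, b, c, d, s, u] m * q ^ (![i, k, 0, j, 0, l] : Fin 6 → ℕ) m := by
    intro m; fin_cases m <;> simp
  rw [← H.betaFun_one (Z := Z) (by rw [prod_fin_six, hprod])
      (hZ.mono (latticePoints_subset (m := fun _ => 0) fun m => by rw [e m, pow_zero, one_mul])),
    H.betaFun_prod_mul (t' := ![a * q ^ i, b * q ^ k, c, d * q ^ j, s, u * q ^ l])
      ![i, k, 0, j, 0, l] h0 e hZ (F := fun _ => 1)]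
  intro x _
  rw [Fin.prod_univ_six]
  simp

theorem bioNum_eq_sum (H : Nomes p q) (n : ℕ) (a b c d s : ℂ) (ht : t ≠ 0) {x : ℂ} (hx : x ≠ 0) :
    bioNum n a b c d t s q p x = ∑ j ∈ Finset.range (n + 1), bioCoef n a b c d t s q p j *
      (ellPochPM d x j q p * ellPochPM (p * t * (q ^ n)⁻¹) x (n - j) q p) := by
  refine Finset.sum_congr rfl fun j hj => ?_
  obtain ⟨m, rfl⟩ := Nat.exists_eq_add_of_le (Nat.lt_succ_iff.1 (Finset.mem_range.1 hj))
  have hqj := pow_ne_zero j H.q_ne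
  have h := ellPochPM_reflect H (t := t * (q ^ j)⁻¹) (mul_ne_zero ht (inv_ne_zero hqj)) hx m
  rw [Nat.add_sub_cancel_left,
    show q * t⁻¹ * q ^ j = q * (t * (q ^ j)⁻¹)⁻¹ by rw [mul_inv, inv_inv]; ring, h, pow_add, mul_inv]
  ring_nf

theorem differentiableAt_bioNum (H : Nomes p q) (n : ℕ) (a b c : ℂ) (hd : d ≠ 0) (hs : s ≠ 0)
    (t : ℂ) : ∀ x ≠ 0, DifferentiableAt ℂ (fun x => bioNum n a b c d s t q p x) x :=
  (isEvenTheta_bioNum H n a b c t hd hs).diff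

/-- Expansion of the first numerator reduces its integral against theta monomials to a
very-well-poised sum of values of the elliptic beta integral. -/
theorem Nomes.betaFun_bioNum_mul (H : Nomes p q) {s' : ℂ} {i k : ℕ}
    (hG : Generic p q ![a * q ^ i, b * q ^ k, c, d, s', p * t])
    (hprod : a * q ^ i * (b * q ^ k) * c * d * s' * t = q) (n : ℕ) {Z : List (ℝ → ℂ)}
    (hZ : CycleSeparates Z (latticePoints ![a, b, c, d, s', p * t * (q ^ n)⁻¹] p q)) :
    betaFun p q ![a, b, c, d, s', p * t * (q ^ n)⁻¹] Z (fun x => bioNum n a b c d t s q p x *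
      (ellPochPM a x i q p * ellPochPM b x k q p)) =
    betaProd ![a * q ^ i, b * q ^ k, c, d, s', p * t] p q *
      ∑ j ∈ Finset.range (n + 1), bioCoef n a b c d t s q p j *
        (ellPoch (a * q ^ i * d) j q p / ellPoch (q * (a * q ^ i * t)⁻¹) j q p *
        (ellPoch (b * q ^ k * d) j q p / ellPoch (q * (b * q ^ k * t)⁻¹) j q p) *
        (ellPoch (c * d) j q p / ellPoch (q * (c * t)⁻¹) j q p) *
        (ellPoch (d * s') j q p / ellPoch (q * (s' * t)⁻¹) j q p)) := by
  have hq := H.q_ne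
  have ha : a ≠ 0 := left_ne_zero_of_mul (hG.ne_zero 0)
  have hb : b ≠ 0 := left_ne_zero_of_mul (hG.ne_zero 1)
  have hc : c ≠ 0 := hG.ne_zero 2
  have hd : d ≠ 0 := hG.ne_zero 3
  have hs' : s' ≠ 0 := hG.ne_zero 4
  have hu : p * t ≠ 0 := hG.ne_zero 5
  have ht : t ≠ 0 := right_ne_zero_of_mul hu
  have hqn := pow_ne_zero n hq
  have hu' : p * t * (q ^ n)⁻¹ ≠ 0 := mul_ne_zero hu (inv_ne_zero hqn)
  have h0 : ∀ m, ![a, b, c, d, s', p * t * (q ^ n)⁻¹] m ≠ 0 := by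
    simp [Fin.forall_fin_succ, ha, hb, hc, hd, hs', hq, H.p_ne, ht]
  have hdiff (w : ℂ) (hw : w ≠ 0) (m : ℕ) (z : ℂ) (hz : z ≠ 0) :
      DifferentiableAt ℂ (fun x => ellPochPM w x m q p) z :=
    (isEvenTheta_ellPochPM H.p_ne H.p_lt hq hw m).diff z hz
  rw [betaFun_congr_fun hZ (G := fun x => ∑ j ∈ Finset.range (n + 1),
      bioCoef n a b c d t s q p j * (ellPochPM a x i q p * ellPochPM b x k q p *
        ellPochPM d x j q p * ellPochPM (p * t * (q ^ n)⁻¹) x (n - j) q p)) fun x hx => by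
      rw [bioNum_eq_sum H n a b c d s ht hx, Finset.sum_mul]
      exact Finset.sum_congr rfl fun j _ => by ring,
    H.betaFun_sum h0 hZ _ (F := fun j x => bioCoef n a b c d t s q p j *
      (ellPochPM a x i q p * ellPochPM b x k q p * ellPochPM d x j q p *
        ellPochPM (p * t * (q ^ n)⁻¹) x (n - j) q p)) fun j _ z hz => ((((hdiff a ha i z hz).mul (hdiff b hb k z hz)).mul
      (hdiff d hd j z hz)).mul (hdiff _ hu' (n - j) z hz)).const_mul _, Finset.mul_sum]
  refine Finset.sum_congr rfl fun j hj => ?_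
  obtain ⟨m, rfl⟩ := Nat.exists_eq_add_of_le (Nat.lt_succ_iff.1 (Finset.mem_range.1 hj))
  have hqj := pow_ne_zero j hq
  have e : p * t * (q ^ (j + m))⁻¹ * q ^ m = p * t * (q ^ j)⁻¹ := by
    rw [pow_add]
    have := pow_ne_zero m hq
    field_simp
  rw [betaFun_const_mul, Nat.add_sub_cancel_left, H.betaFun_ellPochPM h0 (by
    rw [e]
    field_simp
    linear_combination p * hprod) hZ, e, betaProd_mul_pow H hG]
  ring

theorem bioCoef_mul_ratio (H : Nomes p q) (ha : NonRes p q (a * d)) (ha' : NonRes p q (a * t))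
    (hb : NonRes p q (b * d)) (hb' : NonRes p q (b * t)) (hc : NonRes p q (c * d))
    (hc' : NonRes p q (c * t)) (hr : r ^ 2 = d * t⁻¹) (s s' : ℂ) (n i k j : ℕ) :
    bioCoef n a b c d t s q p j *
      (ellPoch (a * q ^ i * d) j q p / ellPoch (q * (a * q ^ i * t)⁻¹) j q p *
      (ellPoch (b * q ^ k * d) j q p / ellPoch (q * (b * q ^ k * t)⁻¹) j q p) *
      (ellPoch (c * d) j q p / ellPoch (q * (c * t)⁻¹) j q p) *
      (ellPoch (d * s') j q p / ellPoch (q * (s' * t)⁻¹) j q p)) =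
    (ellPoch (a * d) i q p * ellPoch (a * t) i q p *
      (ellPoch (b * d) k q p * ellPoch (b * t) k q p))⁻¹ *
    (vwpWeight n r q p j * (q ^ j * (q ^ j) ^ i * (q ^ j) ^ k) *
      (ellPochPM (a * t * r) (r * q ^ j) i q p * ellPochPM (b * t * r) (r * q ^ j) k q p) *
      ((ellPoch (d * s') j q p / ellPoch (q * (s' * t)⁻¹) j q p) *
        (ellPoch (q ^ n * (t * s)⁻¹) j q p / ellPoch (d * s * q * (q ^ n)⁻¹) j q p))) := by
  have ht0 : t ≠ 0 := right_ne_zero_of_mul ha'.1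
  have hd0 : d ≠ 0 := right_ne_zero_of_mul ha.1
  have hq := H.q_ne
  have hr0 : r ≠ 0 := fun h => by
    rw [h] at hr
    exact mul_ne_zero hd0 (inv_ne_zero ht0) (by rw [← hr]; simp)
  have hPM (y : ℂ) (i : ℕ) : ellPochPM (y * t * r) (r * q ^ j) i q p =
      ellPoch (y * d * q ^ j) i q p * ellPoch (y * t * (q ^ j)⁻¹) i q p := by
    have hqj := pow_ne_zero j hq
    rw [ellPochPM_eq, show y * t * r * (r * q ^ j) = y * d * q ^ j by
      rw [show y * t * r * (r * q ^ j) = y * t * r ^ 2 * q ^ j by ring, hr]; field_simp,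
      show y * t * r * (r * q ^ j)⁻¹ = y * t * (q ^ j)⁻¹ by field_simp]
  have hn {y : ℂ} (h : NonRes p q (y * t)) : ellPoch (q * (y * t)⁻¹) j q p ≠ 0 :=
    (h.inv.of_eq_mul H 0 1 (w := q * (y * t)⁻¹) (by simp [mul_comm])).ellPoch_ne_zero H j
  rw [ellPoch_div_ellPoch H ha ha', ellPoch_div_ellPoch H hb hb', hPM, hPM, vwpWeight, hr, bioCoef]
  have a1 := hn ha'
  have b1 := hn hb'
  have c1 := hn hc'
  have a2 := ha.ellPoch_ne_zero H j
  have b2 := hb.ellPoch_ne_zero H j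
  have c2 := hc.ellPoch_ne_zero H j
  clear hPM hn ha ha' hb hb' hc hc'
  generalize ellPoch (q * (a * t)⁻¹) j q p = A1 at *
  generalize ellPoch (q * (b * t)⁻¹) j q p = B1 at *
  generalize ellPoch (q * (c * t)⁻¹) j q p = C1 at *
  generalize ellPoch (a * d) j q p = A2 at *
  generalize ellPoch (b * d) j q p = B2 at *
  generalize ellPoch (c * d) j q p = C2 at *
  generalize ellPoch (d * s') j q p / ellPoch (q * (s' * t)⁻¹) j q p = X
  generalize ellPoch (a * d * q ^ j) i q p * ellPoch (a * t * (q ^ j)⁻¹) i q p = PA,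
    ellPoch (b * d * q ^ j) k q p * ellPoch (b * t * (q ^ j)⁻¹) k q p = PB,
    ellPoch (a * d) i q p * ellPoch (a * t) i q p = QA,
    ellPoch (b * d) k q p * ellPoch (b * t) k q p = QB,
    theta (d * t⁻¹ * q ^ (2 * j)) p / theta (d * t⁻¹) p = W,
    ellPoch (d * t⁻¹) j q p = E1, ellPoch (q ^ n)⁻¹ j q p = E2,
    ellPoch (q ^ n * (t * s)⁻¹) j q p = E3, ellPoch q j q p = E4,
    ellPoch (q ^ n * (q * (d * t⁻¹))) j q p = E5, ellPoch (d * s * q * (q ^ n)⁻¹) j q p = E6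
  have e : E1 * A1 * B1 * C1 * E2 * E3 / (E4 * A2 * B2 * C2 * E5 * E6) *
      (A2 / A1 * (B2 / B1) * (C2 / C1)) = E1 * E2 / (E4 * E5) * (E3 / E6) := by
    rw [div_mul_div_comm, div_mul_div_comm, div_mul_div_comm, div_mul_div_comm,
      ← mul_div_mul_left (E1 * E2 * E3) (E4 * E5 * E6)
        (c := A1 * B1 * C1 * (A2 * B2 * C2)) (by positivity)]
    congr 1 <;> ring
  simp only [div_eq_mul_inv, mul_inv] at e ⊢
  linear_combination (W * q ^ j * (q ^ j) ^ i * PA * QA⁻¹ * (q ^ j) ^ k * PB * QB⁻¹ * X) * e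

theorem generic_nodes (H : Nomes p q) (hG : Generic p q ![a, b, c, d, s, p * t])
    (hr : r ^ 2 = d * t⁻¹) : NonRes p q (r ^ 2) ∧ r ≠ 0 ∧
      (∀ m : ℤ, ∀ j : ℕ, thetaPM (s * t * r * q ^ m) (r * q ^ j) p ≠ 0) := by
  have ht0 : t ≠ 0 := right_ne_zero_of_mul (hG.ne_zero 5)
  have hp := H.p_ne
  have hq := H.q_ne
  have h1 : NonRes p q (r ^ 2) := by
    rw [hr]
    refine (hG.div 3 5 (by decide)).of_eq_mul H 1 0 ?_
    simp only [Matrix.cons_val, zpow_one, zpow_zero]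
    field_simp
  have hr0 : r ≠ 0 := fun h => h1.1 (by rw [h]; simp)
  refine ⟨h1, hr0, fun m j => mul_ne_zero ?_ ?_⟩
  · refine ((hG.mul 3 4).of_eq_mul H 0 (m + j) ?_).theta_ne_zero H
    simp only [Matrix.cons_val, zpow_zero, zpow_add₀ hq, zpow_natCast, one_mul]
    rw [show s * t * r * q ^ m * (r * q ^ j) = s * t * r ^ 2 * q ^ m * q ^ j by ring, hr]
    field_simp
  · refine ((hG.mul 4 5).of_eq_mul H (-1) (m - j) ?_).theta_ne_zero H
    simp only [Matrix.cons_val, zpow_neg_one, zpow_sub₀ hq, zpow_natCast]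
    have := pow_ne_zero j hq
    field_simp

/-- The numerator of the first rational function of degree `n + 1` is orthogonal to even theta
functions of degree `n`. -/
theorem betaFun_bioNum_mul_eq_zero (H : Nomes p q) (hG : Generic p q ![a, b, c, d, s, p * t])
    (hprod : a * b * c * d * s * t = q) {n : ℕ} (hq : ellPoch q (n + 1) q p ≠ 0) {F : ℂ → ℂ}
    (hF : IsEvenTheta p n F) {Z : List (ℝ → ℂ)} (hZ : CycleSeparates Z
      (latticePoints ![a, b, c, d, s * (q ^ n)⁻¹, p * t * (q ^ (n + 1))⁻¹] p q)) :
    betaFun p q ![a, b, c, d, s * (q ^ n)⁻¹, p * t * (q ^ (n + 1))⁻¹] Z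
      (fun x => bioNum (n + 1) a b c d t s q p x * F x) = 0 := by
  have hq0 := H.q_ne
  obtain ⟨ha, hb, hc, hd, hs, ht⟩ := ne_zero_of_prod_eq hq0 hprod
  have hqn := pow_ne_zero n hq0
  have hm (i j : ℕ) (y w : ℂ) (h : NonRes p q (y * w)) : NonRes p q (y * q ^ i * (w * q ^ j)) :=
    h.of_eq_mul H 0 (i + j : ℕ) (by rw [zpow_natCast, pow_add]; simp; ring)
  obtain ⟨cf, hcf⟩ := hF.exists_expansion H.p_ne H.p_lt hq0 (a := a) hb n ha
    (fun i _ => by rw [pow_two]; exact (hm i i a a (hG.mul 0 0)).theta_ne_zero H)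
    (fun i _ j _ => mul_ne_zero ((hm j i b a (hG.mul 1 0)).theta_ne_zero H)
      (((hG.div 1 0 (by decide)).of_eq_mul H 0 (j - i : ℤ) (by
        rw [zpow_sub₀ hq0, zpow_natCast, zpow_natCast]; simp; ring)).theta_ne_zero H))
  have h0 : ∀ m, ![a, b, c, d, s * (q ^ n)⁻¹, p * t * (q ^ (n + 1))⁻¹] m ≠ 0 := by
    simp [Fin.forall_fin_succ, ha, hb, hc, hd, hs, hq0, H.p_ne, ht]
  have hdiff (w : ℂ) (hw : w ≠ 0) (m : ℕ) (z : ℂ) (hz : z ≠ 0) :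
      DifferentiableAt ℂ (fun x => ellPochPM w x m q p) z :=
    (isEvenTheta_ellPochPM H.p_ne H.p_lt hq0 hw m).diff z hz
  rw [betaFun_congr_fun hZ (G := fun x => ∑ i ∈ Finset.range (n + 1), cf i *
      (bioNum (n + 1) a b c d t s q p x * (ellPochPM a x i q p * ellPochPM b x (n - i) q p)))
      fun x hx => by
        rw [hcf x hx, Finset.mul_sum]
        exact Finset.sum_congr rfl fun j _ => by ring,
    H.betaFun_sum h0 hZ _ (F := fun i x => cf i * (bioNum (n + 1) a b c d t s q p x *
      (ellPochPM a x i q p * ellPochPM b x (n - i) q p)))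
      fun j _ z hz => ((differentiableAt_bioNum H (n + 1) a b c hd ht s z hz).mul
      ((hdiff a ha j z hz).mul (hdiff b hb (n - j) z hz))).const_mul _]
  refine Finset.sum_eq_zero fun i hi => ?_
  obtain ⟨k, rfl⟩ := Nat.exists_eq_add_of_le (Nat.lt_succ_iff.1 (Finset.mem_range.1 hi))
  rw [Nat.add_sub_cancel_left, betaFun_const_mul]
  obtain ⟨r, hr⟩ : ∃ r : ℂ, r ^ 2 = d * t⁻¹ := IsAlgClosed.exists_pow_nat_eq _ two_pos
  obtain ⟨hr1, hr0, hγ⟩ := generic_nodes H hG hr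
  have hG' : Generic p q ![a * q ^ i, b * q ^ k, c, d, s * (q ^ (i + k))⁻¹, p * t] := by
    refine hG.shift H fun m => ?_
    fin_cases m
    · exact ⟨0, i, by simp⟩
    · exact ⟨0, k, by simp⟩
    · exact ⟨0, 0, by simp⟩
    · exact ⟨0, 0, by simp⟩
    · exact ⟨0, -(i + k : ℕ), by rw [zpow_neg, zpow_natCast]; simp⟩
    · exact ⟨0, 0, by simp⟩
  have hpt {y : ℂ} (h : NonRes p q (y * (p * t))) : NonRes p q (y * t) :=
    h.of_eq_mul H (-1) 0 (by have := H.p_ne; simp; field_simp)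
  rw [H.betaFun_bioNum_mul hG' (by
    rw [pow_add]
    have := pow_ne_zero i hq0
    have := pow_ne_zero k hq0
    field_simp
    linear_combination hprod) (i + k + 1) hZ]
  have hat := hpt (y := a) (hG.mul 0 5)
  have hbt := hpt (y := b) (hG.mul 1 5)
  have hct := hpt (y := c) (hG.mul 2 5)
  have hst := hpt (y := s) (hG.mul 4 5)
  have hds : NonRes p q (d * s) := hG.mul 3 4
  rw [Finset.sum_congr rfl fun j _ => bioCoef_mul_ratio H (a := a) (b := b) (c := c)
    (d := d) (hG.mul 0 3) hat (hG.mul 1 3) hbt (hG.mul 2 3) hct hr s (s * (q ^ (i + k))⁻¹) (i + k + 1) i k j]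
  have e1 : d * (s * (q ^ (i + k))⁻¹) = d * s * q * (q ^ (i + k + 1))⁻¹ := by
    rw [pow_succ]; field_simp
  have e2 : q * (s * (q ^ (i + k))⁻¹ * t)⁻¹ = q ^ (i + k + 1) * (t * s)⁻¹ := by
    rw [pow_succ]; field_simp
  rw [e1, e2, ← Finset.mul_sum]
  have hsum := sum_vwpWeight_eq_zero H hr1 hq (f := fun z => ellPochPM (a * t * r) z i q p *
    ellPochPM (b * t * r) z k q p) ((isEvenTheta_ellPochPM H.p_ne H.p_lt hq0
      (a := a * t * r) (by positivity) i).mul (isEvenTheta_ellPochPM H.p_ne H.p_lt hq0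
      (a := b * t * r) (by positivity) k)) (γ := s * t * r * q ^ (0 : ℤ))
      (mul_ne_zero (mul_ne_zero (mul_ne_zero hs ht) hr0) (zpow_ne_zero _ hq0))
      (fun j _ => hγ 0 j)
  rw [Finset.sum_congr rfl fun j _ => ?_, hsum, mul_zero, mul_zero, mul_zero]
  have n1 : ellPoch (q ^ (i + k + 1) * (t * s)⁻¹) j q p ≠ 0 := by
    refine (hst.inv.of_eq_mul H 0 (i + k + 1 : ℕ) ?_).ellPoch_ne_zero H j
    rw [zpow_natCast, mul_comm t s]; simp; ring
  have n2 : ellPoch (d * s * q * (q ^ (i + k + 1))⁻¹) j q p ≠ 0 := by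
    refine (hds.of_eq_mul H 0 (-(i + k : ℕ)) ?_).ellPoch_ne_zero H j
    rw [zpow_neg, zpow_natCast, zpow_zero, one_mul, pow_succ]
    field_simp
  rw [div_mul_div_cancel₀ n1, div_self n2]
  ring

end Orthogonality

/-! ### The norm -/

section Norm

variable {p q z : ℂ} {a b c d s t u r : ℂ}

theorem betaProd_mul_pow_fst (H : Nomes p q) (hG : Generic p q ![a, b, c, d, s, u]) (n : ℕ) :
    betaProd ![a * q ^ n, b, c, d, s * (q ^ n)⁻¹, u] p q *
      (ellPoch (b * s * (q ^ n)⁻¹) n q p * ellPoch (c * s * (q ^ n)⁻¹) n q p *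
        ellPoch (d * s * (q ^ n)⁻¹) n q p * ellPoch (s * u * (q ^ n)⁻¹) n q p) =
    betaProd ![a, b, c, d, s, u] p q *
      (ellPoch (a * b) n q p * ellPoch (a * c) n q p * ellPoch (a * d) n q p *
        ellPoch (a * u) n q p) := by
  have hqn := pow_ne_zero n H.q_ne
  have h1 {y : ℂ} (h : NonRes p q (a * y)) :
      ellGamma (a * y * q ^ n) p q = ellPoch (a * y) n q p * ellGamma (a * y) p q :=
    H.ellGamma_mul_pow h.1 (h.pqPoch_ne_zero H) n
  have h2 {y : ℂ} (h : NonRes p q y) :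
      ellGamma y p q = ellPoch (y * (q ^ n)⁻¹) n q p * ellGamma (y * (q ^ n)⁻¹) p q := by
    have h' : NonRes p q (y * (q ^ n)⁻¹) := h.of_eq_mul H 0 (-n) (by simp)
    have e := H.ellGamma_mul_pow h'.1 (h'.pqPoch_ne_zero H) n
    rwa [inv_mul_cancel_right₀ hqn] at e
  have b1 := h1 (y := b) (hG.mul 0 1)
  have c1 := h1 (y := c) (hG.mul 0 2)
  have d1 := h1 (y := d) (hG.mul 0 3)
  have u1 := h1 (y := u) (hG.mul 0 5)
  have b2 := h2 (y := b * s) (hG.mul 1 4)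
  have c2 := h2 (y := c * s) (hG.mul 2 4)
  have d2 := h2 (y := d * s) (hG.mul 3 4)
  have u2 := h2 (y := s * u) (hG.mul 4 5)
  rw [betaProd_vec, betaProd_vec, b2, c2, d2, u2,
    show a * q ^ n * b = a * b * q ^ n by ring, show a * q ^ n * c = a * c * q ^ n by ring,
    show a * q ^ n * d = a * d * q ^ n by ring, show a * q ^ n * u = a * u * q ^ n by ring,
    show a * q ^ n * (s * (q ^ n)⁻¹) = a * s by field_simp, b1, c1, d1, u1,
    ← mul_assoc b s, ← mul_assoc c s, ← mul_assoc d s,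
    show s * (q ^ n)⁻¹ * u = s * u * (q ^ n)⁻¹ by ring]
  ring

/-- The numerator of the second rational function is explicit at the point `q⁻ⁿ s`: only the last
term of the series contributes. -/
theorem bioNum_apply (H : Nomes p q) (hs : s ≠ 0) (n : ℕ) :
    bioNum n a b c d s t q p (s * (q ^ n)⁻¹) =
      bioCoef n a b c d s t q p n * ellPochPM d (s * (q ^ n)⁻¹) n q p := by
  have hq := H.q_ne
  rw [bioNum, Finset.sum_range_succ, Finset.sum_eq_zero fun j hj => ?_]
  · simp
  · obtain ⟨m, rfl⟩ := Nat.exists_eq_add_of_lt (Finset.mem_range.1 hj)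
    have h0 : ellPochPM (q * s⁻¹ * q ^ j) (s * (q ^ (j + m + 1))⁻¹) (j + m + 1 - j) q p = 0 := by
      rw [ellPochPM]
      refine Finset.prod_eq_zero (i := m) (Finset.mem_range.2 (by omega)) ?_
      have e : q * s⁻¹ * q ^ j * q ^ m * (s * (q ^ (j + m + 1))⁻¹) = 1 := by
        have := pow_ne_zero j hq
        have := pow_ne_zero m hq
        rw [pow_succ, pow_add]
        field_simp
      rw [thetaPM, e, theta_one H.p_lt, zero_mul]
    rw [h0]
    ring

/-- The first numerator integrates to zero against even theta functions of the same degree which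
vanish at `q⁻ⁿ s`. -/
theorem betaFun_bioNum_mul_eq_zero_of_apply (H : Nomes p q)
    (hG : Generic p q ![a, b, c, d, s, p * t])
    (hprod : a * b * c * d * s * t = q) {n : ℕ} (hq : ellPoch q n q p ≠ 0) {F : ℂ → ℂ}
    (hF : IsEvenTheta p n F) (hF0 : F (s * (q ^ n)⁻¹) = 0) {Z : List (ℝ → ℂ)}
    (hZ : CycleSeparates Z
      (latticePoints ![a, b, c, d, s * (q ^ n)⁻¹, p * t * (q ^ n)⁻¹] p q)) :
    betaFun p q ![a, b, c, d, s * (q ^ n)⁻¹, p * t * (q ^ n)⁻¹] Z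
      (fun x => bioNum n a b c d t s q p x * F x) = 0 := by
  have hq0 := H.q_ne
  obtain ⟨ha, hb, hc, hd, hs, ht⟩ := ne_zero_of_prod_eq hq0 hprod
  have hx : s * (q ^ n)⁻¹ ≠ 0 := mul_ne_zero hs (inv_ne_zero (pow_ne_zero n hq0))
  cases n with
  | zero =>
    have h := hF.eq_zero_of_zero H.p_ne H.p_lt hx hF0
    rw [betaFun_congr_fun hZ (G := fun x => 0 * 0) fun x hx => by rw [h x hx]; ring,
      betaFun_const_mul, zero_mul]
  | succ n =>
    obtain ⟨G, hG', hGF⟩ := hF.exists_eq_thetaPM_mul H.p_ne H.p_lt hx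
      (((hG.mul 4 4).of_eq_mul H 0 (-(2 * (n + 1) : ℕ)) (by
        rw [zpow_neg, zpow_natCast, pow_mul']; simp; ring)).theta_ne_zero H) hF0
    have h0 : ∀ m, ![a, b, c, d, s * (q ^ (n + 1))⁻¹, p * t * (q ^ (n + 1))⁻¹] m ≠ 0 := by
      simp [Fin.forall_fin_succ, ha, hb, hc, hd, hs, hq0, H.p_ne, ht]
    have e : ∀ m, ![a, b, c, d, s * (q ^ n)⁻¹, p * t * (q ^ (n + 1))⁻¹] m =
        ![a, b, c, d, s * (q ^ (n + 1))⁻¹, p * t * (q ^ (n + 1))⁻¹] m *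
          q ^ (![0, 0, 0, 0, 1, 0] : Fin 6 → ℕ) m := by
      intro m
      fin_cases m <;> simp [pow_succ]
      field_simp
    rw [← betaFun_bioNum_mul_eq_zero H hG hprod hq hG' (hZ.mono (latticePoints_subset
        (m := fun _ => 0) fun m => by rw [e m, pow_zero, one_mul])),
      H.betaFun_prod_mul ![0, 0, 0, 0, 1, 0] h0 e hZ]
    intro x hx
    rw [Fin.prod_univ_six, hGF x hx]
    simp only [Matrix.cons_val, ellPochPM_zero, one_mul, mul_one]
    rw [ellPochPM_succ', ellPochPM_zero]
    ring

/-- The value of the integral of the first numerator against a theta monomial of the same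
degree. -/
theorem betaFun_bioNum_mul_ellPochPM (H : Nomes p q) (hG : Generic p q ![a, b, c, d, s, p * t])
    (hprod : a * b * c * d * s * t = q) {n : ℕ} (hq : ellPoch q n q p ≠ 0) {Z : List (ℝ → ℂ)}
    (hZ : CycleSeparates Z
      (latticePoints ![a, b, c, d, s * (q ^ n)⁻¹, p * t * (q ^ n)⁻¹] p q)) :
    betaFun p q ![a, b, c, d, s * (q ^ n)⁻¹, p * t * (q ^ n)⁻¹] Z
      (fun x => bioNum n a b c d t s q p x * ellPochPM a x n q p) =
    betaProd ![a * q ^ n, b, c, d, s * (q ^ n)⁻¹, p * t] p q *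
      ((ellPoch (a * d) n q p * ellPoch (a * t) n q p)⁻¹ *
        (theta (d * s * (q ^ n)⁻¹) p * theta (q ^ n * (s * t)⁻¹) p *
        (ellPoch (q * (d * t⁻¹)) n q p * ellPoch q n q p) *
        (ellPoch (q * (b * c)⁻¹ * (q ^ n)⁻¹) n q p * ellPoch (a * (q ^ n * s⁻¹)) n q p) /
        (ellPoch (d * s * (q ^ n)⁻¹) (n + 1) q p *
          ellPoch (q ^ n * (s * t)⁻¹) (n + 1) q p))) := by
  have hq0 := H.q_ne
  obtain ⟨ha, hb, hc, hd, hs, ht⟩ := ne_zero_of_prod_eq hq0 hprod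
  have hqn := pow_ne_zero n hq0
  obtain ⟨r, hr⟩ : ∃ r : ℂ, r ^ 2 = d * t⁻¹ := IsAlgClosed.exists_pow_nat_eq _ two_pos
  obtain ⟨hr1, hr0, hγ⟩ := generic_nodes H hG hr
  have hG' : Generic p q ![a * q ^ n, b * q ^ 0, c, d, s * (q ^ n)⁻¹, p * t] := by
    refine hG.shift H fun m => ?_
    fin_cases m
    · exact ⟨0, n, by simp⟩
    · exact ⟨0, 0, by simp⟩
    · exact ⟨0, 0, by simp⟩
    · exact ⟨0, 0, by simp⟩
    · exact ⟨0, -n, by simp⟩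
    · exact ⟨0, 0, by simp⟩
  have hpt {y : ℂ} (h : NonRes p q (y * (p * t))) : NonRes p q (y * t) :=
    h.of_eq_mul H (-1) 0 (by have := H.p_ne; simp; field_simp)
  have hat := hpt (y := a) (hG.mul 0 5)
  have hbt := hpt (y := b) (hG.mul 1 5)
  have hct := hpt (y := c) (hG.mul 2 5)
  have hst := hpt (y := s) (hG.mul 4 5)
  have hds : NonRes p q (d * s) := hG.mul 3 4
  have key := H.betaFun_bioNum_mul (s := s) hG' (by field_simp; linear_combination hprod) n hZ
  rw [Finset.sum_congr rfl fun j _ => bioCoef_mul_ratio H (a := a) (b := b) (c := c) (d := d)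
    (hG.mul 0 3) hat (hG.mul 1 3) hbt (hG.mul 2 3) hct hr s (s * (q ^ n)⁻¹) n n 0 j,
    ← Finset.mul_sum] at key
  simp only [ellPochPM_zero, ellPoch_zero, mul_one, pow_zero] at key
  rw [key]
  congr 2
  set γ := s * t * r * q ^ (-n : ℤ) with hγd
  have hγe : γ = s * t * r * (q ^ n)⁻¹ := by rw [hγd, zpow_neg, zpow_natCast]
  have hγ0 : γ ≠ 0 := by rw [hγe]; positivity
  have hy (j : ℕ) : thetaPM γ (r * q ^ j) p =
      -(q ^ n * (s * t)⁻¹ * q ^ j)⁻¹ * (theta (d * s * (q ^ n)⁻¹ * q ^ j) p *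
        theta (q ^ n * (s * t)⁻¹ * q ^ j) p) := by
    have hqj := pow_ne_zero j hq0
    rw [thetaPM, hγe, show s * t * r * (q ^ n)⁻¹ * (r * q ^ j) = d * s * (q ^ n)⁻¹ * q ^ j by
      rw [show s * t * r * (q ^ n)⁻¹ * (r * q ^ j) = s * t * r ^ 2 * (q ^ n)⁻¹ * q ^ j by ring, hr]
      field_simp,
      show s * t * r * (q ^ n)⁻¹ * (r * q ^ j)⁻¹ = (q ^ n * (s * t)⁻¹ * q ^ j)⁻¹ by field_simp,
      theta_inv H.p_lt (by positivity)]
    ring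
  have hds' : NonRes p q (d * s * (q ^ n)⁻¹) := hds.of_eq_mul H 0 (-n) (by simp)
  have hst' : NonRes p q (q ^ n * (s * t)⁻¹) := hst.inv.of_eq_mul H 0 n (by
    rw [zpow_natCast, zpow_zero, one_mul, mul_comm])
  have hX (j : ℕ) : (ellPoch (d * (s * (q ^ n)⁻¹)) j q p /
        ellPoch (q * (s * (q ^ n)⁻¹ * t)⁻¹) j q p) *
      (ellPoch (q ^ n * (t * s)⁻¹) j q p / ellPoch (d * s * q * (q ^ n)⁻¹) j q p) =
      (theta (d * s * (q ^ n)⁻¹) p * theta (q ^ n * (s * t)⁻¹) p) *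
        (-(q ^ n * (s * t)⁻¹)⁻¹ * (q ^ j)⁻¹ / thetaPM γ (r * q ^ j) p) := by
    have hqj := pow_ne_zero j hq0
    have h1 := ellPoch_succ' (d * s * (q ^ n)⁻¹) j q p
    have h2 := ellPoch_succ' (q ^ n * (s * t)⁻¹) j q p
    rw [ellPoch_succ, show d * s * (q ^ n)⁻¹ * q = d * s * q * (q ^ n)⁻¹ by ring] at h1
    rw [ellPoch_succ] at h2
    rw [hy, show d * (s * (q ^ n)⁻¹) = d * s * (q ^ n)⁻¹ by ring, mul_comm t s,
      show q * (s * (q ^ n)⁻¹ * t)⁻¹ = q ^ n * (s * t)⁻¹ * q by field_simp]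
    have n1 : ellPoch (d * s * q * (q ^ n)⁻¹) j q p ≠ 0 :=
      (hds'.of_eq_mul H 0 1 (by simp; ring)).ellPoch_ne_zero H j
    have n2 : ellPoch (q ^ n * (s * t)⁻¹ * q) j q p ≠ 0 :=
      (hst'.of_eq_mul H 0 1 (by simp)).ellPoch_ne_zero H j
    have n3 : theta (d * s * (q ^ n)⁻¹ * q ^ j) p ≠ 0 :=
      (hds'.of_eq_mul H 0 j (by simp)).theta_ne_zero H
    have n4 : theta (q ^ n * (s * t)⁻¹ * q ^ j) p ≠ 0 :=
      (hst'.of_eq_mul H 0 j (by simp)).theta_ne_zero H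
    have n5 := hst'.1
    generalize q ^ n * (s * t)⁻¹ = w at *
    generalize ellPoch (d * s * q * (q ^ n)⁻¹) j q p = A1 at *
    generalize ellPoch (w * q) j q p = A2 at *
    generalize theta (d * s * (q ^ n)⁻¹ * q ^ j) p = A3 at *
    generalize theta (w * q ^ j) p = A4 at *
    generalize ellPoch (d * s * (q ^ n)⁻¹) j q p = A5 at *
    generalize ellPoch w j q p = A6 at *
    rw [div_mul_div_comm, show theta (d * s * (q ^ n)⁻¹) p * theta w p *
      (-w⁻¹ * (q ^ j)⁻¹ / (-(w * q ^ j)⁻¹ * (A3 * A4))) =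
      theta (d * s * (q ^ n)⁻¹) p * theta w p / (A3 * A4) by field_simp,
      div_eq_div_iff (by positivity) (by positivity)]
    linear_combination (A6 * A4) * h1 + theta (d * s * (q ^ n)⁻¹) p * A1 * h2
  have hsum := sum_vwpWeight_div H hr1 hq (f := fun z => ellPochPM (a * t * r) z n q p)
    (isEvenTheta_ellPochPM H.p_ne H.p_lt hq0 (a := a * t * r) (by positivity) n) hγ0
    (fun j _ => hγ (-n) j)
  rw [Finset.sum_congr rfl fun j _ => show _ = (theta (d * s * (q ^ n)⁻¹) p *
      theta (q ^ n * (s * t)⁻¹) p * (-(q ^ n * (s * t)⁻¹)⁻¹)) * (vwpWeight n r q p j *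
      (q ^ j) ^ n * (ellPochPM (a * t * r) (r * q ^ j) n q p / thetaPM γ (r * q ^ j) p)) by
      rw [hX]
      have hqj := pow_ne_zero j hq0
      generalize theta (q ^ n * (s * t)⁻¹) p = A1, theta (d * s * (q ^ n)⁻¹) p = A2,
        thetaPM γ (r * q ^ j) p = A3, (q ^ n * (s * t)⁻¹)⁻¹ = A4
      field_simp, ← Finset.mul_sum, hsum]
  have hP : ∏ k ∈ Finset.range (n + 1), thetaPM (r * q ^ k) γ p =
      ellPoch (d * s * (q ^ n)⁻¹) (n + 1) q p * ellPoch (q ^ n * (s * t)⁻¹) (n + 1) q p := by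
    rw [ellPoch, ellPoch, ← Finset.prod_mul_distrib]
    refine Finset.prod_congr rfl fun k _ => ?_
    rw [thetaPM, hγe, show r * q ^ k * (s * t * r * (q ^ n)⁻¹) = d * s * (q ^ n)⁻¹ * q ^ k by
      rw [show r * q ^ k * (s * t * r * (q ^ n)⁻¹) = s * t * r ^ 2 * (q ^ n)⁻¹ * q ^ k by ring, hr]
      field_simp,
      show r * q ^ k * (s * t * r * (q ^ n)⁻¹)⁻¹ = q ^ n * (s * t)⁻¹ * q ^ k by field_simp]
  have hα : ellPochPM (a * t * r) γ n q p =
      ellPoch (q * (b * c)⁻¹ * (q ^ n)⁻¹) n q p * ellPoch (a * (q ^ n * s⁻¹)) n q p := by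
    rw [ellPochPM_eq, hγe, show a * t * r * (s * t * r * (q ^ n)⁻¹) =
      q * (b * c)⁻¹ * (q ^ n)⁻¹ by
        rw [show a * t * r * (s * t * r * (q ^ n)⁻¹) = a * s * t * t * r ^ 2 * (q ^ n)⁻¹ by ring, hr]
        field_simp
        linear_combination hprod,
      show a * t * r * (s * t * r * (q ^ n)⁻¹)⁻¹ = a * (q ^ n * s⁻¹) by field_simp]
  have hg : -(q ^ n * (s * t)⁻¹)⁻¹ * (-r * γ⁻¹) = 1 := by rw [hγe]; field_simp
  rw [hP, hα, hr]
  simp only [div_eq_mul_inv]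
  linear_combination (theta (d * s * (q ^ n)⁻¹) p * theta (q ^ n * (s * t)⁻¹) p *
    (ellPoch (q * (d * t⁻¹)) n q p * ellPoch q n q p) *
    (ellPoch (q * (b * c)⁻¹ * (q ^ n)⁻¹) n q p * ellPoch (a * (q ^ n * s⁻¹)) n q p) *
    (ellPoch (d * s * (q ^ n)⁻¹) (n + 1) q p * ellPoch (q ^ n * (s * t)⁻¹) (n + 1) q p)⁻¹) * hg

end Norm

section Norm

variable {p q z : ℂ} {a b c d s t u r : ℂ}

set_option maxHeartbeats 2000000 in
/-- The value of `betaFun_bioNum_mul_ellPochPM`, with the factor comparing `bioNum` with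
`θ(a x^{±1})_n` at the point `q⁻ⁿ s`, simplifies to the normalization `bioNorm`. -/
theorem bioNorm_identity (H : Nomes p q) (hG : Generic p q ![a, b, c, d, s, p * t])
    (hprod : a * b * c * d * s * t = q) {n : ℕ} (hq : ellPoch q n q p ≠ 0) :
    bioFactor n s q * (bioCoef n a b c d s t q p n * ellPochPM d (s * (q ^ n)⁻¹) n q p /
      ellPochPM a (s * (q ^ n)⁻¹) n q p *
      (betaProd ![a * q ^ n, b, c, d, s * (q ^ n)⁻¹, p * t] p q *
      ((ellPoch (a * d) n q p * ellPoch (a * t) n q p)⁻¹ *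
        (theta (d * s * (q ^ n)⁻¹) p * theta (q ^ n * (s * t)⁻¹) p *
        (ellPoch (q * (d * t⁻¹)) n q p * ellPoch q n q p) *
        (ellPoch (q * (b * c)⁻¹ * (q ^ n)⁻¹) n q p * ellPoch (a * (q ^ n * s⁻¹)) n q p) /
        (ellPoch (d * s * (q ^ n)⁻¹) (n + 1) q p *
          ellPoch (q ^ n * (s * t)⁻¹) (n + 1) q p))))) =
      bioNorm n a b c d s t q p * betaProd ![a, b, c, d, s, p * t] p q := by
  have hq0 := H.q_ne
  obtain ⟨ha, hb, hc, hd, hs, ht⟩ := ne_zero_of_prod_eq hq0 hprod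
  have hqn := pow_ne_zero n hq0
  have hT := triPow_ne_zero hq0 n
  have hpt {y : ℂ} (h : NonRes p q (y * (p * t))) : NonRes p q (y * t) :=
    h.of_eq_mul H (-1) 0 (by have := H.p_ne; simp; field_simp)
  have nas : NonRes p q (a * s) := hG.mul 0 4
  have nbs : NonRes p q (b * s) := hG.mul 1 4
  have ncs : NonRes p q (c * s) := hG.mul 2 4
  have nds : NonRes p q (d * s) := hG.mul 3 4
  have nad : NonRes p q (a * d) := hG.mul 0 3
  have nbd : NonRes p q (b * d) := hG.mul 1 3
  have ncd : NonRes p q (c * d) := hG.mul 2 3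
  have nbc : NonRes p q (b * c) := hG.mul 1 2
  have nst : NonRes p q (s * t) := hpt (hG.mul 4 5)
  have ndt : NonRes p q (d * t) := hpt (hG.mul 3 5)
  have nat : NonRes p q (a * t) := hpt (hG.mul 0 5)
  have ndivs : NonRes p q (d * s⁻¹) := hG.div 3 4 (by decide)
  have ndas : NonRes p q (a * s⁻¹) := hG.div 0 4 (by decide)
  have hB := betaProd_mul_pow_fst H hG n
  have r1 := ellPoch_reverse H nas.1 n
  have r2 := ellPoch_reverse H nbs.1 n
  have r3 := ellPoch_reverse H ncs.1 n
  have r4 := ellPoch_reflect H nst.1 n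
  rw [show p * (s * t) * (q ^ n)⁻¹ = s * (p * t) * (q ^ n)⁻¹ by ring] at r4
  have r5 := ellPoch_reverse H (z := q * (b * c)⁻¹) (by positivity) n
  rw [show q * (q * (b * c)⁻¹)⁻¹ = b * c by field_simp] at r5
  have r6 := ellPoch_p_mul H nat.1 n
  rw [show p * (a * t) = a * (p * t) by ring] at r6
  have r7 := ellPoch_reverse H (z := 1) one_ne_zero n
  rw [inv_one, mul_one, one_mul] at r7
  have r8 := ellPoch_reverse H (z := d * t * q) (by positivity) n
  rw [show q * (d * t * q)⁻¹ = (d * t)⁻¹ by field_simp] at r8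
  have r9 := ellPoch_reverse H (z := d * s * q) (by positivity) n
  rw [show q * (d * s * q)⁻¹ = (d * s)⁻¹ by field_simp,
    show d * s * q * (q ^ n)⁻¹ = d * s * (q ^ n)⁻¹ * q by ring] at r9
  have r10 := ellPoch_succ' (d * s * (q ^ n)⁻¹) n q p
  have r11 := ellPoch_succ (q ^ n * (s * t)⁻¹) n q p
  rw [show q ^ n * (s * t)⁻¹ * q ^ n = q ^ (2 * n) * (s * t)⁻¹ by ring] at r11
  have r12 : theta (s * t)⁻¹ p * ellPoch (q * (s * t)⁻¹) n q p =
      ellPoch (s * t)⁻¹ n q p * theta (q ^ n * (s * t)⁻¹) p := by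
    rw [mul_comm q, ← ellPoch_succ', ellPoch_succ, mul_comm (q ^ n)]
  have r13 : ellPoch (d * s⁻¹) n q p * ellPoch (d * (q ^ n * s⁻¹)) n q p *
      theta (d * s⁻¹ * q ^ (2 * n)) p = theta (d * s⁻¹) p * ellPoch (q * (d * s⁻¹)) n q p *
      ellPoch (q ^ n * (q * (d * s⁻¹))) n q p := by
    have h1 := ellPoch_succ (d * s⁻¹) (n + n) q p
    rw [ellPoch_succ', ellPoch_add, ellPoch_add, show d * s⁻¹ * q ^ (n + n) =
      d * s⁻¹ * q ^ (2 * n) by ring, show d * s⁻¹ * q ^ n = d * (q ^ n * s⁻¹) by ring,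
      show d * s⁻¹ * q * q ^ n = q ^ n * (q * (d * s⁻¹)) by ring, mul_comm (d * s⁻¹) q] at h1
    rw [← h1, mul_assoc]
  have hM : q ^ n * ((-(q * (a * s)⁻¹)) ^ n * (-(q * (b * s)⁻¹)) ^ n * (-(q * (c * s)⁻¹)) ^ n) *
      ((-(a * t)⁻¹) ^ n * (-(d * t)⁻¹) ^ n * (-(d * s)⁻¹) ^ n) * q ^ n =
      ((q * s⁻¹) ^ n) ^ 2 * ((-q) ^ n * (-(b * c)) ^ n) := by
    simp only [← mul_pow, ← pow_mul]
    rw [mul_comm n 2, pow_mul, ← mul_pow]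
    congr 1
    field_simp
    linear_combination -(a * b * c * d * s * t + q) * hprod
  have k1 := (nas.of_eq_mul H (w := a * s * (q ^ n)⁻¹) 0 (-n) (by simp)).ellPoch_ne_zero H n
  have k2 := (nbs.of_eq_mul H (w := b * s * (q ^ n)⁻¹) 0 (-n) (by simp)).ellPoch_ne_zero H n
  have k3 := (ncs.of_eq_mul H (w := c * s * (q ^ n)⁻¹) 0 (-n) (by simp)).ellPoch_ne_zero H n
  have k4 := (nds.of_eq_mul H (w := d * s * (q ^ n)⁻¹) 0 (-n) (by simp)).ellPoch_ne_zero H n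
  have k5 := (nst.inv.of_eq_mul H (w := q * (s * t)⁻¹) 0 1 (by simp [mul_comm])).ellPoch_ne_zero
    H n
  have k6 := nad.ellPoch_ne_zero H n
  have k7 := nbd.ellPoch_ne_zero H n
  have k8 := ncd.ellPoch_ne_zero H n
  have k9 := nat.ellPoch_ne_zero H n
  have k10 := ndt.inv.ellPoch_ne_zero H n
  have k11 := nds.inv.ellPoch_ne_zero H n
  have k12 := nst.inv.ellPoch_ne_zero H n
  have k13 := (nst.inv.of_eq_mul H (w := q ^ n * (s * t)⁻¹) 0 n (by
    simp [mul_comm])).ellPoch_ne_zero H n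
  have k14 := (nst.inv.of_eq_mul H (w := q ^ (2 * n) * (s * t)⁻¹) 0 (2 * n : ℕ) (by
    rw [zpow_natCast]; simp [mul_comm])).theta_ne_zero H
  have k15 := (ndas.of_eq_mul H (w := a * (q ^ n * s⁻¹)) 0 n (by simp; ring)).ellPoch_ne_zero H n
  have k16 := ndivs.theta_ne_zero H
  have k17 := (ndivs.of_eq_mul H (w := q ^ n * (q * (d * s⁻¹))) 0 (n + 1 : ℕ) (by
    rw [zpow_natCast]; simp; ring)).ellPoch_ne_zero H n
  have k18 := (nds.of_eq_mul H (w := d * s * (q ^ n)⁻¹) 0 (-n) (by simp)).theta_ne_zero H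
  have k19 : (-(d * t)⁻¹) ^ n ≠ 0 := pow_ne_zero n (neg_ne_zero.2 (by positivity))
  have k20 : (-(d * s)⁻¹) ^ n ≠ 0 := pow_ne_zero n (neg_ne_zero.2 (by positivity))
  have k21 : (-q) ^ n ≠ 0 := pow_ne_zero n (neg_ne_zero.2 hq0)
  have k22 : (-(b * c)) ^ n ≠ 0 := pow_ne_zero n (neg_ne_zero.2 (by positivity))
  have k23 : (q * s⁻¹) ^ n ≠ 0 := by positivity
  rw [bioNorm, bioCoef, bioFactor, ellPochPM_eq, ellPochPM_eq,
    show d * (s * (q ^ n)⁻¹) = d * s * (q ^ n)⁻¹ by ring,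
    show d * (s * (q ^ n)⁻¹)⁻¹ = d * (q ^ n * s⁻¹) by field_simp,
    show a * (s * (q ^ n)⁻¹) = a * s * (q ^ n)⁻¹ by ring,
    show a * (s * (q ^ n)⁻¹)⁻¹ = a * (q ^ n * s⁻¹) by field_simp, mul_pow _ (triPow q n) 2,
    show d * t * q * (q ^ n)⁻¹ = d * t * q * (q ^ n)⁻¹ by ring, r10, r11, r1, r2, r3, r5]
  rw [r6, ← r4] at hB
  rw [r7] at hq ⊢
  rw [r8] at k10 ⊢
  rw [r9] at k11 ⊢
  have k24 := nst.inv.theta_ne_zero H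
  rw [← eq_div_iff (by positivity)] at hB
  rw [hB]
  clear hB
  have hM' : ((-(a * t)⁻¹) ^ n) * (q ^ n * ((-(q * (a * s)⁻¹)) ^ n * (-(q * (b * s)⁻¹)) ^ n *
      (-(q * (c * s)⁻¹)) ^ n) * ((-(d * t)⁻¹) ^ n * (-(d * s)⁻¹) ^ n) * q ^ n) =
      ((q * s⁻¹) ^ n) ^ 2 * ((-q) ^ n * (-(b * c)) ^ n) := by rw [← hM]; ring
  have j1 : (-(q * (a * s)⁻¹)) ^ n ≠ 0 := pow_ne_zero n (neg_ne_zero.2 (by positivity))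
  have j2 : (-(q * (b * s)⁻¹)) ^ n ≠ 0 := pow_ne_zero n (neg_ne_zero.2 (by positivity))
  have j3 : (-(q * (c * s)⁻¹)) ^ n ≠ 0 := pow_ne_zero n (neg_ne_zero.2 (by positivity))
  -- What remains is an identity of rational functions in the theta factors, in which the monomials are
  -- compared by `hM'`.
  clear r1 r2 r3 r4 r5 r6 r7 r8 r9 r10 r11 hM hG nas nbs ncs nds nad nbd ncd nbc nst ndt nat ndivs
    ndas hprod hpt
  generalize betaProd ![a, b, c, d, s, p * t] p q = B
  generalize ellPoch (a * s * (q ^ n)⁻¹) n q p = A1 at *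
  generalize ellPoch (b * s * (q ^ n)⁻¹) n q p = A2 at *
  generalize ellPoch (c * s * (q ^ n)⁻¹) n q p = A3 at *
  generalize ellPoch (d * s * (q ^ n)⁻¹) n q p = A4 at *
  generalize ellPoch (q * (s * t)⁻¹) n q p = A5 at *
  generalize ellPoch (a * d) n q p = A6 at *
  generalize ellPoch (b * d) n q p = A7 at *
  generalize ellPoch (c * d) n q p = A8 at *
  generalize ellPoch (a * t) n q p = A9 at *
  generalize ellPoch (d * t * q * (q ^ n)⁻¹) n q p = A10 at *
  generalize ellPoch (d * s * (q ^ n)⁻¹ * q) n q p = A11 at *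
  generalize ellPoch (s * t)⁻¹ n q p = A12 at *
  generalize ellPoch (q ^ n * (s * t)⁻¹) n q p = A13 at *
  generalize theta (q ^ (2 * n) * (s * t)⁻¹) p = A14 at *
  generalize ellPoch (a * (q ^ n * s⁻¹)) n q p = A15 at *
  generalize theta (d * s⁻¹ * q ^ (2 * n)) p = A25 at *
  generalize ellPoch (q ^ n * (q * (d * s⁻¹))) n q p = A17 at *
  generalize ellPoch (q * (d * s⁻¹)) n q p = A26 at *
  generalize ellPoch (d * (q ^ n * s⁻¹)) n q p = A27 at *
  generalize ellPoch (d * s⁻¹) n q p = A28 at *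
  generalize theta (d * s⁻¹) p = A16 at *
  generalize theta (d * s * (q ^ n)⁻¹) p = A18 at *
  generalize theta (s * t)⁻¹ p = A24 at *
  generalize theta (q ^ n * (s * t)⁻¹) p = A29 at *
  generalize ellPoch (q * (b * c)⁻¹ * (q ^ n)⁻¹) n q p = A30 at *
  generalize ellPoch (q * (d * t⁻¹)) n q p = A31 at *
  generalize ellPoch (a * b) n q p = A32 at *
  generalize ellPoch (a * c) n q p = A33 at *
  generalize ellPoch (q ^ n)⁻¹ n q p = A34 at *
  generalize triPow q n = T at *
  generalize (-(d * t)⁻¹) ^ n = e1 at *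
  generalize (-(d * s)⁻¹) ^ n = e2 at *
  generalize (-q) ^ n = e3 at *
  generalize (-(b * c)) ^ n = e4 at *
  generalize (q * s⁻¹) ^ n = e5 at *
  generalize (-(a * t)⁻¹) ^ n = e6 at *
  generalize (-(q * (a * s)⁻¹)) ^ n = e7 at *
  generalize (-(q * (b * s)⁻¹)) ^ n = e8 at *
  generalize (-(q * (c * s)⁻¹)) ^ n = e9 at *
  generalize q ^ n = Q at *
  rw [← eq_div_iff (by positivity)] at hM'
  have r12' : A29 = A24 * A5 / A12 := by rw [eq_div_iff k12, r12, mul_comm]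
  have r13' : A26 = A28 * A27 * A25 / (A16 * A17) := by
    rw [eq_div_iff (by positivity), r13]
    ring
  subst hM' r12' r13'
  field_simp

end Norm

/-! ### Biorthogonality in one index -/

section SingleIndex

variable {p q z : ℂ} {a b c d s t u r : ℂ}

theorem betaFun_bioNum_mul_bioNum_self (H : Nomes p q)
    (hG : Generic p q ![a, b, c, d, s, p * t]) (hprod : a * b * c * d * s * t = q) {n : ℕ}
    (hq : ellPoch q n q p ≠ 0) {Z : List (ℝ → ℂ)} (hZ : CycleSeparates Z
      (latticePoints ![a, b, c, d, s * (q ^ n)⁻¹, p * t * (q ^ n)⁻¹] p q)) :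
    bioFactor n s q * betaFun p q ![a, b, c, d, s * (q ^ n)⁻¹, p * t * (q ^ n)⁻¹] Z
      (fun x => bioNum n a b c d t s q p x * bioNum n a b c d s t q p x) =
      bioNorm n a b c d s t q p * betaProd ![a, b, c, d, s, p * t] p q := by
  have hq0 := H.q_ne
  obtain ⟨ha, hb, hc, hd, hs, ht⟩ := ne_zero_of_prod_eq hq0 hprod
  rw [← bioNorm_identity H hG hprod hq, ← betaFun_bioNum_mul_ellPochPM H hG hprod hq hZ]
  congr 1
  obtain ⟨y, hy⟩ : ∃ y, y = s * (q ^ n)⁻¹ := ⟨_, rfl⟩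
  rw [← hy] at hZ ⊢
  set c₀ := bioCoef n a b c d s t q p n * ellPochPM d y n q p / ellPochPM a y n q p with hc₀
  have hay : ellPochPM a y n q p ≠ 0 := by
    rw [ellPochPM_eq]
    refine mul_ne_zero (NonRes.ellPoch_ne_zero H ?_ n) (NonRes.ellPoch_ne_zero H ?_ n)
    · exact (hG.mul 0 4).of_eq_mul H 0 (-n) (by simp [hy]; ring)
    · exact (hG.div 0 4 (by decide)).of_eq_mul H 0 n (by simp [hy]; ring)
  have hpa := isEvenTheta_ellPochPM H.p_ne H.p_lt hq0 ha n
  have hF := (isEvenTheta_bioNum H n a b c t hd hs).sub (hpa.const_mul c₀)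
  have h0 := betaFun_bioNum_mul_eq_zero_of_apply H hG hprod hq hF (by
    rw [bioNum_apply H hs, ← hy, hc₀, div_mul_cancel₀ _ hay, sub_self]) (hy ▸ hZ)
  rw [← hy] at h0
  have ht0 : ∀ m, ![a, b, c, d, y, p * t * (q ^ n)⁻¹] m ≠ 0 := by
    simp [Fin.forall_fin_succ, hy, ha, hb, hc, hd, hs, hq0, H.p_ne, ht]
  have hN := differentiableAt_bioNum H n a b c hd ht s (q := q) (p := p)
  have hsum := H.betaFun_sum ht0 hZ Finset.univ (F := fun (i : Bool) x => cond i
    (bioNum n a b c d t s q p x * (bioNum n a b c d s t q p x - c₀ * ellPochPM a x n q p))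
    (c₀ * (bioNum n a b c d t s q p x * ellPochPM a x n q p))) (by
    rintro (_ | _) - x hx
    · exact ((hN x hx).mul (hpa.diff x hx)).const_mul c₀
    · exact (hN x hx).mul (hF.diff x hx))
  simp only [Fintype.sum_bool, cond_true, cond_false] at hsum
  rw [h0, zero_add, betaFun_const_mul] at hsum
  rw [← hsum]
  congr 2
  ext x
  ring

/-- The denominators of the two rational functions shift the last two parameters of the kernel. -/
theorem betaFun_bioRat_mul_bioRat (H : Nomes p q) (hs : s ≠ 0) (ht : t ≠ 0)
    (h0 : ∀ j, ![a, b, c, d, s, p * t] j ≠ 0) (m n : ℕ) {Z : List (ℝ → ℂ)} {P : Set ℂ}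
    (hZ : CycleSeparates Z P) :
    betaFun p q ![a, b, c, d, s, p * t] Z
      (fun x => bioRat n a b c d t s q p x * bioRat m a b c d s t q p x) =
    bioFactor m s q * betaFun p q ![a, b, c, d, s * (q ^ m)⁻¹, p * t * (q ^ n)⁻¹] Z
      (fun x => bioNum n a b c d t s q p x * bioNum m a b c d s t q p x) := by
  rw [← betaFun_const_mul]
  refine betaFun_congr hZ (countable_not_offPoles (p := p) (q := q) h0) fun x _ hx => ?_
  rw [bioRat_mul_bioRat_mul_betaKernel H hs ht (not_not.1 hx), ← mul_assoc]

/-- Filled up with theta factors that belong to the parameter `s`, the numerator of degree `m` becomes an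
even theta function of degree `n - 1`, to which `betaFun_bioNum_mul_eq_zero` applies. The cycle may
not separate the poles of the new kernel, but it can be exchanged for one that does. -/
theorem betaFun_bioRat_mul_bioRat_of_lt (H : Nomes p q)
    (hG : Generic p q ![a, b, c, d, s, p * t]) (hprod : a * b * c * d * s * t = q) {m n : ℕ}
    (hmn : m < n) (hq : ellPoch q n q p ≠ 0) {Z : List (ℝ → ℂ)} (hZ : CycleSeparates Z
      (latticePoints ![a, b, c, d, s * (q ^ m)⁻¹, p * t * (q ^ n)⁻¹] p q)) :
    betaFun p q ![a, b, c, d, s, p * t] Z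
      (fun x => bioRat n a b c d t s q p x * bioRat m a b c d s t q p x) = 0 := by
  have hq0 := H.q_ne
  obtain ⟨ha, hb, hc, hd, hs, ht⟩ := ne_zero_of_prod_eq hq0 hprod
  rw [betaFun_bioRat_mul_bioRat H hs ht hG.ne_zero m n hZ]
  obtain ⟨k, rfl⟩ := Nat.exists_eq_add_of_lt hmn
  have hG' : Generic p q
      ![a, b, c, d, s * (q ^ (m + k))⁻¹, p * t * (q ^ (m + k + 1))⁻¹] := by
    refine hG.shift H fun j => ?_
    fin_cases j
    · exact ⟨0, 0, by simp⟩
    · exact ⟨0, 0, by simp⟩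
    · exact ⟨0, 0, by simp⟩
    · exact ⟨0, 0, by simp⟩
    · exact ⟨0, -(m + k : ℕ), by rw [zpow_neg, zpow_natCast]; simp⟩
    · exact ⟨0, -(m + k + 1 : ℕ), by rw [zpow_neg, zpow_natCast]; simp⟩
  obtain ⟨Z', hZ'⟩ := hG'.exists_cycle H
  have e : ∀ j, ![a, b, c, d, s * (q ^ m)⁻¹, p * t * (q ^ (m + k + 1))⁻¹] j =
      ![a, b, c, d, s * (q ^ (m + k))⁻¹, p * t * (q ^ (m + k + 1))⁻¹] j *
        q ^ (![0, 0, 0, 0, k, 0] : Fin 6 → ℕ) j := by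
    intro j
    fin_cases j <;> simp
    rw [pow_add]
    field_simp
  have ht0 : ∀ j, ![a, b, c, d, s * (q ^ m)⁻¹, p * t * (q ^ (m + k + 1))⁻¹] j ≠ 0 := by
    simp [Fin.forall_fin_succ, ha, hb, hc, hd, hs, hq0, H.p_ne, ht]
  have hR := isEvenTheta_bioNum H m a b c t hd hs
  rw [H.betaFun_eq_of_separates ht0 hZ (hZ'.mono (latticePoints_subset (m := fun _ => 0)
      fun j => by rw [e j, pow_zero, one_mul]))
      (F := fun x => bioNum (m + k + 1) a b c d t s q p x * bioNum m a b c d s t q p x)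
      fun x hx => (differentiableAt_bioNum H _ a b c hd ht s x hx).mul (hR.diff x hx),
    ← H.betaFun_prod_mul ![0, 0, 0, 0, k, 0] hG'.ne_zero e hZ' (G := fun x =>
      bioNum (m + k + 1) a b c d t s q p x * (bioNum m a b c d s t q p x *
        ellPochPM (s * (q ^ (m + k))⁻¹) x k q p)),
    betaFun_bioNum_mul_eq_zero H hG hprod hq
      (hR.mul (isEvenTheta_ellPochPM H.p_ne H.p_lt hq0 (by positivity) k)) hZ', mul_zero]
  intro x _
  rw [Fin.prod_univ_six]
  simp only [Matrix.cons_val, ellPochPM_zero, one_mul, mul_one]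
  ring

theorem vec_swap (a b c d u v : ℂ) (j : Fin 6) :
    ![a, b, c, d, u, v] (Equiv.swap 4 5 j) = ![a, b, c, d, v, u] j := by
  fin_cases j <;> rfl

/-- The functions `bioRat n` with the parameters `(t, s)` and `bioRat m` with the parameters
`(s, t)` are biorthogonal with respect to the beta kernel. -/
theorem betaFun_bioRat_mul_bioRat_eq (H : Nomes p q)
    (hG : Generic p q ![a, b, c, d, s, p * t]) (hprod : a * b * c * d * s * t = q) {m n : ℕ}
    (hm : ellPoch q m q p ≠ 0) (hn : ellPoch q n q p ≠ 0) {Z : List (ℝ → ℂ)}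
    (hZ : CycleSeparates Z
      (latticePoints ![a, b, c, d, s * (q ^ m)⁻¹, p * t * (q ^ n)⁻¹] p q)) :
    betaFun p q ![a, b, c, d, s, p * t] Z
      (fun x => bioRat n a b c d t s q p x * bioRat m a b c d s t q p x) =
    (if m = n then 1 else 0) * (bioNorm n a b c d s t q p *
      betaProd ![a, b, c, d, s, p * t] p q) := by
  have hp0 := H.p_ne
  obtain ⟨ha, hb, hc, hd, hs, ht⟩ := ne_zero_of_prod_eq H.q_ne hprod
  rcases lt_trichotomy m n with h | rfl | h
  · rw [if_neg h.ne, zero_mul, betaFun_bioRat_mul_bioRat_of_lt H hG hprod h hn hZ]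
  · rw [if_pos rfl, one_mul, betaFun_bioRat_mul_bioRat H hs ht hG.ne_zero m m hZ,
      betaFun_bioNum_mul_bioNum_self H hG hprod hm hZ]
  -- The remaining case follows from the first by exchanging the last two parameters.
  · rw [if_neg h.ne', zero_mul]
    have es : p * (p⁻¹ * s) = s := mul_inv_cancel_left₀ hp0 s
    have hG' : Generic p q ![a, b, c, d, p * t, p * (p⁻¹ * s)] := by
      rw [es, ← funext (vec_swap a b c d s (p * t))]
      exact hG.perm (Equiv.swap 4 5)
    have hZ' : CycleSeparates Z (latticePoints
        ![a, b, c, d, p * t * (q ^ n)⁻¹, p * (p⁻¹ * s) * (q ^ m)⁻¹] p q) := by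
      refine hZ.mono fun x hx => ?_
      rw [es] at hx
      obtain ⟨j, i, k, e⟩ := hx
      exact ⟨Equiv.swap 4 5 j, i, k, by rw [vec_swap]; exact e⟩
    rw [← betaFun_bioRat_mul_bioRat_of_lt H hG' (by field_simp; linear_combination hprod) h hm hZ']
    refine betaFun_congr hZ Set.countable_empty fun x hx _ => ?_
    have e1 := bioRat_zpow_mul H hprod m hx 0 0 (-1) 1 (by norm_num)
    have e2 := bioRat_zpow_mul H (a := a) (b := b) (c := c) (d := d) (s := t)
      (t := s) (by linear_combination hprod) n hx 0 0 1 (-1)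
      (by norm_num)
    simp only [zpow_zero, one_mul, zpow_neg, zpow_one] at e1 e2
    rw [e1, e2, es, betaKernel_vec, betaKernel_vec]
    ring

end SingleIndex

/-! ### Biorthogonality in two indices for generic parameters -/

section TwoIndex

variable {p q z : ℂ} {a b c d s t t' u r : ℂ}

/-- The factor by which `θ(w x^{±1})_n` changes when `w` is divided by `p ^ k`. -/
def shiftFactor (n k : ℕ) (w q p : ℂ) : ℂ :=
  ((w ^ 2) ^ k * (triPow p (k + 1) ^ 2)⁻¹) ^ n * triPow q n ^ (2 * k)

theorem thetaPM_mul_pow_inv (H : Nomes p q) {w x : ℂ} (hw : w ≠ 0) (hx : x ≠ 0) (k : ℕ) :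
    thetaPM (w * (p ^ k)⁻¹) x p = (w ^ 2) ^ k * (triPow p (k + 1) ^ 2)⁻¹ * thetaPM w x p := by
  have hp := H.p_ne
  induction k with
  | zero => simp [triPow]
  | succ k ih =>
    have hk := pow_ne_zero k hp
    have e : thetaPM (w * (p ^ (k + 1))⁻¹) x p =
        (p⁻¹ * (w * (p ^ k)⁻¹)) ^ 2 * thetaPM (w * (p ^ k)⁻¹) x p := by
      rw [thetaPM, thetaPM, show w * (p ^ (k + 1))⁻¹ * x = p⁻¹ * (w * (p ^ k)⁻¹ * x) by
        rw [pow_succ, mul_inv]; ring, show w * (p ^ (k + 1))⁻¹ * x⁻¹ =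
        p⁻¹ * (w * (p ^ k)⁻¹ * x⁻¹) by rw [pow_succ, mul_inv]; ring,
        theta_div_p hp H.p_lt (by positivity), theta_div_p hp H.p_lt (by positivity)]
      field_simp
    have hT := triPow_ne_zero hp (k + 1)
    rw [e, ih, triPow_succ p (k + 1)]
    field_simp
    ring

theorem ellPochPM_mul_pow_inv (H : Nomes p q) {w x : ℂ} (hw : w ≠ 0) (hx : x ≠ 0) (n k : ℕ) :
    ellPochPM (w * (p ^ k)⁻¹) x n q p = shiftFactor n k w q p * ellPochPM w x n q p := by
  have hq := H.q_ne
  rw [ellPochPM, ellPochPM, Finset.prod_congr rfl fun j _ => show _ =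
    (w ^ 2) ^ k * (triPow p (k + 1) ^ 2)⁻¹ * (q ^ j) ^ (2 * k) * thetaPM (w * q ^ j) x p by
      rw [show w * (p ^ k)⁻¹ * q ^ j = w * q ^ j * (p ^ k)⁻¹ by ring,
        thetaPM_mul_pow_inv H (by positivity) hx]
      ring,
    Finset.prod_mul_distrib, Finset.prod_mul_distrib, Finset.prod_const, Finset.card_range,
    Finset.prod_pow, shiftFactor]
  rfl

/-- The constant in `bioRat_mul_bioRat_mul_betaKernel_shift`. -/
def bioShift (m n k l : ℕ) (s t q p : ℂ) : ℂ :=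
  bioFactor m s q * shiftFactor m k (s * (q ^ m)⁻¹) q p *
    shiftFactor n l (p * t * (q ^ n)⁻¹) q p

/-- The denominators of the rational functions with nome `p` can be absorbed after the last two
parameters of the kernel have been shifted by powers of `p`: theta functions with nome `p` change only
by monomials under such shifts, and the powers of `x` cancel by evenness. -/
theorem bioRat_mul_bioRat_mul_betaKernel_shift (H : Nomes p q) (hs : s ≠ 0) (ht : t ≠ 0) {x : ℂ}
    (hx : OffPoles p q ![a, b, c, d, s, p * t] x) (m n k l : ℕ) (a' b' : ℂ) :
    bioRat n a' b' c d t s q p x * bioRat m a' b' c d s t q p x *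
      betaKernel ![a, b, c, d, s * (p ^ k)⁻¹, p * t * (p ^ l)⁻¹] p q x =
    bioShift m n k l s t q p * (bioNum n a' b' c d t s q p x * bioNum m a' b' c d s t q p x *
      betaKernel ![a, b, c, d, s * (p ^ k * q ^ m)⁻¹, p * t * (p ^ l * q ^ n)⁻¹] p q x) := by
  have hq := H.q_ne
  have hp := H.p_ne
  have hx0 := hx.ne_zero
  have h4 : NonRes p q (s * (p ^ k)⁻¹ * x) ∧ NonRes p q (s * (p ^ k)⁻¹ * x⁻¹) :=
    ⟨(hx.2 4).1.of_eq_mul H (-k) 0 (by simp; ring), (hx.2 4).2.of_eq_mul H (-k) 0 (by simp; ring)⟩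
  have h5 : NonRes p q (p * t * (p ^ l)⁻¹ * x) ∧ NonRes p q (p * t * (p ^ l)⁻¹ * x⁻¹) :=
    ⟨(hx.2 5).1.of_eq_mul H (-l) 0 (by simp; ring), (hx.2 5).2.of_eq_mul H (-l) 0 (by simp; ring)⟩
  have e4 := ellPochPM_mul_bioRat_left H hs hx0
    (hx.ellPochPM_ne_zero H 4 0 (-m) (by simp) m) a' b' c d t
  have e5 := ellPochPM_mul_bioRat_right H ht hx0
    (hx.ellPochPM_ne_zero H 5 0 (-n) (by simp) n) a' b' c d s
  rw [betaKernel_vec, betaKernel_vec, ellGammaPM_eq_mul H hx0 h4.1 h4.2 m,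
    ellGammaPM_eq_mul H hx0 h5.1 h5.2 n, mul_assoc s, mul_assoc (p * t), ← mul_inv, ← mul_inv,
    show ellPochPM (s * (p ^ k * q ^ m)⁻¹) x m q p = _ by
      rw [mul_comm (p ^ k), mul_inv, ← mul_assoc, ellPochPM_mul_pow_inv H (by positivity) hx0],
    show ellPochPM (p * t * (p ^ l * q ^ n)⁻¹) x n q p = _ by
      rw [mul_comm (p ^ l), mul_inv, ← mul_assoc, ellPochPM_mul_pow_inv H (by positivity) hx0],
    bioShift]
  linear_combination (exp := 1) (ellGammaPM a x p q * ellGammaPM b x p q * ellGammaPM c x p q *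
    ellGammaPM d x p q * ellGammaPM (s * (p ^ k * q ^ m)⁻¹) x p q *
    ellGammaPM (p * t * (p ^ l * q ^ n)⁻¹) x p q * (theta (x ^ 2) p * theta (x ^ 2)⁻¹ q) *
    shiftFactor m k (s * (q ^ m)⁻¹) q p * shiftFactor n l (p * t * (q ^ n)⁻¹) q p) *
    (ellPochPM (p * t * (q ^ n)⁻¹) x n q p * bioRat n a' b' c d t s q p x * e4 +
      bioFactor m s q * bioNum m a' b' c d s t q p x * e5)

/-- The two-index product of rational functions, times the kernel, in terms of the numerators. -/
theorem bioRat_mul_bioRat_two_mul_betaKernel (H : Nomes p q) (hs : s ≠ 0) (ht : t ≠ 0)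
    (ht' : t' ≠ 0) (htt : q * t' = p * t) {x : ℂ} (hx : OffPoles p q ![a, b, c, d, s, p * t] x)
    (m n k l : ℕ) :
    bioRat n a b c d t s q p x * bioRat m a b c d s t q p x *
        (bioRat l a b c d t' s p q x * bioRat k a b c d s t' p q x) *
      betaKernel ![a, b, c, d, s, p * t] p q x =
    bioFactor k s p * bioShift m n k l s t q p *
      (bioNum n a b c d t s q p x * bioNum m a b c d s t q p x *
        (bioNum l a b c d t' s p q x * bioNum k a b c d s t' p q x)) *
      betaKernel ![a, b, c, d, s * (p ^ k * q ^ m)⁻¹, p * t * (p ^ l * q ^ n)⁻¹] p q x := by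
  have h1 := bioRat_mul_bioRat_mul_betaKernel_shift H hs ht hx m n k l a b
  have h2 := bioRat_mul_bioRat_mul_betaKernel H.symm hs ht' (a := a) (b := b) (c := c) (d := d)
    (by rw [htt]; exact hx.symm) k l
  rw [htt, ← H.betaKernel_comm _ hx.ne_zero, ← H.betaKernel_comm _ hx.ne_zero] at h2
  linear_combination bioRat n a b c d t s q p x * bioRat m a b c d s t q p x * h2 +
    bioFactor k s p * (bioNum l a b c d t' s p q x * bioNum k a b c d s t' p q x) * h1

theorem betaFun_bioRat_mul_bioRat_two_eq (H : Nomes p q) (hs : s ≠ 0) (ht : t ≠ 0) (ht' : t' ≠ 0)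
    (h0 : ∀ j, ![a, b, c, d, s, p * t] j ≠ 0) (htt : q * t' = p * t) (m n k l : ℕ)
    {Z : List (ℝ → ℂ)} {P : Set ℂ} (hZ : CycleSeparates Z P) :
    betaFun p q ![a, b, c, d, s, p * t] Z
      (fun x => bioRat n a b c d t s q p x * bioRat m a b c d s t q p x *
        (bioRat l a b c d t' s p q x * bioRat k a b c d s t' p q x)) =
    bioFactor k s p * bioShift m n k l s t q p *
      betaFun p q ![a, b, c, d, s * (p ^ k * q ^ m)⁻¹, p * t * (p ^ l * q ^ n)⁻¹] Z
      (fun x => bioNum n a b c d t s q p x * bioNum m a b c d s t q p x *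
        (bioNum l a b c d t' s p q x * bioNum k a b c d s t' p q x)) := by
  rw [← betaFun_const_mul]
  exact betaFun_congr hZ (countable_not_offPoles (p := p) (q := q) h0) fun x _ hxE =>
    bioRat_mul_bioRat_two_mul_betaKernel H hs ht ht' htt (not_not.1 hxE) m n k l

/-- The two-index analogue of `betaFun_bioRat_mul_bioRat_eq` reduces to that theorem once for
each nome: a product of numerators with nome `q` is a combination of theta monomials, each of which
is absorbed into the kernel as a shift of `a` and `b` by powers of `p`. Such shifts do not change
the functions with nome `p`. -/
theorem betaFun_bioRat_mul_bioRat_two (H : Nomes p q)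
    (hG : Generic p q ![a, b, c, d, s, p * t]) (hprod : a * b * c * d * s * t = q)
    (htt : q * t' = p * t) {m n k l : ℕ}
    (hm : ellPoch q m q p ≠ 0) (hn : ellPoch q n q p ≠ 0) (hk : ellPoch p k p q ≠ 0)
    (hl : ellPoch p l p q ≠ 0) {Z : List (ℝ → ℂ)} (hZ : CycleSeparates Z
      (latticePoints ![a, b, c, d, s * (p ^ k * q ^ m)⁻¹, p * t * (p ^ l * q ^ n)⁻¹] p q)) :
    betaFun p q ![a, b, c, d, s, p * t] Z
      (fun x => bioRat n a b c d t s q p x * bioRat m a b c d s t q p x *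
        (bioRat l a b c d t' s p q x * bioRat k a b c d s t' p q x)) =
    (if m = n then 1 else 0) * (if k = l then 1 else 0) * (bioNorm n a b c d s t q p *
      bioNorm l a b c d s t' p q * betaProd ![a, b, c, d, s, p * t] p q) := by
  have hp := H.p_ne
  have hq := H.q_ne
  obtain ⟨ha, hb, hc, hd, hs, ht⟩ := ne_zero_of_prod_eq hq hprod
  have ht' : t' ≠ 0 := by rintro rfl; exact mul_ne_zero hp ht (by rw [← htt, mul_zero])
  have hprod' : a * b * c * d * s * t' = p := by
    refine mul_left_cancel₀ hq ?_
    linear_combination a * b * c * d * s * htt + p * hprod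
  set τ₀ := ![a, b, c, d, s, p * t] with hτ₀
  set τ₁ := ![a, b, c, d, s * (p ^ k)⁻¹, p * t * (p ^ l)⁻¹] with hτ₁
  set τ := ![a, b, c, d, s * (p ^ k * q ^ m)⁻¹, p * t * (p ^ l * q ^ n)⁻¹] with hτ
  have hE := countable_not_offPoles (p := p) (q := q) hG.ne_zero
  have hτ₁0 : ∀ j, τ₁ j ≠ 0 := by
    simp [hτ₁, Fin.forall_fin_succ, ha, hb, hc, hd, hs, hp, ht]
  have hτ0 : ∀ j, τ j ≠ 0 := by
    simp [hτ, Fin.forall_fin_succ, ha, hb, hc, hd, hs, hp, hq, ht]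
  have hZ₁ : CycleSeparates Z (latticePoints τ₁ p q) :=
    hZ.mono (latticePoints_subset (m := fun _ => 0) (n := ![0, 0, 0, 0, m, n]) fun j => by
      fin_cases j <;> simp [hτ₁, hτ] <;> field_simp)
  -- The product of the numerators with nome `q`, expanded in theta monomials.
  have hgk := isEvenTheta_bioNum H.symm k a b c t' hd hs
  have hgl := isEvenTheta_bioNum H.symm l a b c s hd ht'
  obtain ⟨co, hco⟩ := IsEvenTheta.exists_expansion hq H.q_lt hp hb (l + k) (hgl.mul hgk) ha
    (fun i _ => NonRes.theta_ne_zero H.symm ((hG.mul 0 0).symm.of_eq_mul H.symm 0 (2 * i : ℕ) (by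
      rw [zpow_natCast, pow_mul']; simp [hτ₀]; ring)))
    (fun i _ j _ => mul_ne_zero
      (NonRes.theta_ne_zero H.symm ((hG.mul 0 1).symm.of_eq_mul H.symm 0 (i + j : ℕ) (by
        rw [zpow_natCast, pow_add]; simp [hτ₀]; ring)))
      (NonRes.theta_ne_zero H.symm ((hG.div 1 0 (by decide)).symm.of_eq_mul H.symm 0 (j - i) (by
        rw [zpow_sub₀ hp]; simp [hτ₀]; field_simp))))
  set E : ℕ → ℂ → ℂ := fun i x => ellPochPM a x i p q * ellPochPM b x (l + k - i) p q with hE'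
  have hEd (i : ℕ) : ∀ x ≠ 0, DifferentiableAt ℂ (E i) x := fun x hx =>
    ((isEvenTheta_ellPochPM hq H.q_lt hp ha i).diff x hx).mul
      ((isEvenTheta_ellPochPM hq H.q_lt hp hb _).diff x hx)
  -- The contribution of one monomial.
  have hmon (i : ℕ) (hi : i ≤ l + k) : bioShift m n k l s t q p * betaFun p q τ Z (fun x =>
      bioNum n a b c d t s q p x * bioNum m a b c d s t q p x * E i x) =
      (if m = n then 1 else 0) * bioNorm n a b c d s t q p * betaFun q p τ₁ Z (E i) := by
    have e : ∀ j, ![a * p ^ i, b * p ^ (l + k - i), c, d, s * (p ^ k)⁻¹, p * t * (p ^ l)⁻¹] j =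
        τ₁ j * p ^ (![i, l + k - i, 0, 0, 0, 0] : Fin 6 → ℕ) j := by
      intro j
      fin_cases j <;> simp [hτ₁]
    have hEp : ∀ x, E i x = ∏ j, ellPochPM (τ₁ j) x
        ((![i, l + k - i, 0, 0, 0, 0] : Fin 6 → ℕ) j) p q := fun x => by
      rw [Fin.prod_univ_six]
      simp [hτ₁, ellPochPM_zero, hE']
    have hpow : p ^ i * p ^ (l + k - i) = p ^ k * p ^ l := by
      rw [← pow_add, ← pow_add]
      congr 1
      omega
    have hprod₁ : a * p ^ i * (b * p ^ (l + k - i)) * c * d * (s * (p ^ k)⁻¹) *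
        (t * (p ^ l)⁻¹) = q := by
      rw [show a * p ^ i * (b * p ^ (l + k - i)) * c * d * (s * (p ^ k)⁻¹) * (t * (p ^ l)⁻¹) =
        p ^ i * p ^ (l + k - i) * (p ^ k * p ^ l)⁻¹ * (a * b * c * d * s * t) by
          rw [mul_inv]; ring, hpow, mul_inv_cancel₀ (by positivity), one_mul, hprod]
    have hG₁ : Generic p q
        ![a * p ^ i, b * p ^ (l + k - i), c, d, s * (p ^ k)⁻¹, p * (t * (p ^ l)⁻¹)] := by
      refine hG.shift H fun j => ?_
      fin_cases j
      · exact ⟨i, 0, by simp [hτ₀]⟩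
      · exact ⟨(l + k - i : ℕ), 0, by rw [zpow_natCast]; simp [hτ₀]⟩
      · exact ⟨0, 0, by simp [hτ₀]⟩
      · exact ⟨0, 0, by simp [hτ₀]⟩
      · exact ⟨-k, 0, by simp [hτ₀]⟩
      · exact ⟨-l, 0, by simp [hτ₀]; ring⟩
    have hS := betaFun_bioRat_mul_bioRat_eq H hG₁ hprod₁ hm hn (hZ.mono (latticePoints_subset
      (m := ![i, l + k - i, 0, 0, 0, 0]) (n := fun _ => 0) fun j => by
        fin_cases j <;> simp [hτ] <;> ring))
    have hinv := bioNorm_zpow_mul H hprod n i (l + k - i : ℕ) (-k) (-l) (by omega)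
    rw [← mul_assoc p t] at hS
    rw [← betaFun_const_mul, betaFun_congr (t' := τ₁) (G := fun x => E i x *
      (bioRat n a b c d t s q p x * bioRat m a b c d s t q p x)) hZ hE fun x hx hxE => by
        have := bioRat_mul_bioRat_mul_betaKernel_shift H hs ht (not_not.1 hxE) m n k l a b
        linear_combination -(E i x) * this,
      H.betaFun_comm _ hZ, H.symm.betaFun_prod_mul _ hτ₁0 e hZ fun x _ => by rw [hEp],
      H.symm.betaFun_comm _ hZ]
    have hone : betaFun q p τ₁ Z (E i) = betaProd ![a * p ^ i, b * p ^ (l + k - i), c, d,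
        s * (p ^ k)⁻¹, p * t * (p ^ l)⁻¹] p q := by
      rw [H.symm.betaFun_prod_mul (F := fun _ => 1) _ hτ₁0 e hZ fun x _ => by rw [hEp, mul_one],
        H.symm.betaFun_comm _ hZ, H.betaFun_one _ (hZ₁.mono (latticePoints_subset
          (n := fun _ => 0) fun j => by rw [e j, pow_zero (q : ℂ), mul_one]))]
      rw [Fin.prod_univ_six]
      simp only [Matrix.cons_val]
      linear_combination p * hprod₁
    rw [hone, mul_assoc _ (bioNorm n a b c d s t q p), ← show _ = bioNorm n a b c d s t q p by
      simpa only [zpow_natCast, zpow_neg, mul_comm] using hinv, ← hS]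
    refine betaFun_congr_fun hZ fun x hx => ?_
    have h1 := bioRat_zpow_mul H hprod m hx i (l + k - i : ℕ) (-k) (-l) (by omega)
    have h2 := bioRat_zpow_mul H (a := a) (b := b) (c := c) (d := d) (s := t) (t := s)
      (by linear_combination hprod) n hx i (l + k - i : ℕ) (-l) (-k) (by omega)
    simp only [zpow_natCast, zpow_neg, mul_comm _ a, mul_comm _ b, mul_comm _ s, mul_comm _ t]
      at h1 h2
    rw [h1, h2]
  have hNd (x : ℂ) (hx : x ≠ 0) : DifferentiableAt ℂ
      (fun x => bioNum n a b c d t s q p x * bioNum m a b c d s t q p x) x :=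
    (differentiableAt_bioNum H n a b c hd ht s x hx).mul
      (differentiableAt_bioNum H m a b c hd hs t x hx)
  have hsum := H.betaFun_sum hτ0 hZ (Finset.range (l + k + 1)) (F := fun i x =>
    co i * (bioNum n a b c d t s q p x * bioNum m a b c d s t q p x * E i x))
    fun i _ x hx => ((hNd x hx).mul (hEd i x hx)).const_mul (co i)
  have hsum' := H.symm.betaFun_sum hτ₁0 (latticePoints_comm τ₁ p q ▸ hZ₁)
    (Finset.range (l + k + 1)) (F := fun i x => co i * E i x)
    fun i _ x hx => (hEd i x hx).const_mul (co i)
  simp only [betaFun_const_mul] at hsum hsum'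
  have hQ := betaFun_bioRat_mul_bioRat_eq H.symm (t := t') (by rw [htt]; exact hG.symm) hprod'
    hk hl (Z := Z) (by rw [latticePoints_comm, htt]; exact hZ₁)
  rw [betaFun_bioRat_mul_bioRat H.symm hs ht' (by rw [htt]; exact hG.ne_zero) k l hZ, htt,
    betaFun_congr_fun hZ hco, hsum', betaProd_comm] at hQ
  rw [betaFun_bioRat_mul_bioRat_two_eq H hs ht ht' hG.ne_zero htt m n k l hZ,
    betaFun_congr_fun hZ (G := fun x => ∑ i ∈ Finset.range (l + k + 1),
      co i * (bioNum n a b c d t s q p x * bioNum m a b c d s t q p x * E i x)) fun x hx => by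
        rw [hco x hx, Finset.mul_sum]
        exact Finset.sum_congr rfl fun i _ => mul_left_comm _ _ _,
    hsum, mul_assoc, show (if m = n then (1 : ℂ) else 0) * (if k = l then 1 else 0) *
      (bioNorm n a b c d s t q p * bioNorm l a b c d s t' p q * betaProd τ₀ p q) =
      (if m = n then 1 else 0) * bioNorm n a b c d s t q p * ((if k = l then 1 else 0) *
        (bioNorm l a b c d s t' p q * betaProd τ₀ p q)) by ring, ← hQ,
    mul_left_comm _ (bioFactor k s p)]
  congr 1
  rw [Finset.mul_sum, Finset.mul_sum]
  refine Finset.sum_congr rfl fun i hi => ?_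
  rw [mul_left_comm, hmon i (Nat.lt_succ_iff.1 (Finset.mem_range.1 hi))]
  ring

end TwoIndex

/-! ### Analytic dependence on the parameters -/

section Analytic

variable {p q : ℂ} {E : Type*} [NormedAddCommGroup E] [NormedSpace ℂ E] {y : E}
  {f g a b c d s t x : E → ℂ}

/-- `f` is analytic and nonzero at `y`. -/
def IsAnalyticUnitAt (f : E → ℂ) (y : E) : Prop := AnalyticAt ℂ f y ∧ f y ≠ 0

namespace IsAnalyticUnitAt

theorem mul (hf : IsAnalyticUnitAt f y) (hg : IsAnalyticUnitAt g y) :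
    IsAnalyticUnitAt (fun y => f y * g y) y :=
  ⟨hf.1.mul hg.1, mul_ne_zero hf.2 hg.2⟩

theorem inv (hf : IsAnalyticUnitAt f y) : IsAnalyticUnitAt (fun y => (f y)⁻¹) y :=
  ⟨hf.1.inv hf.2, inv_ne_zero hf.2⟩

theorem pow (hf : IsAnalyticUnitAt f y) (n : ℕ) : IsAnalyticUnitAt (fun y => f y ^ n) y :=
  ⟨hf.1.pow n, pow_ne_zero n hf.2⟩

theorem const {r : ℂ} (hr : r ≠ 0) : IsAnalyticUnitAt (fun _ : E => r) y :=
  ⟨analyticAt_const, hr⟩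

theorem ellPoch (H : Nomes p q) (hf : IsAnalyticUnitAt f y) (n : ℕ) :
    AnalyticAt ℂ (fun y => EllBiorth.ellPoch (f y) n q p) y :=
  Finset.analyticAt_fun_prod _ fun j _ => analyticAt_theta H.p_lt (hf.1.mul analyticAt_const)
    (mul_ne_zero hf.2 (pow_ne_zero j H.q_ne))

theorem ellPochPM (H : Nomes p q) (hf : IsAnalyticUnitAt f y) (hx : IsAnalyticUnitAt x y)
    (n : ℕ) : AnalyticAt ℂ (fun y => EllBiorth.ellPochPM (f y) (x y) n q p) y := by
  simp only [ellPochPM_eq]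
  exact ((hf.mul hx).ellPoch H n).mul ((hf.mul hx.inv).ellPoch H n)

end IsAnalyticUnitAt

theorem ellPoch_ne_zero_of_le {z : ℂ} {j n : ℕ} (h : ellPoch z n q p ≠ 0) (hj : j ≤ n) :
    ellPoch z j q p ≠ 0 := by
  obtain ⟨k, rfl⟩ := Nat.exists_eq_add_of_le hj
  rw [ellPoch_add] at h
  exact left_ne_zero_of_mul h

/-- The denominators of the coefficients of `bioRat n a b c d s t` do not vanish. -/
structure BioRegular (n : ℕ) (a b c d s t q p : ℂ) : Prop where
  theta_ne : theta (d * s⁻¹) p ≠ 0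
  q_ne : ellPoch q n q p ≠ 0
  a_ne : ellPoch (a * d) n q p ≠ 0
  b_ne : ellPoch (b * d) n q p ≠ 0
  c_ne : ellPoch (c * d) n q p ≠ 0
  s_ne : ellPoch (q ^ n * (q * (d * s⁻¹))) n q p ≠ 0
  t_ne : ellPoch (d * t * q * (q ^ n)⁻¹) n q p ≠ 0

theorem BioRegular.analyticAt_bioNum (H : Nomes p q) {n : ℕ}
    (hr : BioRegular n (a y) (b y) (c y) (d y) (s y) (t y) q p)
    (ha : IsAnalyticUnitAt a y) (hb : IsAnalyticUnitAt b y) (hc : IsAnalyticUnitAt c y)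
    (hd : IsAnalyticUnitAt d y) (hs : IsAnalyticUnitAt s y) (ht : IsAnalyticUnitAt t y)
    (hx : IsAnalyticUnitAt x y) :
    AnalyticAt ℂ (fun y => bioNum n (a y) (b y) (c y) (d y) (s y) (t y) q p (x y)) y := by
  have hq {r : ℂ} (hr : r ≠ 0) := IsAnalyticUnitAt.const (y := y) hr
  have hq0 := H.q_ne
  have hqn := pow_ne_zero n hq0
  have hds := hd.mul hs.inv
  unfold bioNum bioCoef
  refine Finset.analyticAt_fun_sum _ fun j hj => ?_
  have hqj := pow_ne_zero j hq0
  have hjn : j ≤ n := Nat.lt_succ_iff.1 (Finset.mem_range.1 hj)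
  refine (((((analyticAt_theta H.p_lt (hds.mul (hq (pow_ne_zero (2 * j) hq0))).1
    (hds.mul (hq (pow_ne_zero (2 * j) hq0))).2).div (analyticAt_theta H.p_lt hds.1 hds.2)
    hr.theta_ne).mul
    (((((((hds.ellPoch H j).mul (((hq hq0).mul (ha.mul hs).inv).ellPoch H j)).mul
      (((hq hq0).mul (hb.mul hs).inv).ellPoch H j)).mul
      (((hq hq0).mul (hc.mul hs).inv).ellPoch H j)).mul
      analyticAt_const).mul (((hq hqn).mul (hs.mul ht).inv).ellPoch H j)).div
      ((((((analyticAt_const (v := ellPoch q j q p)).mul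
        ((ha.mul hd).ellPoch H j)).mul ((hb.mul hd).ellPoch H j)).mul
        ((hc.mul hd).ellPoch H j)).mul (((hq hqn).mul ((hq hq0).mul hds)).ellPoch H j)).mul
        ((((hd.mul ht).mul (hq hq0)).mul (hq (inv_ne_zero hqn))).ellPoch H j)) ?_)).mul
      analyticAt_const)).mul
    ((hd.ellPochPM H hx j).mul
      ((((hq hq0).mul hs.inv).mul (hq hqj)).ellPochPM H hx (n - j)))
  exact mul_ne_zero (mul_ne_zero (mul_ne_zero (mul_ne_zero (mul_ne_zero
    (ellPoch_ne_zero_of_le hr.q_ne hjn) (ellPoch_ne_zero_of_le hr.a_ne hjn))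
    (ellPoch_ne_zero_of_le hr.b_ne hjn)) (ellPoch_ne_zero_of_le hr.c_ne hjn))
    (ellPoch_ne_zero_of_le hr.s_ne hjn)) (ellPoch_ne_zero_of_le hr.t_ne hjn)

/-- The denominator of `bioNorm`. -/
def bioNormDen (n : ℕ) (a b c d s t q p : ℂ) : ℂ :=
  theta (q ^ (2 * n) * (s * t)⁻¹) p * (ellPoch (d * s)⁻¹ n q p * ellPoch (a * d) n q p *
    ellPoch (b * d) n q p * ellPoch (c * d) n q p * ellPoch (d * t)⁻¹ n q p *
    ellPoch (s * t)⁻¹ n q p)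

theorem analyticAt_bioNorm (H : Nomes p q) {n : ℕ}
    (hr : bioNormDen n (a y) (b y) (c y) (d y) (s y) (t y) q p ≠ 0)
    (ha : IsAnalyticUnitAt a y) (hb : IsAnalyticUnitAt b y) (hc : IsAnalyticUnitAt c y)
    (hd : IsAnalyticUnitAt d y) (hs : IsAnalyticUnitAt s y) (ht : IsAnalyticUnitAt t y) :
    AnalyticAt ℂ (fun y => bioNorm n (a y) (b y) (c y) (d y) (s y) (t y) q p) y := by
  have hq {r : ℂ} (hr : r ≠ 0) := IsAnalyticUnitAt.const (y := y) hr
  have hq0 := H.q_ne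
  have hst := (hs.mul ht).inv
  have hst' := (hq (pow_ne_zero (2 * n) hq0)).mul hst
  exact (((analyticAt_theta H.p_lt hst.1 hst.2).mul ((((((analyticAt_const (v :=
    ellPoch q n q p)).mul (((hq hq0).mul (hd.mul hs.inv)).ellPoch H n)).mul
    ((ha.mul hb).ellPoch H n)).mul ((ha.mul hc).ellPoch H n)).mul ((hb.mul hc).ellPoch H n)).mul
    (((hq hq0).mul (hd.mul ht.inv)).ellPoch H n))).mul analyticAt_const).div
    ((analyticAt_theta H.p_lt hst'.1 hst'.2).mul (((((((hd.mul hs).inv.ellPoch H n).mul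
    ((ha.mul hd).ellPoch H n)).mul ((hb.mul hd).ellPoch H n)).mul ((hc.mul hd).ellPoch H n)).mul
    ((hd.mul ht).inv.ellPoch H n)).mul (hst.ellPoch H n))) hr

theorem IsAnalyticUnitAt.bioFactor (hq : q ≠ 0) (hs : IsAnalyticUnitAt s y) (n : ℕ) :
    IsAnalyticUnitAt (fun y => EllBiorth.bioFactor n (s y) q) y :=
  (((((const hq).mul hs.inv).pow n).mul (const (triPow_ne_zero hq n))).pow 2).inv

theorem IsAnalyticUnitAt.bioShift (H : Nomes p q) (hs : IsAnalyticUnitAt s y)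
    (ht : IsAnalyticUnitAt t y) (m n k l : ℕ) :
    IsAnalyticUnitAt (fun y => EllBiorth.bioShift m n k l (s y) (t y) q p) y := by
  have hq (n : ℕ) := const (E := E) (y := y) (inv_ne_zero (pow_ne_zero n H.q_ne))
  have hsh {w : E → ℂ} (hw : IsAnalyticUnitAt w y) (n k : ℕ) :
      IsAnalyticUnitAt (fun y => shiftFactor n k (w y) q p) y :=
    ((((hw.pow 2).pow k).mul (const (inv_ne_zero (pow_ne_zero 2
      (triPow_ne_zero H.p_ne (k + 1)))))).pow n).mul
      (const (pow_ne_zero (2 * k) (triPow_ne_zero H.q_ne n)))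
  exact ((hs.bioFactor H.q_ne m).mul (hsh (hs.mul (hq m)) m k)).mul
    (hsh (((const H.p_ne).mul ht).mul (hq n)) n l)

end Analytic

/-! ### Biorthogonality for all regular parameters -/

section Regular

variable {p q a b c d s t t' : ℂ}

theorem isAnalyticUnitAt_mul_exp {E : Type*} [NormedAddCommGroup E] [NormedSpace ℂ E] {y : E}
    {f : E → ℂ} (hf : AnalyticAt ℂ f y) {r : ℂ} (hr : r ≠ 0) (n : ℤ) :
    IsAnalyticUnitAt (fun y => r * exp (n * f y)) y :=
  ⟨analyticAt_const.mul (analyticAt_cexp.comp (f := fun y => (n : ℂ) * f y)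
    (analyticAt_const.mul hf)), mul_ne_zero hr (exp_ne_zero _)⟩

theorem Nomes.differentiableAt_betaFun (H : Nomes p q) {τ : ℂ → Fin 6 → ℂ} {F : ℂ → ℂ → ℂ} {v : ℂ}
    (hτ : ∀ j, IsAnalyticUnitAt (fun v => τ v j) v)
    (hF : ∀ x ≠ 0, AnalyticAt ℂ (fun y : ℂ × ℂ => F y.1 y.2) (v, x)) {Z : List (ℝ → ℂ)}
    (hZ : CycleSeparates Z (latticePoints (τ v) p q)) :
    DifferentiableAt ℂ (fun v => betaFun p q (τ v) Z (F v)) v := by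
  refine ((differentiableAt_list_sum_map Z fun γ hγ => ?_).const_mul _).const_mul _
  refine (hZ.isContour γ hγ).differentiableAt_contourIntegral
    (F := fun s x => F s x * betaKernel (τ s) p q x * x⁻¹) fun θ hθ => ?_
  have hx0 := hZ.ne_zero γ hγ θ hθ
  have hsnd : AnalyticAt ℂ (fun y : ℂ × ℂ => y.2) (v, γ θ) := analyticAt_snd
  refine ((hF _ hx0).mul (H.analyticAt_betaKernel (t := fun y : ℂ × ℂ => τ y.1) (fun j => ?_) hsnd
    (fun j => (hτ j).2) hx0 (H.pqPoch_mul_ne_zero hx0 fun h => ?_)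
    (H.pqPoch_mul_inv_ne_zero hx0 fun h => ?_))).mul (hsnd.inv hx0)
  · exact AnalyticAt.comp (f := fun y : ℂ × ℂ => y.1) (x := (v, γ θ)) (hτ j).1 analyticAt_fst
  · exact hZ.ne_inv _ h γ hγ θ hθ (inv_inv _).symm
  · exact hZ.ne _ h γ hγ θ hθ rfl

/-- Exponents with sum `0`, such that no sum of two of them and no difference of two distinct ones
vanishes. -/
def genericExponent : Fin 6 → ℤ := ![1, 2, 4, 8, 16, -31]

theorem countable_not_generic_mul_exp (p q : ℂ) (t : Fin 6 → ℂ) (ht : ∀ j, t j ≠ 0) :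
    {v : ℂ | ¬ Generic p q fun j => t j * exp (genericExponent j * v)}.Countable := by
  have key {w : ℂ} (hw : w ≠ 0) {n : ℤ} (hn : n ≠ 0) :
      {v : ℂ | ¬ NonRes p q (w * exp (n * v))}.Countable := by
    refine (Set.countable_iUnion fun x : ℤ × ℤ => countable_exp_mul_eq
      (c := w * (p ^ x.1 * q ^ x.2)⁻¹) (Or.inl (Int.cast_ne_zero.2 hn))).mono fun v hv => ?_
    have h0 := mul_ne_zero hw (exp_ne_zero (n * v))
    simp only [NonRes, Set.mem_ofPred_eq, not_and, not_forall, not_not] at hv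
    obtain ⟨i, j, e⟩ := hv h0
    refine Set.mem_iUnion.2 ⟨(i, j), ?_⟩
    show w * (p ^ i * q ^ j)⁻¹ * exp (n * v) = 1
    rw [← e, mul_right_comm, mul_inv_cancel₀ h0]
  have h1 : ∀ j k, genericExponent j + genericExponent k ≠ 0 := by decide
  have h2 : ∀ j k, j ≠ k → genericExponent j - genericExponent k ≠ 0 := by decide
  have hc : (⋃ x : Fin 6 × Fin 6, {v : ℂ | ¬ NonRes p q (t x.1 * t x.2 *
        exp ((genericExponent x.1 + genericExponent x.2 : ℤ) * v))} ∪
      ⋃ _ : x.1 ≠ x.2, {v : ℂ | ¬ NonRes p q (t x.1 * (t x.2)⁻¹ *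
        exp ((genericExponent x.1 - genericExponent x.2 : ℤ) * v))}).Countable :=
    Set.countable_iUnion fun x => (key (mul_ne_zero (ht _) (ht _)) (h1 _ _)).union
      (Set.countable_iUnion fun hx => key (mul_ne_zero (ht _) (inv_ne_zero (ht _))) (h2 _ _ hx))
  refine hc.mono fun v hv => by_contra fun hv' => hv ?_
  simp only [Set.mem_iUnion, Set.mem_union, Set.mem_ofPred_eq, not_exists, not_or, not_not] at hv'
  refine ⟨fun j => mul_ne_zero (ht j) (exp_ne_zero _), fun j k => ?_, fun j k hjk => ?_⟩
  · have := (hv' (j, k)).1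
    rwa [Int.cast_add, add_mul, exp_add, mul_mul_mul_comm] at this
  · have := (hv' (j, k)).2 hjk
    rwa [Int.cast_sub, sub_mul, exp_sub, div_eq_mul_inv, mul_mul_mul_comm, ← mul_inv] at this

/-- The generic case extends by continuity, along a curve through the given parameters on which
all but countably many points are generic. -/
theorem betaFun_bioRat_mul_bioRat_two_of_regular (H : Nomes p q)
    (hprod : a * b * c * d * s * t = q) (htt : q * t' = p * t) {m n k l : ℕ}
    (hn : BioRegular n a b c d t s q p) (hm : BioRegular m a b c d s t q p)
    (hl : BioRegular l a b c d t' s p q) (hk : BioRegular k a b c d s t' p q)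
    (hdn : bioNormDen n a b c d s t q p ≠ 0) (hdl : bioNormDen l a b c d s t' p q ≠ 0)
    {Z : List (ℝ → ℂ)} (hZ : CycleSeparates Z
      (latticePoints ![a, b, c, d, s * (p ^ k * q ^ m)⁻¹, p * t * (p ^ l * q ^ n)⁻¹] p q)) :
    betaFun p q ![a, b, c, d, s, p * t] Z
      (fun x => bioRat n a b c d t s q p x * bioRat m a b c d s t q p x *
        (bioRat l a b c d t' s p q x * bioRat k a b c d s t' p q x)) =
    (if m = n then 1 else 0) * (if k = l then 1 else 0) * (bioNorm n a b c d s t q p *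
      bioNorm l a b c d s t' p q * betaProd ![a, b, c, d, s, p * t] p q) := by
  have hp := H.p_ne
  have hq := H.q_ne
  obtain ⟨ha, hb, hc, hd, hs, ht⟩ := ne_zero_of_prod_eq hq hprod
  have ht' : t' ≠ 0 := by rintro rfl; exact mul_ne_zero hp ht (by rw [← htt, mul_zero])
  have hτ₀ : ∀ j, ![a, b, c, d, s, p * t] j ≠ 0 := by
    simp [Fin.forall_fin_succ, ha, hb, hc, hd, hs, hp, ht]
  set X : ℂ → ℤ → ℂ → ℂ := fun r i v => r * exp (i * v) with hX
  have hX0 (r : ℂ) (i : ℤ) : X r i 0 = r := by simp [hX]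
  have hXa {r : ℂ} (hr : r ≠ 0) (i : ℤ) : IsAnalyticUnitAt (X r i) 0 :=
    isAnalyticUnitAt_mul_exp analyticAt_id hr i
  have hXne {r : ℂ} (hr : r ≠ 0) (i : ℤ) (v : ℂ) : X r i v ≠ 0 := mul_ne_zero hr (exp_ne_zero _)
  set T : ℂ → Fin 6 → ℂ := fun v =>
    ![X a 1 v, X b 2 v, X c 4 v, X d 8 v, X s 16 v, p * X t (-31) v] with hT
  set τ : ℂ → Fin 6 → ℂ := fun v => ![X a 1 v, X b 2 v, X c 4 v, X d 8 v,
    X s 16 v * (p ^ k * q ^ m)⁻¹, p * X t (-31) v * (p ^ l * q ^ n)⁻¹] with hτ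
  have hTX (v : ℂ) : T v = fun j => ![a, b, c, d, s, p * t] j * exp (genericExponent j * v) := by
    ext j
    fin_cases j <;> simp [hT, hX, genericExponent, mul_assoc]
  have hconst {r : ℂ} (hr : r ≠ 0) := IsAnalyticUnitAt.const (y := (0 : ℂ)) hr
  have hτa (j : Fin 6) : IsAnalyticUnitAt (fun v => τ v j) 0 := by
    have h4 := (hXa hs 16).mul (hconst (inv_ne_zero (mul_ne_zero (pow_ne_zero k hp)
      (pow_ne_zero m hq))))
    have h5 := ((hconst hp).mul (hXa ht (-31))).mul (hconst (inv_ne_zero (mul_ne_zero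
      (pow_ne_zero l hp) (pow_ne_zero n hq))))
    fin_cases j
    exacts [hXa ha 1, hXa hb 2, hXa hc 4, hXa hd 8, h4, h5]
  have hTa (j : Fin 6) : IsAnalyticUnitAt (fun v => T v j) 0 := by
    simp only [hTX]
    exact isAnalyticUnitAt_mul_exp analyticAt_id (hτ₀ j) _
  have hτ0 : τ 0 = ![a, b, c, d, s * (p ^ k * q ^ m)⁻¹, p * t * (p ^ l * q ^ n)⁻¹] := by
    simp only [hτ, hX0]
  have hT0 : T 0 = ![a, b, c, d, s, p * t] := by simp only [hT, hX0]
  have hsub : latticePoints ![a, b, c, d, s, p * t] p q ⊆ latticePoints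
      ![a, b, c, d, s * (p ^ k * q ^ m)⁻¹, p * t * (p ^ l * q ^ n)⁻¹] p q :=
    latticePoints_subset (m := ![0, 0, 0, 0, k, l]) (n := ![0, 0, 0, 0, m, n]) fun j => by
      fin_cases j <;> simp <;> field_simp
  have main := eq_of_countable_compl (z := 0)
    (countable_not_generic_mul_exp p q ![a, b, c, d, s, p * t] hτ₀)
    (f := fun v => bioFactor k (X s 16 v) p * bioShift m n k l (X s 16 v) (X t (-31) v) q p *
      betaFun p q (τ v) Z (fun x =>
        bioNum n (X a 1 v) (X b 2 v) (X c 4 v) (X d 8 v) (X t (-31) v) (X s 16 v) q p x *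
        bioNum m (X a 1 v) (X b 2 v) (X c 4 v) (X d 8 v) (X s 16 v) (X t (-31) v) q p x *
        (bioNum l (X a 1 v) (X b 2 v) (X c 4 v) (X d 8 v) (X t' (-31) v) (X s 16 v) p q x *
          bioNum k (X a 1 v) (X b 2 v) (X c 4 v) (X d 8 v) (X s 16 v) (X t' (-31) v) p q x)))
    (g := fun v => (if m = n then 1 else 0) * (if k = l then 1 else 0) *
      (bioNorm n (X a 1 v) (X b 2 v) (X c 4 v) (X d 8 v) (X s 16 v) (X t (-31) v) q p *
      bioNorm l (X a 1 v) (X b 2 v) (X c 4 v) (X d 8 v) (X s 16 v) (X t' (-31) v) p q *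
      betaProd (T v) p q)) ?_ ?_ ?_
  · simp only [hX0, hτ0, hT0] at main
    rw [betaFun_bioRat_mul_bioRat_two_eq H hs ht ht' hτ₀ htt m n k l hZ, main]
  · refine (((hXa hs 16).bioFactor hp k).mul ((hXa hs 16).bioShift H (hXa ht (-31)) m n k
      l)).1.continuousAt.mul (H.differentiableAt_betaFun hτa (fun x hx => ?_)
      (by rw [hτ0]; exact hZ)).continuousAt
    have hY {r : ℂ} (hr : r ≠ 0) (i : ℤ) :
        IsAnalyticUnitAt (fun y : ℂ × ℂ => X r i y.1) (0, x) :=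
      isAnalyticUnitAt_mul_exp analyticAt_fst hr i
    have hx' : IsAnalyticUnitAt (fun y : ℂ × ℂ => y.2) (0, x) := ⟨analyticAt_snd, hx⟩
    exact ((BioRegular.analyticAt_bioNum H (by simpa only [hX0] using hn) (hY ha 1) (hY hb 2)
      (hY hc 4) (hY hd 8) (hY ht (-31)) (hY hs 16) hx').mul
      (BioRegular.analyticAt_bioNum H (by simpa only [hX0] using hm) (hY ha 1) (hY hb 2)
      (hY hc 4) (hY hd 8) (hY hs 16) (hY ht (-31)) hx')).mul
      ((BioRegular.analyticAt_bioNum H.symm (by simpa only [hX0] using hl) (hY ha 1) (hY hb 2)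
      (hY hc 4) (hY hd 8) (hY ht' (-31)) (hY hs 16) hx').mul
      (BioRegular.analyticAt_bioNum H.symm (by simpa only [hX0] using hk) (hY ha 1) (hY hb 2)
      (hY hc 4) (hY hd 8) (hY hs 16) (hY ht' (-31)) hx'))
  · refine continuousAt_const.mul (((analyticAt_bioNorm H (by simpa only [hX0] using hdn) (hXa ha 1)
      (hXa hb 2) (hXa hc 4) (hXa hd 8) (hXa hs 16) (hXa ht (-31))).mul
      (analyticAt_bioNorm H.symm (by simpa only [hX0] using hdl) (hXa ha 1)
      (hXa hb 2) (hXa hc 4) (hXa hd 8) (hXa hs 16) (hXa ht' (-31)))).mul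
      (Finset.analyticAt_fun_prod _ fun i _ => Finset.analyticAt_fun_prod _ fun j _ => ?_)).continuousAt
    refine H.analyticAt_ellGamma ((hTa i).mul (hTa j)).1 ((hTa i).mul (hTa j)).2 ?_
    -- Otherwise a point to be encircled would be the reciprocal of another one.
    have hlat (j : Fin 6) : T 0 j ∈ latticePoints (T 0) p q := ⟨j, 0, 0, by simp⟩
    rw [← hT0] at hsub
    exact H.pqPoch_mul_ne_zero (hTa j).2
      (fun h => (hZ.mono hsub).inv_notMem (hlat j) h) i
  · have hev := CycleSeparates.eventually_latticePoints H (t := τ)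
      (fun j => (hτa j).1.continuousAt) (fun j => (hτa j).2) (by rw [hτ0]; exact hZ)
    filter_upwards [hev] with v hv hvS
    have hG : Generic p q (T v) := by rw [hTX]; exact not_not.1 hvS
    refine (betaFun_bioRat_mul_bioRat_two_eq H (hXne hs _ v) (hXne ht _ v) (hXne ht' _ v)
      hG.ne_zero ?_ m n k l hv).symm.trans (betaFun_bioRat_mul_bioRat_two H hG ?_ ?_ hm.q_ne hn.q_ne
        hk.q_ne hl.q_ne hv)
    · simp only [hX]
      linear_combination exp ((-31 : ℤ) * v) * htt
    · have he : exp ((1 : ℤ) * v) * exp ((2 : ℤ) * v) * exp ((4 : ℤ) * v) * exp ((8 : ℤ) * v) *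
          exp ((16 : ℤ) * v) * exp ((-31 : ℤ) * v) = 1 := by
        simp only [← exp_add]
        rw [exp_eq_one_iff]
        exact ⟨0, by push_cast; ring⟩
      simp only [hX]
      linear_combination a * b * c * d * s * t * he + hprod
    · simp only [hX]
      linear_combination exp ((-31 : ℤ) * v) * htt

end Regular

/-! ### The weight, the normalization and the regularity conditions -/

section Params

variable {p q : ℂ} {e : Params}

/-- The six parameters of the beta kernel, with product `p q`. -/
def Params.beta (e : Params) (p q : ℂ) : Fin 6 → ℂ :=
  ![e.ε₁, e.ε₂, e.ε₃, e.ε₆, e.ε₈, p * (q * e.A⁻¹)]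

theorem ellGamma_reflect {z : ℂ} (H : Nomes p q) (hz : z ≠ 0) :
    ellGamma (p * q * z⁻¹) p q = (ellGamma z p q)⁻¹ := by
  have hp := H.p_ne
  have hq := H.q_ne
  rw [ellGamma, ellGamma, inv_div, show p * q * (p * q * z⁻¹)⁻¹ = z by field_simp]

theorem weight_eq_betaKernel (H : Nomes p q) (he : ∀ j, e.val j ≠ 0) {x : ℂ}
    (hx : OffPoles p q (e.beta p q) x) : weight e p q x = betaKernel (e.beta p q) p q x := by
  have hA := Params.A_ne_zero he
  have hx0 := hx.ne_zero
  have h2 := H.inv_ellGamma_mul_inv hx.1.1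
    ((hx.1.of_eq_mul H 1 1 (by simp; ring)).pqPoch_ne_zero H)
    (hx.1.pqPoch_reflect_ne_zero H)
  have h3 : ellGammaPM (p * (q * e.A⁻¹)) x p q = (ellGammaPM e.A x p q)⁻¹ := by
    rw [ellGammaPM, ellGammaPM, mul_inv, ← ellGamma_reflect H (by positivity),
      ← ellGamma_reflect H (by positivity), mul_comm]
    congr 2 <;> field_simp
  rw [weight, Params.beta, betaKernel_vec, h3, ← h2, Fin.prod_univ_five, ellGammaPM.eq_1 1,
    one_mul, one_mul, div_eq_mul_inv, mul_inv]
  simp only [Params.val, Matrix.cons_val]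
  ring

theorem h_eq_betaProd (H : Nomes p q) (he : ∀ j, e.val j ≠ 0) (n l : ℕ) :
    h e p q n l = betaProd (e.beta p q) p q * hOne e q p n * hOne e p q l := by
  have hA := Params.A_ne_zero he
  have key (j : Fin 5) : ellGamma (e.val j * (p * (q * e.A⁻¹))) p q =
      (ellGamma (e.A / e.val j) p q)⁻¹ := by
    have := he j
    rw [← ellGamma_reflect H (by positivity)]
    congr 1
    field_simp
  have e0 := key 0
  have e1 := key 1
  have e2 := key 2
  have e3 := key 3
  have e4 := key 4
  simp only [Params.val, Matrix.cons_val] at e0 e1 e2 e3 e4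
  have i0 : Finset.Ioi (0 : Fin 5) = {1, 2, 3, 4} := by decide
  have i1 : Finset.Ioi (1 : Fin 5) = {2, 3, 4} := by decide
  have i2 : Finset.Ioi (2 : Fin 5) = {3, 4} := by decide
  have i3 : Finset.Ioi (3 : Fin 5) = {4} := by decide
  have i4 : Finset.Ioi (4 : Fin 5) = ∅ := by decide
  rw [h, Params.beta, betaProd_vec, e0, e1, e2, e3, e4, Fin.prod_univ_five, Fin.prod_univ_five,
    i0, i1, i2, i3, i4]
  simp only [Params.val, Matrix.cons_val, div_eq_mul_inv, mul_inv, Finset.prod_empty,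
    Finset.prod_insert (show (1 : Fin 5) ∉ ({2, 3, 4} : Finset (Fin 5)) by decide),
    Finset.prod_insert (show (2 : Fin 5) ∉ ({3, 4} : Finset (Fin 5)) by decide),
    Finset.prod_insert (show (3 : Fin 5) ∉ ({4} : Finset (Fin 5)) by decide),
    Finset.prod_singleton]
  ring

theorem ellPoch_ne_zero_of_zpow_mul (H : Nomes p q) {z w : ℂ} {n : ℕ} (hz : z ≠ 0) (i : ℤ)
    (h : ellPoch w n q p ≠ 0) (e : w = p ^ i * z) : ellPoch z n q p ≠ 0 := by
  refine Finset.prod_ne_zero_iff.2 fun j hj h0 => Finset.prod_ne_zero_iff.1 h j hj ?_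
  have hqj := pow_ne_zero j H.q_ne
  obtain ⟨k, hk⟩ := (theta_eq_zero_iff H.p_ne H.p_lt (mul_ne_zero hz hqj)).1 h0
  rw [e, mul_assoc, hk, ← zpow_add₀ H.p_ne, theta_zpow H.p_ne H.p_lt]

theorem RRegular.bioRegular (H : Nomes p q) (he : ∀ j, e.val j ≠ 0) {n l : ℕ}
    (h : RRegular e q p n l) :
    BioRegular n e.ε₁ e.ε₂ e.ε₃ e.ε₆ e.ε₈ (q * e.A⁻¹) q p := by
  obtain ⟨h1, h2, h3, h6, h8⟩ := Params.ne_zero he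
  have hA := Params.A_ne_zero he
  have hp := H.p_ne
  have hq := H.q_ne
  obtain ⟨h0, h⟩ := h
  simp only [ellPochs, List.map_cons, List.map_nil, List.prod_cons, List.prod_nil, mul_one,
    mul_ne_zero_iff] at h
  obtain ⟨k0, k1, k2, k3, k4, k5⟩ := h
  refine ⟨h0, k0, k1, k2, k3, ellPoch_ne_zero_of_zpow_mul H (by positivity) l k4 ?_,
    ellPoch_ne_zero_of_zpow_mul H (by positivity) (-l) k5 ?_⟩
  · rw [Params.ε₄, zpow_natCast]; field_simp; ring
  · rw [Params.ε₅, Params.ε₄, Params.ε₇, Params.A, zpow_neg, zpow_natCast]; field_simp; ring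

theorem TRegular.bioRegular (H : Nomes p q) (he : ∀ j, e.val j ≠ 0) {n l : ℕ}
    (h : TRegular e q p n l) :
    BioRegular n e.ε₁ e.ε₂ e.ε₃ e.ε₆ (q * e.A⁻¹) e.ε₈ q p := by
  obtain ⟨h1, h2, h3, h6, h8⟩ := Params.ne_zero he
  have hA := Params.A_ne_zero he
  have hp := H.p_ne
  have hq := H.q_ne
  obtain ⟨h0, h⟩ := h
  simp only [ellPochs, List.map_cons, List.map_nil, List.prod_cons, List.prod_nil, mul_one,
    mul_ne_zero_iff] at h
  obtain ⟨k0, k1, k2, k3, k4, k5⟩ := h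
  refine ⟨?_, k0, k1, k2, k3, ellPoch_ne_zero_of_zpow_mul H (by positivity) l k4 ?_,
    ellPoch_ne_zero_of_zpow_mul H (by positivity) (-l) k5 ?_⟩
  · rwa [show e.ε₆ * (q * e.A⁻¹)⁻¹ = e.A * e.ε₆ / q by field_simp]
  · rw [Params.ε₄, zpow_natCast]; field_simp; ring
  · rw [Params.ε₅, Params.ε₄, Params.ε₇, Params.A, zpow_neg, zpow_natCast]; field_simp; ring

theorem hDen_eq_bioNormDen (H : Nomes p q) (he : ∀ j, e.val j ≠ 0) (n : ℕ) :
    hDen e q p n = bioNormDen n e.ε₁ e.ε₂ e.ε₃ e.ε₆ e.ε₈ (q * e.A⁻¹) q p := by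
  obtain ⟨h1, h2, h3, h6, h8⟩ := Params.ne_zero he
  have hA := Params.A_ne_zero he
  have hq := H.q_ne
  rw [hDen, bioNormDen, 
    show (e.ε₈ * (q * e.A⁻¹))⁻¹ = e.A / (q * e.ε₈) by field_simp,
    show (e.ε₆ * (q * e.A⁻¹))⁻¹ = e.A / (q * e.ε₆) by field_simp,
    show (e.ε₆ * e.ε₈)⁻¹ = 1 / (e.ε₆ * e.ε₈) by field_simp,
    show q ^ (2 * n) * (e.A / (q * e.ε₈)) = e.A * q ^ (2 * n) / (q * e.ε₈) by field_simp]
  simp only [ellPochs, List.map_cons, List.map_nil, List.prod_cons, List.prod_nil, mul_one]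
  ring

end Params

end EllBiorth

end

/-! ### The biorthogonality relation -/

theorem mainTheorem5 (p q : ℂ) (hp0 : p ≠ 0) (hp1 : ‖p‖ < 1) (hq0 : q ≠ 0) (hq1 : ‖q‖ < 1)
    (e : EllBiorth.Params) (he : ∀ j, e.val j ≠ 0) (n l m k : ℕ)
    (hR : EllBiorth.RRegular e q p m k) (hR' : EllBiorth.RRegular e p q k m)
    (hT : EllBiorth.TRegular e q p n l) (hT' : EllBiorth.TRegular e p q l n)
    (hh : EllBiorth.hDen e q p n ≠ 0) (hh' : EllBiorth.hDen e p q l ≠ 0)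
    (C : ℝ → ℂ) (hC : EllBiorth.Separates C (EllBiorth.innerPoints e p q n l m k)) :
    IntervalIntegrable
      (EllBiorth.pullback (fun x => EllBiorth.T₂ e p q n l x * EllBiorth.R₂ e p q m k x *
        EllBiorth.weight e p q x * x⁻¹) C) MeasureTheory.volume 0 1 ∧
    EllBiorth.kappa p q *
      EllBiorth.contourIntegral (fun x => EllBiorth.T₂ e p q n l x * EllBiorth.R₂ e p q m k x *
        EllBiorth.weight e p q x * x⁻¹) C =
      EllBiorth.h e p q n l * (if m = n then 1 else 0) * (if k = l then 1 else 0) := by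
  open EllBiorth in
  have H : Nomes p q := ⟨hp0, hp1, hq0, hq1⟩
  obtain ⟨h1, h2, h3, h6, h8⟩ := Params.ne_zero he
  have hA := Params.A_ne_zero he
  have hβ : ∀ j, e.beta p q j ≠ 0 := by
    simp [Params.beta, Fin.forall_fin_succ, h1, h2, h3, h6, h8, hA, hp0, hq0]
  have hZ : CycleSeparates [C] (latticePoints ![e.ε₁, e.ε₂, e.ε₃, e.ε₆,
      e.ε₈ * (p ^ k * q ^ m)⁻¹, p * (q * e.A⁻¹) * (p ^ l * q ^ n)⁻¹] p q) := by
    refine hC.cycleSeparates.mono ?_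
    rintro x ⟨j, a, b, rfl⟩
    refine ⟨a, b, ?_⟩
    fin_cases j
    · exact Or.inl rfl
    · exact Or.inr (Or.inl rfl)
    · exact Or.inr (Or.inr (Or.inl rfl))
    · exact Or.inr (Or.inr (Or.inr (Or.inl rfl)))
    · refine Or.inr (Or.inr (Or.inr (Or.inr (Or.inl ?_))))
      simp only [zpow_sub₀ hp0, zpow_sub₀ hq0, zpow_natCast]
      show e.ε₈ * (p ^ k * q ^ m)⁻¹ * p ^ a * q ^ b = _
      field_simp
    · refine Or.inr (Or.inr (Or.inr (Or.inr (Or.inr ?_))))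
      simp only [zpow_sub₀ hp0, zpow_sub₀ hq0, zpow_add₀ hp0, zpow_add₀ hq0, zpow_natCast, zpow_one]
      show p * (q * e.A⁻¹) * (p ^ l * q ^ n)⁻¹ * p ^ a * q ^ b = _
      field_simp
  have ht : q * e.A⁻¹ ≠ 0 := by positivity
  have ht' : p * e.A⁻¹ ≠ 0 := by positivity
  have htt : q * (p * e.A⁻¹) = p * (q * e.A⁻¹) := by ring
  have hprod : e.ε₁ * e.ε₂ * e.ε₃ * e.ε₆ * e.ε₈ * (q * e.A⁻¹) = q := by
    rw [Params.A] at hA ⊢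
    field_simp
  have hfun {x : ℂ} (hx : OffPoles p q (e.beta p q) x) :
      T₂ e p q n l x * R₂ e p q m k x * weight e p q x =
      bioRat n e.ε₁ e.ε₂ e.ε₃ e.ε₆ (q * e.A⁻¹) e.ε₈ q p x *
        bioRat m e.ε₁ e.ε₂ e.ε₃ e.ε₆ e.ε₈ (q * e.A⁻¹) q p x *
        (bioRat l e.ε₁ e.ε₂ e.ε₃ e.ε₆ (p * e.A⁻¹) e.ε₈ p q x *
          bioRat k e.ε₁ e.ε₂ e.ε₃ e.ε₆ e.ε₈ (p * e.A⁻¹) p q x) *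
        betaKernel (e.beta p q) p q x := by
    have hx0 := hx.ne_zero
    rw [weight_eq_betaKernel H he hx, T₂, R₂, T_eq_bioRat H he n l hx0, R_eq_bioRat H he m k hx0,
      T_eq_bioRat H.symm he l n hx0, R_eq_bioRat H.symm he k m hx0]
    ring
  have hE := countable_not_offPoles (p := p) (q := q) hβ
  constructor
  · have hcont : IntervalIntegrable (pullback (fun x =>
        bioFactor k e.ε₈ p * bioShift m n k l e.ε₈ (q * e.A⁻¹) q p *
          (bioNum n e.ε₁ e.ε₂ e.ε₃ e.ε₆ (q * e.A⁻¹) e.ε₈ q p x *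
            bioNum m e.ε₁ e.ε₂ e.ε₃ e.ε₆ e.ε₈ (q * e.A⁻¹) q p x *
            (bioNum l e.ε₁ e.ε₂ e.ε₃ e.ε₆ (p * e.A⁻¹) e.ε₈ p q x *
              bioNum k e.ε₁ e.ε₂ e.ε₃ e.ε₆ e.ε₈ (p * e.A⁻¹) p q x)) *
          betaKernel ![e.ε₁, e.ε₂, e.ε₃, e.ε₆, e.ε₈ * (p ^ k * q ^ m)⁻¹,
            p * (q * e.A⁻¹) * (p ^ l * q ^ n)⁻¹] p q x * x⁻¹) C) MeasureTheory.volume 0 1 := by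
      refine hC.isContour.intervalIntegrable_pullback fun θ hθ => ?_
      have hmem : C ∈ [C] := by simp
      refine (H.differentiableAt_mul_betaKernel ?_ (fun x hx => ?_) (hC.ne_zero θ hθ)
        (fun h => hZ.ne _ h C hmem θ hθ rfl)
        fun h => hZ.ne_inv _ h C hmem θ hθ (inv_inv _).symm).continuousAt
      · simp [Fin.forall_fin_succ, h1, h2, h3, h6, h8, hA, hp0, hq0]
      · exact (((differentiableAt_bioNum H n _ _ _ h6 ht _ x hx).mul
          (differentiableAt_bioNum H m _ _ _ h6 h8 _ x hx)).mul
          ((differentiableAt_bioNum H.symm l _ _ _ h6 ht' _ x hx).mul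
            (differentiableAt_bioNum H.symm k _ _ _ h6 h8 _ x hx))).const_mul _
    refine hcont.congr_ae (pullback_ae_eq C hE fun θ _ hx => ?_)
    rw [hfun (not_not.1 hx), ← bioRat_mul_bioRat_two_mul_betaKernel H h8 ht ht' htt (not_not.1 hx)
      m n k l]
    rfl
  · have key := betaFun_bioRat_mul_bioRat_two_of_regular H hprod htt (hT.bioRegular H he)
      (hR.bioRegular H he) (hT'.bioRegular H.symm he) (hR'.bioRegular H.symm he)
      (by rwa [← hDen_eq_bioNormDen H he]) (by rwa [← hDen_eq_bioNormDen H.symm he]) hZ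
    rw [← hOne_eq_bioNorm H he, ← hOne_eq_bioNorm H.symm he, betaFun, ← cycleIntegral_congr_of_countable
      (f := fun x => T₂ e p q n l x * R₂ e p q m k x * weight e p q x * x⁻¹) hE hZ.ne_zero
      fun x _ hx => by rw [hfun (not_not.1 hx)]; rfl] at key
    rw [h_eq_betaProd H he, show kappa p q = qPoch p p * qPoch q q / 2 * (2 * Real.pi * Complex.I)⁻¹ by
      rw [kappa]; field_simp; ring, mul_assoc (_ / _)]
    rw [cycleIntegral, List.map_singleton, List.sum_singleton] at key
    rw [key, Params.beta]
    ring
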